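/- Let $\mathbb S^1=\mathbb R/2\pi\mathbb Z$ and $\mathbb T^2=\mathbb S^1\times\mathbb S^1$, with coordinate projections $p_\theta,p_\varphi$. For distinct $x_1,x_2\in\mathbb S^1$ let $[x_1;x_2]\subset\mathbb S^1$ be the closed arc that starts at $x_1$ and ends at $x_2$ (in the positive direction). An (oriented) rectangular diagram of a link is a non-empty finite set $R\subset\mathbb T^2$ with a decomposition $R=R^+\sqcup R^-$ such that $p_\theta(R^+)=p_\theta(R^-)$, $p_\varphi(R^+)=p_\varphi(R^-)$, and each of $p_\theta,p_\varphi$ is injective on each of $R^+,R^-$. A passage $R_1\mapsto R_2$ between rectangular diagrams is an elementary move if there are $\theta_1\neq\theta_2$, $\varphi_1\ne\varphi_2$ in $\mathbb S^1$ such that: $R_1\triangle R_2=\{\theta_1,\theta_2\}\times\{\varphi_1,\varphi_2\}$; the rectangle $r=[\theta_1;\theta_2]\times[\varphi_1;\varphi_2]$ satisfies $r\cap(R_1\cup R_2)=R_1\triangle R_2$; one, two, or three consecutive corners of $r$ belong to $R_1$ and the other(s) to $R_2$; and $R_1^+\cap R_2=R_1\cap R_2^+$. It is an exchange move if $|R_1|=|R_2|$,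 and a stabilization if $|R_2|=|R_1|+2$; in the latter case $R_2\mapsto R_1$ is a destabilization. For a stabilization let $v$ be the unique element of $R_1\cap r$, and let $\varphi_0\in\{\varphi_1,\varphi_2\}$ be such that $\{\theta_1,\theta_2\}\times\{\varphi_0\}\subset R_2$. The stabilization and the inverse destabilization are of type $\mathrm I$ if $v\in\{(\theta_1,\varphi_1),(\theta_2,\varphi_2)\}$ and of type $\mathrm{II}$ if $v\in\{(\theta_1,\varphi_2),(\theta_2,\varphi_1)\}$; the oriented type is $\overrightarrow{\mathrm I}$ (respectively, $\overrightarrow{\mathrm{II}}$) if moreover $(\theta_2,\varphi_0)\in R_2^+$, and $\overleftarrow{\mathrm I}$ (respectively, $\overleftarrow{\mathrm{II}}$) if $(\theta_2,\varphi_0)\in R_2^-$. For $T\in\{\overrightarrow{\mathrm I},\overleftarrow{\mathrm I},\overrightarrow{\mathrm{II}},\overleftarrow{\mathrm{II}}\}$ let $[R]_T$ denote the class of $R$ under the equivalence relation on the set of rectangular diagrams generated by exchange moves and by stabilizations and destabilizations of oriented type $T$. Diagrams are given to an algorithm by their combinatorial types. A code is a pair $(P,N)$ of finite lists of points of $\mathbb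 N\times\mathbb N$. It describes a diagram $R$ if there are strictly increasing sequences $(x_i)_{i\in\mathbb N}$ in $[a;a+2\pi)$ and $(y_j)_{j\in\mathbb N}$ in $[b;b+2\pi)$, for some $a,b\in\mathbb R$, such that, modulo $2\pi$, $R^+=\{(x_i,y_j):(i,j)\in P\}$ and $R^-=\{(x_i,y_j):(i,j)\in N\}$. **Theorem.** Every rectangular diagram of a link is described by some code, and for any $T\in\{\overrightarrow{\mathrm I},\overleftarrow{\mathrm I},\overrightarrow{\mathrm{II}},\overleftarrow{\mathrm{II}}\}$ there is an algorithm for deciding, given two rectangular diagrams of a link $R_1$, $R_2$ (by any codes that describe them), whether or not $[R_1]_T=[R_2]_T$; that is, there is a computable function $f$ from pairs of codes to $\{\text{true},\text{false}\}$ such that, whenever $c_1$ describes $R_1$ and $c_2$ describes $R_2$, one has $f(c_1,c_2)=\text{true}$ if and only if $[R_1]_T=[R_2]_T$. -/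

import Mathlib

/-- The two-dimensional torus `𝕋² = 𝕊¹ × 𝕊¹` with angular coordinates `(θ, φ)`, each of them
running through `ℝ / 2πℤ`. -/
abbrev Torus : Type := Real.Angle × Real.Angle

/-- An oriented rectangular diagram of a link: a non-empty finite subset of the torus, decomposed
into positive and negative vertices, such that the two parts have the same projections to each
circle factor and each projection is injective on each part. -/
@[ext]
structure RectDiagram where
  /-- the positive vertices -/
  pos : Set Torus
  /-- the negative vertices -/
  neg : Set Torus
  finite : (pos ∪ neg).Finite
  nonempty : (pos ∪ neg).Nonempty
  disjoint : Disjoint pos neg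
  image_fst : Prod.fst '' pos = Prod.fst '' neg
  image_snd : Prod.snd '' pos = Prod.snd '' neg
  injOn_fst_pos : Set.InjOn Prod.fst pos
  injOn_fst_neg : Set.InjOn Prod.fst neg
  injOn_snd_pos : Set.InjOn Prod.snd pos
  injOn_snd_neg : Set.InjOn Prod.snd neg

namespace RectDiagram

/-- The set of all vertices of a diagram. -/
def verts (R : RectDiagram) : Set Torus := R.pos ∪ R.neg

/-- The rectangle `[θ₁; θ₂] × [φ₁; φ₂]`, where `[x₁; x₂] ⊆ 𝕊¹` is the closed arc that starts at
`x₁` and ends at `x₂` (in the positive direction). -/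
def rect (θ₁ θ₂ φ₁ φ₂ : Real.Angle) : Set Torus := Set.cIcc θ₁ θ₂ ×ˢ Set.cIcc φ₁ φ₂

/-- The corners of the rectangle `[θ₁; θ₂] × [φ₁; φ₂]`, in their cyclic order on its boundary. -/
def corner (θ₁ θ₂ φ₁ φ₂ : Real.Angle) : Fin 4 → Torus :=
  ![(θ₁, φ₁), (θ₂, φ₁), (θ₂, φ₂), (θ₁, φ₂)]

/-- `R₁ ↦ R₂` is an elementary move associated with the rectangle `[θ₁; θ₂] × [φ₁; φ₂]`. -/
structure IsElementaryMoveAt (R₁ R₂ : RectDiagram) (θ₁ θ₂ φ₁ φ₂ : Real.Angle) : Prop where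
  ne_fst : θ₁ ≠ θ₂
  ne_snd : φ₁ ≠ φ₂
  symmDiff_eq : symmDiff R₁.verts R₂.verts = ({θ₁, θ₂} : Set Real.Angle) ×ˢ {φ₁, φ₂}
  rect_inter : rect θ₁ θ₂ φ₁ φ₂ ∩ (R₁.verts ∪ R₂.verts) = symmDiff R₁.verts R₂.verts
  /-- One, two or three consecutive corners belong to `R₁`; the others belong to `R₂` because of
  `symmDiff_eq`. -/
  consecutive : ∃ i : Fin 4,
    let v := corner θ₁ θ₂ φ₁ φ₂
    R₁.verts ∩ Set.range v = {v i} ∨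
    R₁.verts ∩ Set.range v = {v i, v (i + 1)} ∨
    R₁.verts ∩ Set.range v = {v i, v (i + 1), v (i + 2)}
  orientation : R₁.pos ∩ R₂.verts = R₁.verts ∩ R₂.pos

/-- `R₁ ↦ R₂` is an exchange move. -/
def IsExchange (R₁ R₂ : RectDiagram) : Prop :=
  (∃ θ₁ θ₂ φ₁ φ₂, IsElementaryMoveAt R₁ R₂ θ₁ θ₂ φ₁ φ₂) ∧ R₁.verts.ncard = R₂.verts.ncard

end RectDiagram

/-- The four oriented types of stabilizations and destabilizations. -/
inductive StabType
  /-- the type `→I` -/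
  | rightI
  /-- the type `←I` -/
  | leftI
  /-- the type `→II` -/
  | rightII
  /-- the type `←II` -/
  | leftII

namespace StabType

/-- The type (I or II) underlying an oriented type, in terms of the corners at which the unique
vertex of the unstabilized diagram lying in the rectangle `[θ₁; θ₂] × [φ₁; φ₂]` may be. -/
def corners (T : StabType) (θ₁ θ₂ φ₁ φ₂ : Real.Angle) : Set Torus :=
  match T with
  | rightI | leftI => {(θ₁, φ₁), (θ₂, φ₂)}
  | rightII | leftII => {(θ₁, φ₂), (θ₂, φ₁)}

/-- The set of vertices of the stabilized diagram that have the sign prescribed by the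
orientation (the arrow) of the type. -/
def signedVerts (T : StabType) (R : RectDiagram) : Set Torus :=
  match T with
  | rightI | rightII => R.pos
  | leftI | leftII => R.neg

end StabType

namespace RectDiagram

/-- `R₁ ↦ R₂` is a stabilization of oriented type `T` (equivalently, `R₂ ↦ R₁` is a destabilization
of oriented type `T`). -/
def IsStabilization (T : StabType) (R₁ R₂ : RectDiagram) : Prop :=
  ∃ θ₁ θ₂ φ₁ φ₂,
    IsElementaryMoveAt R₁ R₂ θ₁ θ₂ φ₁ φ₂ ∧
    R₂.verts.ncard = R₁.verts.ncard + 2 ∧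
    (∃ v ∈ T.corners θ₁ θ₂ φ₁ φ₂, R₁.verts ∩ rect θ₁ θ₂ φ₁ φ₂ = {v}) ∧
    ∃ φ₀ ∈ ({φ₁, φ₂} : Set Real.Angle),
      ({θ₁, θ₂} : Set Real.Angle) ×ˢ {φ₀} ⊆ R₂.verts ∧ (θ₂, φ₀) ∈ T.signedVerts R₂

/-- The equivalence relation `⟨T₁, …, Tₖ⟩` on the set of rectangular diagrams of links, generated
by exchange moves and by stabilizations and destabilizations of the oriented types in `S`. -/
def moveSetoid (S : Set StabType) : Setoid RectDiagram :=
  Relation.EqvGen.setoid fun R₁ R₂ =>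
    IsExchange R₁ R₂ ∨ ∃ T ∈ S, IsStabilization T R₁ R₂ ∨ IsStabilization T R₂ R₁

/-- The equivalence class `[R]_{T₁, …, Tₖ}`. -/
def moveClass (S : Set StabType) (R : RectDiagram) : Quotient (moveSetoid S) :=
  Quotient.mk (moveSetoid S) R

end RectDiagram

/-- A finite code of a diagram, which can be given to an algorithm: the list of positive vertices
and the list of negative vertices of a diagram drawn on the grid `ℕ × ℕ`. -/
abbrev DiagramCode : Type := List (ℕ × ℕ) × List (ℕ × ℕ)

/-- The code `c` describes (the combinatorial type of) the diagram `R`: the vertices of `R` are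
obtained from those of `c` by placing the columns and the rows of the grid `ℕ × ℕ`, in their order,
on the circle cut at some point. -/
def DiagramCode.Describes (c : DiagramCode) (R : RectDiagram) : Prop :=
  ∃ (a b : ℝ) (x y : ℕ → ℝ),
    StrictMono x ∧ (∀ i, x i ∈ Set.Ico a (a + 2 * Real.pi)) ∧
    StrictMono y ∧ (∀ j, y j ∈ Set.Ico b (b + 2 * Real.pi)) ∧
    R.pos = {t | ∃ p ∈ c.1, t = ((x p.1 : Real.Angle), (y p.2 : Real.Angle))} ∧
    R.neg = {t | ∃ p ∈ c.2, t = ((x p.1 : Real.Angle), (y p.2 : Real.Angle))}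

/-!
Cut the torus open along a meridian and a longitude and read a diagram from left to right. Each
column becomes a *jump* from the height of its negative vertex to the height of its positive vertex,
so that the diagram becomes a *word*, a list of jumps between *levels*. The horizontal edges that
are present at a given moment form the set of *occupied* levels; a jump vacates the level at which
it starts and occupies the level at which it ends, and after the last jump the initial set is
restored: the word is `Closed`.

For the type `←II`, the moves of diagrams become moves of words. An exchange of columns interchanges
two consecutive jumps along chords of the circle of levels that do not cross, an exchange of rows
renames a level, a destabilization merges a jump with the next one that continues it, and a change
of the vertical cut permutes the word cyclically (`JumpWord.Step`). The other three types reduce to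
this one by a reflection of the torus and by the reversal of orientation
(`RectDiagram.moveSetoid_iff_related`).

Since jumps can be subdivided, an equivalence class contains words of any length. However, the moves
preserve the number of occupied levels, the number of passages through the horizontal cut and the
total number of occupied levels over which the jumps pass (`Step.invariants`), and these numbers
control what matters. The jumps that do pass over occupied levels are bounded in number. The parts
of the word between them have no crossings, hence are determined up to subdivision and interchange
by their ends and by the number of passages through the cut (`localEquiv_of_crossings_eq_zero`), and
therefore can be replaced by words that use few levels (`exists_similar_short`). Performing each
move of a chain between such replacements, one connects any two equivalent words by moves within
bounded sets of levels (`near_of_eqvGen`). In a closed word every level is passed equally often, so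
a bound for the number of levels bounds the length too (`length_le`). If the levels are numbered
anew for each move, the whole chain lives in a finite set of words with numbers as levels
(`Near.boundedConn`).

The replacements may use a level several times, so they are not words of diagrams. Such a word is
still the image of the word of a diagram under a monotone map of heights that identifies only
heights that are not occupied simultaneously (`Realizes`), and every move of words lifts to moves of
such diagrams (`Realizes.lift_eqvGen`). As diagrams of the same combinatorial type are related by
exchanges (`IsPlaced.related`), two diagrams are equivalent if and only if their words are connected
in the finite set (`HasWord.related_iff`). The word of a diagram is computed from a code, and the
existence of a connection in a finite graph is a primitive recursive property
(`DiagramCode.primrecPred_decide`).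
-/

namespace JumpWord

variable {Λ : Type*} [LinearOrder Λ]

/-! ### Words of jumps between levels -/

/-- `y` lies strictly inside the arc that goes upwards from `x` to `z` on the circle obtained from
the line `Λ` by joining its ends. -/
def Cyc (x y z : Λ) : Prop := (x < y ∧ y < z) ∨ (y < z ∧ z < x) ∨ (z < x ∧ x < y)

instance (x y z : Λ) : Decidable (Cyc x y z) := by unfold Cyc; infer_instance

theorem Cyc.rot {x y z : Λ} (h : Cyc x y z) : Cyc y z x := by
  unfold Cyc at *; tauto

theorem Cyc.ne₁₂ {x y z : Λ} (h : Cyc x y z) : x ≠ y := by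
  rintro rfl; unfold Cyc at h; grind

theorem Cyc.ne₂₃ {x y z : Λ} (h : Cyc x y z) : y ≠ z := h.rot.ne₁₂

theorem Cyc.ne₁₃ {x y z : Λ} (h : Cyc x y z) : x ≠ z := h.rot.rot.ne₁₂.symm

theorem cyc_or {x y z : Λ} (h₁ : x ≠ y) (h₂ : y ≠ z) (h₃ : x ≠ z) : Cyc x y z ∨ Cyc x z y := by
  unfold Cyc; grind

theorem Cyc.not_swap {x y z : Λ} (h : Cyc x y z) : ¬ Cyc x z y := by
  unfold Cyc at *; grind

/-- The chords `j` and `k` of the circle have four distinct end points and do not cross. -/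
def Noncross (j k : Λ × Λ) : Prop :=
  j.1 ≠ k.1 ∧ j.1 ≠ k.2 ∧ j.2 ≠ k.1 ∧ j.2 ≠ k.2 ∧ (Cyc j.1 k.1 j.2 ↔ Cyc j.1 k.2 j.2)

theorem Noncross.symm {j k : Λ × Λ} (hj : j.1 ≠ j.2) (hk : k.1 ≠ k.2) (h : Noncross j k) :
    Noncross k j := by
  obtain ⟨x, y⟩ := j; obtain ⟨x', y'⟩ := k
  unfold Noncross Cyc at *
  simp only at *
  grind

/-- The set of occupied levels after the jump `j`. -/
def move (S : Finset Λ) (j : Λ × Λ) : Finset Λ := insert j.2 (S.erase j.1)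

theorem mem_move {S : Finset Λ} {j : Λ × Λ} {l : Λ} :
    l ∈ move S j ↔ l = j.2 ∨ (l ≠ j.1 ∧ l ∈ S) := by simp [move]

/-- Every jump of the word starts at an occupied level and ends at a vacant one. -/
def Valid : Finset Λ → List (Λ × Λ) → Prop
  | _, [] => True
  | S, j :: w => j.1 ∈ S ∧ j.2 ∉ S ∧ Valid (move S j) w

/-- The set of occupied levels after all the jumps of a word. -/
def final (S : Finset Λ) (w : List (Λ × Λ)) : Finset Λ := w.foldl move S

@[simp] theorem valid_nil (S : Finset Λ) : Valid S [] := trivial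

@[simp] theorem valid_cons {S : Finset Λ} {j : Λ × Λ} {w : List (Λ × Λ)} :
    Valid S (j :: w) ↔ j.1 ∈ S ∧ j.2 ∉ S ∧ Valid (move S j) w := Iff.rfl

@[simp] theorem final_nil (S : Finset Λ) : final S [] = S := rfl

@[simp] theorem final_cons (S : Finset Λ) (j : Λ × Λ) (w : List (Λ × Λ)) :
    final S (j :: w) = final (move S j) w := rfl

@[simp] theorem final_append (S : Finset Λ) (v w : List (Λ × Λ)) :
    final S (v ++ w) = final (final S v) w := by simp [final]

@[simp] theorem valid_append {S : Finset Λ} {v w : List (Λ × Λ)} :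
    Valid S (v ++ w) ↔ Valid S v ∧ Valid (final S v) w := by
  induction v generalizing S with
  | nil => simp
  | cons j v ih => simp [ih, and_assoc]

theorem card_move {S : Finset Λ} {j : Λ × Λ} (h₁ : j.1 ∈ S) (h₂ : j.2 ∉ S) :
    (move S j).card = S.card := by
  have h : j.2 ∉ S.erase j.1 := fun h => h₂ (Finset.mem_of_mem_erase h)
  rw [move, Finset.card_insert_of_notMem h, Finset.card_erase_of_mem h₁]
  have := Finset.card_pos.2 ⟨_, h₁⟩
  omega

theorem card_final {S : Finset Λ} {w : List (Λ × Λ)} (h : Valid S w) :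
    (final S w).card = S.card := by
  induction w generalizing S with
  | nil => rfl
  | cons j w ih => rw [final_cons, ih h.2.2, card_move h.1 h.2.1]

/-- The levels at which some jump of the word starts or ends. -/
def labels (w : List (Λ × Λ)) : Finset Λ := (w.map Prod.fst ++ w.map Prod.snd).toFinset

theorem mem_labels {w : List (Λ × Λ)} {l : Λ} :
    l ∈ labels w ↔ ∃ j ∈ w, j.1 = l ∨ j.2 = l := by
  simp only [labels, List.mem_toFinset, List.mem_append, List.mem_map]
  constructor
  · rintro (⟨j, hj, rfl⟩ | ⟨j, hj, rfl⟩)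
    exacts [⟨j, hj, .inl rfl⟩, ⟨j, hj, .inr rfl⟩]
  · rintro ⟨j, hj, rfl | rfl⟩
    exacts [.inl ⟨j, hj, rfl⟩, .inr ⟨j, hj, rfl⟩]

@[simp] theorem labels_nil : labels ([] : List (Λ × Λ)) = ∅ := rfl

@[simp] theorem labels_append (v w : List (Λ × Λ)) : labels (v ++ w) = labels v ∪ labels w := by
  ext l; simp only [mem_labels, Finset.mem_union, List.mem_append]; grind

@[simp] theorem labels_cons (j : Λ × Λ) (w : List (Λ × Λ)) :
    labels (j :: w) = {j.1, j.2} ∪ labels w := by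
  ext l; simp only [mem_labels, Finset.mem_union, List.mem_cons, Finset.mem_insert,
    Finset.mem_singleton]; grind

theorem labels_subset_iff {w : List (Λ × Λ)} {A : Finset Λ} :
    labels w ⊆ A ↔ ∀ j ∈ w, j.1 ∈ A ∧ j.2 ∈ A := by
  constructor
  · intro h j hj
    exact ⟨h (mem_labels.2 ⟨j, hj, .inl rfl⟩), h (mem_labels.2 ⟨j, hj, .inr rfl⟩)⟩
  · intro h l hl
    obtain ⟨j, hj, rfl | rfl⟩ := mem_labels.1 hl
    exacts [(h j hj).1, (h j hj).2]

theorem mem_final_of_notMem_labels {S : Finset Λ} {w : List (Λ × Λ)} {l : Λ}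
    (hl : l ∉ labels w) : l ∈ final S w ↔ l ∈ S := by
  induction w generalizing S with
  | nil => rfl
  | cons j w ih =>
    simp only [labels_cons, Finset.mem_union, Finset.mem_insert, Finset.mem_singleton,
      not_or] at hl
    rw [final_cons, ih hl.2, mem_move]
    grind

theorem final_subset (S : Finset Λ) (w : List (Λ × Λ)) : final S w ⊆ S ∪ labels w := by
  intro l hl
  by_contra h
  simp only [Finset.mem_union, not_or] at h
  exact h.1 ((mem_final_of_notMem_labels h.2).1 hl)

/-! ### Invariants of words -/

/-- `1` if the jump passes through the point at which the circle is cut, and `0` otherwise. -/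
def wrap (j : Λ × Λ) : ℕ := if j.2 < j.1 then 1 else 0

/-- The number of times that the jumps of a word pass through the cut. -/
def wraps (w : List (Λ × Λ)) : ℕ := (w.map wrap).sum

@[simp] theorem wraps_nil : wraps ([] : List (Λ × Λ)) = 0 := rfl

@[simp] theorem wraps_cons (j : Λ × Λ) (w : List (Λ × Λ)) :
    wraps (j :: w) = wrap j + wraps w := by simp [wraps]

@[simp] theorem wraps_append (v w : List (Λ × Λ)) : wraps (v ++ w) = wraps v + wraps w := by
  simp [wraps]

/-- The number of occupied levels over which the jump `j` passes. -/
def cross (S : Finset Λ) (j : Λ × Λ) : ℕ := (S.filter fun s => Cyc j.1 s j.2).card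

/-- The total number of occupied levels over which the jumps of a word pass. -/
def crossings : Finset Λ → List (Λ × Λ) → ℕ
  | _, [] => 0
  | S, j :: w => cross S j + crossings (move S j) w

@[simp] theorem crossings_nil (S : Finset Λ) : crossings S [] = 0 := rfl

@[simp] theorem crossings_cons (S : Finset Λ) (j : Λ × Λ) (w : List (Λ × Λ)) :
    crossings S (j :: w) = cross S j + crossings (move S j) w := rfl

@[simp] theorem crossings_append (S : Finset Λ) (v w : List (Λ × Λ)) :
    crossings S (v ++ w) = crossings S v + crossings (final S v) w := by
  induction v generalizing S with
  | nil => simp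
  | cons j v ih => simp [ih, add_assoc]

/-- A jump along a chord that does not cross the chord of `k` does not change the number of occupied
levels over which `k` passes. -/
theorem cross_move_of_noncross {S : Finset Λ} {j k : Λ × Λ} (h₁ : j.1 ∈ S) (h₂ : j.2 ∉ S)
    (h : Noncross k j) : cross (move S j) k = cross S k := by
  unfold cross
  by_cases hc : Cyc k.1 j.1 k.2
  · have hc' := h.2.2.2.2.1 hc
    have e : (move S j).filter (fun s => Cyc k.1 s k.2)
        = move (S.filter fun s => Cyc k.1 s k.2) j := by
      ext l; simp only [Finset.mem_filter, mem_move]; grind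
    rw [e, card_move] <;> simp [*]
  · have hc' := fun h' => hc (h.2.2.2.2.2 h')
    congr 1
    ext l; simp only [Finset.mem_filter, mem_move]; grind

theorem move_comm {S : Finset Λ} {j k : Λ × Λ} (h : Noncross j k) :
    move (move S j) k = move (move S k) j := by
  ext l; simp only [mem_move]; unfold Noncross at h; grind

theorem cyc_split {x y z s : Λ} (h : Cyc x y z) :
    Cyc x s z ↔ (Cyc x s y ∨ s = y ∨ Cyc y s z) := by
  unfold Cyc at *; grind

theorem cyc_split_disjoint {x y z s : Λ} (h : Cyc x y z) (h' : Cyc x s y) : ¬ Cyc y s z := by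
  unfold Cyc at *; grind

theorem move_merge {S : Finset Λ} {x y z : Λ} (hy : y ∉ S) (h : Cyc x y z) :
    move (move S (x, y)) (y, z) = move S (x, z) := by
  have := h.ne₂₃
  ext l; simp only [mem_move]; grind

/-- A jump and its continuation together pass over the levels over which the merged jump passes; the
level `y`, at which they meet, is vacant before and after. -/
theorem cross_merge {S : Finset Λ} {x y z : Λ} (hy : y ∉ S) (h : Cyc x y z) :
    cross S (x, y) + cross (move S (x, y)) (y, z) = cross S (x, z) := by
  unfold cross
  rw [← Finset.card_union_of_disjoint]
  · congr 1
    ext l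
    simp only [Finset.mem_union, Finset.mem_filter, mem_move, cyc_split h (s := l)]
    have h₁ : ¬ Cyc y y z := fun h => h.ne₁₂ rfl
    have h₂ : ¬ Cyc y x z := fun h' => h.rot.not_swap h'.rot.rot.rot.rot.rot.rot |>.elim
    grind
  · rw [Finset.disjoint_left]
    intro l
    simp only [Finset.mem_filter]
    exact fun h₁ h₂ => cyc_split_disjoint h h₁.2 h₂.2

theorem wrap_merge {x y z : Λ} (h : Cyc x y z) : wrap (x, y) + wrap (y, z) = wrap (x, z) := by
  unfold Cyc at h; unfold wrap; simp only; grind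

end JumpWord

namespace JumpWord

variable {Λ : Type*} [LinearOrder Λ]

/-! ### Local moves of words -/

/-- Two consecutive jumps along chords that do not cross are interchanged, or a jump that continues
the preceding one is merged with it. -/
inductive LocalStep : List (Λ × Λ) → List (Λ × Λ) → Prop
  | swap (α β : List (Λ × Λ)) {j k : Λ × Λ} (h : Noncross j k) :
      LocalStep (α ++ j :: k :: β) (α ++ k :: j :: β)
  | merge (α β : List (Λ × Λ)) {x y z : Λ} (h : Cyc x y z) :
      LocalStep (α ++ (x, y) :: (y, z) :: β) (α ++ (x, z) :: β)

/-- The equivalence generated by local moves of words that are valid for the set `S` of initially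
occupied levels and that use only levels from `A`. -/
def LocalEquiv (A S : Finset Λ) : List (Λ × Λ) → List (Λ × Λ) → Prop :=
  Relation.EqvGen fun v w =>
    LocalStep v w ∧ Valid S v ∧ Valid S w ∧ labels v ⊆ A ∧ labels w ⊆ A

theorem LocalStep.context {v w : List (Λ × Λ)} (h : LocalStep v w) (α β : List (Λ × Λ)) :
    LocalStep (α ++ v ++ β) (α ++ w ++ β) := by
  cases h with
  | swap α' β' h => simpa using LocalStep.swap (α ++ α') (β' ++ β) h
  | merge α' β' h => simpa using LocalStep.merge (α ++ α') (β' ++ β) h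

/-- Local moves preserve the final set of occupied levels, the number of passages through the cut
and the number of crossings. -/
theorem LocalStep.invariants {S : Finset Λ} {v w : List (Λ × Λ)} (h : LocalStep v w)
    (hv : Valid S v) (hw : Valid S w) :
    final S v = final S w ∧ wraps v = wraps w ∧ crossings S v = crossings S w := by
  cases h with
  | @swap α β j k h =>
    simp only [valid_append, valid_cons] at hv hw
    obtain ⟨-, hj₁, hj₂, hk₁, hk₂, -⟩ := hv
    obtain ⟨-, hk₁', hk₂', hj₁', hj₂', -⟩ := hw
    have hj : j.1 ≠ j.2 := fun e => hj₂ (e ▸ hj₁)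
    have hk : k.1 ≠ k.2 := fun e => hk₂ (e ▸ hk₁)
    have e := move_comm (S := final S α) h
    refine ⟨?_, ?_, ?_⟩
    · simp [e]
    · simp; omega
    · simp only [crossings_append, crossings_cons, e]
      rw [cross_move_of_noncross hj₁ hj₂ (h.symm hj hk), cross_move_of_noncross hk₁' hk₂' h]
      omega
  | @merge α β x y z h =>
    simp only [valid_append, valid_cons] at hv hw
    obtain ⟨-, hj₁, hj₂, hk₁, hk₂, -⟩ := hv
    have e := move_merge hj₂ h
    refine ⟨?_, ?_, ?_⟩
    · simp [e]
    · have := wrap_merge h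
      simp only [wraps_append, wraps_cons]; omega
    · have := cross_merge hj₂ h
      simp only [crossings_append, crossings_cons, e]; omega

theorem LocalEquiv.refl {A S : Finset Λ} (w : List (Λ × Λ)) : LocalEquiv A S w w :=
  Relation.EqvGen.refl w

theorem LocalEquiv.symm {A S : Finset Λ} {v w : List (Λ × Λ)} (h : LocalEquiv A S v w) :
    LocalEquiv A S w v := Relation.EqvGen.symm _ _ h

theorem LocalEquiv.trans {A S : Finset Λ} {u v w : List (Λ × Λ)} (h : LocalEquiv A S u v)
    (h' : LocalEquiv A S v w) : LocalEquiv A S u w := Relation.EqvGen.trans _ _ _ h h'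

theorem LocalEquiv.invariants {A S : Finset Λ} {v w : List (Λ × Λ)} (h : LocalEquiv A S v w) :
    final S v = final S w ∧ wraps v = wraps w ∧ crossings S v = crossings S w ∧
      (Valid S v ↔ Valid S w) ∧ (labels v ⊆ A ↔ labels w ⊆ A) := by
  induction h with
  | rel v w h =>
    obtain ⟨h₁, h₂, h₃⟩ := h.1.invariants h.2.1 h.2.2.1
    exact ⟨h₁, h₂, h₃, by simp [h.2.1, h.2.2.1], by simp [h.2.2.2.1, h.2.2.2.2]⟩
  | refl v => simp
  | symm v w _ ih => simp [ih]
  | trans u v w _ _ ih₁ ih₂ => simp [ih₁, ih₂]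

theorem LocalEquiv.context {A S : Finset Λ} {v w α β : List (Λ × Λ)}
    (h : LocalEquiv A (final S α) v w) (hα : Valid S α) (hαA : labels α ⊆ A)
    (hβ : Valid (final (final S α) v) β) (hβA : labels β ⊆ A) :
    LocalEquiv A S (α ++ v ++ β) (α ++ w ++ β) := by
  induction h with
  | rel v w h =>
    obtain ⟨h₁, -, -⟩ := h.1.invariants h.2.1 h.2.2.1
    refine Relation.EqvGen.rel _ _ ⟨h.1.context α β, ?_, ?_, ?_, ?_⟩
    · simp [hα, h.2.1, hβ]
    · simp [hα, h.2.2.1, ← h₁, hβ]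
    · simp only [labels_append]
      exact Finset.union_subset (Finset.union_subset hαA h.2.2.2.1) hβA
    · simp only [labels_append]
      exact Finset.union_subset (Finset.union_subset hαA h.2.2.2.2) hβA
  | refl v => exact .refl _
  | symm v w h ih =>
    exact (ih (by rwa [LocalEquiv.invariants h |>.1])).symm
  | trans u v w h₁ h₂ ih₁ ih₂ =>
    exact (ih₁ hβ).trans (ih₂ (by rwa [← LocalEquiv.invariants h₁ |>.1]))

theorem LocalEquiv.cons {A S : Finset Λ} {v w : List (Λ × Λ)} {j : Λ × Λ}
    (h : LocalEquiv A (move S j) v w) (h₁ : j.1 ∈ S) (h₂ : j.2 ∉ S) (h₁A : j.1 ∈ A)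
    (h₂A : j.2 ∈ A) : LocalEquiv A S (j :: v) (j :: w) := by
  have := LocalEquiv.context (α := [j]) (β := []) (S := S) h (by simp [h₁, h₂])
    (by simp [Finset.insert_subset_iff, h₁A, h₂A]) (by simp) (by simp)
  simpa using this

theorem LocalEquiv.append_right {A S : Finset Λ} {v w β : List (Λ × Λ)}
    (h : LocalEquiv A S v w) (hβ : Valid (final S v) β) (hβA : labels β ⊆ A) :
    LocalEquiv A S (v ++ β) (w ++ β) := by
  have := LocalEquiv.context (α := []) (β := β) (S := S) h (by simp) (by simp) hβ hβA
  simpa using this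

theorem LocalEquiv.append_left {A S : Finset Λ} {v w α : List (Λ × Λ)}
    (h : LocalEquiv A (final S α) v w) (hα : Valid S α) (hαA : labels α ⊆ A) :
    LocalEquiv A S (α ++ v) (α ++ w) := by
  have := LocalEquiv.context (α := α) (β := []) (S := S) h hα hαA (by simp) (by simp)
  simpa using this

theorem valid_swap {S : Finset Λ} {j k : Λ × Λ} {w : List (Λ × Λ)} (h : Noncross j k)
    (hv : Valid S (j :: k :: w)) : Valid S (k :: j :: w) := by
  have e := move_comm (S := S) h
  simp only [valid_cons, mem_move] at hv ⊢
  rw [← e]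
  unfold Noncross at h
  grind

theorem labels_swap (j k : Λ × Λ) (w : List (Λ × Λ)) :
    labels (j :: k :: w) = labels (k :: j :: w) := by
  simp only [labels_cons]; exact Finset.union_left_comm _ _ _

theorem LocalEquiv.swap {A S : Finset Λ} {j k : Λ × Λ} {w : List (Λ × Λ)} (h : Noncross j k)
    (hv : Valid S (j :: k :: w)) (hA : labels (j :: k :: w) ⊆ A) :
    LocalEquiv A S (j :: k :: w) (k :: j :: w) :=
  .rel _ _ ⟨by simpa using LocalStep.swap [] w h, hv, valid_swap h hv, hA,
    by rwa [← labels_swap]⟩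

theorem LocalEquiv.merge {A S : Finset Λ} {x y z : Λ} {w : List (Λ × Λ)} (h : Cyc x y z)
    (hv : Valid S ((x, z) :: w)) (hy : y ∉ S) (hyA : y ∈ A) (hA : labels ((x, z) :: w) ⊆ A) :
    LocalEquiv A S ((x, y) :: (y, z) :: w) ((x, z) :: w) := by
  refine .rel _ _ ⟨by simpa using LocalStep.merge [] w h, ?_, hv, ?_, hA⟩
  · have := move_merge hy h
    have := h.ne₂₃
    simp only [valid_cons, mem_move] at hv ⊢
    grind
  · simp only [labels_cons, Finset.union_subset_iff, Finset.insert_subset_iff] at hA ⊢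
    simp_all

/-! ### The flux of a word through a level -/

/-- The number of jumps of a word that start at `l` or pass over `l`, that is, the number of
passages through a point just above `l`. -/
def flux (l : Λ) (w : List (Λ × Λ)) : ℕ := w.countP fun j => l = j.1 ∨ Cyc j.1 l j.2

/-- Conservation of the number of occupied levels up to `l`: it changes by the passages through the
point above `l` and through the cut. Hence the flux is determined by the ends of the word and by
`wraps`. -/
theorem flux_add_card {S : Finset Λ} {w : List (Λ × Λ)} (h : Valid S w) (l : Λ) :
    flux l w + ((final S w).filter (· ≤ l)).card = wraps w + (S.filter (· ≤ l)).card := by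
  induction w generalizing S with
  | nil => simp [flux]
  | cons j w ih =>
    obtain ⟨h₁, h₂, h₃⟩ := h
    have := ih h₃
    have e : (((move S j).filter (· ≤ l)).card : ℤ) + (if j.1 ≤ l then 1 else 0)
        = (S.filter (· ≤ l)).card + (if j.2 ≤ l then 1 else 0) := by
      rw [move, Finset.filter_insert, Finset.filter_erase]
      have h₄ : j.2 ∉ (S.filter (· ≤ l)).erase j.1 := by simp [h₂]
      by_cases ha : j.1 ≤ l
      · have h₅ : j.1 ∈ S.filter (· ≤ l) := by simp [h₁, ha]
        have := Finset.card_erase_of_mem h₅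
        have := Finset.card_pos.2 ⟨_, h₅⟩
        split_ifs with hb
        · rw [Finset.card_insert_of_notMem h₄]; push_cast; omega
        · omega
      · have h₅ : j.1 ∉ S.filter (· ≤ l) := by simp [ha]
        have := Finset.erase_eq_of_notMem h₅
        split_ifs with hb
        · rw [Finset.card_insert_of_notMem h₄, this]; push_cast; omega
        · rw [this]
    have hne : j.1 ≠ j.2 := fun e => h₂ (e ▸ h₁)
    have e' : (if l = j.1 ∨ Cyc j.1 l j.2 then 1 else 0) + (if j.2 ≤ l then 1 else 0)
        = wrap j + (if j.1 ≤ l then 1 else 0) := by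
      unfold Cyc wrap; grind
    have e'' : flux l (j :: w) = flux l w + (if l = j.1 ∨ Cyc j.1 l j.2 then 1 else 0) := by
      simp [flux, List.countP_cons]
    rw [e'', final_cons, wraps_cons]
    zify at *
    linarith

/-- A word without crossings does not pass over an occupied level that it does not use: the first
jump over it would be a crossing. -/
theorem flux_eq_zero {S : Finset Λ} {w : List (Λ × Λ)} {l : Λ} (hc : crossings S w = 0)
    (hl : l ∈ S) (hlw : l ∉ labels w) : flux l w = 0 := by
  induction w generalizing S with
  | nil => rfl
  | cons j w ih =>
    simp only [crossings_cons, Nat.add_eq_zero_iff] at hc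
    simp only [labels_cons, Finset.mem_union, Finset.mem_insert, Finset.mem_singleton,
      not_or] at hlw
    have := ih hc.2 (mem_move.2 (.inr ⟨hlw.1.1, hl⟩)) hlw.2
    have h₁ : ¬ Cyc j.1 l j.2 := by
      have := hc.1
      unfold cross at this
      rw [Finset.card_eq_zero, Finset.filter_eq_empty_iff] at this
      exact this hl
    rw [flux, List.countP_cons, ← flux, this]
    simp [h₁, hlw.1.1]

/-! ### Order preserving relabellings -/

/-- Relabel the levels of a word. -/
abbrev relabel {Λ Λ' : Type*} (f : Λ → Λ') (w : List (Λ × Λ)) : List (Λ' × Λ') :=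
  w.map (Prod.map f f)

section Relabel

variable {Λ' : Type*} [LinearOrder Λ'] {f : Λ → Λ'} {A : Finset Λ}

theorem cyc_map (hf : StrictMonoOn f A) {x y z : Λ} (hx : x ∈ A) (hy : y ∈ A) (hz : z ∈ A) :
    Cyc (f x) (f y) (f z) ↔ Cyc x y z := by
  unfold Cyc
  rw [hf.lt_iff_lt hx hy, hf.lt_iff_lt hy hz, hf.lt_iff_lt hz hx]

theorem noncross_map (hf : StrictMonoOn f A) {j k : Λ × Λ} (hj : j.1 ∈ A ∧ j.2 ∈ A)
    (hk : k.1 ∈ A ∧ k.2 ∈ A) : Noncross (Prod.map f f j) (Prod.map f f k) ↔ Noncross j k := by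
  unfold Noncross
  simp only [Prod.map_fst, Prod.map_snd]
  rw [cyc_map hf hj.1 hk.1 hj.2, cyc_map hf hj.1 hk.2 hj.2, hf.injOn.ne_iff hj.1 hk.1,
    hf.injOn.ne_iff hj.1 hk.2, hf.injOn.ne_iff hj.2 hk.1, hf.injOn.ne_iff hj.2 hk.2]

theorem move_map (hf : Set.InjOn f A) {S : Finset Λ} (hS : S ⊆ A) {j : Λ × Λ} (hj : j.1 ∈ A) :
    move (S.image f) (Prod.map f f j) = (move S j).image f := by
  ext l
  simp only [mem_move, Finset.mem_image, Prod.map_fst, Prod.map_snd]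
  constructor
  · rintro (rfl | ⟨h, s, hs, rfl⟩)
    · exact ⟨_, .inl rfl, rfl⟩
    · exact ⟨s, .inr ⟨fun e => h (e ▸ rfl), hs⟩, rfl⟩
  · rintro ⟨s, rfl | ⟨h, hs⟩, rfl⟩
    · exact .inl rfl
    · exact .inr ⟨fun e => h (hf (hS hs) hj e), s, hs, rfl⟩

theorem move_subset {S : Finset Λ} (hS : S ⊆ A) {j : Λ × Λ} (hj : j.2 ∈ A) : move S j ⊆ A := by
  intro l hl
  rcases mem_move.1 hl with rfl | h
  exacts [hj, hS h.2]

theorem mem_image_iff (hf : Set.InjOn f A) {S : Finset Λ} (hS : S ⊆ A) {x : Λ} (hx : x ∈ A) :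
    f x ∈ S.image f ↔ x ∈ S := by
  simp only [Finset.mem_image]
  exact ⟨fun ⟨s, hs, e⟩ => hf (hS hs) hx e ▸ hs, fun h => ⟨x, h, rfl⟩⟩

theorem final_map (hf : Set.InjOn f A) {S : Finset Λ} (hS : S ⊆ A) {w : List (Λ × Λ)}
    (hw : labels w ⊆ A) : final (S.image f) (relabel f w) = (final S w).image f := by
  induction w generalizing S with
  | nil => rfl
  | cons j w ih =>
    simp only [labels_cons, Finset.union_subset_iff, Finset.insert_subset_iff,
      Finset.singleton_subset_iff] at hw
    simp only [relabel, List.map_cons, final_cons, move_map hf hS hw.1.1]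
    exact ih (move_subset hS hw.1.2) hw.2

theorem valid_map (hf : Set.InjOn f A) {S : Finset Λ} (hS : S ⊆ A) {w : List (Λ × Λ)}
    (hw : labels w ⊆ A) : Valid (S.image f) (relabel f w) ↔ Valid S w := by
  induction w generalizing S with
  | nil => simp
  | cons j w ih =>
    simp only [labels_cons, Finset.union_subset_iff, Finset.insert_subset_iff,
      Finset.singleton_subset_iff] at hw
    simp only [relabel, List.map_cons, valid_cons, move_map hf hS hw.1.1]
    rw [Prod.map_fst, Prod.map_snd, mem_image_iff hf hS hw.1.1, mem_image_iff hf hS hw.1.2,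
      ih (move_subset hS hw.1.2) hw.2]

theorem wraps_map (hf : StrictMonoOn f A) {w : List (Λ × Λ)} (hw : labels w ⊆ A) :
    wraps (relabel f w) = wraps w := by
  induction w with
  | nil => rfl
  | cons j w ih =>
    simp only [labels_cons, Finset.union_subset_iff, Finset.insert_subset_iff,
      Finset.singleton_subset_iff] at hw
    simp only [relabel, List.map_cons, wraps_cons]
    rw [ih hw.2]
    simp only [wrap, Prod.map_fst, Prod.map_snd, hf.lt_iff_lt hw.1.2 hw.1.1]

theorem crossings_map (hf : StrictMonoOn f A) {S : Finset Λ} (hS : S ⊆ A) {w : List (Λ × Λ)}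
    (hw : labels w ⊆ A) : crossings (S.image f) (relabel f w) = crossings S w := by
  induction w generalizing S with
  | nil => rfl
  | cons j w ih =>
    simp only [labels_cons, Finset.union_subset_iff, Finset.insert_subset_iff,
      Finset.singleton_subset_iff] at hw
    simp only [relabel, List.map_cons, crossings_cons, move_map hf.injOn hS hw.1.1]
    rw [ih (move_subset hS hw.1.2) hw.2]
    congr 1
    unfold cross
    rw [Finset.filter_image, Finset.card_image_of_injOn]
    · congr 1
      refine Finset.filter_congr fun s hs => ?_
      exact cyc_map hf hw.1.1 (hS hs) hw.1.2
    · exact hf.injOn.mono fun s hs => hS (Finset.mem_filter.1 hs).1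

theorem labels_map (f : Λ → Λ') (w : List (Λ × Λ)) :
    labels (relabel f w) = (labels w).image f := by
  ext l
  simp only [mem_labels, Finset.mem_image, relabel, List.mem_map]
  constructor
  · rintro ⟨_, ⟨j, hj, rfl⟩, h | h⟩
    exacts [⟨j.1, ⟨j, hj, .inl rfl⟩, h⟩, ⟨j.2, ⟨j, hj, .inr rfl⟩, h⟩]
  · rintro ⟨_, ⟨j, hj, rfl | rfl⟩, rfl⟩
    exacts [⟨_, ⟨j, hj, rfl⟩, .inl rfl⟩, ⟨_, ⟨j, hj, rfl⟩, .inr rfl⟩]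

theorem LocalStep.map (hf : StrictMonoOn f A) {v w : List (Λ × Λ)} (h : LocalStep v w)
    (hv : labels v ⊆ A) : LocalStep (relabel f v) (relabel f w) := by
  cases h with
  | @swap α β j k h =>
    rw [labels_subset_iff] at hv
    simpa [relabel] using LocalStep.swap (relabel f α) (relabel f β)
      ((noncross_map hf (hv j (by simp)) (hv k (by simp))).2 h)
  | @merge α β x y z h =>
    rw [labels_subset_iff] at hv
    have h₁ := hv (x, y) (by simp)
    have h₂ := hv (y, z) (by simp)
    simpa [relabel] using LocalStep.merge (relabel f α) (relabel f β)
      ((cyc_map hf h₁.1 h₁.2 h₂.2).2 h)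

theorem LocalEquiv.map (hf : StrictMonoOn f A) {S : Finset Λ} (hS : S ⊆ A)
    {v w : List (Λ × Λ)} (h : LocalEquiv A S v w) :
    LocalEquiv (A.image f) (S.image f) (relabel f v) (relabel f w) := by
  induction h with
  | rel v w h =>
    refine .rel _ _ ⟨h.1.map hf h.2.2.2.1, (valid_map hf.injOn hS h.2.2.2.1).2 h.2.1,
      (valid_map hf.injOn hS h.2.2.2.2).2 h.2.2.1, ?_, ?_⟩
    · rw [labels_map]; exact Finset.image_subset_image h.2.2.2.1
    · rw [labels_map]; exact Finset.image_subset_image h.2.2.2.2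
  | refl v => exact .refl _
  | symm v w _ ih => exact ih.symm
  | trans u v w _ _ ih₁ ih₂ => exact ih₁.trans ih₂

end Relabel

/-- The elements of a finite set `A` of levels are numbered in increasing order by `g`; the inverse
numbering is `f`. -/
theorem exists_rank (A : Finset Λ) [Inhabited Λ] : ∃ (g : Λ → ℕ) (f : ℕ → Λ),
    StrictMonoOn g A ∧ StrictMonoOn f (Finset.range A.card) ∧
    (∀ a ∈ A, g a < A.card ∧ f (g a) = a) ∧ ∀ i < A.card, f i ∈ A ∧ g (f i) = i := by
  let e := A.orderIsoOfFin rfl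
  let f : ℕ → Λ := fun i => if h : i < A.card then (e ⟨i, h⟩ : Λ) else default
  let g : Λ → ℕ := fun a => if h : a ∈ A then (e.symm ⟨a, h⟩ : ℕ) else 0
  refine ⟨g, f, ?_, ?_, ?_, ?_⟩
  · intro a ha b hb hab
    have ha' : a ∈ A := ha
    have hb' : b ∈ A := hb
    simp only [g, ha', hb', dif_pos]
    have : e.symm ⟨a, ha'⟩ < e.symm ⟨b, hb'⟩ := e.symm.lt_iff_lt.2 hab
    exact this
  · intro i hi k hk hik
    have hi' : i < A.card := by simpa using hi
    have hk' : k < A.card := by simpa using hk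
    simp only [f, hi', hk', dif_pos]
    have : e ⟨i, hi'⟩ < e ⟨k, hk'⟩ := e.lt_iff_lt.2 hik
    exact this
  · intro a ha
    simp [g, f, ha]
  · intro i hi
    simp [g, f, hi]

end JumpWord

namespace JumpWord

/-! ### Words without crossings -/

/-- The level that follows `x` cyclically among `0, …, M - 1`. -/
def up (M x : ℕ) : ℕ := if x + 1 = M then 0 else x + 1

/-- The level that precedes `x` cyclically among `0, …, M - 1`. -/
def down (M x : ℕ) : ℕ := if x = 0 then M - 1 else x - 1

/-- The word that consists of the jumps from the listed levels to the next ones. -/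
abbrev unitWord (M : ℕ) (ℓ : List ℕ) : List (ℕ × ℕ) := ℓ.map fun x => (x, up M x)

theorem up_lt {M x : ℕ} (hx : x < M) : up M x < M := by unfold up; grind

theorem down_lt {M x : ℕ} (hx : x < M) : down M x < M := by unfold down; grind

theorem up_down {M x : ℕ} (hx : x < M) : up M (down M x) = x := by
  unfold up down; grind

theorem down_up {M x : ℕ} (hx : x < M) : down M (up M x) = x := by unfold up down; grind

theorem up_inj {M x y : ℕ} (hx : x < M) (hy : y < M) (h : up M x = up M y) : x = y := by
  rw [← down_up hx, h, down_up hy]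

theorem labels_unitWord {M : ℕ} {ℓ : List ℕ} (h : ∀ e ∈ ℓ, e < M) :
    labels (unitWord M ℓ) ⊆ Finset.range M := by
  rw [labels_subset_iff]
  simp only [List.mem_map, Finset.mem_range]
  rintro _ ⟨e, he, rfl⟩
  exact ⟨h e he, up_lt (h e he)⟩

/-- Induction around the circle of levels, upwards. -/
theorem forall_of_up {M : ℕ} {Q : ℕ → Prop} {a : ℕ} (ha : a < M) (hQ : Q a)
    (h : ∀ l < M, Q l → Q (up M l)) : ∀ l < M, Q l := by
  have h₁ : ∀ l, Q l → ∀ k, l + k < M → Q (l + k) := by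
    intro l hl k
    induction k with
    | zero => exact fun _ => hl
    | succ k ih =>
      intro hk
      have := h (l + k) (by omega) (ih (by omega))
      rwa [up, if_neg (by omega)] at this
  have h₂ : Q (M - 1) := by
    have := h₁ a hQ (M - 1 - a) (by omega)
    rwa [show a + (M - 1 - a) = M - 1 by omega] at this
  have h₃ : Q 0 := by
    have := h _ (by omega) h₂
    rwa [up, if_pos (by omega)] at this
  intro l hl
  simpa using h₁ 0 h₃ l (by omega)

/-- Induction around the circle of levels, downwards. -/
theorem forall_of_down {M : ℕ} {Q : ℕ → Prop} {a : ℕ} (ha : a < M) (hQ : Q a)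
    (h : ∀ l < M, Q l → Q (down M l)) : ∀ l < M, Q l := by
  by_contra hc
  push Not at hc
  obtain ⟨b, hb, hQb⟩ := hc
  refine forall_of_up hb (Q := fun l => ¬ Q l) hQb (fun l hl hQl hQu => hQl ?_) a ha hQ
  have := h _ (up_lt hl) hQu
  rwa [down_up hl] at this

theorem cross_eq_zero_iff {Λ : Type*} [LinearOrder Λ] {S : Finset Λ} {j : Λ × Λ} :
    cross S j = 0 ↔ ∀ s ∈ S, ¬ Cyc j.1 s j.2 := by
  rw [cross, Finset.card_eq_zero, Finset.filter_eq_empty_iff]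

/-- A jump that passes over no occupied level is a sequence of jumps to the next levels. -/
theorem exists_unitWord_of_jump {M : ℕ} (n : ℕ) {S : Finset ℕ} {x y : ℕ}
    (hn : (if x < y then y - x else y + M - x) ≤ n) (hx : x < M) (hy : y < M)
    (hxS : x ∈ S) (hyS : y ∉ S) (h : cross S (x, y) = 0) :
    ∃ ℓ : List ℕ, (∀ e ∈ ℓ, e < M) ∧
      LocalEquiv (Finset.range M) S [(x, y)] (unitWord M ℓ) := by
  have hxy : x ≠ y := fun e => hyS (e ▸ hxS)
  induction n generalizing S x with
  | zero => exfalso; grind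
  | succ n ih =>
    by_cases hz : up M x = y
    · exact ⟨[x], by simpa using hx, by simpa [hz] using LocalEquiv.refl _⟩
    · have hc : Cyc x (up M x) y := by unfold Cyc; unfold up at *; grind
      have hzS : up M x ∉ S := fun hm => cross_eq_zero_iff.1 h _ hm hc
      have hcr := cross_merge hzS hc
      obtain ⟨ℓ, hℓ, hE⟩ := ih (S := move S (x, up M x)) (x := up M x)
        (by unfold up at *; grind) (up_lt hx) (by simp [mem_move])
        (by simp only [mem_move]; grind) (by omega) hz
      refine ⟨x :: ℓ, by simpa [hx] using hℓ, ?_⟩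
      refine LocalEquiv.trans (LocalEquiv.symm (LocalEquiv.merge hc (w := []) ?_ hzS ?_ ?_)) ?_
      · simp [hxS, hyS]
      · simpa using up_lt hx
      · simp [Finset.insert_subset_iff, hx, hy]
      · exact hE.cons hxS hzS (by simpa using hx) (by simpa using up_lt hx)

/-- A word without crossings is equivalent to a word of jumps to the next levels. -/
theorem exists_unitWord {M : ℕ} {S : Finset ℕ} {w : List (ℕ × ℕ)} (hv : Valid S w)
    (hc : crossings S w = 0) (hw : labels w ⊆ Finset.range M) :
    ∃ ℓ : List ℕ, (∀ e ∈ ℓ, e < M) ∧ LocalEquiv (Finset.range M) S w (unitWord M ℓ) := by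
  induction w generalizing S with
  | nil => exact ⟨[], by simp, .refl _⟩
  | cons j w ih =>
    simp only [crossings_cons, Nat.add_eq_zero_iff] at hc
    simp only [labels_cons, Finset.union_subset_iff, Finset.insert_subset_iff,
      Finset.singleton_subset_iff] at hw
    obtain ⟨ℓ, hℓ, hE⟩ := ih hv.2.2 hc.2 hw.2
    obtain ⟨ℓ', hℓ', hE'⟩ := exists_unitWord_of_jump (M := M) _ le_rfl
      (by simpa using hw.1.1) (by simpa using hw.1.2) hv.1 hv.2.1 hc.1
    refine ⟨ℓ' ++ ℓ, ?_, ?_⟩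
    · simp only [List.mem_append]; rintro e (he | he)
      exacts [hℓ' e he, hℓ e he]
    · refine (hE.cons hv.1 hv.2.1 hw.1.1 hw.1.2).trans ?_
      have := hE'.append_right (β := unitWord M ℓ) ?_ (labels_unitWord hℓ)
      · simpa [unitWord] using this
      · simpa using (hE.invariants.2.2.2.1).1 hv.2.2

theorem noncross_unit {M : ℕ} {S : Finset ℕ} {e x : ℕ} (he : e < M) (hx : x < M) (hex : e ≠ x)
    (heS : e ∈ S) (heS' : up M e ∉ S) (hxS : x ∈ S) (hxS' : up M x ∉ S) :
    Noncross (e, up M e) (x, up M x) := by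
  have h₁ : e ≠ up M x := fun h => hxS' (h ▸ heS)
  have h₂ : up M e ≠ x := fun h => heS' (h ▸ hxS)
  have h₃ : up M e ≠ up M x := fun h => hex (up_inj he hx h)
  refine ⟨hex, h₁, h₂, h₃, ?_⟩
  unfold Cyc; unfold up at *; grind

/-- A jump to the next level that is possible at the beginning stays possible until it is made, so
that it can be made first. -/
theorem unitWord_move_front {M : ℕ} {S : Finset ℕ} {α β : List ℕ} {x : ℕ}
    (hM : ∀ e ∈ α ++ x :: β, e < M) (hα : x ∉ α) (hx : x ∈ S) (hx' : up M x ∉ S)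
    (hv : Valid S (unitWord M (α ++ x :: β))) :
    LocalEquiv (Finset.range M) S (unitWord M (α ++ x :: β)) (unitWord M (x :: (α ++ β))) := by
  induction α generalizing S with
  | nil => exact .refl _
  | cons e α ih =>
    have he : e < M := hM e (by simp)
    have hxM : x < M := hM x (by simp)
    simp only [List.mem_cons, not_or] at hα
    have heS : e ∈ S := hv.1
    have heS' : up M e ∉ S := hv.2.1
    have hne : up M e ≠ up M x := fun h => hα.1 (up_inj he hxM h).symm
    have h₁ := ih (S := move S (e, up M e)) (fun a ha => hM a (by simp_all)) hα.2
      (by simp only [mem_move]; grind) (by simp only [mem_move]; grind) hv.2.2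
    have h₂ := h₁.cons (j := (e, up M e)) heS heS' (by simpa using he) (by simpa using up_lt he)
    refine LocalEquiv.trans h₂ (LocalEquiv.swap
      (noncross_unit he hxM (Ne.symm hα.1) heS heS' hx hx') ?_ ?_)
    · exact (h₂.invariants.2.2.2.1).1 hv
    · exact (h₂.invariants.2.2.2.2).1 (labels_unitWord hM)

/-- Jumps to the next level that are both possible do not cross, so the order of the jumps of a
valid word is immaterial. -/
theorem unitWord_perm {M : ℕ} {S : Finset ℕ} {ℓ ℓ' : List ℕ} (hM : ∀ e ∈ ℓ, e < M)
    (hp : ℓ.Perm ℓ') (hv : Valid S (unitWord M ℓ)) (hv' : Valid S (unitWord M ℓ')) :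
    LocalEquiv (Finset.range M) S (unitWord M ℓ) (unitWord M ℓ') := by
  induction ℓ' generalizing S ℓ with
  | nil => rw [hp.eq_nil]; exact .refl _
  | cons x ℓ' ih =>
    have hx : x ∈ ℓ := hp.mem_iff.2 (by simp)
    obtain ⟨α, β, rfl, hα⟩ := List.eq_append_cons_of_mem hx
    have h := unitWord_move_front hM hα hv'.1 hv'.2.1 hv
    refine h.trans ?_
    have hp' : (α ++ β).Perm ℓ' := List.Perm.cons_inv ((List.perm_middle.symm).trans hp)
    have hM' : ∀ e ∈ α ++ β, e < M := fun e he => hM e (by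
      simp only [List.mem_append, List.mem_cons] at he ⊢; tauto)
    exact (ih hM' hp' ((h.invariants.2.2.2.1).1 hv).2.2 hv'.2.2).cons (j := (x, up M x))
      hv'.1 hv'.2.1 (by simpa using hM x (by simp)) (by simpa using up_lt (hM x (by simp)))

theorem flux_unitWord {M l : ℕ} {ℓ : List ℕ} (hl : l < M) :
    flux l (unitWord M ℓ) = ℓ.count l := by
  rw [flux, unitWord, List.countP_map, List.count]
  refine List.countP_congr fun e _ => ?_
  simp only [Function.comp, decide_eq_true_eq, beq_iff_eq]
  unfold Cyc up; grind

/-- The case of `localEquiv_of_crossings_eq_zero` in which all levels `0, …, M - 1` may be used: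
the number of jumps from each level to the next is the flux, which is determined by the ends. -/
theorem localEquiv_of_crossings_eq_zero_nat {M : ℕ} {S : Finset ℕ} {v w : List (ℕ × ℕ)}
    (hv : Valid S v) (hw : Valid S w) (hvc : crossings S v = 0) (hwc : crossings S w = 0)
    (hvM : labels v ⊆ Finset.range M) (hwM : labels w ⊆ Finset.range M)
    (hf : final S v = final S w) (hn : wraps v = wraps w) :
    LocalEquiv (Finset.range M) S v w := by
  obtain ⟨ℓ, hℓ, hE⟩ := exists_unitWord hv hvc hvM
  obtain ⟨ℓ', hℓ', hE'⟩ := exists_unitWord hw hwc hwM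
  refine hE.trans (LocalEquiv.trans ?_ hE'.symm)
  obtain ⟨h₁, h₂, -, h₄, -⟩ := hE.invariants
  obtain ⟨h₁', h₂', -, h₄', -⟩ := hE'.invariants
  refine unitWord_perm hℓ ?_ (h₄.1 hv) (h₄'.1 hw)
  rw [List.perm_iff_count]
  intro l
  by_cases hl : l < M
  · rw [← flux_unitWord hl, ← flux_unitWord hl]
    have e := flux_add_card (h₄.1 hv) l
    have e' := flux_add_card (h₄'.1 hw) l
    rw [← h₁, ← h₂, hf, hn] at e
    rw [← h₁', ← h₂'] at e'
    omega
  · rw [List.count_eq_zero_of_not_mem fun h => hl (hℓ l h),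
      List.count_eq_zero_of_not_mem fun h => hl (hℓ' l h)]

variable {Λ : Type*} [LinearOrder Λ]

theorem relabel_relabel_of_eq {Λ Λ' : Type*} [LinearOrder Λ] {g : Λ → Λ'} {f : Λ' → Λ}
    {A : Finset Λ} (h : ∀ a ∈ A, f (g a) = a) {w : List (Λ × Λ)} (hw : labels w ⊆ A) :
    relabel f (relabel g w) = w := by
  rw [labels_subset_iff] at hw
  simp only [relabel, List.map_map]
  conv_rhs => rw [← List.map_id w]
  refine List.map_congr_left fun j hj => ?_
  ext
  · exact h _ (hw j hj).1
  · exact h _ (hw j hj).2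

theorem image_image_of_eq {Λ Λ' : Type*} [DecidableEq Λ] [DecidableEq Λ'] {g : Λ → Λ'}
    {f : Λ' → Λ} {A S : Finset Λ}
    (h : ∀ a ∈ A, f (g a) = a) (hS : S ⊆ A) : (S.image g).image f = S := by
  rw [Finset.image_image]
  conv_rhs => rw [← Finset.image_id (s := S)]
  exact Finset.image_congr fun a ha => h a (hS ha)

theorem image_rank {A : Finset Λ} {g : Λ → ℕ} {f : ℕ → Λ}
    (h₁ : ∀ a ∈ A, g a < A.card ∧ f (g a) = a) (h₂ : ∀ i < A.card, f i ∈ A ∧ g (f i) = i) :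
    A.image g = Finset.range A.card ∧ (Finset.range A.card).image f = A := by
  constructor
  · ext i; simp only [Finset.mem_image, Finset.mem_range]
    exact ⟨fun ⟨a, ha, e⟩ => e ▸ (h₁ a ha).1, fun hi => ⟨f i, h₂ i hi⟩⟩
  · ext a; simp only [Finset.mem_image, Finset.mem_range]
    exact ⟨fun ⟨i, hi, e⟩ => e ▸ (h₂ i hi).1, fun ha => ⟨g a, h₁ a ha⟩⟩

/-- Words without crossings are determined, up to local moves, by the initial and final sets of
occupied levels and by the number of passages through the cut. -/
theorem localEquiv_of_crossings_eq_zero [Inhabited Λ] {A S : Finset Λ} {v w : List (Λ × Λ)}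
    (hv : Valid S v) (hw : Valid S w) (hvc : crossings S v = 0) (hwc : crossings S w = 0)
    (hS : S ⊆ A) (hvA : labels v ⊆ A) (hwA : labels w ⊆ A)
    (hf : final S v = final S w) (hn : wraps v = wraps w) : LocalEquiv A S v w := by
  obtain ⟨g, f, hg, hf', h₁, h₂⟩ := exists_rank A
  obtain ⟨e₁, e₂⟩ := image_rank h₁ h₂
  have h := localEquiv_of_crossings_eq_zero_nat (M := A.card) (S := S.image g)
    ((valid_map hg.injOn hS hvA).2 hv) ((valid_map hg.injOn hS hwA).2 hw)
    (by rw [crossings_map hg hS hvA, hvc]) (by rw [crossings_map hg hS hwA, hwc])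
    (by rw [labels_map, ← e₁]; exact Finset.image_subset_image hvA)
    (by rw [labels_map, ← e₁]; exact Finset.image_subset_image hwA)
    (by rw [final_map hg.injOn hS hvA, final_map hg.injOn hS hwA, hf])
    (by rw [wraps_map hg hvA, wraps_map hg hwA, hn])
  have hS' : S.image g ⊆ Finset.range A.card := e₁ ▸ Finset.image_subset_image hS
  have h' := h.map hf' hS'
  rwa [e₂, image_image_of_eq (fun a ha => (h₁ a ha).2) hS,
    relabel_relabel_of_eq (fun a ha => (h₁ a ha).2) hvA,
    relabel_relabel_of_eq (fun a ha => (h₁ a ha).2) hwA] at h'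

/-- A flux that is compatible with the initial set `S` and the final set `S'` is the flux of a word
without crossings: as long as a jump to the next level has to be made, some such jump is possible.
-/
theorem exists_unitWord_of_flux {M : ℕ} (n : ℕ) {S S' : Finset ℕ} {G : ℕ → ℕ}
    (hn : ∑ l ∈ Finset.range M, G l ≤ n) (hS : S ⊆ Finset.range M) (hS' : S' ⊆ Finset.range M)
    (hM : S.card < M) (hne : S.Nonempty)
    (hG : ∀ l < M, G l + (if l ∈ S' then 1 else 0) = G (down M l) + (if l ∈ S then 1 else 0)) :
    ∃ ℓ : List ℕ, (∀ e ∈ ℓ, e < M) ∧ Valid S (unitWord M ℓ) ∧ final S (unitWord M ℓ) = S' ∧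
      ∀ l < M, ℓ.count l = G l := by
  induction n generalizing S G with
  | zero =>
    have h₀ : ∀ l < M, G l = 0 := fun l hl =>
      Finset.sum_eq_zero_iff.1 (Nat.le_zero.1 hn) l (Finset.mem_range.2 hl)
    refine ⟨[], by simp, by simp, ?_, fun l hl => by simp [h₀ l hl]⟩
    ext l
    by_cases hl : l < M
    · have := hG l hl
      rw [h₀ l hl, h₀ _ (down_lt hl)] at this
      change l ∈ S ↔ l ∈ S'
      split_ifs at this <;> simp_all
    · exact ⟨fun h => absurd (Finset.mem_range.1 (hS h)) hl,
        fun h => absurd (Finset.mem_range.1 (hS' h)) hl⟩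
  | succ n ih =>
    by_cases h₀ : ∀ l < M, G l = 0
    · exact ih (by rw [Finset.sum_eq_zero fun l hl => h₀ l (Finset.mem_range.1 hl)]; omega) hS hM
        hne hG
    push Not at h₀
    obtain ⟨l₀, hl₀, hGl₀⟩ := h₀
    -- Otherwise, from a level with nonzero flux one concludes around the circle either that all
    -- levels are occupied or that none is.
    have key : ∃ x < M, G x ≠ 0 ∧ x ∈ S ∧ up M x ∉ S := by
      by_contra hc
      push Not at hc
      by_cases hl₀S : l₀ ∈ S
      · have := forall_of_up hl₀ (Q := fun l => G l ≠ 0 ∧ l ∈ S) ⟨hGl₀, hl₀S⟩ (by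
          rintro l hl ⟨h₁, h₂⟩
          have h₃ := hc l hl h₁ h₂
          have h₄ := hG (up M l) (up_lt hl)
          rw [down_up hl] at h₄
          refine ⟨?_, h₃⟩
          simp only [h₃, if_true] at h₄
          split_ifs at h₄ <;> omega)
        have h₅ : Finset.range M ⊆ S := fun l hl => (this l (Finset.mem_range.1 hl)).2
        have := Finset.card_le_card h₅
        rw [Finset.card_range] at this
        omega
      · have := forall_of_down hl₀ (Q := fun l => G l ≠ 0 ∧ l ∉ S) ⟨hGl₀, hl₀S⟩ (by
          rintro l hl ⟨h₁, h₂⟩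
          have h₄ := hG l hl
          simp only [h₂, if_false] at h₄
          have h₅ : G (down M l) ≠ 0 := by omega
          refine ⟨h₅, fun h₆ => h₂ ?_⟩
          have := hc _ (down_lt hl) h₅ h₆
          rwa [up_down hl] at this)
        obtain ⟨s, hs⟩ := hne
        exact (this s (Finset.mem_range.1 (hS hs))).2 hs
    obtain ⟨x, hx, hGx, hxS, hxS'⟩ := key
    have hux : up M x ≠ x := fun e => hxS' (e.symm ▸ hxS)
    have hcard : (move S (x, up M x)).card = S.card := card_move hxS hxS'
    obtain ⟨ℓ, h₁, h₂, h₃, h₄⟩ := ih (S := move S (x, up M x))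
      (G := fun l => if l = x then G x - 1 else G l) (by
        have h₅ : ∑ l ∈ Finset.range M, (if l = x then G x - 1 else G l)
            < ∑ l ∈ Finset.range M, G l :=
          Finset.sum_lt_sum (fun l _ => by split_ifs with e; (· subst e; omega); (· rfl))
            ⟨x, Finset.mem_range.2 hx, by simp; omega⟩
        omega)
      (move_subset hS (by simpa using up_lt hx)) (by omega)
      ⟨up M x, by simp [mem_move]⟩ (by
        intro l hl
        have h₅ := hG l hl
        have h₆ : down M l = x ↔ l = up M x :=
          ⟨fun h => by rw [← h, up_down hl], fun h => by rw [h, down_up hx]⟩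
        simp only [mem_move, h₆]
        by_cases e₁ : l = x
        · subst e₁
          simp only [hux.symm, if_false, hxS, if_true] at h₅ ⊢
          simp only [ne_eq, not_true_eq_false, false_and, or_self, if_false]
          omega
        · by_cases e₂ : l = up M x
          · subst e₂
            rw [down_up hx] at h₅
            simp only [hux, if_false, true_or, if_true, hxS'] at h₅ ⊢
            omega
          · simp only [e₁, e₂, if_false, false_or, ne_eq, not_false_eq_true, true_and]
            exact h₅)
    refine ⟨x :: ℓ, by simpa [hx] using h₁, ⟨hxS, hxS', h₂⟩, h₃, fun l hl => ?_⟩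
    rw [List.count_cons, h₄ l hl]
    by_cases e : l = x
    · subst e; simp; omega
    · simp [e, Ne.symm e]

end JumpWord

namespace JumpWord

variable {Λ : Type*} [LinearOrder Λ]

/-! ### Shortening words without crossings -/

theorem crossings_unitWord {M : ℕ} {S : Finset ℕ} {ℓ : List ℕ} (hS : S ⊆ Finset.range M)
    (hℓ : ∀ e ∈ ℓ, e < M) : crossings S (unitWord M ℓ) = 0 := by
  induction ℓ generalizing S with
  | nil => rfl
  | cons e ℓ ih =>
    have he : e < M := hℓ e (by simp)
    simp only [unitWord, List.map_cons, crossings_cons, Nat.add_eq_zero_iff]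
    refine ⟨cross_eq_zero_iff.2 fun s hs hc => ?_,
      ih (move_subset hS (by simpa using up_lt he)) fun a ha => hℓ a (by simp [ha])⟩
    have := Finset.mem_range.1 (hS hs)
    unfold Cyc up at hc; grind

theorem card_filter_le_succ {A S : Finset Λ} {f : ℕ → Λ} {g : Λ → ℕ}
    (hf : StrictMonoOn f (Finset.range A.card)) (h₁ : ∀ a ∈ A, g a < A.card ∧ f (g a) = a)
    (hS : S ⊆ A) {i : ℕ} (hi : i + 1 < A.card) :
    (S.filter (· ≤ f (i + 1))).card
      = (S.filter (· ≤ f i)).card + if f (i + 1) ∈ S then 1 else 0 := by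
  have key : ∀ s ∈ S, s ≤ f (i + 1) ↔ s ≤ f i ∨ s = f (i + 1) := by
    intro s hs
    obtain ⟨h₃, h₄⟩ := h₁ s (hS hs)
    have hi₁ : i + 1 ∈ (Finset.range A.card : Set ℕ) := by simpa using hi
    have hi₀ : i ∈ (Finset.range A.card : Set ℕ) := by simp; omega
    have hg : g s ∈ (Finset.range A.card : Set ℕ) := by simpa using h₃
    rw [← h₄, hf.le_iff_le hg hi₁, hf.le_iff_le hg hi₀, hf.injOn.eq_iff hg hi₁]
    omega
  have hlt : f i < f (i + 1) := hf (by simp; omega) (by simpa using hi) (by omega)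
  split_ifs with h
  · have e : S.filter (· ≤ f (i + 1)) = insert (f (i + 1)) (S.filter (· ≤ f i)) := by
      ext s; simp only [Finset.mem_filter, Finset.mem_insert]
      constructor
      · rintro ⟨hs, h₅⟩
        rcases (key s hs).1 h₅ with h₆ | h₆
        exacts [.inr ⟨hs, h₆⟩, .inl h₆]
      · rintro (rfl | ⟨hs, h₆⟩)
        exacts [⟨h, le_rfl⟩, ⟨hs, (key s hs).2 (.inl h₆)⟩]
    rw [e, Finset.card_insert_of_notMem]
    simp [hlt]
  · rw [add_zero]
    congr 1
    refine Finset.filter_congr fun s hs => ?_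
    rw [key s hs]
    exact ⟨fun h₅ => h₅.resolve_right fun e => h (e ▸ hs), .inl⟩

/-- A word without crossings has a replacement with few levels: only the levels occupied at the
beginning or at the end and one vacant level are needed. -/
theorem exists_short_of_crossings_eq_zero [Inhabited Λ] {S : Finset Λ} {w : List (Λ × Λ)}
    (hv : Valid S w) (hc : crossings S w = 0) :
    ∃ u, Valid S u ∧ crossings S u = 0 ∧ final S u = final S w ∧ wraps u = wraps w ∧
      labels u ⊆ labels w ∧ (labels u).card ≤ 2 * S.card + 1 := by
  rcases w with _ | ⟨j, w'⟩
  · exact ⟨[], by simp, rfl, rfl, rfl, by simp, by simp⟩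
  have hj₁ := hv.1
  have hj₂ := hv.2.1
  have hjl : j.2 ∈ labels (j :: w') := by simp
  generalize j :: w' = w at hv hc hjl
  have hflux₀ := flux_add_card hv
  have hcard : (final S w).card = S.card := card_final hv
  have hfin : ∀ a ∉ labels w, a ∈ final S w ↔ a ∈ S := fun a => mem_final_of_notMem_labels
  have hfz : ∀ a ∈ S, a ∉ labels w → flux a w = 0 := fun a => flux_eq_zero hc
  generalize final S w = S' at hflux₀ hcard hfin ⊢
  -- The level `j.2` is vacant at the beginning, so not all levels of `A` are occupied.
  obtain ⟨A, hA⟩ : ∃ A : Finset Λ, A = insert j.2 (S ∪ S') := ⟨_, rfl⟩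
  obtain ⟨g, f, hg, hf, h₁, h₂⟩ := exists_rank A
  obtain ⟨e₁, e₂⟩ := image_rank h₁ h₂
  have hSA : S ⊆ A := by grind
  have hS'A : S' ⊆ A := by grind
  have hlt : S.card < A.card := by
    have h : insert j.2 S ⊆ A := by grind
    have := Finset.card_le_card h
    rw [Finset.card_insert_of_notMem hj₂] at this
    omega
  have hAcard : A.card ≤ 2 * S.card + 1 := by
    have h₃ := Finset.card_insert_le j.2 (S ∪ S')
    have h₄ := Finset.card_union_le S S'
    rw [← hA] at h₃
    omega
  have hgS : S.image g ⊆ Finset.range A.card := e₁ ▸ Finset.image_subset_image hSA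
  have hgS' : S'.image g ⊆ Finset.range A.card := e₁ ▸ Finset.image_subset_image hS'A
  have hmem : ∀ T ⊆ A, ∀ i < A.card, i ∈ T.image g ↔ f i ∈ T := by
    intro T hT i hi
    conv_lhs => rw [← (h₂ i hi).2]
    exact mem_image_iff hg.injOn hT (h₂ i hi).1
  -- The flux of `w`, restricted to `A`, is compatible with the sets `S` and `S'`.
  have hflux : ∀ i < A.card, flux (f i) w + (if i ∈ S'.image g then 1 else 0)
      = flux (f (down A.card i)) w + (if i ∈ S.image g then 1 else 0) := by
    intro i hi
    rw [if_congr (hmem S hSA i hi) rfl rfl, if_congr (hmem S' hS'A i hi) rfl rfl]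
    have hfl := hflux₀ (f i)
    have hfl' := hflux₀ (f (down A.card i))
    rcases i with _ | i
    · have key : ∀ T ⊆ A, (T.filter (· ≤ f 0)).card = if f 0 ∈ T then 1 else 0 := by
        intro T hT
        have h₃ : ∀ s ∈ T, s ≤ f 0 ↔ s = f 0 := by
          intro s hs
          obtain ⟨h₄, h₅⟩ := h₁ s (hT hs)
          rw [← h₅, hf.le_iff_le (by simpa using h₄) (by simpa using hi),
            hf.injOn.eq_iff (by simpa using h₄) (by simpa using hi)]
          exact Nat.le_zero
        rw [Finset.filter_congr h₃, Finset.filter_eq']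
        split_ifs <;> simp
      have key' : ∀ T ⊆ A, (T.filter (· ≤ f (A.card - 1))).card = T.card := by
        intro T hT
        congr 1
        refine Finset.filter_true_of_mem fun s hs => ?_
        obtain ⟨h₄, h₅⟩ := h₁ s (hT hs)
        rw [← h₅, hf.le_iff_le (by simpa using h₄)
          (by simp only [Finset.coe_range, Set.mem_Iio]; omega)]
        omega
      simp only [down, if_true] at hfl' ⊢
      rw [key S hSA, key S' hS'A] at hfl
      rw [key' S hSA, key' S' hS'A, hcard] at hfl'
      omega
    · simp only [down, Nat.add_eq_zero_iff, one_ne_zero, and_false, if_false,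
        Nat.add_sub_cancel] at hfl' ⊢
      rw [card_filter_le_succ hf h₁ hSA hi, card_filter_le_succ hf h₁ hS'A hi] at hfl
      omega
  obtain ⟨ℓ, hℓ, hℓv, hℓf, hℓc⟩ := exists_unitWord_of_flux (M := A.card) _ le_rfl hgS hgS'
    (lt_of_le_of_lt Finset.card_image_le hlt) (Finset.Nonempty.image ⟨_, hj₁⟩ _)
    (G := fun i => flux (f i) w) hflux
  have hlab := labels_unitWord hℓ
  have hSS : (S.image g).image f = S := image_image_of_eq (fun a ha => (h₁ a ha).2) hSA
  have hSS' : (S'.image g).image f = S' := image_image_of_eq (fun a ha => (h₁ a ha).2) hS'A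
  have hsub : labels (relabel f (unitWord A.card ℓ)) ⊆ A := by
    rw [labels_map, ← e₂]; exact Finset.image_subset_image (by rwa [e₂])
  refine ⟨relabel f (unitWord A.card ℓ), ?_, ?_, ?_, ?_, ?_, ?_⟩
  · rw [← hSS]; exact (valid_map hf.injOn hgS hlab).2 hℓv
  · rw [← hSS, crossings_map hf hgS hlab]; exact crossings_unitWord hgS hℓ
  · rw [← hSS, final_map hf.injOn hgS hlab, hℓf, hSS']
  · rw [wraps_map hf hlab]
    have hM : A.card - 1 < A.card := by omega
    have hfl := flux_add_card hℓv (A.card - 1)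
    rw [flux_unitWord hM, hℓc _ hM, hℓf] at hfl
    have key : ∀ T ⊆ Finset.range A.card, T.filter (· ≤ A.card - 1) = T := fun T hT =>
      Finset.filter_true_of_mem fun s hs => by have := Finset.mem_range.1 (hT hs); omega
    have hfl' := hflux₀ (f (A.card - 1))
    have key' : ∀ T ⊆ A, T.filter (· ≤ f (A.card - 1)) = T := by
      intro T hT
      refine Finset.filter_true_of_mem fun s hs => ?_
      obtain ⟨h₄, h₅⟩ := h₁ s (hT hs)
      rw [← h₅, hf.le_iff_le (by simpa using h₄) (by simpa using hM)]
      omega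
    rw [key _ hgS, key _ hgS', Finset.card_image_of_injOn (hg.injOn.mono hSA),
      Finset.card_image_of_injOn (hg.injOn.mono hS'A), hcard] at hfl
    rw [key' S hSA, key' _ hS'A, hcard] at hfl'
    omega
  -- A level that `w` does not use is occupied all the time and has flux zero, so the short word
  -- does not use it either.
  · intro a ha
    by_contra hna
    have haA : a ∈ A := hsub ha
    obtain ⟨h₃, h₄⟩ := h₁ a haA
    have haS : a ∈ S := by
      by_contra haS
      rw [hA] at haA
      rcases Finset.mem_insert.1 haA with rfl | h₅
      · exact hna hjl
      · exact haS ((hfin _ hna).1 ((Finset.mem_union.1 h₅).resolve_left haS))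
    have haS' : a ∈ S' := (hfin _ hna).2 haS
    have h₆ := hfz _ haS hna
    have h₇ := hflux (g a) h₃
    rw [h₄, h₆, if_pos (Finset.mem_image_of_mem _ haS), if_pos (Finset.mem_image_of_mem _ haS')]
      at h₇
    rw [labels_map, Finset.mem_image] at ha
    obtain ⟨i, hi, rfl⟩ := ha
    have hiA : i < A.card := Finset.mem_range.1 (hlab hi)
    rw [(h₂ i hiA).2] at h₇
    obtain ⟨k, hk, hki⟩ := mem_labels.1 hi
    obtain ⟨e, he, rfl⟩ := List.mem_map.1 hk
    have hpos := List.count_pos_iff.2 he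
    rw [hℓc e (hℓ e he)] at hpos
    rcases hki with rfl | rfl
    · dsimp only at h₆
      omega
    · rw [down_up (hℓ e he)] at h₇
      omega
  · exact (Finset.card_le_card hsub).trans hAcard

/-! ### Similar words -/

/-- The number of passages through the cut before the first jump that passes over an occupied
level, and the list of all such jumps, with the sets of occupied levels before them and the numbers
of passages through the cut after them. -/
def profile : Finset Λ → List (Λ × Λ) → ℕ × List (Finset Λ × (Λ × Λ) × ℕ)
  | _, [] => (0, [])
  | S, j :: w =>
    let r := profile (move S j) w
    if cross S j = 0 then (wrap j + r.1, r.2) else (0, (S, j, r.1) :: r.2)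

/-- Two words are similar if they differ only in the parts between the jumps that pass over
occupied levels, and these parts are equivalent. -/
def Similar (S : Finset Λ) (v w : List (Λ × Λ)) : Prop :=
  Valid S v ∧ Valid S w ∧ final S v = final S w ∧ profile S v = profile S w

theorem Similar.refl {S : Finset Λ} {w : List (Λ × Λ)} (h : Valid S w) : Similar S w w :=
  ⟨h, h, rfl, rfl⟩

theorem Similar.symm {S : Finset Λ} {v w : List (Λ × Λ)} (h : Similar S v w) : Similar S w v :=
  ⟨h.2.1, h.1, h.2.2.1.symm, h.2.2.2.symm⟩

theorem Similar.trans {S : Finset Λ} {u v w : List (Λ × Λ)} (h : Similar S u v)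
    (h' : Similar S v w) : Similar S u w :=
  ⟨h.1, h'.2.1, h.2.2.1.trans h'.2.2.1, h.2.2.2.trans h'.2.2.2⟩

/-- The profile of a concatenation in terms of the profiles of its parts. -/
def gluePr : ℕ → List (Finset Λ × (Λ × Λ) × ℕ) → ℕ × List (Finset Λ × (Λ × Λ) × ℕ) →
    ℕ × List (Finset Λ × (Λ × Λ) × ℕ)
  | k, [], q => (k + q.1, q.2)
  | k, (S, j, m) :: l, q => (k, (S, j, (gluePr m l q).1) :: (gluePr m l q).2)

omit [LinearOrder Λ] in
theorem gluePr_add (m k : ℕ) (l : List (Finset Λ × (Λ × Λ) × ℕ))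
    (q : ℕ × List (Finset Λ × (Λ × Λ) × ℕ)) :
    gluePr (m + k) l q = (m + (gluePr k l q).1, (gluePr k l q).2) := by
  rcases l with _ | ⟨⟨S, j, n⟩, l⟩
  · simp [gluePr, add_assoc]
  · simp [gluePr]

theorem profile_append (S : Finset Λ) (v w : List (Λ × Λ)) :
    profile S (v ++ w) = gluePr (profile S v).1 (profile S v).2 (profile (final S v) w) := by
  induction v generalizing S with
  | nil => simp [profile, gluePr]
  | cons j v ih =>
    simp only [List.cons_append, profile, ih, final_cons]
    split_ifs with h
    · simp only [gluePr_add]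
    · simp only [gluePr]

theorem Similar.append {S : Finset Λ} {v v' w w' : List (Λ × Λ)} (h : Similar S v v')
    (h' : Similar (final S v) w w') : Similar S (v ++ w) (v' ++ w') := by
  refine ⟨by simp [h.1, h'.1], by simp [h.2.1, ← h.2.2.1, h'.2.1], ?_, ?_⟩
  · rw [final_append, final_append, ← h.2.2.1, h'.2.2.1]
  · rw [profile_append, profile_append, ← h.2.2.1, h.2.2.2, h'.2.2.2]

theorem Similar.cons {S : Finset Λ} {w w' : List (Λ × Λ)} {j : Λ × Λ} (h₁ : j.1 ∈ S)
    (h₂ : j.2 ∉ S) (h : Similar (move S j) w w') : Similar S (j :: w) (j :: w') :=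
  Similar.append (v := [j]) (v' := [j]) (Similar.refl (by simp [h₁, h₂])) h

/-- The effect on the profile of vacating a level `c` that no jump uses. -/
def forgetPr (c : Λ) : ℕ → List (Finset Λ × (Λ × Λ) × ℕ) → ℕ × List (Finset Λ × (Λ × Λ) × ℕ)
  | k, [] => (k, [])
  | k, (S, j, m) :: l =>
    let q := forgetPr c m l
    if cross (S.erase c) j = 0 then (k + (wrap j + q.1), q.2) else (k, (S.erase c, j, q.1) :: q.2)

theorem forgetPr_add (c : Λ) (m k : ℕ) (l : List (Finset Λ × (Λ × Λ) × ℕ)) :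
    forgetPr c (m + k) l = (m + (forgetPr c k l).1, (forgetPr c k l).2) := by
  rcases l with _ | ⟨⟨S, j, n⟩, l⟩
  · simp [forgetPr]
  · simp only [forgetPr]; split_ifs <;> simp [add_assoc]

theorem move_erase {S : Finset Λ} {c : Λ} {j : Λ × Λ} (h₂ : c ≠ j.2) :
    move (S.erase c) j = (move S j).erase c := by
  ext l; simp only [mem_move, Finset.mem_erase]; grind

theorem profile_erase {S : Finset Λ} {w : List (Λ × Λ)} {c : Λ} (hc : c ∉ labels w) :
    profile (S.erase c) w = forgetPr c (profile S w).1 (profile S w).2 := by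
  induction w generalizing S with
  | nil => rfl
  | cons j w ih =>
    simp only [labels_cons, Finset.mem_union, Finset.mem_insert, Finset.mem_singleton,
      not_or] at hc
    simp only [profile, move_erase hc.1.2, ih hc.2]
    by_cases h₀ : cross S j = 0
    · have h₁ : cross (S.erase c) j = 0 := by
        rw [cross_eq_zero_iff] at *
        exact fun s hs => h₀ s (Finset.mem_of_mem_erase hs)
      simp only [h₀, h₁, if_true, forgetPr_add]
    · simp only [h₀, if_false, forgetPr]
      split_ifs <;> simp

theorem valid_erase {S : Finset Λ} {w : List (Λ × Λ)} {c : Λ} (hc : c ∉ labels w) :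
    Valid (S.erase c) w ↔ Valid S w := by
  induction w generalizing S with
  | nil => simp
  | cons j w ih =>
    simp only [labels_cons, Finset.mem_union, Finset.mem_insert, Finset.mem_singleton,
      not_or] at hc
    simp only [valid_cons, move_erase hc.1.2, ih hc.2, Finset.mem_erase]
    grind

theorem final_erase {S : Finset Λ} {w : List (Λ × Λ)} {c : Λ} (hc : c ∉ labels w) :
    final (S.erase c) w = (final S w).erase c := by
  induction w generalizing S with
  | nil => rfl
  | cons j w ih =>
    simp only [labels_cons, Finset.mem_union, Finset.mem_insert, Finset.mem_singleton,
      not_or] at hc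
    simp only [final_cons, move_erase hc.1.2, ih hc.2]

theorem Similar.erase {S : Finset Λ} {v w : List (Λ × Λ)} {c : Λ} (h : Similar S v w)
    (hv : c ∉ labels v) (hw : c ∉ labels w) : Similar (S.erase c) v w :=
  ⟨(valid_erase hv).2 h.1, (valid_erase hw).2 h.2.1, by
    rw [final_erase hv, final_erase hw, h.2.2.1], by
    rw [profile_erase hv, profile_erase hw, h.2.2.2]⟩

/-- The part of a word before its first jump over an occupied level, in terms of the profile. -/
theorem exists_decomposition {S : Finset Λ} {w : List (Λ × Λ)} (hv : Valid S w) :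
    ∃ z r, w = z ++ r ∧ crossings S z = 0 ∧ (profile S w).1 = wraps z ∧
      (r = [] ∧ (profile S w).2 = [] ∨ ∃ j r', r = j :: r' ∧ cross (final S z) j ≠ 0 ∧
        (profile S w).2 = (final S z, j, (profile (move (final S z) j) r').1) ::
          (profile (move (final S z) j) r').2) := by
  induction w generalizing S with
  | nil => exact ⟨[], [], rfl, rfl, rfl, .inl ⟨rfl, rfl⟩⟩
  | cons j w ih =>
    by_cases h₀ : cross S j = 0
    · obtain ⟨z, r, rfl, h₁, h₂, h₃⟩ := ih hv.2.2
      refine ⟨j :: z, r, rfl, by simp [h₀, h₁], by simp [profile, h₀, h₂], ?_⟩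
      simpa [profile, h₀] using h₃
    · exact ⟨[], j :: w, rfl, rfl, by simp [profile, h₀],
        .inr ⟨j, w, rfl, h₀, by simp [profile, h₀]⟩⟩

/-- Similar words are connected by local moves that use no further levels. -/
theorem Similar.localEquiv [Inhabited Λ] {A S : Finset Λ} {v w : List (Λ × Λ)}
    (h : Similar S v w) (hS : S ⊆ A) (hvA : labels v ⊆ A) (hwA : labels w ⊆ A) :
    LocalEquiv A S v w := by
  obtain ⟨hv, hw, hf, hp⟩ := h
  generalize hl : (profile S v).2 = l
  induction l generalizing S v w with
  | nil =>
    obtain ⟨z, r, rfl, h₁, h₂, h₃⟩ := exists_decomposition hv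
    obtain ⟨z', r', rfl, h₁', h₂', h₃'⟩ := exists_decomposition hw
    rw [← hp] at h₂' h₃'
    obtain ⟨rfl, -⟩ := h₃.resolve_right (by rintro ⟨_, _, _, _, h⟩; simp [hl] at h)
    obtain ⟨rfl, -⟩ := h₃'.resolve_right (by rintro ⟨_, _, _, _, h⟩; rw [hl] at h; simp at h)
    rw [List.append_nil, List.append_nil] at *
    exact localEquiv_of_crossings_eq_zero hv hw h₁ h₁' hS hvA hwA hf (h₂.symm.trans h₂')
  | cons a l ih =>
    obtain ⟨z, r, rfl, h₁, h₂, h₃⟩ := exists_decomposition hv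
    obtain ⟨z', r', rfl, h₁', h₂', h₃'⟩ := exists_decomposition hw
    rw [← hp] at h₂' h₃'
    obtain ⟨j, r, rfl, hj, h₄⟩ := h₃.resolve_left (by rintro ⟨-, h⟩; simp [hl] at h)
    obtain ⟨j', r', rfl, hj', h₄'⟩ := h₃'.resolve_left (by rintro ⟨-, h⟩; simp [hl] at h)
    rw [h₄] at h₄' hl
    simp only [List.cons.injEq, Prod.mk.injEq] at h₄' hl
    obtain ⟨⟨e₁, rfl, e₂⟩, e₃⟩ := h₄'
    simp only [valid_append, valid_cons] at hv hw
    simp only [labels_append, labels_cons, Finset.union_subset_iff, Finset.insert_subset_iff,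
      Finset.singleton_subset_iff] at hvA hwA
    have hz : LocalEquiv A S z z' := localEquiv_of_crossings_eq_zero hv.1 hw.1 h₁ h₁' hS hvA.1
      hwA.1 e₁ (h₂.symm.trans h₂')
    have hzA : final S z ⊆ A := (final_subset S z).trans (Finset.union_subset hS hvA.1)
    rw [← e₁] at hw e₂ e₃
    have hr : LocalEquiv A (move (final S z) j) r r' := by
      refine ih (move_subset hzA hvA.2.1.2) hvA.2.2 hwA.2.2 hv.2.2.2 hw.2.2.2 ?_
        (Prod.ext e₂ e₃) hl.2
      simpa [← e₁] using hf
    refine (hz.append_right (β := j :: r) (by simp [hv]) ?_).trans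
      (LocalEquiv.append_left ?_ hw.1 hwA.1)
    · simp [Finset.insert_subset_iff, hvA]
    · rw [← e₁]; exact hr.cons hv.2.1 hv.2.2.1 hvA.2.1.1 hvA.2.1.2

/-- Every word is similar to one whose number of levels is bounded in terms of the crossings: each
of the at most `crossings S w + 1` parts without crossings is shortened. -/
theorem exists_similar_short [Inhabited Λ] {S : Finset Λ} {w : List (Λ × Λ)} (hv : Valid S w) :
    ∃ u, Similar S w u ∧ labels u ⊆ labels w ∧
      (labels u).card ≤ (crossings S w + 1) * (2 * S.card + 3) := by
  induction hn : w.length using Nat.strong_induction_on generalizing S w with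
  | _ n ih =>
  obtain ⟨z, r, rfl, h₁, -, h₃⟩ := exists_decomposition hv
  simp only [valid_append] at hv
  obtain ⟨u, hu, huc, huf, huw, hul, hun⟩ := exists_short_of_crossings_eq_zero hv.1 h₁
  have hzu : Similar S z u := by
    refine ⟨hv.1, hu, huf.symm, ?_⟩
    have key : ∀ {y : List (Λ × Λ)} {T : Finset Λ}, crossings T y = 0 →
        profile T y = (wraps y, []) := by
      intro y
      induction y with
      | nil => intros; rfl
      | cons j y ih =>
        intro T h
        simp only [crossings_cons, Nat.add_eq_zero_iff] at h
        simp [profile, h.1, ih h.2]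
    rw [key h₁, key huc, huw]
  rcases h₃ with ⟨rfl, -⟩ | ⟨j, r, rfl, hj, -⟩
  · rw [List.append_nil, h₁]
    exact ⟨u, hzu, hul, by omega⟩
  · simp only [valid_cons] at hv
    obtain ⟨u', hu', hul', hun'⟩ := ih r.length (by simp at hn; omega) hv.2.2.2 rfl
    refine ⟨u ++ j :: u', hzu.append (Similar.cons hv.2.1 hv.2.2.1 hu'), ?_, ?_⟩
    · simp only [labels_append, labels_cons]
      exact Finset.union_subset_union hul (Finset.union_subset_union le_rfl hul')
    · simp only [labels_append, labels_cons, crossings_append, crossings_cons, h₁, zero_add]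
      have h₅ := Finset.card_union_le (labels u) ({j.1, j.2} ∪ labels u')
      have h₆ := Finset.card_union_le {j.1, j.2} (labels u')
      have h₇ := Finset.card_le_two (a := j.1) (b := j.2)
      rw [card_move hv.2.1 hv.2.2.1, card_final hv.1] at hun'
      have h₈ : 1 ≤ cross (final S z) j := Nat.one_le_iff_ne_zero.2 hj
      set c := crossings (move (final S z) j) r
      calc _ ≤ (2 * S.card + 3) + (c + 1) * (2 * S.card + 3) := by omega
        _ = (1 + c + 1) * (2 * S.card + 3) := by ring
        _ ≤ _ := Nat.mul_le_mul_right _ (by omega)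

end JumpWord

namespace JumpWord

variable {Λ : Type*} [LinearOrder Λ]

/-! ### Closed words and global moves -/

/-- The levels that are occupied at the beginning or used by the jumps. -/
def supp (p : Finset Λ × List (Λ × Λ)) : Finset Λ := p.1 ∪ labels p.2

/-- The word can be performed from the given set of occupied levels and returns to it. -/
def Closed (p : Finset Λ × List (Λ × Λ)) : Prop := Valid p.1 p.2 ∧ final p.1 p.2 = p.1

/-- `x` lies on the closed arc that goes upwards from `a` to `b`. -/
def Arc (a b x : Λ) : Prop := x = a ∨ x = b ∨ Cyc a x b

/-- The moves of closed words: a local move, a cyclic permutation of the jumps, and the replacement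
of a level `a` that is vacated by the first jump and occupied again later by a level `b` such that
no jump performed in between has an end on the arc from `a` to `b`. -/
inductive Step : Finset Λ × List (Λ × Λ) → Finset Λ × List (Λ × Λ) → Prop
  | loc (S : Finset Λ) {v w : List (Λ × Λ)} (h : LocalStep v w) : Step (S, v) (S, w)
  | rot (S : Finset Λ) (j : Λ × Λ) (w : List (Λ × Λ)) : Step (S, j :: w) (move S j, w ++ [j])
  | row (S : Finset Λ) (β γ : List (Λ × Λ)) {a b x y : Λ} (hab : a ≠ b) (hx : ¬ Arc a b x)
      (hy : ¬ Arc a b y) (hβ : ∀ l ∈ labels β, ¬ Arc a b l) (ha : a ∉ labels γ)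
      (hb : b ∉ labels γ) (hbS : b ∉ S) :
      Step (S, (a, y) :: (β ++ (x, a) :: γ)) (move S (a, b), (b, y) :: (β ++ (x, b) :: γ))

/-- A move between closed words. -/
def ClosedStep (p q : Finset Λ × List (Λ × Λ)) : Prop := Step p q ∧ Closed p ∧ Closed q

/-- Closed words connected by moves that use only the levels in `A`. -/
def Linked (A : Finset Λ) : Finset Λ × List (Λ × Λ) → Finset Λ × List (Λ × Λ) → Prop :=
  Relation.EqvGen fun p q => ClosedStep p q ∧ supp p ⊆ A ∧ supp q ⊆ A

/-- If the level `c` is occupied and not used, then vacating it removes the crossings over `c`,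
which are counted by the flux. -/
theorem crossings_erase {S : Finset Λ} {w : List (Λ × Λ)} {c : Λ} (hc : c ∉ labels w)
    (hS : c ∈ S) : crossings S w = crossings (S.erase c) w + flux c w := by
  induction w generalizing S with
  | nil => simp [flux]
  | cons j w ih =>
    simp only [labels_cons, Finset.mem_union, not_or, Finset.mem_insert,
      Finset.mem_singleton] at hc
    have h₁ : c ∈ move S j := mem_move.2 (.inr ⟨hc.1.1, hS⟩)
    rw [crossings_cons, crossings_cons, ih hc.2 h₁, move_erase hc.1.2]
    have h₂ : cross S j = cross (S.erase c) j + if Cyc j.1 c j.2 then 1 else 0 := by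
      unfold cross
      rw [Finset.filter_erase]
      split_ifs with h
      · rw [Finset.card_erase_add_one (by simp [hS, h])]
      · rw [Finset.erase_eq_of_notMem (by simp [h]), add_zero]
    have h₃ : flux c (j :: w) = flux c w + if Cyc j.1 c j.2 then 1 else 0 := by
      unfold flux
      rw [List.countP_cons]
      simp [hc.1.1]
    omega

theorem cyc_of_not_arc {a b x : Λ} (hab : a ≠ b) (h : ¬ Arc a b x) : Cyc a b x := by
  unfold Arc at h; push Not at h
  exact (cyc_or hab (Ne.symm h.2.1) (Ne.symm h.1)).resolve_right h.2.2

/-- The occupied levels over which a jump passes are those over which its two parts pass, if it is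
subdivided at a vacant level. -/
theorem cross_sub {S : Finset Λ} {a b y : Λ} (h : Cyc a b y) (hb : b ∉ S) :
    cross S (a, y) = cross S (a, b) + cross S (b, y) := by
  unfold cross
  rw [← Finset.card_union_of_disjoint]
  · congr 1
    ext s
    simp only [Finset.mem_filter, Finset.mem_union]
    constructor
    · rintro ⟨hs, h'⟩
      rcases (cyc_split h).1 h' with h₁ | rfl | h₁
      exacts [.inl ⟨hs, h₁⟩, (hb hs).elim, .inr ⟨hs, h₁⟩]
    · rintro (⟨hs, h'⟩ | ⟨hs, h'⟩)
      exacts [⟨hs, (cyc_split h).2 (.inl h')⟩, ⟨hs, (cyc_split h).2 (.inr (.inr h'))⟩]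
  · rw [Finset.disjoint_left]
    simp only [Finset.mem_filter]
    exact fun s hs hs' => cyc_split_disjoint h hs.2 hs'.2

theorem cross_congr {S T : Finset Λ} {j : Λ × Λ} (h : ∀ s, Cyc j.1 s j.2 → (s ∈ S ↔ s ∈ T)) :
    cross S j = cross T j := by
  unfold cross
  congr 1
  ext s
  simp only [Finset.mem_filter]
  exact ⟨fun ⟨h₁, h₂⟩ => ⟨(h s h₂).1 h₁, h₂⟩, fun ⟨h₁, h₂⟩ => ⟨(h s h₂).2 h₁, h₂⟩⟩

theorem card_filter_le_add {S : Finset Λ} {a b : Λ} (h : a < b) :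
    (S.filter (· ≤ b)).card = (S.filter (· ≤ a)).card + (S.filter fun s => a < s ∧ s ≤ b).card := by
  rw [← Finset.card_union_of_disjoint]
  · congr 1; ext s; simp only [Finset.mem_filter, Finset.mem_union]; grind
  · rw [Finset.disjoint_left]; simp only [Finset.mem_filter]; grind

/-- If the occupancy of the levels of an arc does not change, then the two ends of the arc are
passed equally often. -/
theorem flux_eq_of_arc {S : Finset Λ} {w : List (Λ × Λ)} {a b : Λ} (hv : Valid S w)
    (h : ∀ s, Arc a b s → (s ∈ final S w ↔ s ∈ S) ) : flux a w = flux b w := by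
  have ha := flux_add_card hv a
  have hb := flux_add_card hv b
  have hc := card_final hv
  have key : ∀ T : Finset Λ, T.card = (T.filter (· ≤ max a b)).card +
      (T.filter fun s => max a b < s).card := by
    intro T
    rw [← Finset.card_union_of_disjoint]
    · congr 1; ext s; simp only [Finset.mem_filter, Finset.mem_union]; grind
    · rw [Finset.disjoint_left]; simp only [Finset.mem_filter]; grind
  rcases lt_trichotomy a b with hab | rfl | hab
  · rw [card_filter_le_add hab, card_filter_le_add hab] at hb
    have : (final S w).filter (fun s => a < s ∧ s ≤ b) = S.filter fun s => a < s ∧ s ≤ b := by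
      ext s
      simp only [Finset.mem_filter]
      have := h s
      unfold Arc Cyc at this
      grind
    rw [this] at hb
    omega
  · rfl
  · rw [card_filter_le_add hab, card_filter_le_add hab] at ha
    have e₁ := key (final S w)
    have e₂ := key S
    rw [max_eq_left hab.le, card_filter_le_add hab] at e₁ e₂
    have h₁ : (final S w).filter (fun s => a < s) = S.filter fun s => a < s := by
      ext s
      simp only [Finset.mem_filter]
      have := h s
      unfold Arc Cyc at this
      grind
    have h₂ : (final S w).filter (· ≤ b) = S.filter (· ≤ b) := by
      ext s
      simp only [Finset.mem_filter]
      have := h s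
      unfold Arc Cyc at this
      grind
    rw [h₁] at e₁
    rw [h₂] at ha hb e₁
    omega

theorem flux_append (l : Λ) (v w : List (Λ × Λ)) : flux l (v ++ w) = flux l v + flux l w := by
  simp [flux]

/-- The moves of closed words preserve the number of occupied levels, the number of passages through
the cut and the number of crossings. -/
theorem Step.invariants {p q : Finset Λ × List (Λ × Λ)} (h : Step p q) (hp : Closed p)
    (hq : Closed q) : p.1.card = q.1.card ∧ wraps p.2 = wraps q.2 ∧
      crossings p.1 p.2 = crossings q.1 q.2 := by
  cases h with
  | loc S h => exact ⟨rfl, (h.invariants hp.1 hq.1).2⟩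
  | rot S j w =>
    obtain ⟨h₁, h₂⟩ := hp
    simp only [valid_cons, final_cons] at h₁ h₂
    refine ⟨(card_move h₁.1 h₁.2.1).symm, by simp [wraps, add_comm], ?_⟩
    simp [h₂, add_comm]
  | @row S β γ a b x y hab hx hy hβ ha hb hbS =>
    obtain ⟨h₁, h₂⟩ := hp
    have cy := cyc_of_not_arc hab hy
    have cx := (cyc_of_not_arc hab hx).rot.rot
    have e₁ : move (move S (a, b)) (b, y) = move S (a, y) := by
      ext l; simp only [mem_move]; have := cy.ne₂₃; grind
    simp only [valid_cons, valid_append, final_cons, final_append] at h₁ h₂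
    obtain ⟨haS, hyS, hvβ, hxT, haT, hvγ⟩ := h₁
    have hbβ : b ∉ labels β := fun h => hβ b h (.inr (.inl rfl))
    have hT : ∀ s, Arc a b s → (s ∈ final (move S (a, y)) β ↔ s ∈ S ∧ s ≠ a) := by
      intro s hs
      rw [mem_final_of_notMem_labels (fun h => hβ s h hs), mem_move]
      grind
    refine ⟨(card_move haS hbS).symm, ?_, ?_⟩
    · have e₂ := wrap_merge cy
      have e₃ := wrap_merge cx
      simp only [wraps, List.map_cons, List.map_append, List.sum_cons, List.sum_append] at *
      omega
    · simp only [crossings_cons, crossings_append, e₁]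
      generalize final (move S (a, y)) β = T at *
      have hbT : b ∉ T := fun h => hbS ((hT b (.inr (.inl rfl))).1 h).1
      -- The jumps at the row lose and gain the levels between `a` and `b`, and these are occupied
      -- equally at both moments; `γ` passes `a` and `b` equally often.
      have f₁ : cross S (a, y) = cross S (a, b) + cross S (b, y) := cross_sub cy hbS
      have f₂ : cross (move S (a, b)) (b, y) = cross S (b, y) := by
        refine cross_congr fun s hs => ?_
        have h₃ := hs.ne₁₂
        have h₄ : s ≠ a := by rintro rfl; exact hs.not_swap cy.rot
        simp only [mem_move]; grind
      have f₃ : cross T (x, b) = cross T (x, a) + cross T (a, b) := cross_sub cx haT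
      have f₄ : cross T (a, b) = cross S (a, b) := by
        refine cross_congr fun s hs => ?_
        rw [hT s (.inr (.inr hs))]
        exact and_iff_left hs.ne₁₂.symm
      have hxb : x ≠ b := fun h => hx (.inr (.inl h))
      have hxa : x ≠ a := fun h => hx (.inl h)
      have f₅ : flux a γ = flux b γ := by
        refine flux_eq_of_arc hvγ fun s hs => ?_
        rw [h₂, mem_move, hT s hs]
        grind
      have haM : a ∈ move T (x, a) := mem_move.2 (.inl rfl)
      have hbM : b ∈ move T (x, b) := mem_move.2 (.inl rfl)
      have f₆ := crossings_erase ha haM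
      have f₇ := crossings_erase hb hbM
      have f₈ : (move T (x, a)).erase a = (move T (x, b)).erase b := by
        ext s; simp only [Finset.mem_erase, mem_move]; grind
      rw [f₈] at f₆

      omega

/-! ### Connecting closed words with few levels -/

/-- The number of levels that suffices for the words in a chain of moves, in terms of the number `n`
of occupied levels and the number `c` of crossings: besides the occupied levels there are at most
five ends of the jumps involved in a move, and the labels of the two other parts of the word, which
have at most `2 * c` crossings with at most `n + 1` occupied levels. -/
def levelBound (n c : ℕ) : ℕ := n + 5 + 2 * ((2 * c + 1) * (2 * n + 5))

theorem closed_of_similar {S : Finset Λ} {v w : List (Λ × Λ)} (h : Similar S v w)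
    (hv : Closed (S, v)) : Closed (S, w) := ⟨h.2.1, h.2.2.1.symm.trans hv.2⟩

end JumpWord

namespace JumpWord

variable {Λ : Type*} [LinearOrder Λ]

theorem card_insert_two_le (a b : Λ) (s : Finset Λ) : (({a, b} : Finset Λ) ∪ s).card ≤ 2 + s.card := by
  have h₁ := Finset.card_union_le {a, b} s
  have h₂ := Finset.card_le_two (a := a) (b := b)
  omega

theorem card_supp_le (p : Finset Λ × List (Λ × Λ)) :
    (supp p).card ≤ p.1.card + (labels p.2).card := Finset.card_union_le _ _

/-- The bound of `exists_similar_short`, in the form in which it enters `levelBound`. -/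
theorem short_mono {m c n d k : ℕ} (h : k ≤ (m + 1) * (2 * n + 3)) (hm : m ≤ 2 * c)
    (hn : n ≤ d + 1) : k ≤ (2 * c + 1) * (2 * d + 5) :=
  h.trans (Nat.mul_le_mul (by omega) (by omega))

theorem similar_append {S : Finset Λ} {α α' β β' : List (Λ × Λ)} {μ : List (Λ × Λ)}
    (hα : Similar S α α') (hμ : Valid (final S α) μ)
    (hβ : Similar (final (final S α) μ) β β') : Similar S (α ++ (μ ++ β)) (α' ++ (μ ++ β')) :=
  hα.append ((Similar.refl hμ).append hβ)

/-- A local move can be performed between short words similar to the given ones. -/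
theorem LocalStep.exists_short [Inhabited Λ] {S : Finset Λ} {v w : List (Λ × Λ)}
    (h : LocalStep v w) (hv : Valid S v) (hw : Valid S w) : ∃ v' w', Similar S v v' ∧
      Similar S w w' ∧ LocalStep v' w' ∧
      (supp (S, v')).card ≤ levelBound S.card (crossings S v) ∧
      (supp (S, w')).card ≤ levelBound S.card (crossings S v) := by
  have key : ∀ (α μ β : List (Λ × Λ)), Valid S (α ++ (μ ++ β)) → ∀ ν : List (Λ × Λ),
      Valid (final S α) ν → final (final S α) ν = final (final S α) μ →
      (labels μ).card ≤ 5 → (labels ν).card ≤ 5 → ∃ α' β', Similar S (α ++ (μ ++ β)) (α' ++ (μ ++ β')) ∧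
        Similar S (α ++ (ν ++ β)) (α' ++ (ν ++ β')) ∧
        (supp (S, α' ++ (μ ++ β'))).card ≤ levelBound S.card (crossings S (α ++ (μ ++ β))) ∧
        (supp (S, α' ++ (ν ++ β'))).card ≤ levelBound S.card (crossings S (α ++ (μ ++ β))) := by
    intro α μ β hv ν hν hf hμc hνc
    simp only [valid_append] at hv
    obtain ⟨α', hα, -, hαn⟩ := exists_similar_short hv.1
    obtain ⟨β', hβ, -, hβn⟩ := exists_similar_short hv.2.2
    refine ⟨α', β', similar_append hα hv.2.1 hβ, similar_append hα hν (by rwa [hf]), ?_⟩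
    rw [card_final hv.2.1, card_final hv.1] at hβn
    have hα' := short_mono (c := crossings S (α ++ (μ ++ β))) (d := S.card) hαn
      (by simp only [crossings_append]; omega) (by omega)
    have hβ' := short_mono (c := crossings S (α ++ (μ ++ β))) (d := S.card) hβn
      (by simp only [crossings_append]; omega) (by omega)
    have bound : ∀ ξ : List (Λ × Λ), (labels ξ).card ≤ 5 → (supp (S, α' ++ (ξ ++ β'))).card ≤
        levelBound S.card (crossings S (α ++ (μ ++ β))) := by
      intro ξ hξ
      refine (card_supp_le _).trans ?_
      simp only [labels_append]
      have h₁ := Finset.card_union_le (labels α') (labels ξ ∪ labels β')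
      have h₂ := Finset.card_union_le (labels ξ) (labels β')
      unfold levelBound
      omega
    exact ⟨bound μ hμc, bound ν hνc⟩
  have two : ∀ j k : Λ × Λ, (labels [j, k]).card ≤ 5 := by
    intro j k
    simp only [labels_cons]
    have h₁ := card_insert_two_le j.1 j.2 ({k.1, k.2} ∪ labels [])
    have h₂ := card_insert_two_le k.1 k.2 (labels [])
    have h₃ : (labels ([] : List (Λ × Λ))).card = 0 := rfl
    omega
  cases h with
  | @swap α β j k h =>
    have hv' := hv
    simp only [valid_append] at hv'
    have h₁ := valid_swap h hv'.2
    obtain ⟨α', β', h₂⟩ := key α [j, k] β (by simpa using hv) [k, j]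
      (by simp only [valid_cons] at h₁ ⊢; exact ⟨h₁.1, h₁.2.1, h₁.2.2.1, h₁.2.2.2.1, trivial⟩)
      (by simp only [final_cons, final_nil]; exact (move_comm h).symm) (two _ _) (two _ _)
    exact ⟨_, _, by simpa using h₂.1, by simpa using h₂.2.1,
      by simpa using LocalStep.swap α' β' h, by simpa using h₂.2.2.1, by simpa using h₂.2.2.2⟩
  | @merge α β x y z h =>
    have hv' := hv
    have hw' := hw
    simp only [valid_append, valid_cons] at hv' hw'
    obtain ⟨α', β', h₂⟩ := key α [(x, y), (y, z)] β (by simpa using hv) [(x, z)]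
      (by simp [hw'.2.1, hw'.2.2.1])
      (by simp only [final_cons, final_nil]; exact (move_merge hv'.2.2.1 h).symm) (two _ _)
      ((Finset.card_le_card (by intro l; simp; grind)).trans (two (x, y) (y, z)))
    exact ⟨_, _, by simpa using h₂.1, by simpa using h₂.2.1,
      by simpa using LocalStep.merge α' β' h, by simpa using h₂.2.2.1, by simpa using h₂.2.2.2⟩

/-- A move can be performed between short words similar to the given ones: the parts of the word
that do not take part in the move are shortened. -/
theorem ClosedStep.exists_short [Inhabited Λ] {p q : Finset Λ × List (Λ × Λ)}
    (h : ClosedStep p q) : ∃ v w, Similar p.1 p.2 v ∧ Similar q.1 q.2 w ∧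
      ClosedStep (p.1, v) (q.1, w) ∧
      (supp (p.1, v)).card ≤ levelBound p.1.card (crossings p.1 p.2) ∧
      (supp (q.1, w)).card ≤ levelBound p.1.card (crossings p.1 p.2) := by
  obtain ⟨h, hp, hq⟩ := h
  suffices H : ∃ v w, Similar p.1 p.2 v ∧ Similar q.1 q.2 w ∧
      Step (p.1, v) (q.1, w) ∧
      (supp (p.1, v)).card ≤ levelBound p.1.card (crossings p.1 p.2) ∧
      (supp (q.1, w)).card ≤ levelBound p.1.card (crossings p.1 p.2) by
    obtain ⟨v, w, h₁, h₂, h₃, h₄⟩ := H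
    exact ⟨v, w, h₁, h₂, ⟨h₃, closed_of_similar h₁ hp, closed_of_similar h₂ hq⟩, h₄⟩
  have inv := h.invariants hp hq
  cases h with
  | loc S h =>
    obtain ⟨v', w', h₁, h₂, h₃, h₄⟩ := h.exists_short hp.1 hq.1
    exact ⟨v', w', h₁, h₂, .loc S h₃, h₄⟩
  | rot S j w =>
    obtain ⟨h₁, h₂⟩ := hp
    simp only [valid_cons, final_cons] at h₁ h₂
    obtain ⟨u, hu, -, hun⟩ := exists_similar_short h₁.2.2
    have hj : Valid S [j] := by simp [h₁]
    refine ⟨j :: u, u ++ [j], .cons h₁.1 h₁.2.1 hu,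
      hu.append (.refl (by rw [h₂]; exact hj)), .rot S j u, ?_⟩
    rw [card_move h₁.1 h₁.2.1] at hun
    have hu' := short_mono (c := crossings S (j :: w)) (d := S.card) hun
      (by simp only [crossings_cons]; omega) (by omega)
    have c₁ := card_insert_two_le j.1 j.2 (labels u)
    have c₂ : labels (u ++ [j]) = {j.1, j.2} ∪ labels u := by
      simp [Finset.union_comm]
    have c₃ := card_move h₁.1 h₁.2.1
    constructor <;> refine (card_supp_le _).trans ?_ <;> simp only [c₂, labels_cons, c₃] <;>
      unfold levelBound <;> omega
  | @row S β γ a b x y hab hx hy hβ ha hb hbS =>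
    have hcl := hp
    obtain ⟨h₁, h₂⟩ := hp
    have cy := cyc_of_not_arc hab hy
    have e₁ : move (move S (a, b)) (b, y) = move S (a, y) := by
      ext l; simp only [mem_move]; have := cy.ne₂₃; grind
    simp only [valid_cons, valid_append, final_cons, final_append] at h₁ h₂
    obtain ⟨haS, hyS, hvβ, hxT, haT, hvγ⟩ := h₁
    have h₃ := hq.1
    simp only [valid_cons, valid_append, e₁] at h₃
    obtain ⟨hbS', hyS', -, -, hbT, -⟩ := h₃
    set T := final (move S (a, y)) β with hT
    have hTc : T.card = S.card := by rw [hT, card_final hvβ, card_move haS hyS]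
    have hxb : x ≠ b := fun h => hx (.inr (.inl h))
    have hxa : x ≠ a := fun h => hx (.inl h)
    have hbM : b ∉ move T (x, a) := by simp only [mem_move]; grind
    -- The word `γ` has to be shortened simultaneously for the occupied level `a` and for `b` in its
    -- place; it is shortened with both levels occupied.
    set U := insert b (move T (x, a)) with hU
    have hUb : U.erase b = move T (x, a) := by rw [hU, Finset.erase_insert hbM]
    have hUa : U.erase a = move T (x, b) := by
      ext s; simp only [hU, Finset.mem_erase, Finset.mem_insert, mem_move]; grind
    have hUc : U.card = S.card + 1 := by
      rw [hU, Finset.card_insert_of_notMem hbM, card_move hxT haT, hTc]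
    have haU : a ∈ U := by simp [hU, mem_move]
    have hvU : Valid U γ := (valid_erase hb).1 (hUb ▸ hvγ)
    obtain ⟨β', hβ', hβl, hβn⟩ := exists_similar_short hvβ
    obtain ⟨γ', hγ', hγl, hγn⟩ := exists_similar_short hvU
    have haγ : a ∉ labels γ' := fun h => ha (hγl h)
    have hbγ : b ∉ labels γ' := fun h => hb (hγl h)
    have hγb := hγ'.erase hb hbγ
    have hγa := hγ'.erase ha haγ
    rw [hUb] at hγb
    rw [hUa] at hγa
    refine ⟨(a, y) :: (β' ++ (x, a) :: γ'), (b, y) :: (β' ++ (x, b) :: γ'), ?_, ?_,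
      .row S β' γ' hab hx hy (fun l h => hβ l (hβl h)) haγ hbγ hbS, ?_⟩
    · exact .cons haS hyS (hβ'.append (.cons hxT haT hγb))
    · refine .cons hbS' hyS' ?_
      rw [e₁]
      exact hβ'.append (.cons hxT hbT hγa)
    -- Occupying one more level at most doubles the crossings.
    have c₀ : crossings U γ ≤ 2 * crossings S ((a, y) :: (β ++ (x, a) :: γ)) := by
      have i₃ := inv.2.2
      simp only [crossings_cons, crossings_append, e₁, ← hT] at i₃ ⊢
      have i₄ := crossings_erase ha haU
      have i₅ := crossings_erase hb (S := U) (by simp [hU])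
      have i₆ : flux b γ ≤ crossings (U.erase a) γ := by
        have : b ∈ U.erase a := by rw [hUa]; exact mem_move.2 (.inl rfl)
        rw [crossings_erase hb this]; omega
      rw [hUa] at i₄ i₆
      rw [hUb] at i₅
      omega
    have c₁ := short_mono (d := S.card) hγn c₀ hUc.le
    rw [card_move haS hyS] at hβn
    have c₂ := short_mono (c := crossings S ((a, y) :: (β ++ (x, a) :: γ))) (d := S.card) hβn
      (by simp only [crossings_cons, crossings_append]; omega) (by omega)
    have c₃ : ∀ e, (labels ((e, y) :: (β' ++ (x, e) :: γ'))).card ≤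
        3 + ((labels β').card + (labels γ').card) := by
      intro e
      have : labels ((e, y) :: (β' ++ (x, e) :: γ')) = {e, y} ∪ ({x} ∪ (labels β' ∪ labels γ')) := by
        ext l; simp only [labels_cons, labels_append, Finset.mem_union, Finset.mem_insert,
          Finset.mem_singleton]; tauto
      rw [this]
      have i₁ := card_insert_two_le e y ({x} ∪ (labels β' ∪ labels γ'))
      have i₂ := Finset.card_union_le {x} (labels β' ∪ labels γ')
      have i₃ := Finset.card_union_le (labels β') (labels γ')
      rw [Finset.card_singleton] at i₂
      omega
    have c₄ : (move S (a, b)).card = S.card := card_move haS hbS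
    constructor
    · refine (card_supp_le _).trans ?_
      have := c₃ a
      unfold levelBound
      simp only
      omega
    · refine (card_supp_le _).trans ?_
      have := c₃ b
      unfold levelBound
      simp only [c₄]
      omega

/-- A local equivalence that starts at a closed word is a chain of moves of closed words. -/
theorem LocalEquiv.linked {A S : Finset Λ} {v w : List (Λ × Λ)} (h : LocalEquiv A S v w)
    (hS : S ⊆ A) (hv : Closed (S, v)) : Linked A (S, v) (S, w) := by
  suffices H : ∀ v w, LocalEquiv A S v w → (Closed (S, v) ↔ Closed (S, w)) ∧
      (Closed (S, v) → Linked A (S, v) (S, w)) from (H v w h).2 hv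
  intro v w h
  induction h with
  | rel v w h =>
    obtain ⟨h₁, h₂, h₃, h₄, h₅⟩ := h
    have inv := h₁.invariants h₂ h₃
    have key : Closed (S, v) ↔ Closed (S, w) := by simp only [Closed, h₂, h₃, inv.1]
    exact ⟨key, fun hc => .rel _ _ ⟨⟨.loc S h₁, hc, key.1 hc⟩, Finset.union_subset hS h₄,
      Finset.union_subset hS h₅⟩⟩
  | refl v => exact ⟨Iff.rfl, fun _ => .refl _⟩
  | symm v w _ ih => exact ⟨ih.1.symm, fun hc => .symm _ _ (ih.2 (ih.1.2 hc))⟩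
  | trans u v w _ _ ih ih' =>
    exact ⟨ih.1.trans ih'.1, fun hc => .trans _ _ _ (ih.2 hc) (ih'.2 (ih.1.1 hc))⟩

/-- Words connected by moves that all take place within a set of at most `M` levels, which may be
different for different moves. -/
def Near (M : ℕ) : Finset Λ × List (Λ × Λ) → Finset Λ × List (Λ × Λ) → Prop :=
  Relation.EqvGen fun p q => ClosedStep p q ∧ (supp p ∪ supp q).card ≤ M

theorem Linked.near {A : Finset Λ} {M : ℕ} (hA : A.card ≤ M) {p q : Finset Λ × List (Λ × Λ)}
    (h : Linked A p q) : Near M p q :=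
  Relation.EqvGen.mono
    (fun _ _ ⟨h₁, h₂, h₃⟩ => ⟨h₁, (Finset.card_le_card (Finset.union_subset h₂ h₃)).trans hA⟩) _ _ h

theorem Similar.near [Inhabited Λ] {S : Finset Λ} {v w : List (Λ × Λ)} {K : ℕ}
    (h : Similar S v w) (hc : Closed (S, v)) (hv : (supp (S, v)).card ≤ K)
    (hw : (supp (S, w)).card ≤ K) : Near (2 * K) (S, v) (S, w) := by
  have hA := Finset.card_union_le (supp (S, v)) (supp (S, w))
  refine Linked.near (A := supp (S, v) ∪ supp (S, w)) (by omega) ?_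
  have hS : S ⊆ supp (S, v) ∪ supp (S, w) := fun s hs => by simp [supp, hs]
  exact (h.localEquiv hS (fun s hs => by simp [supp, hs]) (fun s hs => by simp [supp, hs])).linked
    hS hc

/-- Closed words connected by moves are connected by moves each of which uses few levels. -/
theorem near_of_eqvGen [Inhabited Λ] {p q : Finset Λ × List (Λ × Λ)} {K : ℕ}
    (h : Relation.EqvGen ClosedStep p q) (hpc : Closed p)
    (hK : levelBound p.1.card (crossings p.1 p.2) ≤ K) (hp : (supp p).card ≤ K)
    (hq : (supp q).card ≤ K) : Near (2 * K) p q := by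
  -- The induction concerns all words similar to the given ones.
  suffices H : ∀ p q, Relation.EqvGen ClosedStep p q →
      (Closed p ↔ Closed q) ∧ (Closed p → p.1.card = q.1.card ∧
        crossings p.1 p.2 = crossings q.1 q.2) ∧
      (Closed p → levelBound p.1.card (crossings p.1 p.2) ≤ K → ∀ v w, Similar p.1 p.2 v →
        Similar q.1 q.2 w → (supp (p.1, v)).card ≤ K → (supp (q.1, w)).card ≤ K →
        Near (2 * K) (p.1, v) (q.1, w)) by
    obtain ⟨h₁, -, h₂⟩ := H p q h
    exact h₂ hpc hK p.2 q.2 (.refl hpc.1) (.refl (h₁.1 hpc).1) hp hq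
  intro p q h
  induction h with
  | rel p q h =>
    have inv := h.1.invariants h.2.1 h.2.2
    refine ⟨iff_of_true h.2.1 h.2.2, fun _ => ⟨inv.1, inv.2.2⟩, fun hc hK v w hv hw hvK hwK => ?_⟩
    obtain ⟨v', w', h₁, h₂, h₃, h₄, h₅⟩ := h.exists_short
    refine .trans _ _ _ (Similar.near (hv.symm.trans h₁) (closed_of_similar hv h.2.1) hvK
      (h₄.trans hK)) (.trans _ _ _ (.rel _ _ ⟨h₃, ?_⟩)
      (Similar.near (h₂.symm.trans hw) (closed_of_similar h₂ h.2.2) (h₅.trans hK) hwK))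
    have := Finset.card_union_le (supp (p.1, v')) (supp (q.1, w'))
    omega
  | refl p =>
    exact ⟨Iff.rfl, fun _ => ⟨rfl, rfl⟩, fun hc _ v w hv hw hvK hwK =>
      Similar.near (hv.symm.trans hw) (closed_of_similar hv hc) hvK hwK⟩
  | symm p q _ ih =>
    obtain ⟨h₁, h₂, h₃⟩ := ih
    refine ⟨h₁.symm, fun hc => ?_, fun hc hK v w hv hw hvK hwK => ?_⟩
    · have := h₂ (h₁.2 hc); exact ⟨this.1.symm, this.2.symm⟩
    · have := h₂ (h₁.2 hc)
      exact .symm _ _ (h₃ (h₁.2 hc) (by rwa [this.1, this.2]) w v hw hv hwK hvK)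
  | trans p q r _ _ ih ih' =>
    obtain ⟨h₁, h₂, h₃⟩ := ih
    obtain ⟨h₁', h₂', h₃'⟩ := ih'
    refine ⟨h₁.trans h₁', fun hc => ?_, fun hc hK v w hv hw hvK hwK => ?_⟩
    · have e := h₂ hc; have e' := h₂' (h₁.1 hc)
      exact ⟨e.1.trans e'.1, e.2.trans e'.2⟩
    · have e := h₂ hc
      obtain ⟨u, hu, -, hun⟩ := exists_similar_short (h₁.1 hc).1
      have hK' : levelBound q.1.card (crossings q.1 q.2) ≤ K := by rwa [← e.1, ← e.2]
      have huK : (supp (q.1, u)).card ≤ K := by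
        refine (card_supp_le _).trans (le_trans ?_ hK')
        have := short_mono (c := crossings q.1 q.2) (d := q.1.card) hun (by omega) (by omega)
        unfold levelBound
        simp only
        omega
      exact .trans _ _ _ (h₃ hc hK v u hv hu hvK huK) (h₃' (h₁.1 hc) hK' u w hu hw huK hwK)

end JumpWord

namespace JumpWord

/-! ### Words up to relabelling of the levels -/

section Relabelling

variable {Λ Λ' Λ'' : Type*} [LinearOrder Λ] [LinearOrder Λ'] [LinearOrder Λ'']

/-- The map `f` embeds the finite set `A` of levels with its cyclic order. -/
structure CycIso (f : Λ → Λ') (A : Finset Λ) : Prop where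
  injOn : Set.InjOn f A
  cyc : ∀ x ∈ A, ∀ y ∈ A, ∀ z ∈ A, (Cyc (f x) (f y) (f z) ↔ Cyc x y z)

/-- The effect of a change of the names of levels. -/
def mapState (f : Λ → Λ') (p : Finset Λ × List (Λ × Λ)) : Finset Λ' × List (Λ' × Λ') :=
  (p.1.image f, relabel f p.2)

theorem supp_mapState (f : Λ → Λ') (p : Finset Λ × List (Λ × Λ)) :
    supp (mapState f p) = (supp p).image f := by
  simp only [supp, mapState, labels_map, Finset.image_union]

theorem CycIso.mono {f : Λ → Λ'} {A B : Finset Λ} (h : CycIso f B) (hAB : A ⊆ B) : CycIso f A :=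
  ⟨h.injOn.mono hAB, fun x hx y hy z hz => h.cyc x (hAB hx) y (hAB hy) z (hAB hz)⟩

theorem _root_.StrictMonoOn.cycIso {f : Λ → Λ'} {A : Finset Λ} (h : StrictMonoOn f A) :
    CycIso f A := ⟨h.injOn, fun _ hx _ hy _ hz => cyc_map h hx hy hz⟩

theorem CycIso.comp {f : Λ → Λ'} {g : Λ' → Λ''} {A : Finset Λ} (hf : CycIso f A)
    (hg : CycIso g (A.image f)) : CycIso (g ∘ f) A := by
  have h : ∀ a ∈ A, f a ∈ A.image f := fun a ha => Finset.mem_image_of_mem f ha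
  refine ⟨fun a ha b hb e => hf.injOn ha hb (hg.injOn (h a ha) (h b hb) e), ?_⟩
  intro x hx y hy z hz
  rw [← hf.cyc x hx y hy z hz]
  exact hg.cyc _ (h x hx) _ (h y hy) _ (h z hz)

theorem CycIso.exists_inverse [Nonempty Λ] {f : Λ → Λ'} {A : Finset Λ} (hf : CycIso f A) :
    ∃ g : Λ' → Λ, CycIso g (A.image f) ∧ ∀ a ∈ A, g (f a) = a := by
  have h : ∀ a ∈ A, Function.invFunOn f A (f a) = a := fun a ha =>
    hf.injOn.leftInvOn_invFunOn ha
  refine ⟨Function.invFunOn f A, ⟨?_, ?_⟩, h⟩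
  · intro x hx y hy e
    obtain ⟨a, ha, rfl⟩ := Finset.mem_image.1 hx
    obtain ⟨b, hb, rfl⟩ := Finset.mem_image.1 hy
    rw [h a ha, h b hb] at e
    rw [e]
  · intro x hx y hy z hz
    obtain ⟨a, ha, rfl⟩ := Finset.mem_image.1 hx
    obtain ⟨b, hb, rfl⟩ := Finset.mem_image.1 hy
    obtain ⟨c, hc, rfl⟩ := Finset.mem_image.1 hz
    rw [h a ha, h b hb, h c hc, hf.cyc a ha b hb c hc]

omit [LinearOrder Λ] in
theorem mapState_comp (f : Λ → Λ') (g : Λ' → Λ'') (p : Finset Λ × List (Λ × Λ)) :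
    mapState g (mapState f p) = mapState (g ∘ f) p := by
  simp [mapState, Finset.image_image, relabel]

theorem mapState_congr {f g : Λ → Λ'} {p : Finset Λ × List (Λ × Λ)}
    (h : ∀ a ∈ supp p, f a = g a) : mapState f p = mapState g p := by
  unfold mapState
  congr 1
  · exact Finset.image_congr fun a ha => h a (Finset.mem_union_left _ ha)
  · refine List.map_congr_left fun j hj => ?_
    have h₁ : j.1 ∈ supp p := Finset.mem_union_right _ (mem_labels.2 ⟨j, hj, .inl rfl⟩)
    have h₂ : j.2 ∈ supp p := Finset.mem_union_right _ (mem_labels.2 ⟨j, hj, .inr rfl⟩)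
    simp only [Prod.map, h _ h₁, h _ h₂]

theorem mapState_id (p : Finset Λ × List (Λ × Λ)) : mapState id p = p := by
  simp [mapState, relabel]

theorem closed_mapState {f : Λ → Λ'} {p : Finset Λ × List (Λ × Λ)} (hf : Set.InjOn f (supp p)) :
    Closed (mapState f p) ↔ Closed p := by
  have h₁ : p.1 ⊆ supp p := Finset.subset_union_left
  have h₂ : labels p.2 ⊆ supp p := Finset.subset_union_right
  have h₃ := final_subset p.1 p.2
  unfold Closed mapState
  simp only [valid_map hf h₁ h₂, final_map hf h₁ h₂]
  refine and_congr_right fun _ => ⟨fun h => ?_, fun h => by rw [h]⟩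
  ext a
  constructor
  · intro ha
    exact (mem_image_iff hf h₁ (h₃ ha)).1 (h ▸ Finset.mem_image_of_mem f ha)
  · intro ha
    exact (mem_image_iff hf h₃ (h₁ ha)).1 (h.symm ▸ Finset.mem_image_of_mem f ha)

theorem Step.map {f : Λ → Λ'} {A : Finset Λ} (hf : StrictMonoOn f A)
    {p q : Finset Λ × List (Λ × Λ)} (h : Step p q) (hp : supp p ⊆ A) (hq : supp q ⊆ A) :
    Step (mapState f p) (mapState f q) := by
  have hp₁ : p.1 ⊆ A := Finset.subset_union_left.trans hp
  have hp₂ : labels p.2 ⊆ A := Finset.subset_union_right.trans hp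
  have hq₂ : labels q.2 ⊆ A := Finset.subset_union_right.trans hq
  cases h with
  | loc S h => exact .loc _ (h.map hf hp₂)
  | rot S j w =>
    simp only [labels_cons, Finset.union_subset_iff, Finset.insert_subset_iff,
      Finset.singleton_subset_iff] at hp₂
    have := Step.rot (S.image f) (Prod.map f f j) (relabel f w)
    rw [move_map hf.injOn hp₁ hp₂.1.1] at this
    simpa [mapState] using this
  | @row S β γ a b x y hab hx hy hβ ha hb hbS =>
    simp only [labels_cons, labels_append, Finset.union_subset_iff, Finset.insert_subset_iff,
      Finset.singleton_subset_iff] at hp₂ hq₂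
    obtain ⟨⟨haA, hyA⟩, hβA, ⟨hxA, -⟩, hγA⟩ := hp₂
    obtain ⟨⟨hbA, -⟩, -⟩ := hq₂
    have arc : ∀ l ∈ A, Arc (f a) (f b) (f l) ↔ Arc a b l := by
      intro l hl
      unfold Arc
      rw [hf.injOn.eq_iff hl haA, hf.injOn.eq_iff hl hbA, cyc_map hf haA hl hbA]
    have key : ∀ l ∈ A, ∀ w : List (Λ × Λ), labels w ⊆ A → l ∉ labels w →
        f l ∉ labels (relabel f w) := by
      intro l hl w hw hlw
      rwa [labels_map, mem_image_iff hf.injOn hw hl]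
    have := Step.row (S.image f) (relabel f β) (relabel f γ) (a := f a) (b := f b) (x := f x)
      (y := f y) (fun e => hab (hf.injOn haA hbA e)) (by rwa [arc x hxA]) (by rwa [arc y hyA])
      (by
        intro l hl
        rw [labels_map] at hl
        obtain ⟨m, hm, rfl⟩ := Finset.mem_image.1 hl
        rw [arc m (hβA hm)]
        exact hβ m hm)
      (key a haA γ hγA ha) (key b hbA γ hγA hb) (by rwa [mem_image_iff hf.injOn hp₁ hbA])
    rw [show (f a, f b) = Prod.map f f (a, b) from rfl, move_map hf.injOn hp₁ haA] at this
    simpa [mapState] using this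

theorem ClosedStep.map {f : Λ → Λ'} {A : Finset Λ} (hf : StrictMonoOn f A)
    {p q : Finset Λ × List (Λ × Λ)} (h : ClosedStep p q) (hp : supp p ⊆ A) (hq : supp q ⊆ A) :
    ClosedStep (mapState f p) (mapState f q) :=
  ⟨h.1.map hf hp hq, (closed_mapState (hf.injOn.mono hp)).2 h.2.1,
    (closed_mapState (hf.injOn.mono hq)).2 h.2.2⟩

/-- The number of jumps of a closed word is bounded in terms of the number of levels: the flux
through each level equals the number of passages through the cut, and each jump contributes to the
flux through the level at which it starts. -/
theorem length_le {p : Finset Λ × List (Λ × Λ)} (h : Closed p) :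
    p.2.length ≤ wraps p.2 * (supp p).card := by
  have h₁ : ∀ l, flux l p.2 = wraps p.2 := by
    intro l
    have := flux_add_card h.1 l
    rw [h.2] at this
    omega
  have h₂ : ∀ w : List (Λ × Λ), (∀ j ∈ w, j.1 ∈ supp p) →
      w.length ≤ ∑ l ∈ supp p, flux l w := by
    intro w
    induction w with
    | nil => simp
    | cons j w ih =>
      intro hw
      have h₃ := ih fun j hj => hw j (List.mem_cons_of_mem _ hj)
      have h₄ : ∑ l ∈ supp p, flux l (j :: w) = ∑ l ∈ supp p, flux l w +
          ∑ l ∈ supp p, flux l [j] := by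
        rw [← Finset.sum_add_distrib]
        refine Finset.sum_congr rfl fun l _ => ?_
        rw [show j :: w = [j] ++ w from rfl, flux_append, add_comm]
      have h₅ : 1 ≤ ∑ l ∈ supp p, flux l [j] := by
        refine le_trans ?_ (Finset.single_le_sum (fun _ _ => Nat.zero_le _)
          (hw j List.mem_cons_self))
        simp [flux]
      rw [List.length_cons]
      omega
  have h₃ := h₂ p.2 fun j hj => Finset.mem_union_right _ (mem_labels.2 ⟨j, hj, .inl rfl⟩)
  simp only [h₁, Finset.sum_const, smul_eq_mul] at h₃
  linarith [mul_comm (supp p).card (wraps p.2)]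

end Relabelling

/-! ### Words on numbered levels -/

/-- The moves of closed words whose levels are numbered, including changes of the numbering. -/
def NatStep (c d : Finset ℕ × List (ℕ × ℕ)) : Prop :=
  ClosedStep c d ∨ Closed c ∧ ∃ f : ℕ → ℕ, CycIso f (supp c) ∧ d = mapState f c

/-- The words of length at most `Q` with levels below `M`. -/
def Bounded (M Q : ℕ) (c : Finset ℕ × List (ℕ × ℕ)) : Prop :=
  supp c ⊆ Finset.range M ∧ c.2.length ≤ Q

/-- Words connected by moves that involve only words of bounded size. -/
def BoundedConn (M Q : ℕ) : Finset ℕ × List (ℕ × ℕ) → Finset ℕ × List (ℕ × ℕ) → Prop :=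
  Relation.EqvGen fun c d => NatStep c d ∧ Bounded M Q c ∧ Bounded M Q d

variable {Λ : Type*} [LinearOrder Λ]

/-- `c` is obtained from `p` by numbering the levels with their cyclic order. -/
def Numbering (p : Finset Λ × List (Λ × Λ)) (c : Finset ℕ × List (ℕ × ℕ)) : Prop :=
  ∃ f : Λ → ℕ, CycIso f (supp p) ∧ c = mapState f p

/-- Two numberings of the levels of a closed word differ by a change of the numbering. -/
theorem Numbering.natStep [Nonempty Λ] {p : Finset Λ × List (Λ × Λ)}
    {c d : Finset ℕ × List (ℕ × ℕ)} (hp : Closed p) (hc : Numbering p c) (hd : Numbering p d) :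
    NatStep c d := by
  obtain ⟨f, hf, rfl⟩ := hc
  obtain ⟨g, hg, rfl⟩ := hd
  obtain ⟨f', hf', h⟩ := hf.exists_inverse
  refine .inr ⟨(closed_mapState hf.injOn).2 hp, g ∘ f', ?_, ?_⟩
  · rw [supp_mapState]
    refine hf'.comp (hg.mono ?_)
    intro a ha
    simp only [Finset.mem_image] at ha
    obtain ⟨_, ⟨b, hb, rfl⟩, rfl⟩ := ha
    rwa [h b hb]
  · rw [mapState_comp]
    exact mapState_congr fun a ha => by simp [h a ha]

theorem Near.card_supp {M : ℕ} {p q : Finset Λ × List (Λ × Λ)} (h : Near M p q) :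
    ((supp p).card ≤ M ↔ (supp q).card ≤ M) ∧ (Closed p ↔ Closed q) ∧
      (Closed p → wraps p.2 = wraps q.2) := by
  induction h with
  | rel p q h =>
    exact ⟨iff_of_true ((Finset.card_le_card Finset.subset_union_left).trans h.2)
      ((Finset.card_le_card Finset.subset_union_right).trans h.2), iff_of_true h.1.2.1 h.1.2.2,
      fun _ => (h.1.1.invariants h.1.2.1 h.1.2.2).2.1⟩
  | refl p => exact ⟨Iff.rfl, Iff.rfl, fun _ => rfl⟩
  | symm p q _ ih => exact ⟨ih.1.symm, ih.2.1.symm, fun h => (ih.2.2 (ih.2.1.2 h)).symm⟩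
  | trans p q r _ _ ih ih' =>
    exact ⟨ih.1.trans ih'.1, ih.2.1.trans ih'.2.1, fun h => (ih.2.2 h).trans (ih'.2.2 (ih.2.1.1 h))⟩

theorem exists_numbering [Inhabited Λ] {A : Finset Λ} {M : ℕ} (hA : A.card ≤ M) :
    ∃ f : Λ → ℕ, StrictMonoOn f A ∧ A.image f ⊆ Finset.range M := by
  obtain ⟨g, f, hg, -, h₁, -⟩ := exists_rank A
  refine ⟨g, hg, fun i hi => ?_⟩
  obtain ⟨a, ha, rfl⟩ := Finset.mem_image.1 hi
  exact Finset.mem_range.2 ((h₁ a ha).1.trans_le hA)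

/-- If the levels are numbered anew for each move, then a chain of moves that use at most `M` levels
each becomes a chain of words with levels below `M`. -/
theorem Near.boundedConn [Inhabited Λ] {M Q : ℕ} {p q : Finset Λ × List (Λ × Λ)}
    (h : Near M p q) (hp : Closed p) (hpM : (supp p).card ≤ M) (hQ : wraps p.2 * M ≤ Q)
    {c d : Finset ℕ × List (ℕ × ℕ)} (hc : Numbering p c) (hd : Numbering q d)
    (hcM : supp c ⊆ Finset.range M) (hdM : supp d ⊆ Finset.range M) : BoundedConn M Q c d := by
  have len : ∀ {p : Finset Λ × List (Λ × Λ)} {c : Finset ℕ × List (ℕ × ℕ)}, Closed p →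
      wraps p.2 * M ≤ Q → (supp p).card ≤ M → Numbering p c → c.2.length ≤ Q := by
    rintro p c hp hQ hM ⟨f, hf, rfl⟩
    simp only [mapState, relabel, List.length_map]
    exact (length_le hp).trans ((Nat.mul_le_mul_left _ hM).trans hQ)
  have self : ∀ {p : Finset Λ × List (Λ × Λ)} {c d : Finset ℕ × List (ℕ × ℕ)}, Closed p →
      wraps p.2 * M ≤ Q → (supp p).card ≤ M → Numbering p c → Numbering p d →
      supp c ⊆ Finset.range M → supp d ⊆ Finset.range M → BoundedConn M Q c d :=
    fun hp hQ hM hc hd hcM hdM => .rel _ _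
      ⟨hc.natStep hp hd, ⟨hcM, len hp hQ hM hc⟩, ⟨hdM, len hp hQ hM hd⟩⟩
  induction h generalizing c d with
  | rel p q h =>
    obtain ⟨f, hf, hfM⟩ := exists_numbering h.2
    have hpc : Numbering p (mapState f p) :=
      ⟨f, (hf.mono (by simp)).cycIso, rfl⟩
    have hqd : Numbering q (mapState f q) :=
      ⟨f, (hf.mono (by simp)).cycIso, rfl⟩
    rw [Finset.image_union, Finset.union_subset_iff] at hfM
    have hwr := (h.1.1.invariants h.1.2.1 h.1.2.2).2.1
    have hqM : (supp q).card ≤ M := (Finset.card_le_card Finset.subset_union_right).trans h.2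
    have hQ' : wraps q.2 * M ≤ Q := hwr ▸ hQ
    have i₁ : supp (mapState f p) ⊆ Finset.range M := by rw [supp_mapState]; exact hfM.1
    have i₂ : supp (mapState f q) ⊆ Finset.range M := by rw [supp_mapState]; exact hfM.2
    refine .trans _ _ _ (self hp hQ hpM hc hpc hcM i₁) (.trans _ _ _ (.rel _ _ ⟨.inl ?_, ?_, ?_⟩)
      (self h.1.2.2 hQ' hqM hqd hd i₂ hdM))
    · exact h.1.map hf Finset.subset_union_left Finset.subset_union_right
    · exact ⟨i₁, len hp hQ hpM hpc⟩
    · exact ⟨i₂, len h.1.2.2 hQ' hqM hqd⟩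
  | refl p => exact self hp hQ hpM hc hd hcM hdM
  | symm p q h ih =>
    obtain ⟨h₁, h₂, h₃⟩ := Near.card_supp h
    exact .symm _ _ (ih (h₂.2 hp) (h₁.2 hpM) (h₃ (h₂.2 hp) ▸ hQ) hd hc hdM hcM)
  | trans p q r h _ ih ih' =>
    obtain ⟨h₁, h₂, h₃⟩ := Near.card_supp h
    obtain ⟨f, hf, hfM⟩ := exists_numbering (h₁.1 hpM)
    have hqd : Numbering q (mapState f q) := ⟨f, hf.cycIso, rfl⟩
    have i₂ : supp (mapState f q) ⊆ Finset.range M := by rw [supp_mapState]; exact hfM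
    exact .trans _ _ _ (ih hp hpM hQ hc hqd hcM i₂)
      (ih' (h₂.1 hp) (h₁.1 hpM) (h₃ hp ▸ hQ) hqd hd i₂ hdM)

end JumpWord

/-! ### Arcs of the circle -/

theorem coe_mem_cIcc_iff_le {x y z : ℝ} (hx : x ∈ Set.Ico y (y + 2 * Real.pi))
    (hz : z ∈ Set.Ioc y (y + 2 * Real.pi)) :
    (x : Real.Angle) ∈ Set.cIcc (y : Real.Angle) z ↔ x ≤ z := by
  have : Fact (0 < 2 * Real.pi) := ⟨Real.two_pi_pos⟩
  rw [Set.mem_cIcc]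
  refine (QuotientAddGroup.btw_coe_iff (p := 2 * Real.pi)).trans ?_
  rw [(toIcoMod_eq_self _).2 hx, (toIocMod_eq_self _).2 hz]

theorem coe_add_two_pi (x : ℝ) : ((x + 2 * Real.pi : ℝ) : Real.Angle) = x := by
  rw [Real.Angle.coe_add, Real.Angle.coe_two_pi, add_zero]

theorem coe_inj_of_abs_lt {x y : ℝ} (h : |x - y| < 2 * Real.pi)
    (e : (x : Real.Angle) = y) : x = y := by
  obtain ⟨k, hk⟩ := Real.Angle.angle_eq_iff_two_pi_dvd_sub.1 e
  have hp := Real.two_pi_pos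
  rw [hk, abs_mul, abs_of_pos hp] at h
  have h₁ : |(k : ℝ)| < 1 := by
    by_contra h'
    push Not at h'
    nlinarith
  have h₂ : k = 0 := by
    rw [← Int.cast_abs] at h₁
    exact Int.abs_lt_one_iff.1 (by exact_mod_cast h₁)
  rw [h₂] at hk
  simp at hk
  linarith

theorem coe_inj_of_mem_Ico {a x y : ℝ} (hx : x ∈ Set.Ico a (a + 2 * Real.pi))
    (hy : y ∈ Set.Ico a (a + 2 * Real.pi)) : (x : Real.Angle) = y ↔ x = y := by
  refine ⟨coe_inj_of_abs_lt ?_, fun h => by rw [h]⟩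
  rw [abs_lt]
  constructor <;> linarith [hx.1, hx.2, hy.1, hy.2]

theorem exists_coe_eq (a : ℝ) (θ : Real.Angle) :
    ∃ x ∈ Set.Ico a (a + 2 * Real.pi), (x : Real.Angle) = θ := by
  have : Fact (0 < 2 * Real.pi) := ⟨Real.two_pi_pos⟩
  induction θ using Real.Angle.induction_on with
  | _ x =>
    refine ⟨toIcoMod Real.two_pi_pos a x, toIcoMod_mem_Ico _ _ _, ?_⟩
    rw [Real.Angle.angle_eq_iff_two_pi_dvd_sub]
    refine ⟨-toIcoDiv Real.two_pi_pos a x, ?_⟩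
    rw [toIcoMod]
    simp only [zsmul_eq_mul, Int.cast_neg]
    ring

/-- On a fundamental domain, the arcs of the circle are the arcs of the cyclically ordered line. -/
theorem coe_mem_cIcc_iff_arc {a x y z : ℝ} (hx : x ∈ Set.Ico a (a + 2 * Real.pi))
    (hy : y ∈ Set.Ico a (a + 2 * Real.pi)) (hz : z ∈ Set.Ico a (a + 2 * Real.pi)) (hyz : y ≠ z) :
    (x : Real.Angle) ∈ Set.cIcc (y : Real.Angle) z ↔ JumpWord.Arc y z x := by
  obtain ⟨hx₁, hx₂⟩ := hx
  obtain ⟨hy₁, hy₂⟩ := hy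
  obtain ⟨hz₁, hz₂⟩ := hz
  have hp := Real.two_pi_pos
  unfold JumpWord.Arc JumpWord.Cyc
  have hx' : ∃ x' : ℝ, (x' : Real.Angle) = x ∧ x' ∈ Set.Ico y (y + 2 * Real.pi) ∧
      (y ≤ x ∧ x' = x ∨ x < y ∧ x' = x + 2 * Real.pi) := by
    rcases le_or_gt y x with h | h
    · exact ⟨x, rfl, ⟨h, by linarith⟩, .inl ⟨h, rfl⟩⟩
    · exact ⟨x + 2 * Real.pi, coe_add_two_pi x, ⟨by linarith, by linarith⟩, .inr ⟨h, rfl⟩⟩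
  have hz' : ∃ z' : ℝ, (z' : Real.Angle) = z ∧ z' ∈ Set.Ioc y (y + 2 * Real.pi) ∧
      (y < z ∧ z' = z ∨ z < y ∧ z' = z + 2 * Real.pi) := by
    rcases lt_or_gt_of_ne hyz with h | h
    · exact ⟨z, rfl, ⟨h, by linarith⟩, .inl ⟨h, rfl⟩⟩
    · exact ⟨z + 2 * Real.pi, coe_add_two_pi z, ⟨by linarith, by linarith⟩, .inr ⟨h, rfl⟩⟩
  obtain ⟨x', ex, hx', hx''⟩ := hx'
  obtain ⟨z', ez, hz', hz''⟩ := hz'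
  rw [← ex, ← ez, coe_mem_cIcc_iff_le hx' hz']
  rcases hx'' with ⟨h₁, rfl⟩ | ⟨h₁, rfl⟩ <;> rcases hz'' with ⟨h₂, rfl⟩ | ⟨h₂, rfl⟩
  · grind
  · grind
  · constructor
    · intro h; linarith
    · rintro (h | h | h | h | h) <;> linarith
  · have : x + 2 * Real.pi ≤ z + 2 * Real.pi ↔ x ≤ z := by
      constructor <;> intro h <;> linarith
    rw [this]
    grind

namespace RectDiagram

/-! ### Constructions of diagrams and of moves -/

theorem mem_verts {R : RectDiagram} {t : Torus} : t ∈ R.verts ↔ t ∈ R.pos ∨ t ∈ R.neg := Iff.rfl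

/-- The image of a diagram under maps of the two circles that are injective on its columns and on
its rows. -/
theorem exists_map (R : RectDiagram) {g h : Real.Angle → Real.Angle}
    (hg : Set.InjOn g (Prod.fst '' R.verts)) (hh : Set.InjOn h (Prod.snd '' R.verts)) :
    ∃ R' : RectDiagram, R'.pos = Prod.map g h '' R.pos ∧ R'.neg = Prod.map g h '' R.neg := by
  have inj : Set.InjOn (Prod.map g h) R.verts := by
    intro s hs t ht e
    have e' := Prod.mk.inj e
    exact Prod.ext (hg ⟨s, hs, rfl⟩ ⟨t, ht, rfl⟩ e'.1) (hh ⟨s, hs, rfl⟩ ⟨t, ht, rfl⟩ e'.2)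
  have fst : ∀ A : Set Torus, Prod.fst '' (Prod.map g h '' A) = g '' (Prod.fst '' A) := by
    intro A; simp only [Set.image_image, Prod.map_fst]
  have snd : ∀ A : Set Torus, Prod.snd '' (Prod.map g h '' A) = h '' (Prod.snd '' A) := by
    intro A; simp only [Set.image_image, Prod.map_snd]
  have fstInj : ∀ A ⊆ R.verts, Set.InjOn Prod.fst A →
      Set.InjOn Prod.fst (Prod.map g h '' A) := by
    rintro A hA hi _ ⟨s, hs, rfl⟩ _ ⟨t, ht, rfl⟩ e
    rw [hi hs ht (hg ⟨s, hA hs, rfl⟩ ⟨t, hA ht, rfl⟩ e)]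
  have sndInj : ∀ A ⊆ R.verts, Set.InjOn Prod.snd A →
      Set.InjOn Prod.snd (Prod.map g h '' A) := by
    rintro A hA hi _ ⟨s, hs, rfl⟩ _ ⟨t, ht, rfl⟩ e
    rw [hi hs ht (hh ⟨s, hA hs, rfl⟩ ⟨t, hA ht, rfl⟩ e)]
  have hp : R.pos ⊆ R.verts := Set.subset_union_left
  have hn : R.neg ⊆ R.verts := Set.subset_union_right
  refine ⟨⟨Prod.map g h '' R.pos, Prod.map g h '' R.neg, ?_, ?_, ?_, ?_, ?_, fstInj _ hp
    R.injOn_fst_pos, fstInj _ hn R.injOn_fst_neg, sndInj _ hp R.injOn_snd_pos,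
    sndInj _ hn R.injOn_snd_neg⟩, rfl, rfl⟩
  · rw [← Set.image_union]; exact R.finite.image _
  · rw [← Set.image_union]; exact R.nonempty.image _
  · rw [Set.disjoint_left]
    rintro _ ⟨s, hs, rfl⟩ ⟨t, ht, e⟩
    rw [inj (hn ht) (hp hs) e] at ht
    exact Set.disjoint_left.1 R.disjoint hs ht
  · rw [fst, fst, R.image_fst]
  · rw [snd, snd, R.image_snd]

/-- The diagram with the two coordinates interchanged. -/
def transpose (R : RectDiagram) : RectDiagram where
  pos := Prod.swap ⁻¹' R.pos
  neg := Prod.swap ⁻¹' R.neg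
  finite := by
    rw [← Set.preimage_union]; exact R.finite.preimage Prod.swap_injective.injOn
  nonempty := by
    rw [← Set.preimage_union, ← Set.image_swap_eq_preimage_swap]; exact R.nonempty.image _
  disjoint := R.disjoint.preimage _
  image_fst := by
    simpa only [← Set.image_swap_eq_preimage_swap, Set.image_image, Prod.fst_swap] using R.image_snd
  image_snd := by
    simpa only [← Set.image_swap_eq_preimage_swap, Set.image_image, Prod.snd_swap] using R.image_fst
  injOn_fst_pos s hs t ht e := Prod.swap_injective (R.injOn_snd_pos hs ht e)
  injOn_fst_neg s hs t ht e := Prod.swap_injective (R.injOn_snd_neg hs ht e)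
  injOn_snd_pos s hs t ht e := Prod.swap_injective (R.injOn_fst_pos hs ht e)
  injOn_snd_neg s hs t ht e := Prod.swap_injective (R.injOn_fst_neg hs ht e)

theorem verts_transpose (R : RectDiagram) : R.transpose.verts = Prod.swap ⁻¹' R.verts := rfl

theorem range_corner (θ₁ θ₂ φ₁ φ₂ : Real.Angle) :
    Set.range (corner θ₁ θ₂ φ₁ φ₂) = ({θ₁, θ₂} : Set Real.Angle) ×ˢ {φ₁, φ₂} := by
  ext ⟨x, y⟩
  simp only [Set.mem_range, Fin.exists_fin_succ, corner, Set.mem_prod, Set.mem_insert_iff,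
    Set.mem_singleton_iff]
  simp [Prod.ext_iff]
  grind

theorem corners_subset_rect (θ₁ θ₂ φ₁ φ₂ : Real.Angle) :
    ({θ₁, θ₂} : Set Real.Angle) ×ˢ {φ₁, φ₂} ⊆ rect θ₁ θ₂ φ₁ φ₂ := by
  rintro ⟨x, y⟩ ⟨h₁, h₂⟩
  simp only [Set.mem_insert_iff, Set.mem_singleton_iff] at h₁ h₂
  refine ⟨?_, ?_⟩
  · rcases h₁ with rfl | rfl
    exacts [Set.left_mem_cIcc _ _, Set.right_mem_cIcc _ _]
  · rcases h₂ with rfl | rfl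
    exacts [Set.left_mem_cIcc _ _, Set.right_mem_cIcc _ _]

theorem IsElementaryMoveAt.transpose {R₁ R₂ : RectDiagram} {θ₁ θ₂ φ₁ φ₂ : Real.Angle}
    (h : IsElementaryMoveAt R₁ R₂ θ₁ θ₂ φ₁ φ₂) :
    IsElementaryMoveAt R₁.transpose R₂.transpose φ₁ φ₂ θ₁ θ₂ where
  ne_fst := h.ne_snd
  ne_snd := h.ne_fst
  symmDiff_eq := by
    have := congrArg (Prod.swap ⁻¹' ·) h.symmDiff_eq
    simp only [Set.preimage_swap_prod] at this
    exact this
  rect_inter := by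
    have := congrArg (Prod.swap ⁻¹' ·) h.rect_inter
    rw [rect, Set.preimage_inter, Set.preimage_swap_prod] at this
    exact this
  consecutive := by
    obtain ⟨i, hi⟩ := h.consecutive
    have key : ∀ A : Set Torus, R₁.verts ∩ Set.range (corner θ₁ θ₂ φ₁ φ₂) = A →
        R₁.transpose.verts ∩ Set.range (corner φ₁ φ₂ θ₁ θ₂) = Prod.swap ⁻¹' A := by
      rintro A rfl
      rw [range_corner, range_corner, Set.preimage_inter, Set.preimage_swap_prod]
      rfl
    have e : ∀ k, Prod.swap ⁻¹' {corner θ₁ θ₂ φ₁ φ₂ k} = {corner φ₁ φ₂ θ₁ θ₂ (-k)} := by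
      intro k
      ext ⟨x, y⟩
      fin_cases k <;> simp [corner, Prod.ext_iff, and_comm]
    rcases hi with hi | hi | hi
    · exact ⟨-i, .inl ((key _ hi).trans (e i))⟩
    · refine ⟨-i - 1, .inr (.inl ((key _ hi).trans ?_))⟩
      have e₁ : -i - 1 + 1 = -i := by fin_cases i <;> rfl
      have e₂ : -(i + 1) = -i - 1 := by fin_cases i <;> rfl
      rw [Set.insert_eq, Set.preimage_union, e, e, Set.union_comm, Set.insert_eq, e₁, e₂]
    · refine ⟨-i - 2, .inr (.inr ((key _ hi).trans ?_))⟩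
      have e₁ : -i - 2 + 1 = -(i + 1) := by fin_cases i <;> rfl
      have e₂ : -(i + 2) = -i - 2 := by fin_cases i <;> rfl
      have e₃ : -i - 2 + 2 = -i := by fin_cases i <;> rfl
      rw [Set.insert_eq, Set.insert_eq, Set.preimage_union, Set.preimage_union, e, e, e,
        Set.insert_eq, Set.insert_eq, Set.union_comm, Set.union_comm {_}, Set.union_assoc, e₁, e₂,
        e₃]
  orientation := congrArg (Prod.swap ⁻¹' ·) h.orientation

theorem ncard_transpose (R : RectDiagram) : R.transpose.verts.ncard = R.verts.ncard := by
  rw [verts_transpose, ← Set.image_swap_eq_preimage_swap,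
    Set.ncard_image_of_injective _ Prod.swap_injective]

theorem IsExchange.transpose {R₁ R₂ : RectDiagram} (h : IsExchange R₁ R₂) :
    IsExchange R₁.transpose R₂.transpose := by
  obtain ⟨⟨θ₁, θ₂, φ₁, φ₂, h⟩, hc⟩ := h
  exact ⟨⟨_, _, _, _, h.transpose⟩, by rw [ncard_transpose, ncard_transpose, hc]⟩

/-- An elementary move from its effect: the vertices outside the rectangle are kept. -/
theorem isElementaryMoveAt_of {R₁ R₂ : RectDiagram} {θ₁ θ₂ φ₁ φ₂ : Real.Angle}
    (hθ : θ₁ ≠ θ₂) (hφ : φ₁ ≠ φ₂) {P N A₁ B₁ A₂ B₂ : Set Torus}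
    (hp₁ : R₁.pos = P ∪ A₁) (hn₁ : R₁.neg = N ∪ B₁) (hp₂ : R₂.pos = P ∪ A₂)
    (hn₂ : R₂.neg = N ∪ B₂) (hr : ∀ t ∈ P ∪ N, t ∉ rect θ₁ θ₂ φ₁ φ₂)
    (hc : (A₁ ∪ B₁) ∪ (A₂ ∪ B₂) = ({θ₁, θ₂} : Set Real.Angle) ×ˢ {φ₁, φ₂})
    (hd : Disjoint (A₁ ∪ B₁) (A₂ ∪ B₂))
    (hi : ∃ i : Fin 4, let v := corner θ₁ θ₂ φ₁ φ₂
      A₁ ∪ B₁ = {v i} ∨ A₁ ∪ B₁ = {v i, v (i + 1)} ∨ A₁ ∪ B₁ = {v i, v (i + 1), v (i + 2)}) :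
    IsElementaryMoveAt R₁ R₂ θ₁ θ₂ φ₁ φ₂ := by
  have hv₁ : R₁.verts = (P ∪ N) ∪ (A₁ ∪ B₁) := by
    rw [verts, hp₁, hn₁, Set.union_union_union_comm]
  have hv₂ : R₂.verts = (P ∪ N) ∪ (A₂ ∪ B₂) := by
    rw [verts, hp₂, hn₂, Set.union_union_union_comm]
  have hsub := corners_subset_rect θ₁ θ₂ φ₁ φ₂
  have h₁ : ∀ t ∈ A₁ ∪ B₁, t ∉ P ∪ N := fun t ht ht' => hr t ht' (hsub (hc ▸ .inl ht))
  have h₂ : ∀ t ∈ A₂ ∪ B₂, t ∉ P ∪ N := fun t ht ht' => hr t ht' (hsub (hc ▸ .inr ht))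
  have hd' : ∀ t ∈ A₁ ∪ B₁, t ∉ A₂ ∪ B₂ := fun t ht => Set.disjoint_left.1 hd ht
  have hA₁ : A₁ ⊆ A₁ ∪ B₁ := Set.subset_union_left
  have hA₂ : A₂ ⊆ A₂ ∪ B₂ := Set.subset_union_left
  have hP : P ⊆ P ∪ N := Set.subset_union_left
  rw [← range_corner] at hc hsub
  generalize A₁ ∪ B₁ = D at *
  generalize A₂ ∪ B₂ = E at *
  generalize P ∪ N = C at *
  have hs : symmDiff R₁.verts R₂.verts = D ∪ E := by
    rw [hv₁, hv₂]
    ext t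
    simp only [Set.mem_symmDiff, Set.mem_union]
    grind
  have hDE : D ∪ E ⊆ rect θ₁ θ₂ φ₁ φ₂ := hc ▸ hsub
  refine ⟨hθ, hφ, hs.trans (hc.trans (range_corner _ _ _ _)), ?_, ?_, ?_⟩
  · rw [hs, hv₁, hv₂]
    refine Set.Subset.antisymm ?_ (fun t ht => ⟨hDE ht, ?_⟩)
    · rintro t ⟨ht, (ht' | ht') | (ht' | ht')⟩
      exacts [(hr t ht' ht).elim, .inl ht', (hr t ht' ht).elim, .inr ht']
    · rcases ht with ht | ht
      exacts [.inl (.inr ht), .inr (.inr ht)]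
  · obtain ⟨i, hi⟩ := hi
    refine ⟨i, ?_⟩
    have e : R₁.verts ∩ Set.range (corner θ₁ θ₂ φ₁ φ₂) = D := by
      rw [← hc, hv₁]
      ext t
      simp only [Set.mem_inter_iff, Set.mem_union]
      grind
    simp only [e]
    exact hi
  · rw [hv₁, hv₂, hp₁, hp₂]
    ext t
    simp only [Set.mem_inter_iff, Set.mem_union]
    grind

/-- A column has only two vertices. -/
theorem eq_or_eq_of_fst_eq {R : RectDiagram} {θ φ₁ φ₂ : Real.Angle} (hφ : φ₁ ≠ φ₂)
    (h₁ : (θ, φ₁) ∈ R.verts) (h₂ : (θ, φ₂) ∈ R.verts) {t : Torus} (ht : t ∈ R.verts)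
    (e : t.1 = θ) : t = (θ, φ₁) ∨ t = (θ, φ₂) := by
  have hp := @R.injOn_fst_pos
  have hn := @R.injOn_fst_neg
  have hne : ((θ, φ₁) : Torus) ≠ (θ, φ₂) := fun h => hφ (Prod.ext_iff.1 h).2
  simp only [mem_verts] at *
  rcases h₁ with h₁ | h₁ <;> rcases h₂ with h₂ | h₂
  · exact (hne (hp h₁ h₂ rfl)).elim
  · rcases ht with ht | ht
    exacts [.inl (hp ht h₁ e), .inr (hn ht h₂ e)]
  · rcases ht with ht | ht
    exacts [.inr (hp ht h₂ e), .inl (hn ht h₁ e)]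
  · exact (hne (hn h₁ h₂ rfl)).elim

theorem union_columns (θ θ' φ₁ φ₂ : Real.Angle) :
    ({(θ, φ₁), (θ, φ₂)} ∪ {(θ', φ₁), (θ', φ₂)} : Set Torus) =
      ({θ, θ'} : Set Real.Angle) ×ˢ {φ₁, φ₂} := by
  ext ⟨x, y⟩
  simp only [Set.mem_union, Set.mem_insert_iff, Set.mem_singleton_iff, Set.mem_prod,
    Prod.mk.injEq]
  tauto

theorem disjoint_columns {θ θ' φ₁ φ₂ : Real.Angle} (h : θ ≠ θ') :
    Disjoint ({(θ, φ₁), (θ, φ₂)} : Set Torus) {(θ', φ₁), (θ', φ₂)} := by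
  rw [Set.disjoint_left]
  rintro ⟨x, y⟩ h₁ h₂
  simp only [Set.mem_insert_iff, Set.mem_singleton_iff, Prod.mk.injEq] at h₁ h₂
  exact h (by rw [← h₁.elim (·.1) (·.1), h₂.elim (·.1) (·.1)])

open scoped Classical in
/-- Moving a column is an exchange if the strip between the old and the new positions contains no
other vertices. -/
theorem exists_column_exchange (R : RectDiagram) {θ θ' φ₁ φ₂ : Real.Angle} (hφ : φ₁ ≠ φ₂)
    (h₁ : (θ, φ₁) ∈ R.verts) (h₂ : (θ, φ₂) ∈ R.verts) (hθ' : ∀ t ∈ R.verts, t.1 ≠ θ')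
    (hr : (∀ t ∈ R.verts, t.1 ≠ θ → t ∉ rect θ θ' φ₁ φ₂) ∨
      (∀ t ∈ R.verts, t.1 ≠ θ → t ∉ rect θ' θ φ₁ φ₂)) :
    ∃ R' : RectDiagram, R'.pos = Prod.map (Function.update id θ θ') id '' R.pos ∧
      R'.neg = Prod.map (Function.update id θ θ') id '' R.neg ∧ IsExchange R R' := by
  have hne : θ ≠ θ' := hθ' _ h₁
  have hinj : Set.InjOn (Function.update id θ θ') (Prod.fst '' R.verts) := by
    rintro _ ⟨s, hs, rfl⟩ _ ⟨t, ht, rfl⟩ e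
    by_cases hs' : s.1 = θ <;> by_cases ht' : t.1 = θ
    · rw [hs', ht']
    · rw [hs', Function.update_self, Function.update_of_ne ht'] at e
      exact (hθ' t ht e.symm).elim
    · rw [ht', Function.update_self, Function.update_of_ne hs'] at e
      exact (hθ' s hs e).elim
    · rwa [Function.update_of_ne hs', Function.update_of_ne ht'] at e
  obtain ⟨R', hp, hn⟩ := R.exists_map hinj (h := id) Function.injective_id.injOn
  refine ⟨R', hp, hn, ?_⟩
  have hcard : R.verts.ncard = R'.verts.ncard := by
    rw [verts, verts, hp, hn, ← Set.image_union]
    refine (Set.InjOn.ncard_image ?_).symm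
    intro s hs t ht e
    have e' := Prod.mk.inj e
    exact Prod.ext (hinj ⟨s, hs, rfl⟩ ⟨t, ht, rfl⟩ e'.1) e'.2
  have split : ∀ A : Set Torus, A = {t ∈ A | t.1 ≠ θ} ∪ {t ∈ A | t.1 = θ} := by
    intro A; ext t; simp only [Set.mem_union, Set.mem_ofPred_eq]; tauto
  have split' : ∀ A : Set Torus, Prod.map (Function.update id θ θ') id '' A =
      {t ∈ A | t.1 ≠ θ} ∪ (fun t : Torus => (θ', t.2)) '' {t ∈ A | t.1 = θ} := by
    intro A
    conv_lhs => rw [split A]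
    rw [Set.image_union]
    congr 1
    · ext t
      constructor
      · rintro ⟨s, hs, rfl⟩
        rw [Prod.map, Function.update_of_ne hs.2]
        exact hs
      · intro ht
        exact ⟨t, ht, by rw [Prod.map, Function.update_of_ne ht.2]; rfl⟩
    · refine Set.image_congr fun t ht => ?_
      rw [Prod.map, ht.2, Function.update_self]; rfl
  have hcol : {t ∈ R.pos | t.1 = θ} ∪ {t ∈ R.neg | t.1 = θ} = {(θ, φ₁), (θ, φ₂)} := by
    ext t
    simp only [Set.mem_union, Set.mem_ofPred_eq, Set.mem_insert_iff, Set.mem_singleton_iff]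
    constructor
    · rintro (⟨ht, e⟩ | ⟨ht, e⟩)
      exacts [eq_or_eq_of_fst_eq hφ h₁ h₂ (.inl ht) e, eq_or_eq_of_fst_eq hφ h₁ h₂ (.inr ht) e]
    · rintro (rfl | rfl)
      · rcases h₁ with h | h
        exacts [.inl ⟨h, rfl⟩, .inr ⟨h, rfl⟩]
      · rcases h₂ with h | h
        exacts [.inl ⟨h, rfl⟩, .inr ⟨h, rfl⟩]
  have hcol' : (fun t : Torus => (θ', t.2)) '' {t ∈ R.pos | t.1 = θ} ∪
      (fun t : Torus => (θ', t.2)) '' {t ∈ R.neg | t.1 = θ} = {(θ', φ₁), (θ', φ₂)} := by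
    rw [← Set.image_union, hcol, Set.image_pair]
  rw [split'] at hp hn
  have hPN : ∀ B : Set Torus, (∀ t ∈ R.verts, t.1 ≠ θ → t ∉ B) →
      ∀ t ∈ {t ∈ R.pos | t.1 ≠ θ} ∪ {t ∈ R.neg | t.1 ≠ θ}, t ∉ B := by
    rintro B hB t (⟨ht, e⟩ | ⟨ht, e⟩)
    exacts [hB t (.inl ht) e, hB t (.inr ht) e]
  refine ⟨?_, hcard⟩
  rcases hr with hr | hr
  · refine ⟨θ, θ', φ₁, φ₂, isElementaryMoveAt_of hne hφ (split R.pos) (split R.neg) hp hn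
      (hPN _ hr) ?_ ?_ ⟨3, .inr (.inl ?_)⟩⟩
    · rw [hcol, hcol', union_columns]
    · rw [hcol, hcol']; exact disjoint_columns hne
    · rw [hcol]; simp [corner, Set.pair_comm]
  · refine ⟨θ', θ, φ₁, φ₂, isElementaryMoveAt_of hne.symm hφ (split R.pos) (split R.neg) hp hn
      (hPN _ hr) ?_ ?_ ⟨1, .inr (.inl ?_)⟩⟩
    · rw [hcol, hcol', Set.union_comm, union_columns]
    · rw [hcol, hcol']; exact disjoint_columns hne
    · rw [hcol]; simp [corner]

open scoped Classical in
/-- Moving a row is an exchange if the strip between the old and the new positions contains no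
other vertices. -/
theorem exists_row_exchange (R : RectDiagram) {φ φ' θ₁ θ₂ : Real.Angle} (hθ : θ₁ ≠ θ₂)
    (h₁ : (θ₁, φ) ∈ R.verts) (h₂ : (θ₂, φ) ∈ R.verts) (hφ' : ∀ t ∈ R.verts, t.2 ≠ φ')
    (hr : (∀ t ∈ R.verts, t.2 ≠ φ → t ∉ rect θ₁ θ₂ φ φ') ∨
      (∀ t ∈ R.verts, t.2 ≠ φ → t ∉ rect θ₁ θ₂ φ' φ)) :
    ∃ R' : RectDiagram, R'.pos = Prod.map id (Function.update id φ φ') '' R.pos ∧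
      R'.neg = Prod.map id (Function.update id φ φ') '' R.neg ∧ IsExchange R R' := by
  obtain ⟨R', hp, hn, he⟩ := R.transpose.exists_column_exchange (θ := φ) (θ' := φ') hθ
    (show (θ₁, φ) ∈ R.verts from h₁) h₂ (fun t ht => hφ' t.swap ht) (hr.imp
      (fun h t ht e h' => h t.swap ht e ⟨h'.2, h'.1⟩)
      (fun h t ht e h' => h t.swap ht e ⟨h'.2, h'.1⟩))
  have key : ∀ A : Set Torus,
      Prod.swap ⁻¹' (Prod.map (Function.update id φ φ') id '' (Prod.swap ⁻¹' A)) =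
        Prod.map id (Function.update id φ φ') '' A := by
    intro A
    rw [← Set.image_swap_eq_preimage_swap, Set.image_image,
      Set.image_image]
    rfl
  refine ⟨R'.transpose, ?_, ?_, ?_⟩
  · exact (congrArg (Prod.swap ⁻¹' ·) hp).trans (key R.pos)
  · exact (congrArg (Prod.swap ⁻¹' ·) hn).trans (key R.neg)
  · exact he.transpose

/-- Subdividing a vertical edge near its lower end is a stabilization of type `←II`. -/
theorem isStabilization_of {R₁ R₂ : RectDiagram} {θ₁ θ₂ φ₁ φ₂ : Real.Angle}
    (hθ : θ₁ ≠ θ₂) (hφ : φ₁ ≠ φ₂) (hv : (θ₂, φ₁) ∈ R₁.neg)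
    (hp : R₂.pos = R₁.pos ∪ {(θ₁, φ₂)})
    (hn : R₂.neg = (R₁.neg \ {(θ₂, φ₁)}) ∪ {(θ₁, φ₁), (θ₂, φ₂)})
    (hr : ∀ t ∈ R₁.verts, t ≠ (θ₂, φ₁) → t ∉ rect θ₁ θ₂ φ₁ φ₂) :
    IsStabilization .leftII R₁ R₂ := by
  have hv' : (θ₂, φ₁) ∉ R₁.pos := fun h => Set.disjoint_left.1 R₁.disjoint h hv
  have hr' : ∀ t ∈ R₁.pos ∪ (R₁.neg \ {(θ₂, φ₁)}), t ∉ rect θ₁ θ₂ φ₁ φ₂ := by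
    rintro t (ht | ht)
    · exact hr t (.inl ht) fun h => hv' (h ▸ ht)
    · exact hr t (.inr ht.1) ht.2
  have hsub := corners_subset_rect θ₁ θ₂ φ₁ φ₂
  have hc : (∅ ∪ {(θ₂, φ₁)}) ∪ ({(θ₁, φ₂)} ∪ {(θ₁, φ₁), (θ₂, φ₂)}) =
      ({θ₁, θ₂} : Set Real.Angle) ×ˢ {φ₁, φ₂} := by
    ext ⟨x, y⟩
    simp only [Set.mem_union, Set.mem_insert_iff, Set.mem_singleton_iff, Set.mem_prod,
      Prod.mk.injEq, Set.mem_empty_iff_false]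
    tauto
  have hn₁ : R₁.neg = (R₁.neg \ {(θ₂, φ₁)}) ∪ {(θ₂, φ₁)} := by
    rw [Set.sdiff_union_self, Set.union_eq_self_of_subset_right (by simpa using hv)]
  refine ⟨θ₁, θ₂, φ₁, φ₂, isElementaryMoveAt_of hθ hφ (Set.union_empty _).symm hn₁ hp hn hr' hc
    ?_ ⟨1, .inl ?_⟩, ?_, ⟨(θ₂, φ₁), by simp [StabType.corners], ?_⟩, φ₂, by simp, ?_, ?_⟩
  · rw [Set.disjoint_left]
    rintro ⟨x, y⟩ h₁ h₂
    simp only [Set.mem_union, Set.mem_insert_iff, Set.mem_singleton_iff,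
      Prod.mk.injEq, Set.mem_empty_iff_false, false_or] at h₁ h₂
    obtain ⟨rfl, rfl⟩ := h₁
    rcases h₂ with h | h | h
    exacts [hθ h.1.symm, hθ h.1.symm, hφ h.2]
  · simp [corner]
  · have e₁ : R₁.verts = (R₁.pos ∪ (R₁.neg \ {(θ₂, φ₁)})) ∪ {(θ₂, φ₁)} := by
      conv_lhs => rw [verts, hn₁]
      rw [Set.union_assoc]
    have e₂ : R₂.verts = (R₁.pos ∪ (R₁.neg \ {(θ₂, φ₁)})) ∪ {(θ₁, φ₂), (θ₁, φ₁), (θ₂, φ₂)} := by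
      rw [verts, hp, hn, Set.union_union_union_comm]; rfl
    have hf : (R₁.pos ∪ (R₁.neg \ {(θ₂, φ₁)})).Finite := by
      have : (R₁.verts).Finite := R₁.finite
      rw [e₁] at this
      exact this.subset Set.subset_union_left
    have h3 : ({(θ₁, φ₂), (θ₁, φ₁), (θ₂, φ₂)} : Set Torus).ncard = 3 :=
      Set.ncard_eq_three.2 ⟨_, _, _, by simp [hφ.symm], by simp [hθ], by simp [hθ], rfl⟩
    rw [e₁, e₂, Set.ncard_union_eq _ hf (Set.finite_singleton _),
      Set.ncard_union_eq _ hf (by simp), Set.ncard_singleton, h3]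
    · rw [Set.disjoint_left]
      intro t ht ht'
      refine hr' t ht (hsub ?_)
      rw [← hc]
      exact .inr ht'
    · rw [Set.disjoint_left]
      intro t ht ht'
      refine hr' t ht (hsub ?_)
      rw [← hc]
      exact .inl (.inr ht')
  · ext t
    simp only [Set.mem_inter_iff, Set.mem_singleton_iff]
    constructor
    · rintro ⟨h₁, h₂⟩
      by_contra h
      exact hr t h₁ h h₂
    · rintro rfl
      exact ⟨.inr hv, hsub (by simp)⟩
  · rintro ⟨x, y⟩ ⟨h₁, h₂⟩
    simp only [Set.mem_insert_iff, Set.mem_singleton_iff] at h₁ h₂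
    subst h₂
    rcases h₁ with rfl | rfl
    · exact .inl (hp ▸ .inr rfl)
    · exact .inr (hn ▸ .inr (by simp))
  · change (θ₂, φ₂) ∈ R₂.neg
    rw [hn]
    exact .inr (by simp)

end RectDiagram

open JumpWord

/-! ### Drawings of diagrams -/

/-- There is room above `x` and below finitely many larger numbers. -/
theorem exists_gt_forall_lt (x : ℝ) (l : List ℝ) (h : ∀ a ∈ l, x < a) :
    ∃ y, x < y ∧ ∀ a ∈ l, y < a := by
  induction l with
  | nil => exact ⟨x + 1, by linarith, by simp⟩
  | cons a l ih =>
    obtain ⟨y, hy, hl⟩ := ih fun a ha => h a (List.mem_cons_of_mem _ ha)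
    obtain ⟨z, hz, hz'⟩ := exists_between (lt_min hy (h a List.mem_cons_self))
    refine ⟨z, hz, fun c hc => ?_⟩
    rcases List.mem_cons.1 hc with rfl | hc
    · exact hz'.trans_le (min_le_right _ _)
    · exact (hz'.trans_le (min_le_left _ _)).trans (hl c hc)

/-- There is room below `x` and above finitely many smaller numbers. -/
theorem exists_lt_forall_gt (x : ℝ) (l : List ℝ) (h : ∀ a ∈ l, a < x) :
    ∃ y, y < x ∧ ∀ a ∈ l, a < y := by
  obtain ⟨y, hy, hl⟩ := exists_gt_forall_lt (-x) (l.map (-·)) (by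
    intro a ha
    obtain ⟨c, hc, rfl⟩ := List.mem_map.1 ha
    linarith [h c hc])
  exact ⟨-y, by linarith, fun a ha => by linarith [hl (-a) (List.mem_map_of_mem ha)]⟩

/-- The list `L` of columns `(x, (f, t))` with positions `x` and with heights `f` and `t` of the
negative and of the positive vertex shows the diagram `R`: the columns are listed in their order on
the circle, and the heights are those on the circle cut at the height `b`. -/
structure IsDrawing (b : ℝ) (L : List (ℝ × ℝ × ℝ)) (R : RectDiagram) : Prop where
  sorted : L.Pairwise fun c d => c.1 < d.1 ∧ d.1 < c.1 + 2 * Real.pi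
  mem_Ico : ∀ l ∈ labels (L.map Prod.snd), l ∈ Set.Ico b (b + 2 * Real.pi)
  pos_eq : R.pos = {t | ∃ c ∈ L, t = ((c.1 : Real.Angle), (c.2.2 : Real.Angle))}
  neg_eq : R.neg = {t | ∃ c ∈ L, t = ((c.1 : Real.Angle), (c.2.1 : Real.Angle))}

namespace JumpWord

/-- Every level that occurs is left exactly once and reached exactly once. -/
structure Genuine {Λ : Type*} (u : List (Λ × Λ)) : Prop where
  nodup_fst : (u.map Prod.fst).Nodup
  nodup_snd : (u.map Prod.snd).Nodup
  mem_iff : ∀ l, l ∈ u.map Prod.fst ↔ l ∈ u.map Prod.snd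
  ne : ∀ j ∈ u, j.1 ≠ j.2

/-- Subdividing a jump at a new level keeps the word genuine. -/
theorem genuine_split {Λ : Type*} {α β : List (Λ × Λ)} {x y z : Λ} (hxy : x ≠ y) (hyz : y ≠ z)
    (hxz : x ≠ z) : Genuine (α ++ (x, y) :: (y, z) :: β) ↔
      Genuine (α ++ (x, z) :: β) ∧ y ∉ (α ++ (x, z) :: β).map Prod.fst := by
  have p₁ : ((α ++ (x, y) :: (y, z) :: β).map Prod.fst).Perm
      (y :: (α ++ (x, z) :: β).map Prod.fst) := by
    simp only [List.map_append, List.map_cons]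
    have := List.perm_middle (a := y) (l₁ := α.map Prod.fst ++ [x]) (l₂ := β.map Prod.fst)
    simpa using this
  have p₂ : ((α ++ (x, y) :: (y, z) :: β).map Prod.snd).Perm
      (y :: (α ++ (x, z) :: β).map Prod.snd) := by
    simp only [List.map_append, List.map_cons]
    exact List.perm_middle
  have hne : (∀ j ∈ α ++ (x, y) :: (y, z) :: β, j.1 ≠ j.2) ↔
      ∀ j ∈ α ++ (x, z) :: β, j.1 ≠ j.2 := by
    simp only [List.mem_append, List.mem_cons]
    constructor
    · rintro h j (hj | rfl | hj)
      exacts [h _ (.inl hj), hxz, h _ (.inr (.inr (.inr hj)))]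
    · rintro h j (hj | rfl | rfl | hj)
      exacts [h _ (.inl hj), hxy, hyz, h _ (.inr (.inr hj))]
  constructor
  · rintro ⟨h₁, h₂, h₃, h₄⟩
    rw [p₁.nodup_iff, List.nodup_cons] at h₁
    rw [p₂.nodup_iff, List.nodup_cons] at h₂
    refine ⟨⟨h₁.2, h₂.2, fun l => ?_, hne.1 h₄⟩, h₁.1⟩
    by_cases hl : l = y
    · subst hl; exact iff_of_false h₁.1 h₂.1
    · have := h₃ l
      rwa [p₁.mem_iff, p₂.mem_iff, List.mem_cons, List.mem_cons, or_iff_right hl,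
        or_iff_right hl] at this
  · rintro ⟨⟨h₁, h₂, h₃, h₄⟩, h₅⟩
    refine ⟨p₁.nodup_iff.2 (List.nodup_cons.2 ⟨h₅, h₁⟩),
      p₂.nodup_iff.2 (List.nodup_cons.2 ⟨fun h => h₅ ((h₃ y).2 h), h₂⟩), fun l => ?_, hne.2 h₄⟩
    rw [p₁.mem_iff, p₂.mem_iff, List.mem_cons, List.mem_cons, h₃]

end JumpWord

namespace IsDrawing

variable {b : ℝ} {L : List (ℝ × ℝ × ℝ)} {R : RectDiagram}

theorem mem_Ico₁ (h : IsDrawing b L R) {c : ℝ × ℝ × ℝ} (hc : c ∈ L) :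
    c.2.1 ∈ Set.Ico b (b + 2 * Real.pi) :=
  h.mem_Ico _ (mem_labels.2 ⟨c.2, List.mem_map_of_mem hc, .inl rfl⟩)

theorem mem_Ico₂ (h : IsDrawing b L R) {c : ℝ × ℝ × ℝ} (hc : c ∈ L) :
    c.2.2 ∈ Set.Ico b (b + 2 * Real.pi) :=
  h.mem_Ico _ (mem_labels.2 ⟨c.2, List.mem_map_of_mem hc, .inr rfl⟩)

theorem _root_.List.Pairwise.fst_coe_inj {L : List (ℝ × ℝ × ℝ)}
    (h : L.Pairwise fun c d => c.1 < d.1 ∧ d.1 < c.1 + 2 * Real.pi) {c d : ℝ × ℝ × ℝ}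
    (hc : c ∈ L) (hd : d ∈ L) (e : (c.1 : Real.Angle) = d.1) : c = d := by
  have hp := Real.two_pi_pos
  by_contra hne
  have h' : L.Pairwise fun c d => |c.1 - d.1| < 2 * Real.pi ∧ c.1 ≠ d.1 :=
    h.imp fun ⟨h₁, h₂⟩ => ⟨abs_lt.2 ⟨by linarith, by linarith⟩, h₁.ne⟩
  have : Std.Symm fun c d : ℝ × ℝ × ℝ => |c.1 - d.1| < 2 * Real.pi ∧ c.1 ≠ d.1 :=
    ⟨fun c d ⟨h₁, h₂⟩ => ⟨by rwa [abs_sub_comm], h₂.symm⟩⟩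
  have key := h'.forall hc hd hne
  exact key.2 (coe_inj_of_abs_lt key.1 e)

theorem pos_mem (h : IsDrawing b L R) {c : ℝ × ℝ × ℝ} (hc : c ∈ L) :
    ((c.1 : Real.Angle), (c.2.2 : Real.Angle)) ∈ R.pos := by rw [h.pos_eq]; exact ⟨c, hc, rfl⟩

theorem neg_mem (h : IsDrawing b L R) {c : ℝ × ℝ × ℝ} (hc : c ∈ L) :
    ((c.1 : Real.Angle), (c.2.1 : Real.Angle)) ∈ R.neg := by rw [h.neg_eq]; exact ⟨c, hc, rfl⟩

theorem mem_verts (h : IsDrawing b L R) {t : Torus} : t ∈ R.verts ↔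
    ∃ c ∈ L, t.1 = (c.1 : Real.Angle) ∧ (t.2 = (c.2.1 : Real.Angle) ∨ t.2 = c.2.2) := by
  rw [RectDiagram.mem_verts, h.pos_eq, h.neg_eq]
  constructor
  · rintro (⟨c, hc, rfl⟩ | ⟨c, hc, rfl⟩)
    exacts [⟨c, hc, rfl, .inr rfl⟩, ⟨c, hc, rfl, .inl rfl⟩]
  · rintro ⟨c, hc, e, e' | e'⟩
    exacts [.inr ⟨c, hc, Prod.ext e e'⟩, .inl ⟨c, hc, Prod.ext e e'⟩]

theorem eq_of_snd_eq (h : IsDrawing b L R) {c d : ℝ × ℝ × ℝ} (hc : c ∈ L) (hd : d ∈ L)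
    (e : c.2.2 = d.2.2) : c = d :=
  h.sorted.fst_coe_inj hc hd (Prod.ext_iff.1 (R.injOn_snd_pos (h.pos_mem hc) (h.pos_mem hd)
    (by rw [e]))).1

theorem eq_of_fst_eq (h : IsDrawing b L R) {c d : ℝ × ℝ × ℝ} (hc : c ∈ L) (hd : d ∈ L)
    (e : c.2.1 = d.2.1) : c = d :=
  h.sorted.fst_coe_inj hc hd (Prod.ext_iff.1 (R.injOn_snd_neg (h.neg_mem hc) (h.neg_mem hd)
    (by rw [e]))).1

theorem nodup (h : IsDrawing b L R) : L.Nodup :=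
  h.sorted.imp fun ⟨h₁, _⟩ e => h₁.ne (by rw [e])

theorem ne_nil (h : IsDrawing b L R) : L ≠ [] := by
  rintro rfl
  obtain ⟨t, ht⟩ := R.nonempty
  simpa using h.mem_verts.1 ht

theorem genuine (h : IsDrawing b L R) : Genuine (L.map Prod.snd) where
  nodup_fst := by
    rw [List.map_map]
    exact h.nodup.map_on fun c hc d hd e => h.eq_of_fst_eq hc hd e
  nodup_snd := by
    rw [List.map_map]
    exact h.nodup.map_on fun c hc d hd e => h.eq_of_snd_eq hc hd e
  mem_iff l := by
    simp only [List.map_map, List.mem_map, Function.comp]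
    constructor
    · rintro ⟨c, hc, rfl⟩
      have : (c.2.1 : Real.Angle) ∈ Prod.snd '' R.pos := by
        rw [R.image_snd]; exact ⟨_, h.neg_mem hc, rfl⟩
      rw [h.pos_eq] at this
      obtain ⟨_, ⟨d, hd, rfl⟩, e⟩ := this
      exact ⟨d, hd, (coe_inj_of_mem_Ico (h.mem_Ico₂ hd) (h.mem_Ico₁ hc)).1 e⟩
    · rintro ⟨c, hc, rfl⟩
      have : (c.2.2 : Real.Angle) ∈ Prod.snd '' R.neg := by
        rw [← R.image_snd]; exact ⟨_, h.pos_mem hc, rfl⟩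
      rw [h.neg_eq] at this
      obtain ⟨_, ⟨d, hd, rfl⟩, e⟩ := this
      exact ⟨d, hd, (coe_inj_of_mem_Ico (h.mem_Ico₁ hd) (h.mem_Ico₂ hc)).1 e⟩
  ne j hj e := by
    obtain ⟨c, hc, rfl⟩ := List.mem_map.1 hj
    exact Set.disjoint_left.1 R.disjoint (h.pos_mem hc) (by rw [← e]; exact h.neg_mem hc)

end IsDrawing

/-- The diagram shown by a list of columns. -/
theorem exists_isDrawing {b : ℝ} {L : List (ℝ × ℝ × ℝ)}
    (hs : L.Pairwise fun c d => c.1 < d.1 ∧ d.1 < c.1 + 2 * Real.pi)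
    (hI : ∀ l ∈ labels (L.map Prod.snd), l ∈ Set.Ico b (b + 2 * Real.pi))
    (hg : Genuine (L.map Prod.snd)) (hne : L ≠ []) : ∃ R, IsDrawing b L R := by
  have mem₁ : ∀ c ∈ L, c.2.1 ∈ Set.Ico b (b + 2 * Real.pi) := fun c hc =>
    hI _ (mem_labels.2 ⟨c.2, List.mem_map_of_mem hc, .inl rfl⟩)
  have mem₂ : ∀ c ∈ L, c.2.2 ∈ Set.Ico b (b + 2 * Real.pi) := fun c hc =>
    hI _ (mem_labels.2 ⟨c.2, List.mem_map_of_mem hc, .inr rfl⟩)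
  have fin : ∀ f : ℝ × ℝ × ℝ → ℝ,
      {t : Torus | ∃ c ∈ L, t = ((c.1 : Real.Angle), (f c : Real.Angle))}.Finite := by
    intro f
    refine ((L.finite_toSet).image fun c => ((c.1 : Real.Angle), (f c : Real.Angle))).subset ?_
    rintro _ ⟨c, hc, rfl⟩
    exact ⟨c, hc, rfl⟩
  have inj₁ : ∀ c ∈ L, ∀ d ∈ L, c.2.1 = d.2.1 → c = d := by
    have := hg.nodup_fst
    rw [List.map_map] at this
    exact fun c hc d hd e => List.inj_on_of_nodup_map this hc hd e
  have inj₂ : ∀ c ∈ L, ∀ d ∈ L, c.2.2 = d.2.2 → c = d := by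
    have := hg.nodup_snd
    rw [List.map_map] at this
    exact fun c hc d hd e => List.inj_on_of_nodup_map this hc hd e
  have mem_iff := hg.mem_iff
  simp only [List.map_map, List.mem_map, Function.comp] at mem_iff
  refine ⟨⟨{t | ∃ c ∈ L, t = ((c.1 : Real.Angle), (c.2.2 : Real.Angle))},
    {t | ∃ c ∈ L, t = ((c.1 : Real.Angle), (c.2.1 : Real.Angle))},
    (fin fun c => c.2.2).union (fin fun c => c.2.1), ?_, ?_, ?_, ?_, ?_, ?_, ?_, ?_⟩,
    hs, hI, rfl, rfl⟩
  · obtain ⟨c, hc⟩ := List.exists_mem_of_ne_nil L hne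
    exact ⟨_, .inl ⟨c, hc, rfl⟩⟩
  · rw [Set.disjoint_left]
    rintro _ ⟨c, hc, rfl⟩ ⟨d, hd, e⟩
    obtain ⟨e₁, e₂⟩ := Prod.mk.inj e
    have := hs.fst_coe_inj hc hd e₁
    subst this
    exact hg.ne _ (List.mem_map_of_mem hc) ((coe_inj_of_mem_Ico (mem₂ c hc) (mem₁ c hc)).1 e₂).symm
  · ext θ
    constructor
    · rintro ⟨_, ⟨c, hc, rfl⟩, rfl⟩; exact ⟨_, ⟨c, hc, rfl⟩, rfl⟩
    · rintro ⟨_, ⟨c, hc, rfl⟩, rfl⟩; exact ⟨_, ⟨c, hc, rfl⟩, rfl⟩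
  · ext φ
    constructor
    · rintro ⟨_, ⟨c, hc, rfl⟩, rfl⟩
      obtain ⟨d, hd, e⟩ := (mem_iff c.2.2).2 ⟨c, hc, rfl⟩
      exact ⟨_, ⟨d, hd, rfl⟩, by rw [e]⟩
    · rintro ⟨_, ⟨c, hc, rfl⟩, rfl⟩
      obtain ⟨d, hd, e⟩ := (mem_iff c.2.1).1 ⟨c, hc, rfl⟩
      exact ⟨_, ⟨d, hd, rfl⟩, by rw [e]⟩
  · rintro _ ⟨c, hc, rfl⟩ _ ⟨d, hd, rfl⟩ e
    rw [hs.fst_coe_inj hc hd e]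
  · rintro _ ⟨c, hc, rfl⟩ _ ⟨d, hd, rfl⟩ e
    rw [hs.fst_coe_inj hc hd e]
  · rintro _ ⟨c, hc, rfl⟩ _ ⟨d, hd, rfl⟩ e
    rw [inj₂ c hc d hd ((coe_inj_of_mem_Ico (mem₂ c hc) (mem₂ d hd)).1 e)]
  · rintro _ ⟨c, hc, rfl⟩ _ ⟨d, hd, rfl⟩ e
    rw [inj₁ c hc d hd ((coe_inj_of_mem_Ico (mem₁ c hc) (mem₁ d hd)).1 e)]

namespace IsDrawing

variable {b : ℝ} {L : List (ℝ × ℝ × ℝ)} {R : RectDiagram}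

theorem rotate {c : ℝ × ℝ × ℝ} (h : IsDrawing b (c :: L) R) :
    IsDrawing b (L ++ [(c.1 + 2 * Real.pi, c.2)]) R := by
  have hs := List.pairwise_cons.1 h.sorted
  have key : ∀ (f : ℝ × ℝ → ℝ) (t : Torus), (∃ d ∈ c :: L, t = ((d.1 : Real.Angle),
      (f d.2 : Real.Angle))) ↔ ∃ d ∈ L ++ [(c.1 + 2 * Real.pi, c.2)],
        t = ((d.1 : Real.Angle), (f d.2 : Real.Angle)) := by
    intro f t
    simp only [List.mem_cons, List.mem_append, List.not_mem_nil, or_false]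
    constructor
    · rintro ⟨d, rfl | hd, rfl⟩
      · exact ⟨_, .inr rfl, by simp⟩
      · exact ⟨d, .inl hd, rfl⟩
    · rintro ⟨d, hd | rfl, rfl⟩
      · exact ⟨d, .inr hd, rfl⟩
      · exact ⟨c, .inl rfl, by simp⟩
  refine ⟨?_, ?_, ?_, ?_⟩
  · rw [List.pairwise_append]
    refine ⟨hs.2, List.pairwise_singleton _ _, fun d hd e he => ?_⟩
    rw [List.mem_singleton] at he
    subst he
    have := hs.1 d hd
    exact ⟨this.2, by simp only; linarith [this.1]⟩
  · intro l hl
    refine h.mem_Ico l ?_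
    simp only [List.map_append, List.map_cons, List.map_nil, labels_append, labels_cons] at hl ⊢
    rw [Finset.union_comm]
    simpa using hl
  · rw [h.pos_eq]; ext t; exact key Prod.snd t
  · rw [h.neg_eq]; ext t; exact key Prod.fst t

/-- The cut can be chosen to avoid the rows. -/
theorem exists_Ioo (h : IsDrawing b L R) :
    ∃ b', IsDrawing b' L R ∧ ∀ l ∈ labels (L.map Prod.snd), b' < l := by
  obtain ⟨b', hb', hl⟩ := exists_lt_forall_gt b
    ((labels (L.map Prod.snd)).toList.map (· - 2 * Real.pi)) (by
      intro a ha
      obtain ⟨l, hl, rfl⟩ := List.mem_map.1 ha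
      linarith [(h.mem_Ico l (Finset.mem_toList.1 hl)).2])
  have key : ∀ l ∈ labels (L.map Prod.snd), b' < l ∧ l < b' + 2 * Real.pi := by
    intro l hl'
    have := hl _ (List.mem_map_of_mem (Finset.mem_toList.2 hl'))
    exact ⟨hb'.trans_le (h.mem_Ico l hl').1, by linarith⟩
  exact ⟨b', ⟨h.sorted, fun l hl => ⟨(key l hl).1.le, (key l hl).2⟩, h.pos_eq, h.neg_eq⟩,
    fun l hl => (key l hl).1⟩

/-- The effect of a change of the cut. -/
theorem change_cut (h : IsDrawing b L R) {t : ℝ} (ht : t ∈ Set.Icc b (b + 2 * Real.pi)) :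
    let f : ℝ → ℝ := fun l => if l < t then l + 2 * Real.pi else l
    IsDrawing t (L.map (Prod.map id (Prod.map f f))) R := by
  intro f
  have hf : ∀ l : ℝ, ((f l : ℝ) : Real.Angle) = l := by
    intro l
    simp only [f]
    split_ifs
    exacts [coe_add_two_pi l, rfl]
  have key : ∀ (g : ℝ × ℝ → ℝ) (_ : ∀ j, g (Prod.map f f j) = f (g j)) (t : Torus),
      (∃ d ∈ L, t = ((d.1 : Real.Angle), (g d.2 : Real.Angle))) ↔
        ∃ d ∈ L.map (Prod.map id (Prod.map f f)),
          t = ((d.1 : Real.Angle), (g d.2 : Real.Angle)) := by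
    intro g hg t
    simp only [List.mem_map]
    constructor
    · rintro ⟨d, hd, rfl⟩
      exact ⟨_, ⟨d, hd, rfl⟩, by simp [hg, hf]⟩
    · rintro ⟨_, ⟨d, hd, rfl⟩, rfl⟩
      exact ⟨d, hd, by simp [hg, hf]⟩
  refine ⟨List.pairwise_map.2 h.sorted, ?_, ?_, ?_⟩
  · intro l hl
    have e : (L.map (Prod.map id (Prod.map f f))).map Prod.snd =
        relabel f (L.map Prod.snd) := by simp [relabel]
    rw [e, labels_map] at hl
    obtain ⟨m, hm, rfl⟩ := Finset.mem_image.1 hl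
    obtain ⟨h₁, h₂⟩ := h.mem_Ico m hm
    obtain ⟨h₃, h₄⟩ := ht
    simp only [f]
    split_ifs with h₅
    · exact ⟨by linarith, by linarith⟩
    · exact ⟨by linarith, by linarith⟩
  · rw [h.pos_eq]; ext t; exact key Prod.snd (fun _ => rfl) t
  · rw [h.neg_eq]; ext t; exact key Prod.fst (fun _ => rfl) t

open scoped Classical in
/-- The drawing after the column at `x` has been moved to `x'`. -/
theorem move_column {α β L' : List (ℝ × ℝ × ℝ)} {x x' : ℝ} {j : ℝ × ℝ} {R R' : RectDiagram}
    (h : IsDrawing b (α ++ (x, j) :: β) R)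
    (hp : R'.pos = Prod.map (Function.update id (x : Real.Angle) x') id '' R.pos)
    (hn : R'.neg = Prod.map (Function.update id (x : Real.Angle) x') id '' R.neg)
    (hs : L'.Pairwise fun c d => c.1 < d.1 ∧ d.1 < c.1 + 2 * Real.pi)
    (hL : L'.Perm (α ++ (x', j) :: β)) : IsDrawing b L' R' := by
  have hmem : ∀ c, c ∈ α ++ (x, j) :: β ↔ c = (x, j) ∨ c ∈ α ∨ c ∈ β := by
    intro c; simp only [List.mem_append, List.mem_cons]; tauto
  have hmem' : ∀ c, c ∈ L' ↔ c = (x', j) ∨ c ∈ α ∨ c ∈ β := by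
    intro c; rw [hL.mem_iff]; simp only [List.mem_append, List.mem_cons]; tauto
  have hne : ∀ c, c ∈ α ∨ c ∈ β → (c.1 : Real.Angle) ≠ x := by
    intro c hc e
    have e' := h.sorted.fst_coe_inj ((hmem c).2 (.inr hc)) ((hmem (x, j)).2 (.inl rfl)) e
    have := h.nodup
    rw [List.nodup_middle, List.nodup_cons, List.mem_append] at this
    exact this.1 (e' ▸ hc)
  have key : ∀ g : ℝ × ℝ → ℝ, Prod.map (Function.update id (x : Real.Angle) x') id ''
      {t : Torus | ∃ c ∈ α ++ (x, j) :: β, t = ((c.1 : Real.Angle), (g c.2 : Real.Angle))} =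
      {t | ∃ c ∈ L', t = ((c.1 : Real.Angle), (g c.2 : Real.Angle))} := by
    intro g
    ext t
    constructor
    · rintro ⟨_, ⟨c, hc, rfl⟩, rfl⟩
      rcases (hmem c).1 hc with rfl | hc
      · exact ⟨(x', j), (hmem' _).2 (.inl rfl), by simp⟩
      · exact ⟨c, (hmem' _).2 (.inr hc), by simp [Function.update_of_ne (hne c hc)]⟩
    · rintro ⟨c, hc, rfl⟩
      rcases (hmem' c).1 hc with rfl | hc
      · exact ⟨_, ⟨(x, j), (hmem _).2 (.inl rfl), rfl⟩, by simp⟩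
      · exact ⟨_, ⟨c, (hmem _).2 (.inr hc), rfl⟩, by simp [Function.update_of_ne (hne c hc)]⟩
  refine ⟨hs, ?_, ?_, ?_⟩
  · intro l hl
    refine h.mem_Ico l ?_
    rw [mem_labels] at hl ⊢
    obtain ⟨k, hk, hl⟩ := hl
    obtain ⟨c, hc, rfl⟩ := List.mem_map.1 hk
    rcases (hmem' c).1 hc with rfl | hc
    · exact ⟨j, List.mem_map.2 ⟨(x, j), (hmem _).2 (.inl rfl), rfl⟩, hl⟩
    · exact ⟨c.2, List.mem_map_of_mem ((hmem _).2 (.inr hc)), hl⟩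
  · rw [hp, h.pos_eq]; exact key Prod.snd
  · rw [hn, h.neg_eq]; exact key Prod.fst

end IsDrawing

open JumpWord

/-! ### Moves of diagrams from moves of words -/

theorem pairwise_middle_iff {α β : List (ℝ × ℝ × ℝ)} {c : ℝ × ℝ × ℝ} :
    (α ++ c :: β).Pairwise (fun c d => c.1 < d.1 ∧ d.1 < c.1 + 2 * Real.pi) ↔
      (α ++ β).Pairwise (fun c d => c.1 < d.1 ∧ d.1 < c.1 + 2 * Real.pi) ∧
      (∀ d ∈ α, d.1 < c.1 ∧ c.1 < d.1 + 2 * Real.pi) ∧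
      ∀ d ∈ β, c.1 < d.1 ∧ d.1 < c.1 + 2 * Real.pi := by
  simp only [List.pairwise_append, List.pairwise_cons, List.mem_cons, forall_eq_or_imp]
  constructor
  · rintro ⟨h₁, ⟨h₂, h₃⟩, h₄⟩
    exact ⟨⟨h₁, h₃, fun a ha => (h₄ a ha).2⟩, fun d hd => (h₄ d hd).1, h₂⟩
  · rintro ⟨⟨h₁, h₂, h₃⟩, h₄, h₅⟩
    exact ⟨h₁, ⟨h₅, h₂⟩, fun a ha => ⟨h₄ a ha, h₃ a ha⟩⟩

namespace IsDrawing

variable {b : ℝ} {L : List (ℝ × ℝ × ℝ)} {R : RectDiagram}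

/-- The columns other than the one at `c.1` and those passed on the way do not lie in the strip
between `c.1` and `x'`. -/
theorem notMem_cIcc {α β : List (ℝ × ℝ × ℝ)} {c d : ℝ × ℝ × ℝ} {x' : ℝ}
    (hs : (α ++ c :: β).Pairwise fun c d => c.1 < d.1 ∧ d.1 < c.1 + 2 * Real.pi)
    (hcx : c.1 < x') (hxc : x' < c.1 + 2 * Real.pi) (hα : ∀ d ∈ α, x' < d.1 + 2 * Real.pi)
    (hd : d ∈ α ∨ d ∈ β ∧ x' < d.1) :
    (d.1 : Real.Angle) ∉ Set.cIcc (c.1 : Real.Angle) x' := by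
  obtain ⟨-, h₁, h₂⟩ := pairwise_middle_iff.1 hs
  rcases hd with hd | ⟨hd, hd'⟩
  · have h₃ := h₁ d hd
    rw [← coe_add_two_pi d.1, coe_mem_cIcc_iff_le ⟨by linarith, by linarith⟩ ⟨hcx, hxc.le⟩]
    linarith [hα d hd]
  · have h₃ := h₂ d hd
    rw [coe_mem_cIcc_iff_le ⟨by linarith, by linarith⟩ ⟨hcx, hxc.le⟩]
    linarith

/-- A column can be moved past the next one if their vertical chords do not interlace. -/
theorem swap {α β : List (ℝ × ℝ × ℝ)} {x x' : ℝ} {j k : ℝ × ℝ}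
    (h : IsDrawing b (α ++ (x, j) :: (x', k) :: β) R) (hjk : Noncross j k) :
    ∃ R' x'', R.IsExchange R' ∧ IsDrawing b (α ++ (x', k) :: (x'', j) :: β) R' := by
  classical
  have hp := Real.two_pi_pos
  obtain ⟨hs, hα, hβ⟩ := pairwise_middle_iff.1 h.sorted
  obtain ⟨hs', hα', hβ'⟩ := pairwise_middle_iff.1 hs
  have hxx' := hβ (x', k) (by simp)
  -- A position immediately to the right of `x'`.
  obtain ⟨x'', h₁, h₂⟩ := exists_gt_forall_lt x'
    ((x + 2 * Real.pi) :: (α.map fun d => d.1 + 2 * Real.pi) ++ β.map fun d => d.1) (by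
      intro a ha
      simp only [List.cons_append, List.mem_cons, List.mem_append, List.mem_map] at ha
      rcases ha with rfl | ⟨d, hd, rfl⟩ | ⟨d, hd, rfl⟩
      exacts [hxx'.2, (hα' d hd).2, (hβ' d hd).1])
  simp only [List.cons_append, List.mem_cons, List.mem_append, List.mem_map, forall_eq_or_imp] at h₂
  obtain ⟨h₂, h₃⟩ := h₂
  have h₄ : ∀ d ∈ α, x'' < d.1 + 2 * Real.pi := fun d hd => h₃ _ (.inl ⟨d, hd, rfl⟩)
  have h₅ : ∀ d ∈ β, x'' < d.1 := fun d hd => h₃ _ (.inr ⟨d, hd, rfl⟩)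
  have hs'' : (α ++ (x', k) :: (x'', j) :: β).Pairwise
      fun c d => c.1 < d.1 ∧ d.1 < c.1 + 2 * Real.pi := by
    rw [pairwise_middle_iff]
    refine ⟨pairwise_middle_iff.2 ⟨hs', fun d hd => ⟨by linarith [(hα' d hd).1], h₄ d hd⟩,
      fun d hd => ⟨h₅ d hd, by linarith [(hβ' d hd).2]⟩⟩, hα', ?_⟩
    intro d hd
    rcases List.mem_cons.1 hd with rfl | hd
    · simp only at hxx' ⊢; exact ⟨h₁, by linarith⟩
    · exact hβ' d hd
  have hmemj : (x, j) ∈ α ++ (x, j) :: (x', k) :: β := by simp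
  have hmemk : (x', k) ∈ α ++ (x, j) :: (x', k) :: β := by simp
  have hmem : ∀ c, c ∈ α ++ (x, j) :: (x', k) :: β ↔ c = (x, j) ∨ c = (x', k) ∨ c ∈ α ∨ c ∈ β := by
    intro c; simp only [List.mem_append, List.mem_cons]; tauto
  have hxx'' : x < x'' := hxx'.1.trans h₁
  have hnew : ∀ t ∈ R.verts, t.1 ≠ (x'' : Real.Angle) := by
    intro t ht e
    obtain ⟨c, hc, e', -⟩ := h.mem_verts.1 ht
    rw [e] at e'
    rcases (hmem c).1 hc with rfl | rfl | hc | hc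
    · exact hxx''.ne' (coe_inj_of_abs_lt (abs_lt.2 ⟨by linarith, by linarith⟩) e')
    · exact h₁.ne' (coe_inj_of_abs_lt (abs_lt.2 ⟨by simp only at hxx' ⊢; linarith,
        by simp only at hxx' ⊢; linarith⟩) e')
    · exact ((hα' c hc).1.trans h₁).ne' (coe_inj_of_abs_lt (abs_lt.2
        ⟨by linarith [(hα' c hc).1], by linarith [h₄ c hc]⟩) e')
    · exact (h₅ c hc).ne (coe_inj_of_abs_lt (abs_lt.2
        ⟨by linarith [(hβ' c hc).2], by linarith [h₅ c hc]⟩) e')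
  have hj := h.genuine.ne j (List.mem_map.2 ⟨(x, j), hmemj, rfl⟩)
  have hj₁ := h.mem_Ico₁ hmemj
  have hj₂ := h.mem_Ico₂ hmemj
  have hk₁ := h.mem_Ico₁ hmemk
  have hk₂ := h.mem_Ico₂ hmemk
  have hjc : (j.1 : Real.Angle) ≠ j.2 := fun e => hj ((coe_inj_of_mem_Ico hj₁ hj₂).1 e)
  have strip : ∀ y z : ℝ, ¬ Arc y z k.1 → ¬ Arc y z k.2 → y ∈ Set.Ico b (b + 2 * Real.pi) →
      z ∈ Set.Ico b (b + 2 * Real.pi) → y ≠ z → ∀ t ∈ R.verts, t.1 ≠ (x : Real.Angle) →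
      t ∉ RectDiagram.rect x x'' y z := by
    intro y z hy hz hy' hz' hyz t ht hne hr
    obtain ⟨c, hc, e, e'⟩ := h.mem_verts.1 ht
    rcases (hmem c).1 hc with rfl | rfl | hc
    · exact hne e
    · have h₆ := hr.2
      rcases e' with e' | e'
      · rw [e', coe_mem_cIcc_iff_arc hk₁ hy' hz' hyz] at h₆
        exact hy h₆
      · rw [e', coe_mem_cIcc_iff_arc hk₂ hy' hz' hyz] at h₆
        exact hz h₆
    · have h₆ := hr.1
      rw [e] at h₆
      refine notMem_cIcc h.sorted hxx'' h₂ h₄ ?_ h₆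
      rcases hc with hc | hc
      exacts [.inl hc, .inr ⟨by simp [hc], h₅ c hc⟩]
  have hv₁ : ((x : Real.Angle), (j.1 : Real.Angle)) ∈ R.verts := .inr (h.neg_mem hmemj)
  have hv₂ : ((x : Real.Angle), (j.2 : Real.Angle)) ∈ R.verts := .inl (h.pos_mem hmemj)
  have hperm : (α ++ (x', k) :: (x'', j) :: β).Perm (α ++ (x'', j) :: (x', k) :: β) :=
    (List.Perm.swap _ _ _).append_left α
  by_cases hcyc : Cyc j.1 k.1 j.2
  · have hcyc' := hjk.2.2.2.2.1 hcyc
    obtain ⟨R', hp, hn, he⟩ := R.exists_column_exchange hjc.symm hv₂ hv₁ hnew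
      (.inl (strip j.2 j.1 (by unfold Arc; unfold Noncross at hjk; unfold Cyc at *; grind)
        (by unfold Arc; unfold Noncross at hjk; unfold Cyc at *; grind) hj₂ hj₁ hj.symm))
    exact ⟨R', x'', he, h.move_column hp hn hs'' hperm⟩
  · obtain ⟨R', hp, hn, he⟩ := R.exists_column_exchange hjc hv₁ hv₂ hnew
      (.inl (strip j.1 j.2 (by unfold Arc; unfold Noncross at hjk; unfold Cyc at *; grind)
        (by unfold Arc; unfold Noncross at hjk; unfold Cyc at *; grind) hj₁ hj₂ hj))
    exact ⟨R', x'', he, h.move_column hp hn hs'' hperm⟩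

/-- Subdividing a column is a stabilization of type `←II`. -/
theorem isStabilization {α β : List (ℝ × ℝ × ℝ)} {X X' x y z : ℝ} {R' : RectDiagram}
    (h : IsDrawing b (α ++ (X', (x, z)) :: β) R)
    (h' : IsDrawing b (α ++ (X, (x, y)) :: (X', (y, z)) :: β) R') (hc : Cyc x y z) :
    RectDiagram.IsStabilization .leftII R R' := by
  have hm : (X', (x, z)) ∈ α ++ (X', (x, z)) :: β := by simp
  have hm' : (X, (x, y)) ∈ α ++ (X, (x, y)) :: (X', (y, z)) :: β := by simp
  have hm'' : (X', (y, z)) ∈ α ++ (X, (x, y)) :: (X', (y, z)) :: β := by simp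
  have hmem : ∀ c, c ∈ α ++ (X', (x, z)) :: β ↔ c = (X', (x, z)) ∨ c ∈ α ∨ c ∈ β := by
    intro c; simp only [List.mem_append, List.mem_cons]; tauto
  have hmem' : ∀ c, c ∈ α ++ (X, (x, y)) :: (X', (y, z)) :: β ↔
      c = (X, (x, y)) ∨ c = (X', (y, z)) ∨ c ∈ α ∨ c ∈ β := by
    intro c; simp only [List.mem_append, List.mem_cons]; tauto
  have hx := h'.mem_Ico₁ hm'
  have hy := h'.mem_Ico₂ hm'
  have hz := h'.mem_Ico₂ hm''
  have hX : X < X' ∧ X' < X + 2 * Real.pi := by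
    have := (pairwise_middle_iff.1 h'.sorted).2.2 (X', (y, z)) (by simp)
    exact this
  refine RectDiagram.isStabilization_of (θ₁ := X) (θ₂ := X') (φ₁ := x) (φ₂ := y) ?_ ?_
    (h.neg_mem hm) ?_ ?_ ?_
  · intro e
    have := congrArg Prod.fst (h'.sorted.fst_coe_inj hm' hm'' e)
    exact hX.1.ne this
  · exact fun e => hc.ne₁₂ ((coe_inj_of_mem_Ico hx hy).1 e)
  · rw [h.pos_eq, h'.pos_eq]
    ext t
    simp only [Set.mem_ofPred_eq, Set.mem_union, Set.mem_singleton_iff, hmem, hmem']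
    constructor
    · rintro ⟨c, rfl | rfl | hc, rfl⟩
      exacts [.inr rfl, .inl ⟨_, .inl rfl, rfl⟩, .inl ⟨c, .inr hc, rfl⟩]
    · rintro (⟨c, rfl | hc, rfl⟩ | rfl)
      exacts [⟨_, .inr (.inl rfl), rfl⟩, ⟨c, .inr (.inr hc), rfl⟩, ⟨_, .inl rfl, rfl⟩]
  · rw [h.neg_eq, h'.neg_eq]
    ext t
    simp only [Set.mem_ofPred_eq, Set.mem_union, Set.mem_singleton_iff, hmem, hmem',
      Set.mem_sdiff, Set.mem_insert_iff]
    constructor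
    · rintro ⟨c, rfl | rfl | hc, rfl⟩
      · exact .inr (.inl rfl)
      · exact .inr (.inr rfl)
      · refine .inl ⟨⟨c, .inr hc, rfl⟩, fun e => ?_⟩
        have := h.sorted.fst_coe_inj ((hmem c).2 (.inr hc)) hm (Prod.mk.inj e).1
        have hnd := h.nodup
        rw [List.nodup_middle, List.nodup_cons, List.mem_append] at hnd
        exact hnd.1 (this ▸ hc)
    · rintro (⟨⟨c, rfl | hc, rfl⟩, hne⟩ | rfl | rfl)
      exacts [(hne rfl).elim, ⟨c, .inr (.inr hc), rfl⟩, ⟨_, .inl rfl, rfl⟩,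
        ⟨_, .inr (.inl rfl), rfl⟩]
  · intro t ht hne hr
    obtain ⟨c, hc', e, e'⟩ := h.mem_verts.1 ht
    rcases (hmem c).1 hc' with rfl | hc'
    · rcases e' with e' | e'
      · exact hne (Prod.ext e e')
      · have h₂ := hr.2
        rw [e', coe_mem_cIcc_iff_arc hz hx hy hc.ne₁₂] at h₂
        unfold Arc Cyc at *
        grind
    · have h₁ := hr.1
      rw [e] at h₁
      obtain ⟨hs₁, hs₂, hs₃⟩ := pairwise_middle_iff.1 h.sorted
      refine notMem_cIcc h'.sorted hX.1 hX.2 (fun d hd => (hs₂ d hd).2) ?_ h₁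
      rcases hc' with hc' | hc'
      exacts [.inl hc', .inr ⟨by simp [hc'], (hs₃ c hc').1⟩]

/-- A column can be subdivided at any new height between its ends. -/
theorem split {α β : List (ℝ × ℝ × ℝ)} {X' x y z : ℝ}
    (h : IsDrawing b (α ++ (X', (x, z)) :: β) R) (hc : Cyc x y z)
    (hy : y ∈ Set.Ico b (b + 2 * Real.pi))
    (hyL : y ∉ labels ((α ++ (X', (x, z)) :: β).map Prod.snd)) :
    ∃ R' X, R.IsStabilization .leftII R' ∧
      IsDrawing b (α ++ (X, (x, y)) :: (X', (y, z)) :: β) R' := by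
  obtain ⟨hs, hα, hβ⟩ := pairwise_middle_iff.1 h.sorted
  have hp := Real.two_pi_pos
  -- A position immediately to the left of `X'`.
  obtain ⟨X, h₁, h₂⟩ := exists_lt_forall_gt X'
    ((X' - 2 * Real.pi) :: (β.map fun d => d.1 - 2 * Real.pi) ++ α.map fun d => d.1) (by
      intro a ha
      simp only [List.cons_append, List.mem_cons, List.mem_append, List.mem_map] at ha
      rcases ha with rfl | ⟨d, hd, rfl⟩ | ⟨d, hd, rfl⟩
      · linarith
      · linarith [(hβ d hd).2]
      · exact (hα d hd).1)
  simp only [List.cons_append, List.mem_cons, List.mem_append, List.mem_map, forall_eq_or_imp] at h₂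
  obtain ⟨h₂, h₃⟩ := h₂
  have h₄ : ∀ d ∈ β, d.1 - 2 * Real.pi < X := fun d hd => h₃ _ (.inl ⟨d, hd, rfl⟩)
  have h₅ : ∀ d ∈ α, d.1 < X := fun d hd => h₃ _ (.inr ⟨d, hd, rfl⟩)
  have hm : (x, z) ∈ (α ++ (X', (x, z)) :: β).map Prod.snd := List.mem_map.2 ⟨(X', (x, z)), by simp, rfl⟩
  obtain ⟨R', h'⟩ := exists_isDrawing (b := b) (L := α ++ (X, (x, y)) :: (X', (y, z)) :: β) (by
      rw [pairwise_middle_iff]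
      refine ⟨pairwise_middle_iff.2 ⟨hs, hα, hβ⟩, fun d hd => ⟨h₅ d hd, ?_⟩, fun d hd => ?_⟩
      · linarith [(hα d hd).2]
      · rcases List.mem_cons.1 hd with rfl | hd
        · exact ⟨h₁, by simp only; linarith⟩
        · exact ⟨by linarith [(hβ d hd).1], by linarith [h₄ d hd]⟩) (by
      intro l hl
      by_cases hly : l = y
      · exact hly ▸ hy
      · refine h.mem_Ico l ?_
        simp only [List.map_append, List.map_cons, labels_append, labels_cons, Finset.mem_union,
          Finset.mem_insert, Finset.mem_singleton] at hl ⊢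
        tauto) (by
      simp only [List.map_append, List.map_cons]
      refine (genuine_split hc.ne₁₂ hc.ne₂₃ (h.genuine.ne _ hm)).2
        ⟨by simpa using h.genuine, fun hy' => hyL ?_⟩
      obtain ⟨j, hj, e⟩ := List.mem_map.1 hy'
      exact mem_labels.2 ⟨j, by simpa using hj, .inl e⟩) (by simp)
  exact ⟨R', X, h.isStabilization h' hc, h'⟩

/-- Two columns of which the second continues the first can be merged. -/
theorem merge {α β : List (ℝ × ℝ × ℝ)} {X X' x y z : ℝ}
    (h : IsDrawing b (α ++ (X, (x, y)) :: (X', (y, z)) :: β) R) (hc : Cyc x y z) :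
    ∃ R', RectDiagram.IsStabilization .leftII R' R ∧ IsDrawing b (α ++ (X', (x, z)) :: β) R' := by
  obtain ⟨R', h'⟩ := exists_isDrawing (b := b) (L := α ++ (X', (x, z)) :: β)
    (by
      have hs := pairwise_middle_iff.1 (pairwise_middle_iff.1 h.sorted).1
      exact pairwise_middle_iff.2 hs) (by
      intro l hl
      refine h.mem_Ico l ?_
      simp only [List.map_append, List.map_cons, labels_append, labels_cons, Finset.mem_union,
        Finset.mem_insert, Finset.mem_singleton] at hl ⊢
      tauto) (by
      have := h.genuine
      simp only [List.map_append, List.map_cons] at this ⊢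
      exact ((genuine_split hc.ne₁₂ hc.ne₂₃ hc.ne₁₃).1 this).1) (by simp)
  exact ⟨R', h'.isStabilization h hc, h'⟩

open scoped Classical in
/-- The drawing after the row at the height `a` has been moved to `a'`. -/
theorem move_row {a a' : ℝ} {R' : RectDiagram}
    (h : IsDrawing b L R) (ha : a ∈ Set.Ico b (b + 2 * Real.pi))
    (ha' : a' ∈ Set.Ico b (b + 2 * Real.pi))
    (hp : R'.pos = Prod.map id (Function.update id (a : Real.Angle) a') '' R.pos)
    (hn : R'.neg = Prod.map id (Function.update id (a : Real.Angle) a') '' R.neg) :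
    IsDrawing b (L.map (Prod.map id (Prod.map (Function.update id a a')
      (Function.update id a a')))) R' := by
  set f : ℝ → ℝ := Function.update id a a' with hf
  have key : ∀ g : ℝ × ℝ → ℝ, (∀ c ∈ L, g c.2 ∈ Set.Ico b (b + 2 * Real.pi)) →
      (∀ j, g (Prod.map f f j) = f (g j)) →
      Prod.map id (Function.update id (a : Real.Angle) a') ''
      {t : Torus | ∃ c ∈ L, t = ((c.1 : Real.Angle), (g c.2 : Real.Angle))} =
      {t | ∃ c ∈ L.map (Prod.map id (Prod.map f f)),
        t = ((c.1 : Real.Angle), (g c.2 : Real.Angle))} := by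
    intro g hg hg'
    have e : ∀ c ∈ L, Prod.map id (Function.update id (a : Real.Angle) a')
        ((c.1 : Real.Angle), (g c.2 : Real.Angle)) =
          ((c.1 : Real.Angle), (f (g c.2) : Real.Angle)) := by
      intro c hc
      by_cases h' : g c.2 = a
      · simp [h', hf]
      · have : (g c.2 : Real.Angle) ≠ a := fun e => h' ((coe_inj_of_mem_Ico (hg c hc) ha).1 e)
        simp [Function.update_of_ne this, hf, Function.update_of_ne h']
    ext t
    constructor
    · rintro ⟨_, ⟨c, hc, rfl⟩, rfl⟩
      exact ⟨_, List.mem_map_of_mem hc, by rw [e c hc]; simp [hg']⟩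
    · rintro ⟨_, hc', rfl⟩
      obtain ⟨c, hc, rfl⟩ := List.mem_map.1 hc'
      exact ⟨_, ⟨c, hc, rfl⟩, by rw [e c hc]; simp [hg']⟩
  refine ⟨List.pairwise_map.2 h.sorted, ?_, ?_, ?_⟩
  · intro l hl
    have e : (L.map (Prod.map id (Prod.map f f))).map Prod.snd =
        relabel f (L.map Prod.snd) := by simp [relabel]
    rw [e, labels_map] at hl
    obtain ⟨m, hm, rfl⟩ := Finset.mem_image.1 hl
    by_cases h' : m = a
    · simpa [hf, h'] using ha'
    · simpa [hf, Function.update_of_ne h'] using h.mem_Ico m hm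
  · rw [hp, h.pos_eq]; exact key Prod.snd (fun c hc => h.mem_Ico₂ hc) (fun _ => rfl)
  · rw [hn, h.neg_eq]; exact key Prod.fst (fun c hc => h.mem_Ico₁ hc) (fun _ => rfl)

/-- A row can be moved if the columns between its ends have no vertices between the old and the
new heights. -/
theorem row {β γ : List (ℝ × ℝ × ℝ)} {X X' a a' x y : ℝ}
    (h : IsDrawing b ((X, (a, y)) :: (β ++ (X', (x, a)) :: γ)) R)
    (ha' : a' ∈ Set.Ico b (b + 2 * Real.pi))
    (haL : a' ∉ labels (((X, (a, y)) :: (β ++ (X', (x, a)) :: γ)).map Prod.snd))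
    (hav : (∀ l, (l = x ∨ l = y ∨ l ∈ labels (β.map Prod.snd)) → ¬ Arc a a' l) ∨
      (∀ l, (l = x ∨ l = y ∨ l ∈ labels (β.map Prod.snd)) → ¬ Arc a' a l)) :
    ∃ R', R.IsExchange R' ∧ IsDrawing b ((X, (a', y)) :: (β ++ (X', (x, a')) :: γ)) R' := by
  classical
  have hmem : ∀ c, c ∈ (X, (a, y)) :: (β ++ (X', (x, a)) :: γ) ↔
      c = (X, (a, y)) ∨ c = (X', (x, a)) ∨ c ∈ β ∨ c ∈ γ := by
    intro c; simp only [List.mem_append, List.mem_cons]; tauto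
  have hm₁ := (hmem _).2 (.inl rfl)
  have hm₂ := (hmem _).2 (.inr (.inl rfl))
  have ha := h.mem_Ico₁ hm₁
  have hx := h.mem_Ico₁ hm₂
  have hy := h.mem_Ico₂ hm₁
  simp only at ha hx hy
  have hs := List.pairwise_cons.1 h.sorted
  have hXX' : X < X' ∧ X' < X + 2 * Real.pi := hs.1 (X', (x, a)) (by simp)
  have haa' : a ≠ a' := fun e => haL (mem_labels.2 ⟨(a, y), by simp, .inl e⟩)
  have hnd := h.nodup
  have htoβγ : ∀ c, c ∈ β ∨ c ∈ γ → c.2.1 ≠ a ∧ c.2.2 ≠ a := by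
    intro c hc
    constructor
    · intro e
      have := h.eq_of_fst_eq ((hmem c).2 (.inr (.inr hc))) hm₁ e
      rw [List.nodup_cons] at hnd
      refine hnd.1 (this ▸ ?_)
      simp only [List.mem_append, List.mem_cons]; tauto
    · intro e
      have := h.eq_of_snd_eq ((hmem c).2 (.inr (.inr hc))) hm₂ e
      rw [List.nodup_cons, List.nodup_middle, List.nodup_cons] at hnd
      refine hnd.2.1 (this ▸ ?_)
      simp only [List.mem_append]; tauto
  have hxa : x ≠ a := h.genuine.ne (x, a) (List.mem_map.2 ⟨_, hm₂, rfl⟩)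
  have hay : a ≠ y := h.genuine.ne (a, y) (List.mem_map.2 ⟨_, hm₁, rfl⟩)
  have hv₁ : ((X : Real.Angle), (a : Real.Angle)) ∈ R.verts := .inr (h.neg_mem hm₁)
  have hv₂ : ((X' : Real.Angle), (a : Real.Angle)) ∈ R.verts := .inl (h.pos_mem hm₂)
  have hnew : ∀ t ∈ R.verts, t.2 ≠ (a' : Real.Angle) := by
    intro t ht e
    obtain ⟨c, hc, -, e'⟩ := h.mem_verts.1 ht
    refine haL (mem_labels.2 ⟨c.2, List.mem_map_of_mem hc, ?_⟩)
    rw [e] at e'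
    exact e'.imp (fun e' => ((coe_inj_of_mem_Ico ha' (h.mem_Ico₁ hc)).1 e').symm)
      (fun e' => ((coe_inj_of_mem_Ico ha' (h.mem_Ico₂ hc)).1 e').symm)
  have hγ : ∀ c ∈ γ, X' < c.1 := by
    intro c hc
    exact ((pairwise_middle_iff.1 hs.2).2.2 c hc).1
  have strip : ∀ p q : ℝ, p ∈ Set.Ico b (b + 2 * Real.pi) → q ∈ Set.Ico b (b + 2 * Real.pi) →
      p ≠ q → (∀ l, (l = x ∨ l = y ∨ l ∈ labels (β.map Prod.snd)) → ¬ Arc p q l) →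
      ∀ t ∈ R.verts, t.2 ≠ (a : Real.Angle) → t ∉ RectDiagram.rect X X' p q := by
    intro p q hp hq hpq hl t ht hne hr
    obtain ⟨c, hc, e, e'⟩ := h.mem_verts.1 ht
    have h₂ := hr.2
    have arc : ∀ l ∈ Set.Ico b (b + 2 * Real.pi), t.2 = (l : Real.Angle) →
        (l = x ∨ l = y ∨ l ∈ labels (β.map Prod.snd)) → False := by
      intro l hlI e'' h'
      rw [e'', coe_mem_cIcc_iff_arc hlI hp hq hpq] at h₂
      exact hl l h' h₂
    rcases (hmem c).1 hc with rfl | rfl | hc' | hc'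
    · rcases e' with e' | e'
      exacts [hne e', arc y hy e' (.inr (.inl rfl))]
    · rcases e' with e' | e'
      exacts [arc x hx e' (.inl rfl), hne e']
    · rcases e' with e' | e'
      · exact arc _ (h.mem_Ico₁ hc) e' (.inr (.inr (mem_labels.2 ⟨_, List.mem_map_of_mem hc', .inl rfl⟩)))
      · exact arc _ (h.mem_Ico₂ hc) e' (.inr (.inr (mem_labels.2 ⟨_, List.mem_map_of_mem hc', .inr rfl⟩)))
    · have h₁ := hr.1
      rw [e] at h₁
      exact notMem_cIcc (α := []) h.sorted hXX'.1 hXX'.2 (by simp)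
        (.inr ⟨by simp [hc'], hγ c hc'⟩) h₁
  obtain ⟨R', hp, hn, he⟩ := R.exists_row_exchange
    (fun e => hXX'.1.ne (coe_inj_of_abs_lt (abs_lt.2 ⟨by linarith [Real.two_pi_pos], by linarith⟩) e))
    hv₁ hv₂ hnew (hav.imp (fun hl => strip a a' ha ha' haa' hl)
      (fun hl => strip a' a ha' ha haa'.symm hl))
  refine ⟨R', he, ?_⟩
  have h' := h.move_row ha ha' hp hn
  have fix : ∀ δ : List (ℝ × ℝ × ℝ), (∀ c ∈ δ, c.2.1 ≠ a ∧ c.2.2 ≠ a) →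
      δ.map (Prod.map id (Prod.map (Function.update id a a') (Function.update id a a'))) = δ := by
    intro δ hδ
    conv_rhs => rw [← List.map_id δ]
    refine List.map_congr_left fun c hc => ?_
    obtain ⟨h₁, h₂⟩ := hδ c hc
    simp [Prod.map, Function.update_of_ne h₁, Function.update_of_ne h₂]
  simpa [fix β fun c hc => htoβγ c (.inl hc), fix γ fun c hc => htoβγ c (.inr hc),
    Function.update_of_ne hxa, Function.update_of_ne hay.symm] using h'

end IsDrawing

open JumpWord

namespace JumpWord

/-! ### Lifting moves of words to moves of diagrams -/

theorem lt_iff_of_monotoneOn {Λ Λ' : Type*} [LinearOrder Λ] [LinearOrder Λ'] {f : Λ → Λ'}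
    {A : Set Λ} (hf : MonotoneOn f A) {x y : Λ} (hx : x ∈ A) (hy : y ∈ A) (h : f x ≠ f y) :
    f x < f y ↔ x < y := by
  constructor
  · intro h'
    by_contra h''
    exact (hf hy hx (not_lt.1 h'')).not_gt h'
  · exact fun h' => (hf hx hy h'.le).lt_of_ne h

theorem cyc_of_monotoneOn {Λ Λ' : Type*} [LinearOrder Λ] [LinearOrder Λ'] {f : Λ → Λ'}
    {A : Set Λ} (hf : MonotoneOn f A) {x y z : Λ} (hx : x ∈ A) (hy : y ∈ A) (hz : z ∈ A)
    (hxy : f x ≠ f y) (hyz : f y ≠ f z) (hxz : f x ≠ f z) :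
    Cyc (f x) (f y) (f z) ↔ Cyc x y z := by
  unfold Cyc
  rw [lt_iff_of_monotoneOn hf hx hy hxy, lt_iff_of_monotoneOn hf hy hz hyz,
    lt_iff_of_monotoneOn hf hz hx hxz.symm]

/-- If a word and its image under a map of the levels can both be performed, then the map never
identifies two levels that are occupied at the same time. -/
theorem injOn_final {Λ Λ' : Type*} [LinearOrder Λ] [LinearOrder Λ'] {f : Λ → Λ'}
    {S : Finset Λ} {u : List (Λ × Λ)} (hf : Set.InjOn f S) (hu : Valid S u)
    (hw : Valid (S.image f) (relabel f u)) :
    Set.InjOn f (final S u) ∧ final (S.image f) (relabel f u) = (final S u).image f := by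
  induction u generalizing S with
  | nil => exact ⟨hf, rfl⟩
  | cons j u ih =>
    simp only [relabel, List.map_cons, valid_cons, final_cons] at hw ⊢
    obtain ⟨h₁, h₂, h₃⟩ := hu
    obtain ⟨h₁', h₂', h₃'⟩ := hw
    have e : move (S.image f) (Prod.map f f j) = (move S j).image f := by
      ext l
      simp only [mem_move, Finset.mem_image, Prod.map_fst, Prod.map_snd]
      constructor
      · rintro (rfl | ⟨hl, s, hs, rfl⟩)
        · exact ⟨j.2, .inl rfl, rfl⟩
        · exact ⟨s, .inr ⟨fun e => hl (by rw [e]), hs⟩, rfl⟩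
      · rintro ⟨s, rfl | ⟨hs, hs'⟩, rfl⟩
        · exact .inl rfl
        · exact .inr ⟨fun e => hs (hf hs' h₁ e), s, hs', rfl⟩
    have hf' : Set.InjOn f (move S j) := by
      have h₄ : ∀ s ∈ S, f s ≠ f j.2 := fun s hs e =>
      h₂' (by rw [Prod.map_snd, ← e]; exact Finset.mem_image_of_mem f hs)
      intro s hs t ht e'
      rcases mem_move.1 hs with rfl | ⟨-, hs⟩ <;> rcases mem_move.1 ht with rfl | ⟨-, ht⟩
      exacts [rfl, (h₄ t ht e'.symm).elim, (h₄ s hs e').elim, hf hs ht e']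
    rw [e] at h₃' ⊢
    exact ih hf' h₃ h₃'

/-- Two disjoint finite sets of levels, one above the other, can be separated by a level. -/
theorem exists_separating {b c : ℝ} {A : Finset ℝ} (hbc : b < c) (hA : ∀ l ∈ A, b < l ∧ l < c)
    (D : ℝ → Prop) (hD : ∀ l ∈ A, D l → ∀ m ∈ A, ¬ D m → l < m) :
    ∃ t, b < t ∧ t < c ∧ ∀ l ∈ A, (D l → l < t) ∧ (¬ D l → t < l) := by
  classical
  obtain ⟨m, hm, hmax⟩ := (insert b (A.filter D)).exists_max_image id ⟨b, by simp⟩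
  simp only [Finset.mem_insert, Finset.mem_filter, id] at hm hmax
  obtain ⟨t, h₁, h₂⟩ := exists_gt_forall_lt m (insert c (A.filter fun l => ¬ D l)).toList (by
    intro a ha
    simp only [Finset.mem_toList, Finset.mem_insert, Finset.mem_filter] at ha
    rcases hm with rfl | hm <;> rcases ha with rfl | ha
    exacts [hbc, (hA _ ha.1).1, (hA _ hm.1).2, hD _ hm.1 hm.2 _ ha.1 ha.2])
  simp only [Finset.mem_toList, Finset.mem_insert, Finset.mem_filter] at h₂
  exact ⟨t, (hmax b (.inl rfl)).trans_lt h₁, h₂ c (.inl rfl), fun l hl =>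
    ⟨fun h => (hmax l (.inr ⟨hl, h⟩)).trans_lt h₁, fun h => h₂ l (.inr ⟨hl, h⟩)⟩⟩

/-- A new level with a prescribed image can be inserted. -/
theorem exists_fresh {b c : ℝ} {A : Finset ℝ} (hbc : b < c) (hA : ∀ l ∈ A, b < l ∧ l < c)
    {π : ℝ → ℕ} (hπ : MonotoneOn π A) (n : ℕ) :
    ∃ y, b < y ∧ y < c ∧ y ∉ A ∧ MonotoneOn (Function.update π y n) (insert y A : Finset ℝ) := by
  obtain ⟨y, h₁, h₂, h₃⟩ := exists_separating hbc hA (fun l => π l ≤ n) (by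
    intro l hl hl' m hm hm'
    by_contra h
    exact hm' ((hπ hm hl (not_lt.1 h)).trans hl'))
  have hy : y ∉ A := fun hy => by
    by_cases h : π y ≤ n
    · exact ((h₃ y hy).1 h).false
    · exact ((h₃ y hy).2 h).false
  refine ⟨y, h₁, h₂, hy, ?_⟩
  intro l hl m hm hlm
  simp only [Finset.coe_insert, Set.mem_insert_iff, Finset.mem_coe] at hl hm
  by_cases e₁ : l = y <;> by_cases e₂ : m = y
  · rw [e₁, e₂]
  · rw [e₁, Function.update_self, Function.update_of_ne e₂]
    have hm := hm.resolve_left e₂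
    by_contra h
    have := (h₃ m hm).1 (not_le.1 h).le
    rw [e₁] at hlm
    linarith
  · rw [e₂, Function.update_self, Function.update_of_ne e₁]
    have hl := hl.resolve_left e₁
    by_contra h
    have := (h₃ l hl).2 h
    rw [e₂] at hlm
    linarith
  · rw [Function.update_of_ne e₁, Function.update_of_ne e₂]
    exact hπ (hl.resolve_left e₁) (hm.resolve_left e₂) hlm

/-- An embedding of cyclically ordered finite sets of numbers is increasing up to a cut. -/
theorem CycIso.exists_threshold {f : ℕ → ℕ} {A : Finset ℕ} (hf : CycIso f A) :
    ∃ T, (∀ x ∈ A, ∀ y ∈ A, x < y → (x < T ↔ y < T) → f x < f y) ∧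
      ∀ x ∈ A, ∀ y ∈ A, x < T → T ≤ y → f y < f x := by
  rcases A.eq_empty_or_nonempty with rfl | hA
  · exact ⟨0, by simp, by simp⟩
  obtain ⟨m, hm, hmin⟩ := A.exists_min_image f hA
  have hlt : ∀ x ∈ A, x ≠ m → f m < f x := fun x hx h =>
    (hmin x hx).lt_of_ne fun e => h (hf.injOn hm hx e).symm
  refine ⟨m, fun x hx y hy hxy h => ?_, fun x hx y hy hxm hmy => ?_⟩
  · by_cases hxm : x = m
    · subst hxm; exact hlt y hy hxy.ne'
    by_cases hym : y = m
    · subst hym; simp at h; omega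
    have h₁ := hlt x hx hxm
    have h₂ := hlt y hy hym
    have h₃ := (hf.cyc x hx y hy m hm).2 (by unfold Cyc; omega)
    unfold Cyc at h₃; omega
  · by_cases hym : y = m
    · subst hym; exact hlt x hx hxm.ne
    have h₁ := hlt x hx hxm.ne
    have h₂ := hlt y hy hym
    have h₃ := (hf.cyc x hx m hm y hy).2 (by unfold Cyc; omega)
    unfold Cyc at h₃; omega

end JumpWord

namespace RectDiagram

/-- The equivalence of diagrams generated by exchange moves and (de)stabilizations of type `←II`. -/
def Related (R R' : RectDiagram) : Prop := (moveSetoid {.leftII}).r R R'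

theorem Related.refl (R : RectDiagram) : Related R R := (moveSetoid _).refl R

theorem Related.symm {R R' : RectDiagram} (h : Related R R') : Related R' R := (moveSetoid _).symm h

theorem Related.trans {R R' R'' : RectDiagram} (h : Related R R') (h' : Related R' R'') :
    Related R R'' := (moveSetoid _).trans h h'

theorem IsExchange.related {R R' : RectDiagram} (h : IsExchange R R') : Related R R' :=
  .rel _ _ (.inl h)

theorem IsStabilization.related {R R' : RectDiagram} (h : IsStabilization .leftII R R') :
    Related R R' := .rel _ _ (.inr ⟨_, rfl, .inl h⟩)

end RectDiagram

/-- The closed word `p` is obtained from the word of a drawing of `R` by a monotone map of the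
heights to numbers, which may identify heights that are never occupied simultaneously. -/
def Realizes (R : RectDiagram) (p : Finset ℕ × List (ℕ × ℕ)) : Prop :=
  ∃ (b : ℝ) (L : List (ℝ × ℝ × ℝ)) (T : Finset ℝ) (π : ℝ → ℕ), IsDrawing b L R ∧
    Closed (T, L.map Prod.snd) ∧ T ⊆ labels (L.map Prod.snd) ∧
    MonotoneOn π (labels (L.map Prod.snd)) ∧ Set.InjOn π T ∧ p = mapState π (T, L.map Prod.snd)

namespace Realizes

open RectDiagram

variable {R : RectDiagram}

theorem exists_Ioo {p : Finset ℕ × List (ℕ × ℕ)} (h : Realizes R p) :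
  ∃ (b : ℝ) (L : List (ℝ × ℝ × ℝ)) (T : Finset ℝ) (π : ℝ → ℕ), IsDrawing b L R ∧
    (∀ l ∈ labels (L.map Prod.snd), b < l ∧ l < b + 2 * Real.pi) ∧
    Closed (T, L.map Prod.snd) ∧ T ⊆ labels (L.map Prod.snd) ∧
    MonotoneOn π (labels (L.map Prod.snd)) ∧ Set.InjOn π T ∧
    p = mapState π (T, L.map Prod.snd) := by
  obtain ⟨b, L, T, π, hL, h⟩ := h
  obtain ⟨b', hL', hb'⟩ := hL.exists_Ioo
  exact ⟨b', L, T, π, hL', fun l hl => ⟨hb' l hl, (hL'.mem_Ico l hl).2⟩, h⟩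

/-- The interchange of two jumps lifts to an exchange of columns: the chords of the jumps do not
cross before the heights are identified either. -/
theorem lift_swap {S : Finset ℕ} {α β : List (ℕ × ℕ)} {j k : ℕ × ℕ}
    (h : Realizes R (S, α ++ j :: k :: β)) (hc : Closed (S, α ++ j :: k :: β))
    (hjk : Noncross j k) : ∃ R', Related R R' ∧ Realizes R' (S, α ++ k :: j :: β) := by
  obtain ⟨b, L, T, π, hL, hT, hTL, hπ, hinj, hp⟩ := h
  simp only [mapState, Prod.mk.injEq] at hp
  obtain ⟨rfl, hw⟩ := hp
  rw [relabel, List.map_map, eq_comm, List.map_eq_append_iff] at hw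
  obtain ⟨Lα, L₁, rfl, rfl, hw₁⟩ := hw
  obtain ⟨⟨X, j'⟩, L₂, rfl, rfl, hw₂⟩ := List.map_eq_cons_iff.1 hw₁
  obtain ⟨⟨X', k'⟩, Lβ, rfl, rfl, rfl⟩ := List.map_eq_cons_iff.1 hw₂
  have hv := hc.1
  simp only [valid_append, valid_cons, Function.comp, Prod.map_fst, Prod.map_snd] at hv
  have hj : π j'.1 ≠ π j'.2 := fun e => hv.2.2.1 (e ▸ hv.2.1)
  have hk : π k'.1 ≠ π k'.2 := fun e => hv.2.2.2.2.1 (e ▸ hv.2.2.2.1)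
  have m₁ : ∀ c, c ∈ [(X, j'), (X', k')] → c.2.1 ∈ labels ((Lα ++ (X, j') :: (X', k') :: Lβ).map Prod.snd) ∧
      c.2.2 ∈ labels ((Lα ++ (X, j') :: (X', k') :: Lβ).map Prod.snd) := by
    intro c hc
    have : c.2 ∈ (Lα ++ (X, j') :: (X', k') :: Lβ).map Prod.snd := by
      refine List.mem_map_of_mem ?_
      simp only [List.mem_append, List.mem_cons, List.not_mem_nil, or_false] at hc ⊢
      tauto
    exact ⟨mem_labels.2 ⟨_, this, .inl rfl⟩, mem_labels.2 ⟨_, this, .inr rfl⟩⟩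
  obtain ⟨mj₁, mj₂⟩ := m₁ (X, j') (by simp)
  obtain ⟨mk₁, mk₂⟩ := m₁ (X', k') (by simp)
  have hjk' : Noncross j' k' := by
    obtain ⟨h₁, h₂, h₃, h₄, h₅⟩ := hjk
    simp only [Function.comp, Prod.map_fst, Prod.map_snd] at h₁ h₂ h₃ h₄ h₅
    rw [cyc_of_monotoneOn hπ mj₁ mk₁ mj₂ h₁ h₃.symm hj,
      cyc_of_monotoneOn hπ mj₁ mk₂ mj₂ h₂ h₄.symm hj] at h₅
    exact ⟨fun e => h₁ (by rw [e]), fun e => h₂ (by rw [e]), fun e => h₃ (by rw [e]),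
      fun e => h₄ (by rw [e]), h₅⟩
  obtain ⟨R', X'', he, hL'⟩ := hL.swap hjk'
  have hlab : labels ((Lα ++ (X', k') :: (X'', j') :: Lβ).map Prod.snd) =
      labels ((Lα ++ (X, j') :: (X', k') :: Lβ).map Prod.snd) := by
    simp only [List.map_append, List.map_cons, labels_append]
    rw [labels_swap]
  have hT' : Closed (T, (Lα ++ (X', k') :: (X'', j') :: Lβ).map Prod.snd) := by
    simp only [List.map_append, List.map_cons, Closed, valid_append, final_append] at hT ⊢
    refine ⟨⟨hT.1.1, valid_swap hjk' hT.1.2⟩, ?_⟩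
    refine Eq.trans ?_ hT.2
    simp only [final_cons]
    rw [move_comm hjk']
  exact ⟨R', he.related, b, _, T, π, hL', hT', by rw [hlab]; exact hTL, by rw [hlab]; exact hπ, hinj,
    by simp [mapState, relabel]⟩

/-- Merging two jumps lifts to a destabilization: the second jump starts where the first one ends
already before the heights are identified, as the map is injective on occupied heights. -/
theorem lift_merge {S : Finset ℕ} {α β : List (ℕ × ℕ)} {x y z : ℕ}
    (h : Realizes R (S, α ++ (x, y) :: (y, z) :: β)) (hc : Closed (S, α ++ (x, y) :: (y, z) :: β))
    (hxyz : Cyc x y z) : ∃ R', Related R R' ∧ Realizes R' (S, α ++ (x, z) :: β) := by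
  obtain ⟨b, L, T, π, hL, hT, hTL, hπ, hinj, hp⟩ := h
  simp only [mapState, Prod.mk.injEq] at hp
  obtain ⟨rfl, hw⟩ := hp
  rw [relabel, List.map_map, eq_comm, List.map_eq_append_iff] at hw
  obtain ⟨Lα, L₁, rfl, rfl, hw₁⟩ := hw
  obtain ⟨⟨X, x', y'⟩, L₂, rfl, e₁, hw₂⟩ := List.map_eq_cons_iff.1 hw₁
  obtain ⟨⟨X', y'', z'⟩, Lβ, rfl, e₂, rfl⟩ := List.map_eq_cons_iff.1 hw₂
  simp only [Function.comp, Prod.map, Prod.mk.injEq] at e₁ e₂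
  obtain ⟨rfl, rfl⟩ := e₁
  obtain ⟨ey, rfl⟩ := e₂
  have hv := hc.1
  have hvT := hT.1
  simp only [List.map_append, List.map_cons, valid_append, valid_cons] at hv hvT
  rw [← List.map_map] at hv
  obtain ⟨hi, hi'⟩ := injOn_final (S := T) (u := Lα.map Prod.snd) hinj hvT.1 hv.1
  have hy' : y' = y'' := by
    obtain ⟨hi₂, -⟩ := injOn_final (S := T) (u := Lα.map Prod.snd ++ [(x', y')]) hinj
      (by simp [hvT.1, hvT.2.1, hvT.2.2.1]) (by simp [relabel] at hv ⊢; simp [hv.1, hv.2.1, hv.2.2.1])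
    refine hi₂ ?_ ?_ ey.symm
    · simp [mem_move]
    · simpa using hvT.2.2.2.1
  subst hy'
  have hlab : ∀ l, l ∈ labels ((Lα ++ (X, x', y') :: (X', y', z') :: Lβ).map Prod.snd) ↔
      l = y' ∨ l ∈ labels ((Lα ++ (X', x', z') :: Lβ).map Prod.snd) := by
    intro l
    simp only [List.map_append, List.map_cons, labels_append, labels_cons, Finset.mem_union,
      Finset.mem_insert, Finset.mem_singleton]
    tauto
  have hcyc : Cyc x' y' z' := by
    refine (cyc_of_monotoneOn hπ ?_ ?_ ?_ hxyz.ne₁₂ hxyz.ne₂₃ hxyz.ne₁₃).1 hxyz <;>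
      refine Finset.mem_coe.2 ?_ <;>
      simp only [List.map_append, List.map_cons, labels_append, labels_cons, Finset.mem_union,
        Finset.mem_insert, Finset.mem_singleton] <;> tauto
  obtain ⟨R', he, hL'⟩ := hL.merge hcyc
  have hmm := move_merge hvT.2.2.1 hcyc
  have hsub : labels ((Lα ++ (X', x', z') :: Lβ).map Prod.snd) ⊆
      labels ((Lα ++ (X, x', y') :: (X', y', z') :: Lβ).map Prod.snd) :=
    fun l hl => (hlab l).2 (.inr hl)
  refine ⟨R', he.related.symm, b, _, T, π, hL', ⟨?_, ?_⟩, ?_, hπ.mono hsub, hinj,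
    by simp [mapState, relabel]⟩
  · simp only [List.map_append, List.map_cons, valid_append, valid_cons]
    refine ⟨hvT.1, hvT.2.1, fun h => ?_, by rw [← hmm]; exact hvT.2.2.2.2.2⟩
    exact hvT.2.2.2.2.1 (mem_move.2 (.inr ⟨hcyc.ne₁₃.symm, h⟩))
  · have := hT.2
    simp only [List.map_append, List.map_cons, final_append, final_cons] at this ⊢
    rw [← hmm, this]
  · intro s hs
    rcases (hlab s).1 (hTL hs) with rfl | h
    · by_contra hn
      refine hvT.2.2.1 ((mem_final_of_notMem_labels fun h => hn ?_).2 hs)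
      simp only [List.map_append, labels_append]
      exact Finset.mem_union_left _ h
    · exact h

open scoped Classical in
theorem update_mapState {π : ℝ → ℕ} {y : ℝ} {n : ℕ} {p : Finset ℝ × List (ℝ × ℝ)}
    (hy : y ∉ supp p) : mapState (Function.update π y n) p = mapState π p :=
  mapState_congr fun a ha => Function.update_of_ne (fun e => hy (by rwa [← e])) _ _

/-- Subdividing a jump lifts to a stabilization at a new height with the prescribed image. -/
theorem lift_split {S : Finset ℕ} {α β : List (ℕ × ℕ)} {x y z : ℕ}
    (h : Realizes R (S, α ++ (x, z) :: β)) (hc : Closed (S, α ++ (x, y) :: (y, z) :: β))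
    (hxyz : Cyc x y z) :
    ∃ R', Related R R' ∧ Realizes R' (S, α ++ (x, y) :: (y, z) :: β) := by
  obtain ⟨b, L, T, π, hL, hb, hT, hTL, hπ, hinj, hp⟩ := h.exists_Ioo
  simp only [mapState, Prod.mk.injEq] at hp
  obtain ⟨rfl, hw⟩ := hp
  rw [relabel, List.map_map, eq_comm, List.map_eq_append_iff] at hw
  obtain ⟨Lα, L₁, rfl, rfl, hw₁⟩ := hw
  obtain ⟨⟨X', x', z'⟩, Lβ, rfl, e₁, rfl⟩ := List.map_eq_cons_iff.1 hw₁
  simp only [Function.comp, Prod.map, Prod.mk.injEq] at e₁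
  obtain ⟨rfl, rfl⟩ := e₁
  obtain ⟨y', h₁, h₂, h₃, h₄⟩ := exists_fresh (by linarith [Real.two_pi_pos]) hb hπ y
  set π' := Function.update π y' y with hπ'
  have mem : ∀ l, l = x' ∨ l = z' → l ∈ labels ((Lα ++ (X', x', z') :: Lβ).map Prod.snd) := by
    intro l hl
    simp only [List.map_append, List.map_cons, labels_append, labels_cons, Finset.mem_union,
      Finset.mem_insert, Finset.mem_singleton]
    tauto
  have hx' : π' x' = π x' := Function.update_of_ne (fun e => h₃ (by rw [← e]; exact mem x' (.inl rfl))) _ _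
  have hz' : π' z' = π z' := Function.update_of_ne (fun e => h₃ (by rw [← e]; exact mem z' (.inr rfl))) _ _
  have hy' : π' y' = y := Function.update_self _ _ _
  have hcyc : Cyc x' y' z' := by
    rw [← hx', ← hz', ← hy'] at hxyz
    exact (cyc_of_monotoneOn h₄ (by simp) (by simp) (by simp) hxyz.ne₁₂ hxyz.ne₂₃
      hxyz.ne₁₃).1 hxyz
  obtain ⟨R', X, he, hL'⟩ := hL.split hcyc ⟨h₁.le, h₂⟩ h₃
  have hlab : labels ((Lα ++ (X, x', y') :: (X', y', z') :: Lβ).map Prod.snd) =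
      insert y' (labels ((Lα ++ (X', x', z') :: Lβ).map Prod.snd)) := by
    ext l
    simp only [List.map_append, List.map_cons, labels_append, labels_cons, Finset.mem_union,
      Finset.mem_insert, Finset.mem_singleton]
    tauto
  have hyT : y' ∉ T := fun h => h₃ (hTL h)
  have hyα : y' ∉ labels (Lα.map Prod.snd) := fun h => h₃ (by
    simp only [List.map_append, labels_append]; exact Finset.mem_union_left _ h)
  have hyβ : y' ∉ labels (Lβ.map Prod.snd) := fun h => h₃ (by
    simp only [List.map_append, List.map_cons, labels_append, labels_cons, Finset.mem_union]; tauto)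
  have hyF : y' ∉ final T (Lα.map Prod.snd) := fun h => hyT ((mem_final_of_notMem_labels hyα).1 h)
  have hmm := move_merge hyF hcyc
  have hvT := hT.1
  have hfT := hT.2
  simp only [List.map_append, List.map_cons, valid_append, valid_cons, final_append,
    final_cons] at hvT hfT
  refine ⟨R', he.related, b, _, T, π', hL', ⟨?_, ?_⟩, ?_, ?_, ?_, ?_⟩
  · simp only [List.map_append, List.map_cons, valid_append, valid_cons]
    refine ⟨hvT.1, hvT.2.1, hyF, mem_move.2 (.inl rfl), fun h => ?_, by rw [hmm]; exact hvT.2.2.2⟩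
    rcases mem_move.1 h with e | ⟨-, h⟩
    exacts [hcyc.ne₂₃ e.symm, hvT.2.2.1 h]
  · simp only [List.map_append, List.map_cons, final_append, final_cons]
    rw [hmm, hfT]
  · rw [hlab]; exact hTL.trans (Finset.subset_insert _ _)
  · rw [hlab]; exact h₄
  · intro s hs t ht e
    rw [hπ', Function.update_of_ne (fun e => hyT (by rw [← e]; exact hs)),
      Function.update_of_ne (fun e => hyT (by rw [← e]; exact ht))] at e
    exact hinj hs ht e
  · have eT := update_mapState (π := π) (y := y') (n := y) (p := (T, [])) (by simpa [supp] using hyT)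
    have eα := update_mapState (π := π) (y := y') (n := y) (p := (∅, Lα.map Prod.snd))
      (by simpa [supp] using hyα)
    have eβ := update_mapState (π := π) (y := y') (n := y) (p := (∅, Lβ.map Prod.snd))
      (by simpa [supp] using hyβ)
    simp only [mapState, Prod.mk.injEq, relabel, List.map_map, ← hπ'] at eT eα eβ
    simp only [mapState, relabel, Prod.mk.injEq, List.map_append, List.map_cons, List.map_map,
      Prod.map, hx', hy', hz']
    exact ⟨eT.1.symm, by rw [eα.2, eβ.2]⟩

/-- A cyclic permutation of the jumps is a change of the vertical cut. -/
theorem lift_rot {S : Finset ℕ} {j : ℕ × ℕ} {w : List (ℕ × ℕ)} (h : Realizes R (S, j :: w))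
    (hc : Closed (S, j :: w)) : Realizes R (move S j, w ++ [j]) := by
  obtain ⟨b, L, T, π, hL, hT, hTL, hπ, hinj, hp⟩ := h
  simp only [mapState, Prod.mk.injEq] at hp
  obtain ⟨rfl, hw⟩ := hp
  rw [relabel, List.map_map, eq_comm] at hw
  obtain ⟨⟨X, j⟩, L, rfl, rfl, rfl⟩ := List.map_eq_cons_iff.1 hw
  have hvT := hT.1
  have hfT := hT.2
  have hv := hc.1
  simp only [List.map_cons, valid_cons, final_cons] at hvT hfT hv
  obtain ⟨h₁, h₂⟩ := injOn_final (S := T) (u := [j]) hinj (by simp [hvT])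
    (by simp only [relabel, List.map_cons, List.map_nil, valid_cons, valid_nil, and_true]; exact ⟨hv.1, hv.2.1⟩)
  have hlab : labels ((L ++ [(X + 2 * Real.pi, j)]).map Prod.snd) =
      labels (((X, j) :: L).map Prod.snd) := by
    ext l
    simp only [List.map_append, List.map_cons, List.map_nil, labels_append, labels_cons,
      Finset.mem_union, labels_nil]
    have : l ∉ (∅ : Finset ℝ) := by simp
    tauto
  refine ⟨b, _, move T j, π, hL.rotate, ⟨?_, ?_⟩, ?_, by rw [hlab]; exact hπ, h₁, ?_⟩
  · simp only [List.map_append, List.map_cons, List.map_nil, valid_append, valid_cons, valid_nil]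
    rw [hfT]
    exact ⟨hvT.2.2, hvT.1, hvT.2.1, trivial⟩
  · simp only [List.map_append, List.map_cons, List.map_nil, final_append, final_cons, final_nil]
    rw [hfT]
  · rw [hlab]
    refine move_subset hTL ?_
    simp
  · simp only [mapState, relabel, List.map_append, List.map_map, List.map_cons, List.map_nil,
      Prod.mk.injEq]
    exact ⟨h₂, rfl⟩

theorem lift_rot_symm {S : Finset ℕ} {j : ℕ × ℕ} {w : List (ℕ × ℕ)}
    (h : Realizes R (move S j, w ++ [j])) (hc : Closed (S, j :: w)) : Realizes R (S, j :: w) := by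
  have key : ∀ (w v : List (ℕ × ℕ)) (S : Finset ℕ), Realizes R (S, w ++ v) → Closed (S, w ++ v) →
      Realizes R (final S w, v ++ w) := by
    intro w
    induction w with
    | nil => intro v S h _; simpa using h
    | cons k w ih =>
      intro v S h hc
      have hc' : Closed (move S k, w ++ v ++ [k]) := by
        obtain ⟨h₁, h₂⟩ := hc
        simp only [List.cons_append, valid_cons, final_cons] at h₁ h₂
        refine ⟨?_, ?_⟩
        · simp only [valid_append (v := w ++ v), valid_cons, valid_nil, h₂]
          exact ⟨h₁.2.2, h₁.1, h₁.2.1, trivial⟩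
        · simp only [final_append (v := w ++ v), final_cons, final_nil, h₂]
      have := ih (v ++ [k]) (move S k) (by
        have := lift_rot (by simpa using h) (by simpa using hc)
        rwa [List.append_assoc] at this)
        (by simpa using hc')
      simpa using this
  have hc' : Closed (move S j, w ++ [j]) := by
    obtain ⟨h₁, h₂⟩ := hc
    simp only [valid_cons, final_cons] at h₁ h₂
    refine ⟨?_, ?_⟩
    · simp only [valid_append, valid_cons, valid_nil, h₂]
      exact ⟨h₁.2.2, h₁.1, h₁.2.1, trivial⟩
    · simp only [final_append, final_cons, final_nil, h₂]
  have h' := key w [j] _ h hc'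
  have := hc.2
  simp only [final_cons] at this
  rw [this] at h'
  exact h'

/-- A cyclic renumbering of the levels is a monotone renumbering after a change of the horizontal
cut. -/
theorem lift_relabel {p : Finset ℕ × List (ℕ × ℕ)} {f : ℕ → ℕ} (h : Realizes R p)
    (hf : CycIso f (supp p)) : Realizes R (mapState f p) := by
  obtain ⟨b, L, T, π, hL, hb, hT, hTL, hπ, hinj, rfl⟩ := h.exists_Ioo
  rw [supp_mapState] at hf
  have hsupp : supp (T, L.map Prod.snd) = labels (L.map Prod.snd) :=
    Finset.union_eq_right.2 hTL
  rw [hsupp] at hf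
  obtain ⟨N, hN₁, hN₂⟩ := hf.exists_threshold
  have hmem : ∀ l ∈ labels (L.map Prod.snd), π l ∈ (labels (L.map Prod.snd)).image π :=
    fun l hl => Finset.mem_image_of_mem π hl
  -- The new cut separates the heights with images below and above the threshold of `f`.
  obtain ⟨t, ht₁, ht₂, ht⟩ := exists_separating (by linarith [Real.two_pi_pos]) hb
    (fun l => π l < N) (by
      intro l hl hl' m hm hm'
      by_contra h
      exact hm' ((hπ hm hl (not_lt.1 h)).trans_lt hl'))
  have hlt : ∀ l ∈ labels (L.map Prod.snd), l < t ↔ π l < N := by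
    intro l hl
    refine ⟨fun h => ?_, (ht l hl).1⟩
    by_contra h'
    exact ((ht l hl).2 h').not_gt h
  have hL' := hL.change_cut (t := t) ⟨ht₁.le, ht₂.le⟩
  set g : ℝ → ℝ := fun l => if l < t then l + 2 * Real.pi else l with hg
  set π' : ℝ → ℕ := fun m => f (π (if b + 2 * Real.pi ≤ m then m - 2 * Real.pi else m)) with hπ'
  have hgl : ∀ l ∈ labels (L.map Prod.snd), π' (g l) = f (π l) := by
    intro l hl
    have h₁ := hb l hl
    simp only [hπ', hg]
    by_cases h : l < t
    · rw [if_pos h, if_pos (by linarith)]; congr 2; ring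
    · rw [if_neg h, if_neg (by linarith)]
  have hginj : Set.InjOn g (labels (L.map Prod.snd)) := by
    intro l hl m hm e
    have h₁ := hb l hl
    have h₂ := hb m hm
    simp only [hg] at e
    split_ifs at e <;> linarith
  have hL'u : (L.map (Prod.map id (Prod.map g g))).map Prod.snd = relabel g (L.map Prod.snd) := by
    simp [relabel]
  have hpair : (T.image g, relabel g (L.map Prod.snd)) = mapState g (T, L.map Prod.snd) := rfl
  refine ⟨t, _, T.image g, π', hL', ?_, ?_, ?_, ?_, ?_⟩
  · rw [hL'u, hpair, closed_mapState (by rw [hsupp]; exact hginj)]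
    exact hT
  · rw [hL'u, labels_map]; exact Finset.image_subset_image hTL
  · rw [hL'u, labels_map]
    intro l' hl' m' hm' hlm
    obtain ⟨l, hl, rfl⟩ := Finset.mem_image.1 hl'
    obtain ⟨m, hm, rfl⟩ := Finset.mem_image.1 hm'
    rw [hgl l hl, hgl m hm]
    have h₁ := hb l hl
    have h₂ := hb m hm
    have mono : l ≤ m → (π l < N ↔ π m < N) → f (π l) ≤ f (π m) := by
      intro h h'
      rcases (hπ hl hm h).eq_or_lt with e | h''
      · rw [e]
      · exact (hN₁ _ (hmem l hl) _ (hmem m hm) h'' h').le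
    by_cases h₃ : l < t <;> by_cases h₄ : m < t
    · refine mono ?_ (iff_of_true ((hlt l hl).1 h₃) ((hlt m hm).1 h₄))
      simp only [hg, if_pos h₃, if_pos h₄] at hlm
      linarith
    · simp only [hg, if_pos h₃, if_neg h₄] at hlm
      linarith
    · exact (hN₂ _ (hmem m hm) _ (hmem l hl) ((hlt m hm).1 h₄)
        (not_lt.1 fun h => h₃ ((hlt l hl).2 h))).le
    · refine mono ?_ (iff_of_false (fun h => h₃ ((hlt l hl).2 h)) (fun h => h₄ ((hlt m hm).2 h)))
      simp only [hg, if_neg h₃, if_neg h₄] at hlm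
      linarith
  · intro s' hs t' ht e
    obtain ⟨s, hs₁, rfl⟩ := Finset.mem_image.1 hs
    obtain ⟨m, hm₁, rfl⟩ := Finset.mem_image.1 ht
    rw [hgl s (hTL hs₁), hgl m (hTL hm₁)] at e
    rw [hinj hs₁ hm₁ (hf.injOn (hmem s (hTL hs₁)) (hmem m (hTL hm₁)) e)]
  · rw [hL'u, hpair, mapState_comp, mapState_comp]
    refine mapState_congr fun a ha => ?_
    rw [hsupp] at ha
    exact (hgl a ha).symm


theorem not_arc_of_monotoneOn {π : ℝ → ℕ} {A : Set ℝ} (hπ : MonotoneOn π A) {a b l : ℝ}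
    (ha : a ∈ A) (hb : b ∈ A) (hl : l ∈ A) (hab : π a ≠ π b) (h : ¬ Arc (π a) (π b) (π l)) :
    ¬ Arc a b l := by
  unfold Arc at h ⊢
  push Not at h ⊢
  obtain ⟨h₁, h₂, h₃⟩ := h
  refine ⟨fun e => h₁ (by rw [e]), fun e => h₂ (by rw [e]), fun h => h₃ ?_⟩
  exact (cyc_of_monotoneOn hπ ha hl hb h₁.symm h₂ hab).2 h

/-- The renaming of a level lifts to an exchange of rows: a new height with the prescribed image is
chosen for the row. -/
theorem lift_row {S : Finset ℕ} {β γ : List (ℕ × ℕ)} {a a' x y : ℕ}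
    (h : Realizes R (S, (a, y) :: (β ++ (x, a) :: γ))) (haa' : a ≠ a')
    (hav : (∀ l, (l = x ∨ l = y ∨ l ∈ labels β) → ¬ Arc a a' l) ∨
      (∀ l, (l = x ∨ l = y ∨ l ∈ labels β) → ¬ Arc a' a l))
    (haγ : a ∉ labels γ) (haγ' : a' ∉ labels γ) (haS : a' ∉ S) :
    ∃ R', Related R R' ∧
      Realizes R' (move S (a, a'), (a', y) :: (β ++ (x, a') :: γ)) := by
  classical
  have hav₀ : ∀ l, (l = x ∨ l = y ∨ l ∈ labels β) → l ≠ a ∧ l ≠ a' := by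
    intro l hl
    unfold Arc at hav
    rcases hav with hav | hav <;> have := hav l hl <;> push Not at this <;> tauto
  obtain ⟨b, L, T, π, hL, hb, hT, hTL, hπ, hinj, hp⟩ := h.exists_Ioo
  simp only [mapState, Prod.mk.injEq] at hp
  obtain ⟨rfl, hw⟩ := hp
  rw [relabel, List.map_map, eq_comm] at hw
  obtain ⟨⟨X, a₁, y₁⟩, L₁, rfl, e₁, hw₁⟩ := List.map_eq_cons_iff.1 hw
  obtain ⟨Lβ, L₂, rfl, rfl, hw₂⟩ := List.map_eq_append_iff.1 hw₁
  obtain ⟨⟨X', x₁, a₂⟩, Lγ, rfl, e₂, rfl⟩ := List.map_eq_cons_iff.1 hw₂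
  simp only [Function.comp, Prod.map, Prod.mk.injEq] at e₁ e₂
  obtain ⟨rfl, rfl⟩ := e₁
  obtain ⟨rfl, ea⟩ := e₂
  rw [← List.map_map] at hav hav₀ haγ haγ'
  have hvT := hT.1
  have hfT := hT.2
  simp only [List.map_append, List.map_cons, valid_append, valid_cons, final_append,
    final_cons] at hvT hfT
  have notMem : ∀ {l : ℝ} {δ : List (ℝ × ℝ)}, π l ∉ labels (relabel π δ) → l ∉ labels δ := by
    intro l δ h h'
    rw [labels_map] at h
    exact h (Finset.mem_image_of_mem π h')
  have ha₂ : a₂ ∈ T := by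
    rw [← hfT]
    have : a₂ ∉ labels (Lγ.map Prod.snd) := notMem (by rw [ea]; exact haγ)
    exact (mem_final_of_notMem_labels this).2 (mem_move.2 (.inl rfl))
  -- Both heights are occupied at the beginning, hence the two ends of the row are at the same
  -- height.
  have hea : a₂ = a₁ := hinj ha₂ hvT.1 ea
  subst hea
  obtain ⟨c, h₁, h₂, h₃, h₄⟩ := exists_fresh (by linarith [Real.two_pi_pos]) hb hπ a'
  set π' := Function.update π c a' with hπ'
  have hlab : ∀ l, l ∈ labels (((X, a₂, y₁) :: (Lβ ++ (X', x₁, a₂) :: Lγ)).map Prod.snd) ↔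
      l = a₂ ∨ (l = x₁ ∨ l = y₁ ∨ l ∈ labels (Lβ.map Prod.snd)) ∨ l ∈ labels (Lγ.map Prod.snd) := by
    intro l
    simp only [List.map_append, List.map_cons, labels_append, labels_cons, Finset.mem_union,
      Finset.mem_insert, Finset.mem_singleton]
    tauto
  have hc' : π' c = a' := Function.update_self _ _ _
  have hne : ∀ l ∈ labels (((X, a₂, y₁) :: (Lβ ++ (X', x₁, a₂) :: Lγ)).map Prod.snd), π' l = π l :=
    fun l hl => Function.update_of_ne (fun e => h₃ (by rw [← e]; exact hl)) _ _
  have himg : ∀ l, (l = x₁ ∨ l = y₁ ∨ l ∈ labels (Lβ.map Prod.snd)) →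
      (π l = π x₁ ∨ π l = π y₁ ∨ π l ∈ labels ((Lβ.map Prod.snd).map (Prod.map π π))) := by
    rintro l (rfl | rfl | hl)
    · exact .inl rfl
    · exact .inr (.inl rfl)
    · refine .inr (.inr ?_)
      rw [show (Lβ.map Prod.snd).map (Prod.map π π) = relabel π (Lβ.map Prod.snd) from rfl, labels_map]
      exact Finset.mem_image_of_mem π hl
  have arcs : (∀ l, (l = x₁ ∨ l = y₁ ∨ l ∈ labels (Lβ.map Prod.snd)) → ¬ Arc a₂ c l) ∨
      (∀ l, (l = x₁ ∨ l = y₁ ∨ l ∈ labels (Lβ.map Prod.snd)) → ¬ Arc c a₂ l) := by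
    have hmem : ∀ l, (l = x₁ ∨ l = y₁ ∨ l ∈ labels (Lβ.map Prod.snd)) →
        l ∈ labels (((X, a₂, y₁) :: (Lβ ++ (X', x₁, a₂) :: Lγ)).map Prod.snd) :=
      fun l hl => (hlab l).2 (.inr (.inl hl))
    have hma := (hlab a₂).2 (.inl rfl)
    refine hav.imp (fun hav l hl => ?_) (fun hav l hl => ?_)
    · refine not_arc_of_monotoneOn h₄ (Finset.mem_insert_of_mem hma) (Finset.mem_insert_self _ _)
        (Finset.mem_insert_of_mem (hmem l hl)) (by rw [hne _ hma, hc']; exact haa') ?_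
      rw [hne _ hma, hc', hne _ (hmem l hl)]
      exact hav _ (himg l hl)
    · refine not_arc_of_monotoneOn h₄ (Finset.mem_insert_self _ _) (Finset.mem_insert_of_mem hma)
        (Finset.mem_insert_of_mem (hmem l hl)) (by rw [hne _ hma, hc']; exact haa'.symm) ?_
      rw [hne _ hma, hc', hne _ (hmem l hl)]
      exact hav _ (himg l hl)
  obtain ⟨R', he, hL'⟩ := hL.row ⟨h₁.le, h₂⟩ h₃ arcs
  -- the new word arises from the old one by renaming the level
  set g : ℝ → ℝ := Function.update id a₂ c with hg
  have hga : g a₂ = c := Function.update_self _ _ _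
  have hgne : ∀ l, l ≠ a₂ → g l = l := fun l hl => Function.update_of_ne hl _ _
  have hxa : x₁ ≠ a₂ := fun e => (hav₀ _ (.inl rfl)).1 (by rw [e])
  have hya : y₁ ≠ a₂ := fun e => (hav₀ _ (.inr (.inl rfl))).1 (by rw [e])
  have hβa : a₂ ∉ labels (Lβ.map Prod.snd) := fun h => (hav₀ _ (himg _ (.inr (.inr h)))).1 rfl
  have hγa : a₂ ∉ labels (Lγ.map Prod.snd) := notMem haγ
  have hcT : c ∉ T := fun h => h₃ (hTL h)
  have fix : ∀ δ : List (ℝ × ℝ), a₂ ∉ labels δ → relabel g δ = δ := by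
    intro δ hδ
    conv_rhs => rw [← List.map_id δ]
    refine List.map_congr_left fun j hj => ?_
    have i₁ : j.1 ≠ a₂ := fun e => hδ (mem_labels.2 ⟨j, hj, .inl e⟩)
    have i₂ : j.2 ≠ a₂ := fun e => hδ (mem_labels.2 ⟨j, hj, .inr e⟩)
    simp [Prod.map, hgne _ i₁, hgne _ i₂]
  have hTg : T.image g = move T (a₂, c) := by
    ext l
    simp only [Finset.mem_image, mem_move]
    constructor
    · rintro ⟨s, hs, rfl⟩
      by_cases e : s = a₂
      · rw [e, hga]; exact .inl rfl
      · rw [hgne s e]; exact .inr ⟨e, hs⟩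
    · rintro (rfl | ⟨e, hs⟩)
      · exact ⟨a₂, ha₂, hga⟩
      · exact ⟨l, hs, hgne l e⟩
  have hug : ((X, c, y₁) :: (Lβ ++ (X', x₁, c) :: Lγ)).map Prod.snd =
      relabel g (((X, a₂, y₁) :: (Lβ ++ (X', x₁, a₂) :: Lγ)).map Prod.snd) := by
    have i₁ := fix _ hβa
    have i₂ := fix _ hγa
    simp only [relabel] at i₁ i₂
    simp only [List.map_append, List.map_cons, relabel, i₁, i₂, Prod.map, hga, hgne _ hxa,
      hgne _ hya]
  have hsupp : supp (T, ((X, a₂, y₁) :: (Lβ ++ (X', x₁, a₂) :: Lγ)).map Prod.snd) =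
    labels (((X, a₂, y₁) :: (Lβ ++ (X', x₁, a₂) :: Lγ)).map Prod.snd) := Finset.union_eq_right.2 hTL
  have hginj : Set.InjOn g (supp (T, ((X, a₂, y₁) :: (Lβ ++ (X', x₁, a₂) :: Lγ)).map Prod.snd)) := by
    rw [hsupp]
    intro l hl m hm e
    have hlc : l ≠ c := fun e => h₃ (by rw [← e]; exact hl)
    have hmc : m ≠ c := fun e => h₃ (by rw [← e]; exact hm)
    by_cases i₁ : l = a₂ <;> by_cases i₂ : m = a₂
    · rw [i₁, i₂]
    · rw [i₁, hga, hgne m i₂] at e; exact (hmc e.symm).elim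
    · rw [i₂, hga, hgne l i₁] at e; exact (hlc e).elim
    · rwa [hgne l i₁, hgne m i₂] at e
  have hpair : (move T (a₂, c), ((X, c, y₁) :: (Lβ ++ (X', x₁, c) :: Lγ)).map Prod.snd) =
      mapState g (T, ((X, a₂, y₁) :: (Lβ ++ (X', x₁, a₂) :: Lγ)).map Prod.snd) := by
    rw [mapState, hTg, hug]
  have hsub : labels (((X, c, y₁) :: (Lβ ++ (X', x₁, c) :: Lγ)).map Prod.snd) ⊆
      insert c (labels (((X, a₂, y₁) :: (Lβ ++ (X', x₁, a₂) :: Lγ)).map Prod.snd)) := by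
    rw [hug, labels_map]
    intro l hl
    obtain ⟨m, hm, rfl⟩ := Finset.mem_image.1 hl
    by_cases e : m = a₂
    · rw [e, hga]; exact Finset.mem_insert_self _ _
    · rw [hgne m e]; exact Finset.mem_insert_of_mem hm
  have hTa : ∀ s ∈ T, π s ≠ a' := fun s hs e => haS (e ▸ Finset.mem_image_of_mem π hs)
  refine ⟨R', he.related, b, _, move T (a₂, c), π', hL', ?_, ?_, h₄.mono hsub, ?_, ?_⟩
  · rw [hpair, closed_mapState hginj]
    exact hT
  · rw [← hTg, hug, labels_map]
    exact Finset.image_subset_image hTL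
  · intro s hs t ht e
    rcases mem_move.1 hs with i | ⟨-, i⟩ <;> rcases mem_move.1 ht with k | ⟨-, k⟩
    · rw [i, k]
    · rw [i, hc', hne t (hTL k)] at e; exact (hTa t k e.symm).elim
    · rw [k, hc', hne s (hTL i)] at e; exact (hTa s i e).elim
    · rw [hne s (hTL i), hne t (hTL k)] at e; exact hinj i k e
  · have hβπ : ∀ δ : List (ℝ × ℝ × ℝ), (∀ l ∈ labels (δ.map Prod.snd),
        l ∈ labels (((X, a₂, y₁) :: (Lβ ++ (X', x₁, a₂) :: Lγ)).map Prod.snd)) →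
        δ.map (Prod.map π' π' ∘ Prod.snd) = δ.map (Prod.map π π ∘ Prod.snd) := by
      intro δ hδ
      refine List.map_congr_left fun d hd => ?_
      have i₁ := hne _ (hδ _ (mem_labels.2 ⟨d.2, List.mem_map_of_mem hd, .inl rfl⟩))
      have i₂ := hne _ (hδ _ (mem_labels.2 ⟨d.2, List.mem_map_of_mem hd, .inr rfl⟩))
      simp [Prod.map, i₁, i₂]
    have i₁ := hβπ Lβ fun l hl => (hlab l).2 (.inr (.inl (.inr (.inr hl))))
    have i₂ := hβπ Lγ fun l hl => (hlab l).2 (.inr (.inr hl))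
    have i₃ := hne x₁ ((hlab _).2 (.inr (.inl (.inl rfl))))
    have i₄ := hne y₁ ((hlab _).2 (.inr (.inl (.inr (.inl rfl)))))
    simp only [mapState, relabel, Prod.mk.injEq, List.map_append, List.map_cons, List.map_map, i₁,
      i₂, Prod.map, hc', i₃, i₄, and_true]
    ext l
    simp only [Finset.mem_image, mem_move]
    constructor
    · rintro (rfl | ⟨e, s, hs, rfl⟩)
      · exact ⟨c, .inl rfl, hc'⟩
      · exact ⟨s, .inr ⟨fun e' => e (by rw [e']), hs⟩, hne s (hTL hs)⟩
    · rintro ⟨s, rfl | ⟨e, hs⟩, rfl⟩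
      · exact .inl hc'
      · rw [hne s (hTL hs)]
        exact .inr ⟨fun e' => e (hinj hs ha₂ e'), s, hs, rfl⟩

/-- Every move of words, in either direction, lifts to a sequence of moves of diagrams. -/
theorem lift {p q : Finset ℕ × List (ℕ × ℕ)} (hpq : NatStep p q) :
    (Realizes R p → ∃ R', Related R R' ∧ Realizes R' q) ∧
      (Realizes R q → ∃ R', Related R R' ∧ Realizes R' p) := by
  rcases hpq with ⟨h, hp, hq⟩ | ⟨-, f, hf, rfl⟩
  · cases h with
    | loc S h =>
      cases h with
      | @swap α β j k h =>
        refine ⟨fun hR => hR.lift_swap hp h, fun hR => hR.lift_swap hq (h.symm ?_ ?_)⟩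
        · have := hp.1
          simp only [valid_append, valid_cons] at this
          exact fun e => this.2.2.1 (e ▸ this.2.1)
        · have := hq.1
          simp only [valid_append, valid_cons] at this
          exact fun e => this.2.2.1 (e ▸ this.2.1)
      | merge α β h =>
        exact ⟨fun hR => hR.lift_merge hp h, fun hR => hR.lift_split hp h⟩
    | rot S j w =>
      exact ⟨fun hR => ⟨R, .refl R, hR.lift_rot hp⟩, fun hR => ⟨R, .refl R, hR.lift_rot_symm hp⟩⟩
    | @row S β γ a b x y hab hx hy hβ ha hb hbS =>
      have key : ∀ l, (l = x ∨ l = y ∨ l ∈ labels β) → ¬ Arc a b l := by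
        rintro l (rfl | rfl | hl)
        exacts [hx, hy, hβ l hl]
      refine ⟨fun hR => hR.lift_row hab (.inl key) ha hb hbS, fun hR => ?_⟩
      have haS : a ∈ S := hp.1.1
      have := hR.lift_row hab.symm (.inr key) hb ha (by simp [mem_move, hab])
      have e : move (move S (a, b)) (b, a) = S := by
        ext l; simp only [mem_move]; grind
      rwa [e] at this
  · refine ⟨fun hR => ⟨R, .refl R, hR.lift_relabel hf⟩, fun hR => ⟨R, .refl R, ?_⟩⟩
    obtain ⟨g, hg, hgf⟩ := hf.exists_inverse
    rw [← supp_mapState] at hg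
    have := hR.lift_relabel hg
    rwa [mapState_comp, mapState_congr (g := id) (fun a ha => by simp [hgf a ha]), mapState_id]
      at this

/-- Diagrams can be transported along chains of moves of words. -/
theorem lift_eqvGen {p q : Finset ℕ × List (ℕ × ℕ)} (h : Relation.EqvGen NatStep p q) :
    (∀ R, Realizes R p → ∃ R', Related R R' ∧ Realizes R' q) ∧
      (∀ R, Realizes R q → ∃ R', Related R R' ∧ Realizes R' p) := by
  induction h with
  | rel p q h => exact ⟨fun R => (lift h).1, fun R => (lift h).2⟩
  | refl p => exact ⟨fun R h => ⟨R, .refl R, h⟩, fun R h => ⟨R, .refl R, h⟩⟩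
  | symm p q _ ih => exact ⟨ih.2, ih.1⟩
  | trans p q r _ _ ih ih' =>
    refine ⟨fun R h => ?_, fun R h => ?_⟩
    · obtain ⟨R', h₁, h₂⟩ := ih.1 R h
      obtain ⟨R'', h₃, h₄⟩ := ih'.1 R' h₂
      exact ⟨R'', h₁.trans h₃, h₄⟩
    · obtain ⟨R', h₁, h₂⟩ := ih'.2 R h
      obtain ⟨R'', h₃, h₄⟩ := ih.2 R' h₂
      exact ⟨R'', h₁.trans h₃, h₄⟩

end Realizes

open JumpWord

/-! ### Isotopies -/

/-- The numbers `x i`, `i ∈ A`, increase and lie within one turn of the circle. -/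
def WithinTurn (A : Finset ℕ) (x : ℕ → ℝ) : Prop :=
  ∀ i ∈ A, ∀ j ∈ A, i < j → x i < x j ∧ x j < x i + 2 * Real.pi

/-- The space of the sequences within one turn is open and convex, so any two of them are connected
by a chain of sequences each of which differs from the preceding one in one place only. -/
theorem WithinTurn.connected {A : Finset ℕ} {P : (ℕ → ℝ) → Prop}
    (hc : ∀ x y, (∀ i ∈ A, x i = y i) → P x → P y)
    (hs : ∀ x, ∀ i ∈ A, ∀ v, P x → WithinTurn A x → WithinTurn A (Function.update x i v) →
      P (Function.update x i v)) {x y : ℕ → ℝ} (hx : WithinTurn A x) (hy : WithinTurn A y)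
    (h : P x) : P y := by
  have gap : ∀ z, WithinTurn A z → ∃ δ > 0, ∀ i ∈ A, ∀ j ∈ A, i < j →
      δ < z j - z i ∧ δ < z i + 2 * Real.pi - z j := by
    intro z hz
    obtain ⟨δ, h₀, hδ⟩ := exists_gt_forall_lt 0
      (((A ×ˢ A).filter fun p => p.1 < p.2).toList.flatMap
        fun p => [z p.2 - z p.1, z p.1 + 2 * Real.pi - z p.2]) (by
      intro a ha
      simp only [List.mem_flatMap, Finset.mem_toList, Finset.mem_filter, Finset.mem_product,
        List.mem_cons, List.not_mem_nil, or_false] at ha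
      obtain ⟨p, ⟨⟨h₁, h₂⟩, h₃⟩, rfl | rfl⟩ := ha
      · linarith [(hz _ h₁ _ h₂ h₃).1]
      · linarith [(hz _ h₁ _ h₂ h₃).2])
    refine ⟨δ, h₀, fun i hi j hj hij => ⟨hδ _ ?_, hδ _ ?_⟩⟩ <;>
      refine List.mem_flatMap.2 ⟨(i, j), by simp [hi, hj, hij], by simp⟩
  obtain ⟨δ₁, h₁, hδ₁⟩ := gap x hx
  obtain ⟨δ₂, h₂, hδ₂⟩ := gap y hy
  set δ := min δ₁ δ₂ with hδ
  have h₀ : 0 < δ := lt_min h₁ h₂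
  have e₁ : δ ≤ δ₁ := min_le_left _ _
  have e₂ : δ ≤ δ₂ := min_le_right _ _
  -- Between sequences at distance less than `δ / 2` one can move one place after another.
  have near : ∀ u v : ℕ → ℝ, (∀ i ∈ A, ∀ j ∈ A, i < j →
      δ ≤ u j - u i ∧ δ ≤ u i + 2 * Real.pi - u j) →
      (∀ i ∈ A, |v i - u i| < δ / 2) → P u → P v := by
    intro u v hu huv hPu
    have hw : ∀ w : ℕ → ℝ, (∀ i ∈ A, w i = u i ∨ w i = v i) → WithinTurn A w := by
      intro w hw i hi j hj hij
      have key : ∀ k ∈ A, |w k - u k| < δ / 2 := by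
        intro k hk
        rcases hw k hk with e | e
        · rw [e, sub_self, abs_zero]; linarith
        · rw [e]; exact huv k hk
      have h₃ := abs_lt.1 (key i hi)
      have h₄ := abs_lt.1 (key j hj)
      have h₅ := hu i hi j hj hij
      exact ⟨by linarith [h₅.1], by linarith [h₅.2]⟩
    have hpw : ∀ B : Finset ℕ, WithinTurn A (B.piecewise v u) := fun B => hw _ fun i _ => by
      by_cases hi : i ∈ B
      · exact .inr (B.piecewise_eq_of_mem _ _ hi)
      · exact .inl (B.piecewise_eq_of_notMem _ _ hi)
    have main : ∀ B : Finset ℕ, B ⊆ A → P (B.piecewise v u) := by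
      intro B
      induction B using Finset.induction_on with
      | empty => intro _; simpa using hPu
      | insert i B hi ih =>
        intro hB
        have := hpw (insert i B)
        rw [Finset.piecewise_insert] at this ⊢
        exact hs _ i (hB (Finset.mem_insert_self _ _)) _
          (ih fun k hk => hB (Finset.mem_insert_of_mem hk)) (hpw B) this
    exact hc _ _ (fun i hi => A.piecewise_eq_of_mem _ _ hi) (main A le_rfl)
  obtain ⟨N, hN⟩ : ∃ N : ℕ, ∀ i ∈ A, |y i - x i| < (N + 1) * (δ / 2) := by
    obtain ⟨N, hN⟩ := exists_nat_gt ((∑ i ∈ A, |y i - x i|) / (δ / 2))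
    refine ⟨N, fun i hi => ?_⟩
    rw [div_lt_iff₀ (by linarith)] at hN
    have := Finset.single_le_sum (f := fun i => |y i - x i|) (fun i _ => abs_nonneg _) hi
    linarith
  have hN' : (0 : ℝ) < N + 1 := by positivity
  -- the straight path from `x` to `y`
  have path : ∀ k : ℕ, k ≤ N + 1 → P fun i => x i + k / (N + 1) * (y i - x i) := by
    intro k
    induction k with
    | zero => intro _; simpa using h
    | succ k ih =>
      intro hk
      refine near _ _ ?_ ?_ (ih (by omega))
      · intro i hi j hj hij
        have h₃ := hδ₁ i hi j hj hij
        have h₄ := hδ₂ i hi j hj hij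
        have ht : (k : ℝ) / (N + 1) ≤ 1 := by
          rw [div_le_one hN']; exact_mod_cast (by omega : k ≤ N + 1)
        have ht' : (0 : ℝ) ≤ k / (N + 1) := by positivity
        generalize (k : ℝ) / (N + 1) = t at ht ht'
        constructor <;> nlinarith
      · intro i hi
        have : x i + ((k + 1 : ℕ) : ℝ) / (N + 1) * (y i - x i) -
            (x i + (k : ℝ) / (N + 1) * (y i - x i)) = (y i - x i) / (N + 1) := by
          push_cast; field_simp; ring
        rw [this, abs_div, abs_of_pos hN', div_lt_iff₀ hN']
        linarith [hN i hi]
  refine hc _ _ (fun i _ => ?_) (path (N + 1) le_rfl)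
  push_cast
  rw [div_self hN'.ne']
  ring

namespace RectDiagram

/-- The vertices of `R` are those of the code `(P, N)`, with columns at `x i` and rows at `y j`. -/
structure IsPlaced (P N : Set (ℕ × ℕ)) (x y : ℕ → ℝ) (R : RectDiagram) : Prop where
  pos_eq : R.pos = (fun p => ((x p.1 : Real.Angle), (y p.2 : Real.Angle))) '' P
  neg_eq : R.neg = (fun p => ((x p.1 : Real.Angle), (y p.2 : Real.Angle))) '' N

theorem IsPlaced.transpose {P N : Set (ℕ × ℕ)} {x y : ℕ → ℝ} {R : RectDiagram}
    (h : IsPlaced P N x y R) : IsPlaced (Prod.swap ⁻¹' P) (Prod.swap ⁻¹' N) y x R.transpose := by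
  have key : ∀ Q : Set (ℕ × ℕ), Prod.swap ⁻¹'
      ((fun p : ℕ × ℕ => ((x p.1 : Real.Angle), (y p.2 : Real.Angle))) '' Q) =
      (fun p : ℕ × ℕ => ((y p.1 : Real.Angle), (x p.2 : Real.Angle))) '' (Prod.swap ⁻¹' Q) := by
    intro Q
    ext ⟨s, t⟩
    constructor
    · rintro ⟨p, hp, e⟩
      exact ⟨p.swap, by simpa using hp, by simpa [and_comm] using e⟩
    · rintro ⟨p, hp, e⟩
      exact ⟨p.swap, hp, by simpa [and_comm] using e⟩
  exact ⟨by rw [← key, ← h.pos_eq]; rfl, by rw [← key, ← h.neg_eq]; rfl⟩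

theorem exists_pos_neg_of_mem_verts {R : RectDiagram} {t : Torus} (ht : t ∈ R.verts) :
    ∃ φ₁ φ₂, φ₁ ≠ φ₂ ∧ (t.1, φ₁) ∈ R.pos ∧ (t.1, φ₂) ∈ R.neg := by
  have h₁ : t.1 ∈ Prod.fst '' R.pos := by
    rcases ht with h | h
    · exact ⟨t, h, rfl⟩
    · rw [R.image_fst]; exact ⟨t, h, rfl⟩
  have h₂ := h₁
  rw [R.image_fst] at h₂
  obtain ⟨⟨θ, φ₁⟩, h₁, rfl⟩ := h₁
  obtain ⟨⟨θ', φ₂⟩, h₂, e⟩ := h₂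
  simp only at e
  subst e
  exact ⟨φ₁, φ₂, fun e => Set.disjoint_left.1 R.disjoint h₁ (by rw [e]; exact h₂), h₁, h₂⟩

/-- Moving one column without passing another one is an exchange, or does nothing. -/
theorem IsPlaced.update {P N : Set (ℕ × ℕ)} {x y : ℕ → ℝ} {R : RectDiagram} {A : Finset ℕ}
    (h : IsPlaced P N x y R) (hA : ∀ p, p ∈ P ∨ p ∈ N → p.1 ∈ A) (hx : WithinTurn A x) {i : ℕ}
    (hi : i ∈ A) {v : ℝ} (hv : WithinTurn A (Function.update x i v)) :
    ∃ R', IsPlaced P N (Function.update x i v) y R' ∧ Relation.EqvGen IsExchange R R' := by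
  classical
  have hverts : ∀ t, t ∈ R.verts ↔ ∃ p, (p ∈ P ∨ p ∈ N) ∧ t = ((x p.1 : Real.Angle), (y p.2 : Real.Angle)) := by
    intro t
    rw [RectDiagram.mem_verts, h.pos_eq, h.neg_eq]
    constructor
    · rintro (⟨p, hp, rfl⟩ | ⟨p, hp, rfl⟩)
      exacts [⟨p, .inl hp, rfl⟩, ⟨p, .inr hp, rfl⟩]
    · rintro ⟨p, hp | hp, rfl⟩
      exacts [.inl ⟨p, hp, rfl⟩, .inr ⟨p, hp, rfl⟩]
  -- the columns other than the `i`-th one, up to a turn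
  have far : ∀ k ∈ A, k ≠ i → ∃ r : ℝ, (r : Real.Angle) = x k ∧
      x i < r ∧ r < x i + 2 * Real.pi ∧ v < r ∧ r < v + 2 * Real.pi := by
    intro k hk hki
    rcases lt_or_gt_of_ne hki with hlt | hlt
    · have h₁ := hx k hk i hi hlt
      have h₂ := hv k hk i hi hlt
      rw [Function.update_self, Function.update_of_ne hki] at h₂
      exact ⟨x k + 2 * Real.pi, coe_add_two_pi _, by linarith, by linarith, by linarith, by linarith⟩
    · have h₁ := hx i hi k hk hlt
      have h₂ := hv i hi k hk hlt
      rw [Function.update_self, Function.update_of_ne hki] at h₂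
      exact ⟨x k, rfl, by linarith, by linarith, by linarith, by linarith⟩
  have hne : ∀ k ∈ A, k ≠ i → (x k : Real.Angle) ≠ x i ∧ (x k : Real.Angle) ≠ v := by
    intro k hk hki
    obtain ⟨r, hr, h₁, h₂, h₃, h₄⟩ := far k hk hki
    rw [← hr]
    exact ⟨fun e => h₁.ne' ((coe_inj_of_mem_Ico (a := x i) ⟨h₁.le, h₂⟩ ⟨le_rfl, by linarith⟩).1 e),
      fun e => h₃.ne' ((coe_inj_of_mem_Ico (a := v) ⟨h₃.le, h₄⟩ ⟨le_rfl, by linarith⟩).1 e)⟩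
  have himg : ∀ Q : Set (ℕ × ℕ), (∀ p ∈ Q, p.1 ∈ A) →
      Prod.map (Function.update id (x i : Real.Angle) v) id ''
        ((fun p : ℕ × ℕ => ((x p.1 : Real.Angle), (y p.2 : Real.Angle))) '' Q) =
      (fun p : ℕ × ℕ => (((Function.update x i v p.1 : ℝ) : Real.Angle), (y p.2 : Real.Angle))) '' Q := by
    intro Q hQ
    rw [Set.image_image]
    refine Set.image_congr fun p hp => ?_
    by_cases e : p.1 = i
    · simp [e]
    · simp [Function.update_of_ne e, Function.update_of_ne (hne p.1 (hQ p hp) e).1]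
  have finish : ∀ R' : RectDiagram,
      R'.pos = Prod.map (Function.update id (x i : Real.Angle) v) id '' R.pos →
      R'.neg = Prod.map (Function.update id (x i : Real.Angle) v) id '' R.neg →
      IsPlaced P N (Function.update x i v) y R' := by
    intro R' hp hn
    exact ⟨by rw [hp, h.pos_eq, himg P fun p hp => hA p (.inl hp)],
      by rw [hn, h.neg_eq, himg N fun p hp => hA p (.inr hp)]⟩
  by_cases hex : (x i : Real.Angle) = v ∨ ∀ p, p ∈ P ∨ p ∈ N → p.1 ≠ i
  · have fix : ∀ Q ⊆ R.verts, Q = Prod.map (Function.update id (x i : Real.Angle) v) id '' Q := by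
      intro Q hQ
      conv_lhs => rw [← Set.image_id Q]
      refine Set.image_congr fun t ht => ?_
      rcases hex with e | hex
      · rw [← e, Function.update_eq_self_iff.2 (by rfl)]; rfl
      · obtain ⟨p, hp, rfl⟩ := (hverts t).1 (hQ ht)
        simp [Function.update_of_ne (hne p.1 (hA p hp) (hex p hp)).1]
    exact ⟨R, finish R (fix _ fun _ => .inl) (fix _ fun _ => .inr), .refl R⟩
  push Not at hex
  obtain ⟨hxv, p, hp, rfl⟩ := hex
  obtain ⟨φ₁, φ₂, hφ, h₁, h₂⟩ := exists_pos_neg_of_mem_verts ((hverts _).2 ⟨p, hp, rfl⟩)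
  have hother : ∀ t ∈ R.verts, t.1 ≠ x p.1 → ∃ k ∈ A, k ≠ p.1 ∧ t.1 = x k := by
    intro t ht hne
    obtain ⟨q, hq, rfl⟩ := (hverts t).1 ht
    exact ⟨q.1, hA q hq, fun e => hne (by rw [e]), rfl⟩
  obtain ⟨R', hp', hn', he⟩ := R.exists_column_exchange (θ' := (v : Real.Angle)) hφ (.inl h₁) (.inr h₂)
    (by
      intro t ht e
      by_cases e' : t.1 = x p.1
      · exact hxv (e'.symm.trans e)
      · obtain ⟨k, hk, hki, e''⟩ := hother t ht e'
        exact (hne k hk hki).2 (e''.symm.trans e)) (by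
      rcases le_total (x p.1) v with hle | hle
      · refine .inl fun t ht hne ⟨hr, _⟩ => ?_
        obtain ⟨k, hk, hki, e⟩ := hother t ht hne
        obtain ⟨r, hr', i₁, i₂, i₃, i₄⟩ := far k hk hki
        rw [e, ← hr', coe_mem_cIcc_iff_le ⟨i₁.le, i₂⟩
          ⟨hle.lt_of_ne fun e => hxv (by rw [e]), by linarith⟩] at hr
        linarith
      · refine .inr fun t ht hne ⟨hr, _⟩ => ?_
        obtain ⟨k, hk, hki, e⟩ := hother t ht hne
        obtain ⟨r, hr', i₁, i₂, i₃, i₄⟩ := far k hk hki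
        rw [e, ← hr', coe_mem_cIcc_iff_le ⟨i₃.le, i₄⟩
          ⟨hle.lt_of_ne fun e => hxv (by rw [e]), by linarith⟩] at hr
        linarith)
  exact ⟨R', finish R' hp' hn', .rel _ _ he⟩

/-- Diagrams of the same combinatorial type with the same rows are related by exchanges of columns.
-/
theorem IsPlaced.move_columns {P N : Set (ℕ × ℕ)} {x x' y : ℕ → ℝ} {R : RectDiagram} {A : Finset ℕ}
    (h : IsPlaced P N x y R) (hA : ∀ p, p ∈ P ∨ p ∈ N → p.1 ∈ A) (hx : WithinTurn A x)
    (hx' : WithinTurn A x') :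
    ∃ R', IsPlaced P N x' y R' ∧ Relation.EqvGen IsExchange R R' := by
  refine WithinTurn.connected (A := A) (x := x)
    (P := fun x => ∃ R', IsPlaced P N x y R' ∧ Relation.EqvGen IsExchange R R') ?_ ?_ hx hx'
    ⟨R, h, .refl R⟩
  · rintro x₁ x₂ he ⟨R', h', hR⟩
    refine ⟨R', ⟨?_, ?_⟩, hR⟩
    · rw [h'.pos_eq]
      exact Set.image_congr fun p hp => by rw [he _ (hA p (.inl hp))]
    · rw [h'.neg_eq]
      exact Set.image_congr fun p hp => by rw [he _ (hA p (.inr hp))]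
  · rintro x₁ i hi v ⟨R', h', hR⟩ h₁ h₂
    obtain ⟨R'', h'', hR'⟩ := h'.update hA h₁ hi h₂
    exact ⟨R'', h'', hR.trans _ _ _ hR'⟩

theorem eqvGen_transpose {R R' : RectDiagram} (h : Relation.EqvGen IsExchange R R') :
    Relation.EqvGen IsExchange R.transpose R'.transpose := by
  induction h with
  | rel _ _ h => exact .rel _ _ h.transpose
  | refl _ => exact .refl _
  | symm _ _ _ ih => exact .symm _ _ ih
  | trans _ _ _ _ _ ih ih' => exact .trans _ _ _ ih ih'

/-- Diagrams of the same combinatorial type are related by exchanges. -/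
theorem IsPlaced.related {P N : Set (ℕ × ℕ)} {x x' y y' : ℕ → ℝ} {R R' : RectDiagram}
    {A B : Finset ℕ} (h : IsPlaced P N x y R) (h' : IsPlaced P N x' y' R')
    (hA : ∀ p, p ∈ P ∨ p ∈ N → p.1 ∈ A) (hB : ∀ p, p ∈ P ∨ p ∈ N → p.2 ∈ B) (hx : WithinTurn A x)
    (hx' : WithinTurn A x') (hy : WithinTurn B y) (hy' : WithinTurn B y') : Related R R' := by
  obtain ⟨R₁, h₁, e₁⟩ := h.move_columns hA hx hx'
  obtain ⟨R₂, h₂, e₂⟩ := h₁.transpose.move_columns (fun p hp => hB p.swap hp) hy hy'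
  have e : R₂.transpose = R' := by
    have h₃ := h₂.transpose
    exact RectDiagram.ext (h₃.pos_eq.trans h'.pos_eq.symm) (h₃.neg_eq.trans h'.neg_eq.symm)
  have key : Relation.EqvGen IsExchange R R' := by
    rw [← e]
    exact e₁.trans _ _ _ (eqvGen_transpose e₂)
  clear * - key
  induction key with
  | rel _ _ h => exact h.related
  | refl _ => exact .refl _
  | symm _ _ _ ih => exact ih.symm
  | trans _ _ _ _ _ ih ih' => exact ih.trans ih'

end RectDiagram

open RectDiagram

/-- A drawing places the diagram, with the columns numbered by their positions in the list. -/
theorem IsDrawing.isPlaced {b : ℝ} {L : List (ℝ × ℝ × ℝ)} {R : RectDiagram} {y : ℕ → ℝ}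
    {w : List (ℕ × ℕ)} (h : IsDrawing b L R) (hw : L.map Prod.snd = relabel y w) :
    IsPlaced {p | ∃ j, w[p.1]? = some j ∧ p.2 = j.2} {p | ∃ j, w[p.1]? = some j ∧ p.2 = j.1}
      (fun i => (L.getD i 0).1) y R := by
  have key : ∀ f : ∀ {T : Type}, T × T → T, (∀ j : ℕ × ℕ, f (Prod.map y y j) = y (f j)) →
      {t : Torus | ∃ c ∈ L, t = ((c.1 : Real.Angle), ((f c.2 : ℝ) : Real.Angle))} =
      (fun p : ℕ × ℕ => (((L.getD p.1 0).1 : Real.Angle), (y p.2 : Real.Angle))) ''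
        {p | ∃ j, w[p.1]? = some j ∧ p.2 = f j} := by
    intro f hf
    have hget : ∀ k : ℕ, (L[k]?).map Prod.snd = (w[k]?).map (Prod.map y y) := by
      intro k
      rw [← List.getElem?_map, hw, relabel, List.getElem?_map]
    ext t
    constructor
    · rintro ⟨c, hc, rfl⟩
      obtain ⟨k, hk⟩ := List.mem_iff_getElem?.1 hc
      have := hget k
      rw [hk, Option.map_some, eq_comm, Option.map_eq_some_iff] at this
      obtain ⟨j, hj, e⟩ := this
      exact ⟨(k, f j), ⟨j, hj, rfl⟩, by simp [List.getD_eq_getElem?_getD, hk, ← e, hf]⟩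
    · rintro ⟨⟨k, _⟩, ⟨j, hj, rfl⟩, rfl⟩
      have := hget k
      simp only at hj
      rw [hj, Option.map_some, Option.map_eq_some_iff] at this
      obtain ⟨c, hc, e⟩ := this
      exact ⟨c, List.mem_of_getElem? hc, by simp [List.getD_eq_getElem?_getD, hc, e, hf]⟩
  exact ⟨h.pos_eq.trans (key Prod.snd fun _ => rfl), h.neg_eq.trans (key Prod.fst fun _ => rfl)⟩

/-- Diagrams that have drawings with the same word, up to monotone maps of the heights, are related.
-/
theorem IsDrawing.related {b b' : ℝ} {L L' : List (ℝ × ℝ × ℝ)} {R R' : RectDiagram} {y y' : ℕ → ℝ}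
    {w : List (ℕ × ℕ)} (h : IsDrawing b L R) (h' : IsDrawing b' L' R')
    (hw : L.map Prod.snd = relabel y w) (hw' : L'.map Prod.snd = relabel y' w)
    (hy : StrictMonoOn y (labels w)) (hy' : StrictMonoOn y' (labels w)) : Related R R' := by
  have col : ∀ {b L R y}, IsDrawing b L R → L.map Prod.snd = relabel y w →
      WithinTurn (Finset.range w.length) (fun i => (L.getD i 0).1) := by
    intro b L R y h hw i hi j hj hij
    have hl : L.length = w.length := by simpa [relabel] using congrArg List.length hw
    rw [Finset.mem_range, ← hl] at hi hj
    have := List.pairwise_iff_getElem.1 h.sorted i j hi hj hij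
    simpa [List.getD_eq_getElem?_getD, hi, hj] using this
  have row : ∀ {b L R y}, IsDrawing b L R → L.map Prod.snd = relabel y w →
      StrictMonoOn y (labels w) → WithinTurn (labels w) y := by
    intro b L R y h hw hy i hi j hj hij
    have mem : ∀ i ∈ labels w, y i ∈ Set.Ico b (b + 2 * Real.pi) := fun i hi => h.mem_Ico _ (by
      rw [hw, labels_map]; exact Finset.mem_image_of_mem y hi)
    exact ⟨hy hi hj hij, by linarith [(mem i hi).1, (mem j hj).2]⟩
  refine (h.isPlaced hw).related (h'.isPlaced hw') ?_ ?_ (col h hw) (col h' hw') (row h hw hy)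
    (row h' hw' hy')
  · rintro p (⟨j, hj, -⟩ | ⟨j, hj, -⟩) <;>
      exact Finset.mem_range.2 (List.getElem?_eq_some_iff.1 hj).1
  · rintro p (⟨j, hj, e⟩ | ⟨j, hj, e⟩)
    · exact mem_labels.2 ⟨j, List.mem_of_getElem? hj, .inr e.symm⟩
    · exact mem_labels.2 ⟨j, List.mem_of_getElem? hj, .inl e.symm⟩

/-- A diagram that realizes the word of a drawing of another diagram is related to it. -/
theorem Realizes.related {R R' : RectDiagram} {S : Finset ℕ} {w : List (ℕ × ℕ)} {b : ℝ}
    {L : List (ℝ × ℝ × ℝ)} {y : ℕ → ℝ} (h : Realizes R (S, w)) (h' : IsDrawing b L R')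
    (hw : L.map Prod.snd = relabel y w) (hy : StrictMonoOn y (labels w)) : Related R R' := by
  obtain ⟨b', L', T, π, hL, -, -, hπ, -, hp⟩ := h
  simp only [mapState, Prod.mk.injEq] at hp
  obtain ⟨-, rfl⟩ := hp
  set u := L'.map Prod.snd with hu
  have hu' : ∀ l ∈ labels u, l ∈ u.map Prod.fst := by
    intro l hl
    obtain ⟨j, hj, rfl | rfl⟩ := mem_labels.1 hl
    · exact List.mem_map_of_mem hj
    · exact (hL.genuine.mem_iff _).2 (List.mem_map_of_mem hj)
  have hnd : ((u.map Prod.fst).map π).Nodup := by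
    have := h'.genuine.nodup_fst
    rw [hw, relabel, List.map_map, show Prod.fst ∘ Prod.map y y = y ∘ Prod.fst from rfl,
      ← List.map_map] at this
    have := this.of_map
    rw [relabel, List.map_map] at this
    rw [List.map_map]
    exact this
  have hinj : Set.InjOn π (labels u) := fun l hl m hm e =>
    List.inj_on_of_nodup_map hnd (hu' l hl) (hu' m hm) e
  -- The word of a drawing leaves each level once, so here no heights are identified.
  have hmono : StrictMonoOn π (labels u) := fun l hl m hm hlm =>
    (hπ hl hm hlm.le).lt_of_ne fun e => hlm.ne (hinj hl hm e)
  refine hL.related (y := Function.invFunOn π (labels u)) h' ?_ hw ?_ hy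
  · rw [relabel, relabel, List.map_map, ← hu]
    conv_lhs => rw [← List.map_id u]
    refine List.map_congr_left fun j hj => ?_
    exact Prod.ext (hinj.leftInvOn_invFunOn (mem_labels.2 ⟨j, hj, .inl rfl⟩)).symm
      (hinj.leftInvOn_invFunOn (mem_labels.2 ⟨j, hj, .inr rfl⟩)).symm
  · rw [labels_map]
    intro l hl m hm hlm
    simp only [Finset.coe_image, Set.mem_image, Finset.mem_coe] at hl hm
    obtain ⟨l, hl, rfl⟩ := hl
    obtain ⟨m, hm, rfl⟩ := hm
    rw [hinj.leftInvOn_invFunOn hl, hinj.leftInvOn_invFunOn hm]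
    exact (hmono.lt_iff_lt hl hm).1 hlm

namespace JumpWord

/-! ### Words of diagrams -/

section Need

variable {Λ : Type*} [LinearOrder Λ]

/-- The smallest set of occupied levels from which the word can be performed: it consists of the
levels whose first occurrence is a departure. -/
def need : List (Λ × Λ) → Finset Λ
  | [] => ∅
  | j :: u => insert j.1 ((need u).erase j.2)

theorem mem_need_cons {j : Λ × Λ} {u : List (Λ × Λ)} {l : Λ} :
    l ∈ need (j :: u) ↔ l = j.1 ∨ l ≠ j.2 ∧ l ∈ need u := by
  simp [need]

theorem need_append_congr {u v : List (Λ × Λ)} (α : List (Λ × Λ)) (h : need u = need v) :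
    need (α ++ u) = need (α ++ v) := by
  induction α with
  | nil => exact h
  | cons j α ih => simp only [List.cons_append, need, ih]

theorem mem_need_imp {u : List (Λ × Λ)} {l : Λ} (h : l ∈ need u) : l ∈ u.map Prod.fst := by
  induction u with
  | nil => simp [need] at h
  | cons j u ih =>
    rw [List.map_cons, List.mem_cons]
    exact (mem_need_cons.1 h).imp_right fun h => ih h.2

theorem need_subset_labels (u : List (Λ × Λ)) : need u ⊆ labels u := fun l hl => by
  obtain ⟨j, hj, rfl⟩ := List.mem_map.1 (mem_need_imp hl)
  exact mem_labels.2 ⟨j, hj, .inl rfl⟩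

theorem mem_need_of_notMem {u : List (Λ × Λ)} {l : Λ} (h : l ∈ u.map Prod.fst)
    (h' : l ∉ u.map Prod.snd) : l ∈ need u := by
  induction u with
  | nil => simp at h
  | cons j u ih =>
    simp only [List.map_cons, List.mem_cons, not_or] at h h'
    rw [mem_need_cons]
    exact h.imp_right fun h => ⟨h'.1, ih h h'.2⟩

/-- A word in which no level is left twice or reached twice can be performed from the levels it
needs. -/
theorem valid_of_need {u : List (Λ × Λ)} (h₁ : (u.map Prod.fst).Nodup) (h₂ : (u.map Prod.snd).Nodup)
    (h₃ : ∀ j ∈ u, j.1 ≠ j.2) {S : Finset Λ} (hS : ∀ l ∈ labels u, l ∈ S ↔ l ∈ need u) :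
    Valid S u := by
  induction u generalizing S with
  | nil => trivial
  | cons j u ih =>
    simp only [List.map_cons, List.nodup_cons, List.mem_cons, forall_eq_or_imp] at h₁ h₂ h₃
    have hl : ∀ l, l ∈ labels (j :: u) ↔ l = j.1 ∨ l = j.2 ∨ l ∈ labels u := by
      intro l; rw [labels_cons]; simp only [Finset.mem_union, Finset.mem_insert,
        Finset.mem_singleton]; tauto
    refine ⟨(hS _ ((hl _).2 (.inl rfl))).2 (mem_need_cons.2 (.inl rfl)), fun h => ?_,
      ih h₁.2 h₂.2 h₃.2 fun l hlu => ?_⟩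
    · rcases mem_need_cons.1 ((hS _ ((hl _).2 (.inr (.inl rfl)))).1 h) with e | e
      exacts [h₃.1 e.symm, e.1 rfl]
    · rw [mem_move]
      by_cases e₂ : l = j.2
      · refine iff_of_true (.inl e₂) (mem_need_of_notMem ?_ (by rw [e₂]; exact h₂.1))
        obtain ⟨k, hk, rfl | hk'⟩ := mem_labels.1 hlu
        · exact List.mem_map_of_mem hk
        · exact (h₂.1 (by rw [← e₂, ← hk']; exact List.mem_map_of_mem hk)).elim
      by_cases e₁ : l = j.1
      · refine iff_of_false (by rintro (h | h); exacts [e₂ h, h.1 e₁]) fun h =>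
          h₁.1 (by rw [← e₁]; exact mem_need_imp h)
      have := hS l ((hl l).2 (.inr (.inr hlu)))
      rw [mem_need_cons] at this
      tauto

/-- A level is occupied at the end if and only if it is reached more often than left, where the
initial occupation counts as an arrival. -/
theorem count_final {S : Finset Λ} {u : List (Λ × Λ)} (h : Valid S u) (l : Λ) :
    (if l ∈ S then 1 else 0) + (u.map Prod.snd).count l =
      (if l ∈ final S u then 1 else 0) + (u.map Prod.fst).count l := by
  induction u generalizing S with
  | nil => by_cases h : l ∈ S <;> simp [h]
  | cons j u ih =>
    have := ih h.2.2
    have hj : j.1 ≠ j.2 := fun e => h.2.1 (by rw [← e]; exact h.1)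
    simp only [List.map_cons, List.count_cons, final_cons, beq_iff_eq, mem_move] at this ⊢
    by_cases hf : l ∈ final (move S j) u <;> by_cases e₁ : j.1 = l <;> by_cases e₂ : j.2 = l
    · exact (hj (e₁.trans e₂.symm)).elim
    · have hl : l ∈ S := by rw [← e₁]; exact h.1
      simp only [hf, e₁, Ne.symm e₂, e₂, ne_eq, not_true_eq_false, false_and, or_false, if_false, hl,
        if_true] at this ⊢
      omega
    · have hl : l ∉ S := by rw [← e₂]; exact h.2.1
      simp only [hf, e₁, e₂, true_or, if_true, hl, if_false] at this ⊢
      omega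
    · simp only [hf, e₁, e₂, Ne.symm e₁, Ne.symm e₂, ne_eq, not_false_eq_true, true_and, false_or,
        if_false] at this ⊢
      omega
    · exact (hj (e₁.trans e₂.symm)).elim
    · have hl : l ∈ S := by rw [← e₁]; exact h.1
      simp only [hf, e₁, Ne.symm e₂, e₂, ne_eq, not_true_eq_false, false_and, or_false, if_false, hl,
        if_true] at this ⊢
      omega
    · have hl : l ∉ S := by rw [← e₂]; exact h.2.1
      simp only [hf, e₁, e₂, true_or, if_true, hl, if_false] at this ⊢
      omega
    · simp only [hf, e₁, e₂, Ne.symm e₁, Ne.symm e₂, ne_eq, not_false_eq_true, true_and, false_or,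
        if_false] at this ⊢
      omega

/-- The word of a diagram is a closed word. -/
theorem Genuine.closed {u : List (Λ × Λ)} (h : Genuine u) : Closed (need u, u) := by
  have hv := valid_of_need h.nodup_fst h.nodup_snd h.ne (S := need u) fun _ _ => Iff.rfl
  refine ⟨hv, ?_⟩
  ext l
  have := count_final hv l
  have e : (u.map Prod.fst).count l = (u.map Prod.snd).count l := by
    by_cases hl : l ∈ u.map Prod.fst
    · rw [List.count_eq_one_of_mem h.nodup_fst hl,
        List.count_eq_one_of_mem h.nodup_snd ((h.mem_iff l).1 hl)]
    · rw [List.count_eq_zero_of_not_mem hl,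
        List.count_eq_zero_of_not_mem fun h' => hl ((h.mem_iff l).2 h')]
  simp only at this ⊢
  rw [e] at this
  by_cases h₁ : l ∈ need u <;> by_cases h₂ : l ∈ final (need u) u <;> simp [h₁, h₂] at this ⊢

/-- The first jump that uses a level determines whether the level is occupied initially. -/
theorem Valid.mem_iff {S T : Finset Λ} {u : List (Λ × Λ)} (hS : Valid S u) (hT : Valid T u) :
    ∀ l ∈ labels u, l ∈ S ↔ l ∈ T := by
  induction u generalizing S T with
  | nil => simp [labels_nil]
  | cons j u ih =>
    intro l hl
    by_cases e₁ : l = j.1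
    · rw [e₁]; exact iff_of_true hS.1 hT.1
    by_cases e₂ : l = j.2
    · rw [e₂]; exact iff_of_false hS.2.1 hT.2.1
    have hl' : l ∈ labels u := by
      rw [labels_cons] at hl
      simp only [Finset.mem_union, Finset.mem_insert, Finset.mem_singleton] at hl
      tauto
    have := ih hS.2.2 hT.2.2 l hl'
    simp only [mem_move] at this
    tauto

theorem Genuine.eq_need {S : Finset Λ} {u : List (Λ × Λ)} (hu : Genuine u) (h : Valid S u)
    (hS : S ⊆ labels u) : S = need u := by
  ext l
  constructor
  · exact fun hl => (h.mem_iff hu.closed.1 l (hS hl)).1 hl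
  · exact fun hl => (h.mem_iff hu.closed.1 l (need_subset_labels u hl)).2 hl

omit [LinearOrder Λ] in
theorem Genuine.perm {u v : List (Λ × Λ)} (h : Genuine u) (p : u.Perm v) : Genuine v where
  nodup_fst := (p.map _).nodup_iff.1 h.nodup_fst
  nodup_snd := (p.map _).nodup_iff.1 h.nodup_snd
  mem_iff l := by rw [← (p.map Prod.fst).mem_iff, ← (p.map Prod.snd).mem_iff]; exact h.mem_iff l
  ne j hj := h.ne j (p.mem_iff.2 hj)

/-- The words, with the levels they need, are connected by moves of closed words. -/
def Conn (u v : List (Λ × Λ)) : Prop := Relation.EqvGen ClosedStep (need u, u) (need v, v)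

theorem Conn.trans {u v w : List (Λ × Λ)} (h : Conn u v) (h' : Conn v w) : Conn u w :=
  Relation.EqvGen.trans _ _ _ h h'

theorem Conn.symm {u v : List (Λ × Λ)} (h : Conn u v) : Conn v u := Relation.EqvGen.symm _ _ h

theorem Conn.of_need_eq {u v : List (Λ × Λ)} (hu : Genuine u) (hv : Genuine v) (h : LocalStep u v)
    (e : need u = need v) : Conn u v := by
  have hv' := hv.closed
  refine .rel _ _ ⟨?_, hu.closed, hv'⟩
  rw [← e]
  exact .loc _ h

theorem Genuine.swap {α β : List (Λ × Λ)} {j k : Λ × Λ} (hu : Genuine (α ++ j :: k :: β))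
    (h : Noncross j k) : Conn (α ++ j :: k :: β) (α ++ k :: j :: β) := by
  refine .of_need_eq hu (hu.perm (.append_left α (.swap k j β))) (.swap α β h) ?_
  refine need_append_congr α ?_
  obtain ⟨h₁, h₂, h₃, h₄, -⟩ := h
  ext l
  simp only [mem_need_cons]
  grind

theorem Genuine.merge {α β : List (Λ × Λ)} {x y z : Λ} (hu : Genuine (α ++ (x, y) :: (y, z) :: β))
    (h : Cyc x y z) : Conn (α ++ (x, y) :: (y, z) :: β) (α ++ (x, z) :: β) := by
  have hv := (genuine_split h.ne₁₂ h.ne₂₃ h.ne₁₃).1 hu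
  refine .of_need_eq hu hv.1 (.merge α β h) (need_append_congr α ?_)
  have hy : y ∉ need β := fun hy => hv.2 (by
    simp only [List.map_append, List.map_cons, List.mem_append, List.mem_cons]
    exact .inr (.inr (mem_need_imp hy)))
  have := h.ne₁₂
  ext l
  simp only [mem_need_cons]
  grind

/-- A jump can be moved past a part of the word whose chords do not cross its chord. -/
theorem Genuine.commute {α β γ : List (Λ × Λ)} {j : Λ × Λ} (hu : Genuine (α ++ j :: (β ++ γ)))
    (h : ∀ k ∈ β, Noncross j k) : Conn (α ++ j :: (β ++ γ)) (α ++ (β ++ j :: γ)) := by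
  induction β generalizing α with
  | nil => exact .refl _
  | cons k β ih =>
    have h₁ := Genuine.swap hu (h k List.mem_cons_self)
    have h₂ := hu.perm (.append_left α (.swap k j _))
    have h₃ := ih (α := α ++ [k]) (by simpa using h₂) fun k' hk' => h k' (List.mem_cons_of_mem _ hk')
    simpa using h₁.trans (by simpa using h₃)

theorem Genuine.rot {j : Λ × Λ} {u : List (Λ × Λ)} (hu : Genuine (j :: u)) :
    Conn (j :: u) (u ++ [j]) := by
  have hv : Genuine (u ++ [j]) := hu.perm (List.perm_append_singleton j u).symm
  obtain ⟨h₁, h₂⟩ := hu.closed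
  have hv' : Closed (move (need (j :: u)) j, u ++ [j]) := by
    refine ⟨?_, ?_⟩
    · simp only [valid_cons, final_cons] at h₁ h₂
      simp only [valid_append, valid_cons, h₂]
      exact ⟨h₁.2.2, h₁.1, h₁.2.1, trivial⟩
    · simp only [final_cons] at h₂
      simp only [final_append, h₂, final_cons, final_nil]
  have e : move (need (j :: u)) j = need (u ++ [j]) := hv.eq_need hv'.1 fun l hl => by
    have hlab : labels (u ++ [j]) = labels (j :: u) := by
      ext l; simp only [mem_labels, List.mem_append, List.mem_cons, List.not_mem_nil]; grind
    rw [hlab]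
    rcases mem_move.1 hl with rfl | h
    · exact mem_labels.2 ⟨j, List.mem_cons_self, .inr rfl⟩
    · exact need_subset_labels _ h.2
  refine .rel _ _ ⟨?_, hu.closed, hv.closed⟩
  rw [← e]
  exact .rot _ _ _

/-- The renaming of a level that is first left and then reached. -/
theorem Genuine.row_departure {β γ : List (Λ × Λ)} {a b x y : Λ}
    (hu : Genuine ((a, y) :: (β ++ (x, a) :: γ))) (hv : Genuine ((b, y) :: (β ++ (x, b) :: γ)))
    (hab : a ≠ b) (hx : ¬ Arc a b x) (hy : ¬ Arc a b y)
    (hβ : ∀ l ∈ labels β, ¬ Arc a b l) :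
    Conn ((a, y) :: (β ++ (x, a) :: γ)) ((b, y) :: (β ++ (x, b) :: γ)) := by
  have fresh : ∀ {c : Λ}, Genuine ((c, y) :: (β ++ (x, c) :: γ)) → c ∉ labels γ := by
    intro c h hc
    obtain ⟨j, hj, rfl | rfl⟩ := mem_labels.1 hc
    · have := h.nodup_fst
      simp only [List.map_cons, List.map_append, List.nodup_cons, List.mem_append, List.mem_cons,
        not_or] at this
      exact this.1.2.2 (List.mem_map_of_mem hj)
    · have := h.nodup_snd
      simp only [List.map_cons, List.map_append] at this
      rw [List.nodup_cons, List.nodup_middle, List.nodup_cons] at this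
      exact this.2.1 (List.mem_append_right _ (List.mem_map_of_mem hj))
  have hbS : b ∉ need ((a, y) :: (β ++ (x, a) :: γ)) := by
    intro h
    obtain ⟨j, hj, e⟩ := mem_labels.1 (need_subset_labels _ h)
    simp only [List.mem_cons, List.mem_append] at hj
    rcases hj with rfl | hj | rfl | hj
    · rcases e with e | e
      exacts [hab e, hy (by rw [← e]; exact .inr (.inl rfl))]
    · exact hβ b (mem_labels.2 ⟨j, hj, e⟩) (.inr (.inl rfl))
    · rcases e with e | e
      exacts [hx (by rw [← e]; exact .inr (.inl rfl)), hab e]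
    · exact fresh hv (mem_labels.2 ⟨j, hj, e⟩)
  have ha : a ∈ need ((a, y) :: (β ++ (x, a) :: γ)) := hu.closed.1.1
  have hyx : y ≠ a ∧ x ≠ a := ⟨fun e => hy (.inl e), fun e => hx (.inl e)⟩
  set f : Λ → Λ := Function.update id a b with hf
  have hfa : f a = b := Function.update_self _ _ _
  have hfne : ∀ l, l ≠ a → f l = l := fun l hl => Function.update_of_ne hl _ _
  have fix : ∀ δ : List (Λ × Λ), a ∉ labels δ → relabel f δ = δ := by
    intro δ hδ
    conv_rhs => rw [← List.map_id δ]
    refine List.map_congr_left fun j hj => ?_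
    have i₁ : j.1 ≠ a := fun e => hδ (mem_labels.2 ⟨j, hj, .inl e⟩)
    have i₂ : j.2 ≠ a := fun e => hδ (mem_labels.2 ⟨j, hj, .inr e⟩)
    simp [Prod.map, hfne _ i₁, hfne _ i₂]
  have hrel : relabel f ((a, y) :: (β ++ (x, a) :: γ)) = (b, y) :: (β ++ (x, b) :: γ) := by
    have i₁ := fix β fun h => hβ a h (.inl rfl)
    have i₂ := fix γ (fresh hu)
    simp only [relabel] at i₁ i₂
    simp [relabel, i₁, i₂, hfa, hfne _ hyx.1, hfne _ hyx.2]
  have himg : (need ((a, y) :: (β ++ (x, a) :: γ))).image f =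
      move (need ((a, y) :: (β ++ (x, a) :: γ))) (a, b) := by
    ext l
    simp only [Finset.mem_image, mem_move]
    constructor
    · rintro ⟨s, hs, rfl⟩
      by_cases e : s = a
      · rw [e, hfa]; exact .inl rfl
      · rw [hfne s e]; exact .inr ⟨e, hs⟩
    · rintro (rfl | ⟨e, hs⟩)
      exacts [⟨a, ha, hfa⟩, ⟨l, hs, hfne l e⟩]
  -- The levels needed by the renamed word are the renamed ones, as the renaming is injective.
  have e : move (need ((a, y) :: (β ++ (x, a) :: γ))) (a, b) =
      need ((b, y) :: (β ++ (x, b) :: γ)) := by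
    refine hv.eq_need ?_ ?_
    · rw [← himg, ← hrel]
      refine ((closed_mapState (p := (_, _)) fun l hl m hm e => ?_).2 hu.closed).1
      have hb' : ∀ l ∈ supp (need ((a, y) :: (β ++ (x, a) :: γ)), (a, y) :: (β ++ (x, a) :: γ)),
          l ≠ b := by
        rintro l hl rfl
        obtain ⟨j, hj, e⟩ := mem_labels.1
          ((Finset.union_subset (need_subset_labels _) le_rfl : _ ⊆ labels _) hl)
        simp only [List.mem_cons, List.mem_append] at hj
        rcases hj with rfl | hj | rfl | hj
        · rcases e with e | e
          exacts [hab e, hy (by rw [← e]; exact .inr (.inl rfl))]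
        · exact hβ l (mem_labels.2 ⟨j, hj, e⟩) (.inr (.inl rfl))
        · rcases e with e | e
          exacts [hx (by rw [← e]; exact .inr (.inl rfl)), hab e]
        · exact fresh hv (mem_labels.2 ⟨j, hj, e⟩)
      by_cases i₁ : l = a <;> by_cases i₂ : m = a
      · rw [i₁, i₂]
      · rw [i₁, hfa, hfne m i₂] at e; exact (hb' m hm e.symm).elim
      · rw [i₂, hfa, hfne l i₁] at e; exact (hb' l hl e).elim
      · rwa [hfne l i₁, hfne m i₂] at e
    · rw [← himg, ← hrel, labels_map]
      exact Finset.image_subset_image (need_subset_labels _)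
  refine .rel _ _ ⟨?_, hu.closed, hv.closed⟩
  rw [← e]
  exact .row _ β γ hab hx hy hβ (fresh hu) (fresh hv) hbS

theorem noncross_of_not_arc {a b : Λ} {k : Λ × Λ} (h₁ : ¬ Arc a b k.1) (h₂ : ¬ Arc a b k.2) :
    Noncross (a, b) k ∧ Noncross (b, a) k := by
  unfold Arc Noncross Cyc at *
  grind

/-- The renaming of a level that is first reached and then left. The jump from `a` to `b` is split
off from the second jump, moved to the first one, and merged with it. -/
theorem Genuine.row_arrival {β γ : List (Λ × Λ)} {a b x y : Λ}
    (hu : Genuine ((x, a) :: (β ++ (a, y) :: γ))) (hv : Genuine ((x, b) :: (β ++ (b, y) :: γ)))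
    (hab : a ≠ b) (hx : ¬ Arc a b x) (hy : ¬ Arc a b y)
    (hβ : ∀ l ∈ labels β, ¬ Arc a b l) :
    Conn ((x, a) :: (β ++ (a, y) :: γ)) ((x, b) :: (β ++ (b, y) :: γ)) := by
  have hy' : Cyc a b y := cyc_of_not_arc hab hy
  have hx' : Cyc x a b := (cyc_of_not_arc hab hx).rot.rot
  have hb : b ∉ ((x, a) :: β ++ (a, y) :: γ).map Prod.fst := by
    have := hv.nodup_fst
    rw [List.map_cons, List.map_append, List.map_cons, ← List.cons_append, List.nodup_middle,
      List.nodup_cons] at this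
    simp only [List.map_append, List.map_cons, List.mem_append, List.mem_cons, not_or] at this ⊢
    exact ⟨this.1.1, hab.symm, this.1.2⟩
  have hm : Genuine ((x, a) :: β ++ (a, b) :: (b, y) :: γ) :=
    (genuine_split hy'.ne₁₂ hy'.ne₂₃ hy'.ne₁₃).2 ⟨hu, hb⟩
  have h₁ := hm.merge hy'
  have hm' : Genuine ([(x, a)] ++ (a, b) :: (β ++ (b, y) :: γ)) :=
    hm.perm (List.perm_middle (l₁ := β)|>.cons _)
  have h₂ := hm'.commute fun k hk =>
    (noncross_of_not_arc (hβ _ (mem_labels.2 ⟨k, hk, .inl rfl⟩))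
      (hβ _ (mem_labels.2 ⟨k, hk, .inr rfl⟩))).1
  have h₃ := Genuine.merge (α := []) hm' hx'
  exact h₁.symm.trans (h₂.symm.trans h₃)

end Need

end JumpWord

open JumpWord RectDiagram

/-! ### Drawings of a given diagram -/

theorem List.Pairwise.exists_split {L : List (ℝ × ℝ × ℝ)}
    (h : L.Pairwise fun c d => c.1 < d.1 ∧ d.1 < c.1 + 2 * Real.pi) (x : ℝ) :
    ∃ β γ, L = β ++ γ ∧ (∀ c ∈ β, c.1 < x) ∧ ∀ c ∈ γ, x ≤ c.1 := by
  induction L with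
  | nil => exact ⟨[], [], rfl, by simp, by simp⟩
  | cons c L ih =>
    obtain ⟨h₁, h₂⟩ := List.pairwise_cons.1 h
    by_cases hc : c.1 < x
    · obtain ⟨β, γ, rfl, hβ, hγ⟩ := ih h₂
      exact ⟨c :: β, γ, rfl, by simpa [hc] using hβ, hγ⟩
    · refine ⟨[], c :: L, rfl, by simp, fun d hd => ?_⟩
      rcases List.mem_cons.1 hd with rfl | hd
      · exact not_lt.1 hc
      · exact (not_lt.1 hc).trans (h₁ d hd).1.le

theorem pairwise_turn_of_lt {a : ℝ} {L : List (ℝ × ℝ × ℝ)} (h : L.Pairwise fun c d => c.1 < d.1)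
    (hI : ∀ c ∈ L, c.1 ∈ Set.Ico a (a + 2 * Real.pi)) :
    L.Pairwise fun c d => c.1 < d.1 ∧ d.1 < c.1 + 2 * Real.pi :=
  h.imp_of_mem fun hc hd hcd => ⟨hcd, by linarith [(hI _ hc).1, (hI _ hd).2]⟩

namespace IsDrawing

variable {b : ℝ} {L L' : List (ℝ × ℝ × ℝ)} {R R' : RectDiagram}

/-- A list of columns shows `R` if it consists of columns of `R` and contains all of them. -/
theorem of_columns (hs : L.Pairwise fun c d => c.1 < d.1 ∧ d.1 < c.1 + 2 * Real.pi)
    (hI : ∀ c ∈ L, c.2.1 ∈ Set.Ico b (b + 2 * Real.pi) ∧ c.2.2 ∈ Set.Ico b (b + 2 * Real.pi))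
    (hL : ∀ c ∈ L, ((c.1 : Real.Angle), (c.2.2 : Real.Angle)) ∈ R.pos ∧
      ((c.1 : Real.Angle), (c.2.1 : Real.Angle)) ∈ R.neg)
    (hR : ∀ t ∈ R.verts, ∃ c ∈ L, t.1 = (c.1 : Real.Angle)) : IsDrawing b L R := by
  refine ⟨hs, fun l hl => ?_, ?_, ?_⟩
  · obtain ⟨j, hj, e⟩ := mem_labels.1 hl
    obtain ⟨c, hc, rfl⟩ := List.mem_map.1 hj
    rcases e with rfl | rfl
    exacts [(hI c hc).1, (hI c hc).2]
  · ext t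
    constructor
    · intro ht
      obtain ⟨c, hc, e⟩ := hR t (.inl ht)
      exact ⟨c, hc, R.injOn_fst_pos ht (hL c hc).1 e⟩
    · rintro ⟨c, hc, rfl⟩; exact (hL c hc).1
  · ext t
    constructor
    · intro ht
      obtain ⟨c, hc, e⟩ := hR t (.inr ht)
      exact ⟨c, hc, R.injOn_fst_neg ht (hL c hc).2 e⟩
    · rintro ⟨c, hc, rfl⟩; exact (hL c hc).2

/-- A column with its heights. -/
theorem exists_column (a b : ℝ) {t : Torus} (ht : t ∈ R.verts) : ∃ c : ℝ × ℝ × ℝ,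
    c.1 ∈ Set.Ico a (a + 2 * Real.pi) ∧ c.2.1 ∈ Set.Ico b (b + 2 * Real.pi) ∧
    c.2.2 ∈ Set.Ico b (b + 2 * Real.pi) ∧ (c.1 : Real.Angle) = t.1 ∧
    ((c.1 : Real.Angle), (c.2.2 : Real.Angle)) ∈ R.pos ∧
      ((c.1 : Real.Angle), (c.2.1 : Real.Angle)) ∈ R.neg := by
  obtain ⟨φ₁, φ₂, -, h₁, h₂⟩ := exists_pos_neg_of_mem_verts ht
  obtain ⟨x, hx, ex⟩ := exists_coe_eq a t.1
  obtain ⟨y, hy, ey⟩ := exists_coe_eq b φ₁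
  obtain ⟨z, hz, ez⟩ := exists_coe_eq b φ₂
  exact ⟨(x, z, y), hx, hz, hy, ex, by rwa [ex, ey], by rwa [ex, ez]⟩

/-- Every diagram has a drawing for any given cuts of the two circles. -/
theorem exists_of_cut (R : RectDiagram) (a b : ℝ) :
    ∃ L, IsDrawing b L R ∧ ∀ c ∈ L, c.1 ∈ Set.Ico a (a + 2 * Real.pi) := by
  classical
  choose! col h₁ h₂ h₃ h₄ h₅ h₆ using fun t (ht : t ∈ R.verts) => exists_column a b ht
  have hfin : (col '' R.verts).Finite := R.finite.image col
  set C := hfin.toFinset with hC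
  have hmem : ∀ c, c ∈ C ↔ ∃ t ∈ R.verts, col t = c := fun c => by simp [hC]
  have hinj : ∀ c ∈ C, ∀ d ∈ C, c.1 = d.1 → c = d := by
    intro c hc d hd e
    obtain ⟨s, hs, rfl⟩ := (hmem c).1 hc
    obtain ⟨t, ht, rfl⟩ := (hmem d).1 hd
    have i₁ := R.injOn_fst_pos (h₅ s hs) (h₅ t ht) (by simp only [e])
    have i₂ := R.injOn_fst_neg (h₆ s hs) (h₆ t ht) (by simp only [e])
    exact Prod.ext e (Prod.ext
      ((coe_inj_of_mem_Ico (h₂ s hs) (h₂ t ht)).1 (Prod.ext_iff.1 i₂).2)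
      ((coe_inj_of_mem_Ico (h₃ s hs) (h₃ t ht)).1 (Prod.ext_iff.1 i₁).2))
  obtain ⟨L, hL, hLs⟩ : ∃ L : List (ℝ × ℝ × ℝ), (∀ c, c ∈ L ↔ c ∈ C) ∧
      L.Pairwise fun c d => c.1 < d.1 := by
    have hle : C.toList.mergeSort (fun c d => decide (c.1 ≤ d.1)) |>.Pairwise
        fun c d => c.1 ≤ d.1 := by
      have := List.pairwise_mergeSort (le := fun c d : ℝ × ℝ × ℝ => decide (c.1 ≤ d.1))
        (fun a b c h₁ h₂ => by simp at *; exact h₁.trans h₂)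
        (fun a b => by simpa using le_total a.1 b.1) C.toList
      exact this.imp fun h => by simpa using h
    have hp := List.mergeSort_perm C.toList (fun c d => decide (c.1 ≤ d.1))
    have hm : ∀ c, c ∈ C.toList.mergeSort (fun c d => decide (c.1 ≤ d.1)) ↔ c ∈ C := fun c => by
      rw [hp.mem_iff, Finset.mem_toList]
    refine ⟨_, hm, ?_⟩
    have hnd := hp.nodup_iff.2 C.nodup_toList
    exact (hle.and hnd).imp_of_mem fun hc hd ⟨i₁, i₂⟩ => i₁.lt_of_ne fun e =>
      i₂ (hinj _ ((hm _).1 hc) _ ((hm _).1 hd) e)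
  have hI : ∀ c ∈ L, c.1 ∈ Set.Ico a (a + 2 * Real.pi) := by
    intro c hc
    obtain ⟨t, ht, rfl⟩ := (hmem c).1 ((hL c).1 hc)
    exact h₁ t ht
  refine ⟨L, of_columns (pairwise_turn_of_lt hLs hI) ?_ ?_ ?_, hI⟩
  · intro c hc
    obtain ⟨t, ht, rfl⟩ := (hmem c).1 ((hL c).1 hc)
    exact ⟨h₂ t ht, h₃ t ht⟩
  · intro c hc
    obtain ⟨t, ht, rfl⟩ := (hmem c).1 ((hL c).1 hc)
    exact ⟨h₅ t ht, h₆ t ht⟩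
  · exact fun t ht => ⟨col t, (hL _).2 ((hmem _).2 ⟨t, ht, rfl⟩), (h₄ t ht).symm⟩

theorem shift (h : IsDrawing b L R) (k : ℤ) :
    IsDrawing b (L.map fun c => (c.1 + 2 * Real.pi * k, c.2)) R := by
  have hc : ∀ x : ℝ, ((x + 2 * Real.pi * k : ℝ) : Real.Angle) = x := fun x =>
    Real.Angle.angle_eq_iff_two_pi_dvd_sub.2 ⟨k, by ring⟩
  refine of_columns (List.pairwise_map.2 (h.sorted.imp fun ⟨h₁, h₂⟩ => ⟨by simpa, by
    simp only; linarith⟩)) ?_ ?_ ?_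
  · intro c hc
    obtain ⟨d, hd, rfl⟩ := List.mem_map.1 hc
    exact ⟨h.mem_Ico₁ (c := d) hd, h.mem_Ico₂ (c := d) hd⟩
  · intro c hc'
    obtain ⟨d, hd, rfl⟩ := List.mem_map.1 hc'
    simp only [hc]
    exact ⟨h.pos_mem hd, h.neg_mem hd⟩
  · intro t ht
    obtain ⟨d, hd, e, -⟩ := h.mem_verts.1 ht
    exact ⟨_, List.mem_map_of_mem hd, by simp only [hc, e]⟩

theorem subset {a : ℝ} (h : IsDrawing b L R) (h' : IsDrawing b L' R)
    (hI : ∀ c ∈ L, c.1 ∈ Set.Ico a (a + 2 * Real.pi))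
    (hI' : ∀ c ∈ L', c.1 ∈ Set.Ico a (a + 2 * Real.pi)) : L ⊆ L' := by
  intro c hc
  obtain ⟨d, hd, e, -⟩ := h'.mem_verts.1 (.inl (h.pos_mem hc))
  simp only at e
  have i₁ := R.injOn_fst_pos (h.pos_mem hc) (h'.pos_mem hd) e
  have i₂ := R.injOn_fst_neg (h.neg_mem hc) (h'.neg_mem hd) e
  have : c = d := Prod.ext ((coe_inj_of_mem_Ico (hI c hc) (hI' d hd)).1 e) (Prod.ext
      ((coe_inj_of_mem_Ico (h.mem_Ico₁ hc) (h'.mem_Ico₁ hd)).1 (Prod.ext_iff.1 i₂).2)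
      ((coe_inj_of_mem_Ico (h.mem_Ico₂ hc) (h'.mem_Ico₂ hd)).1 (Prod.ext_iff.1 i₁).2))
  rwa [this]

/-- A diagram has only one drawing for given cuts of the two circles. -/
theorem eq_of_mem_Ico {a : ℝ} (h : IsDrawing b L R) (h' : IsDrawing b L' R)
    (hI : ∀ c ∈ L, c.1 ∈ Set.Ico a (a + 2 * Real.pi))
    (hI' : ∀ c ∈ L', c.1 ∈ Set.Ico a (a + 2 * Real.pi)) : L = L' := by
  have hp : L.Perm L' := (List.perm_ext_iff_of_nodup h.nodup h'.nodup).2 fun c =>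
    ⟨fun hc => h.subset h' hI hI' hc, fun hc => h'.subset h hI' hI hc⟩
  exact hp.eq_of_pairwise (fun c d _ _ h₁ h₂ => (h₁.1.not_gt h₂.1).elim) h.sorted h'.sorted

/-- A change of the vertical cut permutes the word cyclically. -/
theorem rotate_conn {s t : List (ℝ × ℝ × ℝ)} (h : IsDrawing b (s ++ t) R) :
    ∃ s', IsDrawing b (t ++ s') R ∧ Conn ((s ++ t).map Prod.snd) ((t ++ s').map Prod.snd) := by
  induction s generalizing t with
  | nil => exact ⟨[], by simpa using h, by simpa using .refl _⟩
  | cons c s ih =>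
    rw [List.cons_append] at h
    have h' := rotate h
    rw [List.append_assoc] at h'
    obtain ⟨s', h₁, h₂⟩ := ih h'
    refine ⟨[(c.1 + 2 * Real.pi, c.2)] ++ s', by simpa using h₁, ?_⟩
    have h₃ := h.genuine.rot
    simp only [List.map_append, List.map_cons, List.map_nil, List.append_assoc] at h₂ h₃ ⊢
    exact h₃.trans h₂

/-- The words of any two drawings of a diagram with the same cut are connected. -/
theorem conn (h : IsDrawing b L R) (h' : IsDrawing b L' R) :
    Conn (L.map Prod.snd) (L'.map Prod.snd) := by
  obtain ⟨c', t', rfl⟩ := List.exists_cons_of_ne_nil h'.ne_nil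
  obtain ⟨c, hc, e, -⟩ := h.mem_verts.1 (.inl (h'.pos_mem List.mem_cons_self))
  obtain ⟨s, t, rfl⟩ := List.append_of_mem hc
  obtain ⟨s', h₁, h₂⟩ := h.rotate_conn
  obtain ⟨k, hk⟩ := Real.Angle.angle_eq_iff_two_pi_dvd_sub.1 e
  have h₃ := h₁.shift k
  have hw : ∀ {c : ℝ × ℝ × ℝ} {t}, (c :: t).Pairwise
      (fun c d : ℝ × ℝ × ℝ => c.1 < d.1 ∧ d.1 < c.1 + 2 * Real.pi) →
      ∀ d ∈ c :: t, d.1 ∈ Set.Ico c.1 (c.1 + 2 * Real.pi) := by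
    intro c t h d hd
    rcases List.mem_cons.1 hd with rfl | hd
    · exact ⟨le_rfl, by linarith [Real.two_pi_pos]⟩
    · exact ⟨((List.pairwise_cons.1 h).1 d hd).1.le, ((List.pairwise_cons.1 h).1 d hd).2⟩
  have hc₁ : c.1 + 2 * Real.pi * k = c'.1 := by linarith
  have h₄ : ∀ d ∈ (c :: t ++ s').map fun c => (c.1 + 2 * Real.pi * k, c.2),
      d.1 ∈ Set.Ico c'.1 (c'.1 + 2 * Real.pi) := by
    rw [← hc₁]
    exact hw h₃.sorted
  -- After a rotation and a translation by full turns, both drawings start with the same column.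
  have h₅ := h₃.eq_of_mem_Ico h' h₄ (hw h'.sorted)
  rw [← h₅]
  simpa [Function.comp_def] using h₂

end IsDrawing

open JumpWord

namespace RectDiagram

/-! ### Moves of words from moves of diagrams -/

/-- The diagram with the opposite orientation. -/
def flip (R : RectDiagram) : RectDiagram where
  pos := R.neg
  neg := R.pos
  finite := by rw [Set.union_comm]; exact R.finite
  nonempty := by rw [Set.union_comm]; exact R.nonempty
  disjoint := R.disjoint.symm
  image_fst := R.image_fst.symm
  image_snd := R.image_snd.symm
  injOn_fst_pos := R.injOn_fst_neg
  injOn_fst_neg := R.injOn_fst_pos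
  injOn_snd_pos := R.injOn_snd_neg
  injOn_snd_neg := R.injOn_snd_pos

theorem verts_flip (R : RectDiagram) : R.flip.verts = R.verts := Set.union_comm _ _

theorem neg_of_pos_fst {R : RectDiagram} {θ φ φ' : Real.Angle} (h : (θ, φ) ∈ R.pos)
    (h' : (θ, φ') ∈ R.verts) (hne : φ' ≠ φ) : (θ, φ') ∈ R.neg :=
  h'.resolve_left fun h'' => hne (Prod.ext_iff.1 (R.injOn_fst_pos h'' h rfl)).2

theorem pos_of_neg_fst {R : RectDiagram} {θ φ φ' : Real.Angle} (h : (θ, φ) ∈ R.neg)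
    (h' : (θ, φ') ∈ R.verts) (hne : φ' ≠ φ) : (θ, φ') ∈ R.pos :=
  h'.resolve_right fun h'' => hne (Prod.ext_iff.1 (R.injOn_fst_neg h'' h rfl)).2

theorem neg_of_pos_snd {R : RectDiagram} {θ θ' φ : Real.Angle} (h : (θ, φ) ∈ R.pos)
    (h' : (θ', φ) ∈ R.verts) (hne : θ' ≠ θ) : (θ', φ) ∈ R.neg :=
  h'.resolve_left fun h'' => hne (Prod.ext_iff.1 (R.injOn_snd_pos h'' h rfl)).1

theorem pos_of_neg_snd {R : RectDiagram} {θ θ' φ : Real.Angle} (h : (θ, φ) ∈ R.neg)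
    (h' : (θ', φ) ∈ R.verts) (hne : θ' ≠ θ) : (θ', φ) ∈ R.pos :=
  h'.resolve_right fun h'' => hne (Prod.ext_iff.1 (R.injOn_snd_neg h'' h rfl)).1

/-- The diagrams agree, with signs, except at the corners of the rectangle, each of which belongs to
exactly one of them; there are no other vertices in the rectangle. -/
structure Differ (R R' : RectDiagram) (θ₁ θ₂ φ₁ φ₂ : Real.Angle) : Prop where
  ne_fst : θ₁ ≠ θ₂
  ne_snd : φ₁ ≠ φ₂
  corner_iff : ∀ t : Torus, t.1 = θ₁ ∨ t.1 = θ₂ → t.2 = φ₁ ∨ t.2 = φ₂ → (t ∈ R.verts ↔ t ∉ R'.verts)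
  pos_iff : ∀ t : Torus, ¬ ((t.1 = θ₁ ∨ t.1 = θ₂) ∧ (t.2 = φ₁ ∨ t.2 = φ₂)) → (t ∈ R.pos ↔ t ∈ R'.pos)
  neg_iff : ∀ t : Torus, ¬ ((t.1 = θ₁ ∨ t.1 = θ₂) ∧ (t.2 = φ₁ ∨ t.2 = φ₂)) → (t ∈ R.neg ↔ t ∈ R'.neg)
  rect : ∀ t : Torus, t ∈ R.verts ∨ t ∈ R'.verts → t ∈ rect θ₁ θ₂ φ₁ φ₂ →
    (t.1 = θ₁ ∨ t.1 = θ₂) ∧ (t.2 = φ₁ ∨ t.2 = φ₂)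

namespace Differ

variable {R R' : RectDiagram} {θ₁ θ₂ φ₁ φ₂ : Real.Angle}

theorem symm (h : Differ R R' θ₁ θ₂ φ₁ φ₂) : Differ R' R θ₁ θ₂ φ₁ φ₂ where
  ne_fst := h.ne_fst
  ne_snd := h.ne_snd
  corner_iff t h₁ h₂ := by rw [h.corner_iff t h₁ h₂, not_not]
  pos_iff t ht := (h.pos_iff t ht).symm
  neg_iff t ht := (h.neg_iff t ht).symm
  rect t ht := h.rect t ht.symm

theorem flip (h : Differ R R' θ₁ θ₂ φ₁ φ₂) : Differ R.flip R'.flip θ₁ θ₂ φ₁ φ₂ where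
  ne_fst := h.ne_fst
  ne_snd := h.ne_snd
  corner_iff := by simpa only [verts_flip] using h.corner_iff
  pos_iff := h.neg_iff
  neg_iff := h.pos_iff
  rect := by simpa only [verts_flip] using h.rect

theorem transpose (h : Differ R R' θ₁ θ₂ φ₁ φ₂) : Differ R.transpose R'.transpose φ₁ φ₂ θ₁ θ₂ where
  ne_fst := h.ne_snd
  ne_snd := h.ne_fst
  corner_iff t h₁ h₂ := h.corner_iff t.swap h₂ h₁
  pos_iff t ht := h.pos_iff t.swap fun h' => ht ⟨h'.2, h'.1⟩
  neg_iff t ht := h.neg_iff t.swap fun h' => ht ⟨h'.2, h'.1⟩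
  rect t ht ht' := (h.rect t.swap ht ⟨ht'.2, ht'.1⟩).symm

theorem verts_iff (h : Differ R R' θ₁ θ₂ φ₁ φ₂) {t : Torus}
    (ht : ¬ ((t.1 = θ₁ ∨ t.1 = θ₂) ∧ (t.2 = φ₁ ∨ t.2 = φ₂))) : t ∈ R.verts ↔ t ∈ R'.verts :=
  or_congr (h.pos_iff t ht) (h.neg_iff t ht)

/-- A side of the rectangle with two vertices of one diagram carries no vertices of the other. -/
theorem no_column (h : Differ R R' θ₁ θ₂ φ₁ φ₂) {θ : Real.Angle} (hθ : θ = θ₁ ∨ θ = θ₂)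
    (h₁ : (θ, φ₁) ∈ R'.verts) (h₂ : (θ, φ₂) ∈ R'.verts) : ∀ t ∈ R.verts, t.1 ≠ θ := by
  rintro ⟨_, φ⟩ ht rfl
  have hc : ¬ (φ = φ₁ ∨ φ = φ₂) := by
    rintro (rfl | rfl)
    exacts [(h.corner_iff _ hθ (.inl rfl)).1 ht h₁, (h.corner_iff _ hθ (.inr rfl)).1 ht h₂]
  rcases eq_or_eq_of_fst_eq h.ne_snd h₁ h₂ ((h.verts_iff fun h' => hc h'.2).1 ht) rfl with e | e
  exacts [hc (.inl (Prod.ext_iff.1 e).2), hc (.inr (Prod.ext_iff.1 e).2)]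

/-- If a vertex moves vertically to the other end of the side of the rectangle, it keeps its sign
and its partner. -/
theorem column_neg (h : Differ R R' θ₁ θ₂ φ₁ φ₂) {θ φ φ' : Real.Angle} (hθ : θ = θ₁ ∨ θ = θ₂)
    (hφ : φ = φ₁ ∧ φ' = φ₂ ∨ φ = φ₂ ∧ φ' = φ₁) (m : (θ, φ) ∈ R.neg) (m' : (θ, φ') ∈ R'.verts) :
    ∃ ψ, (θ, ψ) ∈ R.pos ∧ (θ, ψ) ∈ R'.pos ∧ (θ, φ') ∈ R'.neg ∧ ψ ∉ Set.cIcc φ₁ φ₂ := by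
  obtain ⟨ψ, -, -, hψ, -⟩ := exists_pos_neg_of_mem_verts (R := R) (.inr m)
  have n₁ : ψ ≠ φ := fun e => Set.disjoint_left.1 R.disjoint hψ (by rw [e]; exact m)
  have n₂ : ψ ≠ φ' := fun e =>
    (h.corner_iff (θ, ψ) hθ (by rcases hφ with ⟨-, h⟩ | ⟨-, h⟩ <;> simp [e, h])).1 (.inl hψ)
      (by rw [e]; exact m')
  have hc : ¬ ((θ = θ₁ ∨ θ = θ₂) ∧ (ψ = φ₁ ∨ ψ = φ₂)) := by
    rintro ⟨-, e⟩
    rcases hφ with ⟨rfl, rfl⟩ | ⟨rfl, rfl⟩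
    exacts [e.elim n₁ n₂, e.elim n₂ n₁]
  have hψ' := (h.pos_iff (θ, ψ) hc).1 hψ
  refine ⟨ψ, hψ, hψ', neg_of_pos_fst hψ' m' n₂.symm, fun hr => hc (h.rect (θ, ψ) (.inl (.inl hψ)) ⟨?_, hr⟩)⟩
  rcases hθ with rfl | rfl
  exacts [Set.left_mem_cIcc _ _, Set.right_mem_cIcc _ _]

theorem column_pos (h : Differ R R' θ₁ θ₂ φ₁ φ₂) {θ φ φ' : Real.Angle} (hθ : θ = θ₁ ∨ θ = θ₂)
    (hφ : φ = φ₁ ∧ φ' = φ₂ ∨ φ = φ₂ ∧ φ' = φ₁) (m : (θ, φ) ∈ R.pos) (m' : (θ, φ') ∈ R'.verts) :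
    ∃ ψ, (θ, ψ) ∈ R.neg ∧ (θ, ψ) ∈ R'.neg ∧ (θ, φ') ∈ R'.pos ∧ ψ ∉ Set.cIcc φ₁ φ₂ :=
  h.flip.column_neg hθ hφ m (by rwa [verts_flip])

/-- A list with the column of the diagram at `x`, if there is one. -/
def Column (R : RectDiagram) (b x : ℝ) (κ : List (ℝ × ℝ × ℝ)) : Prop :=
  (κ = [] ∧ ∀ t ∈ R.verts, t.1 ≠ (x : Real.Angle)) ∨ ∃ y z, κ = [(x, y, z)] ∧
    y ∈ Set.Ico b (b + 2 * Real.pi) ∧ z ∈ Set.Ico b (b + 2 * Real.pi) ∧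
    ((x : Real.Angle), (z : Real.Angle)) ∈ R.pos ∧ ((x : Real.Angle), (y : Real.Angle)) ∈ R.neg

/-- A drawing from the columns at `a` and `a'` and the lists `β`, `γ` of the columns to the right of
them. -/
theorem isDrawing_of_frame {a a' b : ℝ} {β γ κ μ : List (ℝ × ℝ × ℝ)} (haa' : a < a')
    (ha' : a' < a + 2 * Real.pi) (hs : (β ++ γ).Pairwise fun c d => c.1 < d.1)
    (hβ : ∀ c ∈ β, a < c.1 ∧ c.1 < a') (hγ : ∀ c ∈ γ, a' < c.1 ∧ c.1 < a + 2 * Real.pi)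
    (hI : ∀ c ∈ β ++ γ, c.2.1 ∈ Set.Ico b (b + 2 * Real.pi) ∧ c.2.2 ∈ Set.Ico b (b + 2 * Real.pi))
    (hL : ∀ c ∈ β ++ γ, ((c.1 : Real.Angle), (c.2.2 : Real.Angle)) ∈ R.pos ∧
      ((c.1 : Real.Angle), (c.2.1 : Real.Angle)) ∈ R.neg)
    (hR : ∀ t ∈ R.verts, t.1 ≠ a → t.1 ≠ a' → ∃ c ∈ β ++ γ, t.1 = (c.1 : Real.Angle))
    (hκ : Column R b a κ) (hμ : Column R b a' μ) : IsDrawing b (κ ++ (β ++ (μ ++ γ))) R := by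
  have single : ∀ {x κ}, Column R b x κ → (∀ c ∈ κ, c.1 = x) ∧ κ.Pairwise (fun c d => c.1 < d.1) ∧
      (∀ c ∈ κ, c.2.1 ∈ Set.Ico b (b + 2 * Real.pi) ∧ c.2.2 ∈ Set.Ico b (b + 2 * Real.pi)) ∧
      (∀ c ∈ κ, ((c.1 : Real.Angle), (c.2.2 : Real.Angle)) ∈ R.pos ∧
        ((c.1 : Real.Angle), (c.2.1 : Real.Angle)) ∈ R.neg) ∧
      ∀ t ∈ R.verts, t.1 = x → ∃ c ∈ κ, t.1 = (c.1 : Real.Angle) := by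
    rintro x κ (⟨rfl, h⟩ | ⟨y, z, rfl, h₁, h₂, h₃, h₄⟩)
    · exact ⟨by simp, by simp, by simp, by simp, fun t ht e => (h t ht e).elim⟩
    · refine ⟨by simp, by simp, by simpa using ⟨h₁, h₂⟩, by simp [h₃, h₄], fun t _ e => ?_⟩
      exact ⟨_, List.mem_cons_self, e⟩
  obtain ⟨κ₁, κ₂, κ₃, κ₄, κ₅⟩ := single hκ
  obtain ⟨μ₁, μ₂, μ₃, μ₄, μ₅⟩ := single hμ
  have hmem : ∀ c, c ∈ κ ++ (β ++ (μ ++ γ)) ↔ c ∈ κ ∨ c ∈ μ ∨ c ∈ β ++ γ := by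
    intro c; simp only [List.mem_append]; tauto
  obtain ⟨s₁, s₂, s₃⟩ := List.pairwise_append.1 hs
  refine .of_columns (pairwise_turn_of_lt (a := a) ?_ ?_) ?_ ?_ ?_
  · simp only [List.pairwise_append, List.mem_append]
    refine ⟨κ₂, ⟨s₁, ⟨μ₂, s₂, fun c hc d hd => ?_⟩, ?_⟩, ?_⟩
    · rw [μ₁ c hc]; exact (hγ d hd).1
    · rintro c hc d (hd | hd)
      · rw [μ₁ d hd]; exact (hβ c hc).2
      · exact s₃ c hc d hd
    · rintro c hc d (hd | hd | hd) <;> rw [κ₁ c hc]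
      · exact (hβ d hd).1
      · rw [μ₁ d hd]; exact haa'
      · exact haa'.trans (hγ d hd).1
  · intro c hc
    rcases (hmem c).1 hc with hc | hc | hc
    · rw [κ₁ c hc]; exact ⟨le_rfl, by linarith⟩
    · rw [μ₁ c hc]; exact ⟨haa'.le, ha'⟩
    · rcases List.mem_append.1 hc with hc | hc
      · exact ⟨(hβ c hc).1.le, by linarith [(hβ c hc).2]⟩
      · exact ⟨by linarith [(hγ c hc).1], (hγ c hc).2⟩
  · intro c hc
    rcases (hmem c).1 hc with hc | hc | hc
    exacts [κ₃ c hc, μ₃ c hc, hI c hc]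
  · intro c hc
    rcases (hmem c).1 hc with hc | hc | hc
    exacts [κ₄ c hc, μ₄ c hc, hL c hc]
  · intro t ht
    by_cases e₁ : t.1 = a
    · obtain ⟨c, hc, e⟩ := κ₅ t ht e₁
      exact ⟨c, (hmem c).2 (.inl hc), e⟩
    by_cases e₂ : t.1 = a'
    · obtain ⟨c, hc, e⟩ := μ₅ t ht e₂
      exact ⟨c, (hmem c).2 (.inr (.inl hc)), e⟩
    obtain ⟨c, hc, e⟩ := hR t ht e₁ e₂
    exact ⟨c, (hmem c).2 (.inr (.inr hc)), e⟩

/-- The common part of drawings of the two diagrams: the columns `β` between the vertical sides of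
the rectangle, which have no ends at the heights of the rectangle, and the columns `γ` outside. -/
theorem exists_frame (h : Differ R R' θ₁ θ₂ φ₁ φ₂) (b : ℝ) :
    ∃ (a a' : ℝ) (β γ : List (ℝ × ℝ × ℝ)), (a : Real.Angle) = θ₁ ∧ (a' : Real.Angle) = θ₂ ∧
      (∀ l ∈ labels (β.map Prod.snd), l ∈ Set.Ico b (b + 2 * Real.pi) ∧
        (l : Real.Angle) ∉ Set.cIcc φ₁ φ₂) ∧
      (∀ κ μ, Column R b a κ → Column R b a' μ → IsDrawing b (κ ++ (β ++ (μ ++ γ))) R) ∧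
      ∀ κ μ, Column R' b a κ → Column R' b a' μ → IsDrawing b (κ ++ (β ++ (μ ++ γ))) R' := by
  classical
  obtain ⟨a, -, rfl⟩ := exists_coe_eq 0 θ₁
  obtain ⟨a', ⟨ha, ha'⟩, rfl⟩ := exists_coe_eq a θ₂
  have haa' : a < a' := ha.lt_of_ne fun e => h.ne_fst (by rw [e])
  obtain ⟨L, hL, hLI⟩ := IsDrawing.exists_of_cut R a b
  obtain ⟨β, γ, e, hβ, hγ⟩ := (hL.sorted.filter fun c => decide (c.1 ≠ a ∧ c.1 ≠ a')).exists_split a'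
  have hmem : ∀ c, c ∈ β ++ γ ↔ c ∈ L ∧ c.1 ≠ a ∧ c.1 ≠ a' := by
    intro c; rw [← e]; simp
  have hs := hL.sorted.filter fun c => decide (c.1 ≠ a ∧ c.1 ≠ a')
  rw [e] at hs
  have hβ' : ∀ c ∈ β, a < c.1 ∧ c.1 < a' := fun c hc => by
    have := (hmem c).1 (List.mem_append_left _ hc)
    exact ⟨(hLI c this.1).1.lt_of_ne this.2.1.symm, hβ c hc⟩
  have hγ' : ∀ c ∈ γ, a' < c.1 ∧ c.1 < a + 2 * Real.pi := fun c hc => by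
    have := (hmem c).1 (List.mem_append_right _ hc)
    exact ⟨(hγ c hc).lt_of_ne this.2.2.symm, (hLI c this.1).2⟩
  have hne : ∀ c ∈ β ++ γ, ¬ ((c.1 : Real.Angle) = a ∨ (c.1 : Real.Angle) = a') := by
    intro c hc
    have := (hmem c).1 hc
    rw [coe_inj_of_mem_Ico (hLI c this.1) ⟨le_rfl, by linarith⟩,
      coe_inj_of_mem_Ico (hLI c this.1) ⟨ha, ha'⟩]
    tauto
  have hI := fun c hc => (⟨hL.mem_Ico₁ ((hmem c).1 hc).1, hL.mem_Ico₂ ((hmem c).1 hc).1⟩ :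
    c.2.1 ∈ Set.Ico b (b + 2 * Real.pi) ∧ c.2.2 ∈ Set.Ico b (b + 2 * Real.pi))
  have hR : ∀ t ∈ R.verts, t.1 ≠ a → t.1 ≠ a' → ∃ c ∈ β ++ γ, t.1 = (c.1 : Real.Angle) := by
    intro t ht h₁ h₂
    obtain ⟨c, hc, e, -⟩ := hL.mem_verts.1 ht
    exact ⟨c, (hmem c).2 ⟨hc, fun i => h₁ (by rw [e, i]), fun i => h₂ (by rw [e, i])⟩, e⟩
  refine ⟨a, a', β, γ, rfl, rfl, ?_, fun κ μ => ?_, fun κ μ => ?_⟩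
  · have key : ∀ c ∈ β, ∀ φ : Real.Angle, ((c.1 : Real.Angle), φ) ∈ R.verts → φ ∉ Set.cIcc φ₁ φ₂ := by
      intro c hc φ hφ hφ'
      refine hne c (List.mem_append_left _ hc) (h.rect _ (.inl hφ) ⟨?_, hφ'⟩).1
      have := hβ' c hc
      exact (coe_mem_cIcc_iff_le ⟨this.1.le, by linarith⟩ ⟨haa', ha'.le⟩).2 this.2.le
    intro l hl
    obtain ⟨j, hj, e⟩ := mem_labels.1 hl
    obtain ⟨c, hc, rfl⟩ := List.mem_map.1 hj
    have hcL := ((hmem c).1 (List.mem_append_left _ hc)).1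
    rcases e with rfl | rfl
    · exact ⟨(hI c (List.mem_append_left _ hc)).1, key c hc _ (.inr (hL.neg_mem hcL))⟩
    · exact ⟨(hI c (List.mem_append_left _ hc)).2, key c hc _ (.inl (hL.pos_mem hcL))⟩
  · exact isDrawing_of_frame haa' ha' (hs.imp And.left) hβ' hγ' hI (fun c hc =>
      ⟨hL.pos_mem ((hmem c).1 hc).1, hL.neg_mem ((hmem c).1 hc).1⟩) hR
  · refine isDrawing_of_frame haa' ha' (hs.imp And.left) hβ' hγ' hI (fun c hc =>
      ⟨(h.pos_iff _ fun i => hne c hc i.1).1 (hL.pos_mem ((hmem c).1 hc).1),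
        (h.neg_iff _ fun i => hne c hc i.1).1 (hL.neg_mem ((hmem c).1 hc).1)⟩) ?_
    intro t ht h₁ h₂
    exact hR t ((h.verts_iff fun i => i.1.elim h₁ h₂).2 ht) h₁ h₂

end Differ

end RectDiagram

open JumpWord

namespace RectDiagram

/-- For every cut, the diagrams have drawings with connected words. -/
def Akin (R R' : RectDiagram) : Prop := ∀ b : ℝ, ∃ L L' : List (ℝ × ℝ × ℝ),
  IsDrawing b L R ∧ IsDrawing b L' R' ∧ Conn (L.map Prod.snd) (L'.map Prod.snd)

theorem Akin.symm {R R' : RectDiagram} (h : Akin R R') : Akin R' R := fun b => by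
  obtain ⟨L, L', h₁, h₂, h₃⟩ := h b
  exact ⟨L', L, h₂, h₁, h₃.symm⟩

theorem Akin.conn {R R' : RectDiagram} (h : Akin R R') {b : ℝ} {L L' : List (ℝ × ℝ × ℝ)}
    (hL : IsDrawing b L R) (hL' : IsDrawing b L' R') : Conn (L.map Prod.snd) (L'.map Prod.snd) := by
  obtain ⟨M, M', h₁, h₂, h₃⟩ := h b
  exact (hL.conn h₁).trans (h₃.trans (h₂.conn hL'))

theorem Akin.trans {R R' R'' : RectDiagram} (h : Akin R R') (h' : Akin R' R'') : Akin R R'' := by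
  intro b
  obtain ⟨L, L', h₁, h₂, h₃⟩ := h b
  obtain ⟨M, M', h₄, h₅, h₆⟩ := h' b
  exact ⟨L, M', h₁, h₅, h₃.trans ((h₂.conn h₄).trans h₆)⟩

theorem Akin.refl (R : RectDiagram) : Akin R R := fun b => by
  obtain ⟨L, hL, -⟩ := IsDrawing.exists_of_cut R 0 b
  exact ⟨L, L, hL, hL, .refl _⟩

namespace Differ

variable {R R' : RectDiagram} {θ₁ θ₂ φ₁ φ₂ : Real.Angle}

theorem not_arc {b h₁ h₂ l : ℝ} (i₁ : h₁ ∈ Set.Ico b (b + 2 * Real.pi))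
    (i₂ : h₂ ∈ Set.Ico b (b + 2 * Real.pi)) (hne : (h₁ : Real.Angle) ≠ h₂)
    (hl : l ∈ Set.Ico b (b + 2 * Real.pi) ∧ (l : Real.Angle) ∉ Set.cIcc (h₁ : Real.Angle) h₂) :
    ¬ Arc h₁ h₂ l := fun h =>
  hl.2 ((coe_mem_cIcc_iff_arc hl.1 i₁ i₂ fun e => hne (by rw [e])).2 h)

/-- The jump along a side of the rectangle can be moved past the columns in the strip above the
rectangle, as these have no ends between the heights of the rectangle. -/
theorem commute_word {b h₁ h₂ : ℝ} {β : List (ℝ × ℝ × ℝ)} (i₁ : h₁ ∈ Set.Ico b (b + 2 * Real.pi))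
    (i₂ : h₂ ∈ Set.Ico b (b + 2 * Real.pi)) (hne : (h₁ : Real.Angle) ≠ h₂)
    (hβ : ∀ l ∈ labels (β.map Prod.snd), l ∈ Set.Ico b (b + 2 * Real.pi) ∧
        (l : Real.Angle) ∉ Set.cIcc (h₁ : Real.Angle) h₂) {j : ℝ × ℝ}
    (hj : j = (h₁, h₂) ∨ j = (h₂, h₁)) {α γ : List (ℝ × ℝ)}
    (hu : Genuine (α ++ j :: (β.map Prod.snd ++ γ))) :
    Conn (α ++ j :: (β.map Prod.snd ++ γ)) (α ++ (β.map Prod.snd ++ j :: γ)) := by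
  refine hu.commute fun k hk => ?_
  have := noncross_of_not_arc (not_arc i₁ i₂ hne (hβ _ (mem_labels.2 ⟨k, hk, .inl rfl⟩)))
    (not_arc i₁ i₂ hne (hβ _ (mem_labels.2 ⟨k, hk, .inr rfl⟩)))
  rcases hj with rfl | rfl
  exacts [this.1, this.2]

/-- The exchange of a column moves its jump past the jumps of the columns in the strip. -/
theorem akin_of_left (h : Differ R R' θ₁ θ₂ φ₁ φ₂) (m₁ : (θ₁, φ₁) ∈ R.verts)
    (m₂ : (θ₁, φ₂) ∈ R.verts) (m₃ : (θ₂, φ₁) ∈ R'.verts) (m₄ : (θ₂, φ₂) ∈ R'.verts) : Akin R R' := by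
  intro b
  obtain ⟨a, a', β, γ, rfl, rfl, hβ, hR, hR'⟩ := h.exists_frame b
  obtain ⟨h₁, i₁, rfl⟩ := exists_coe_eq b φ₁
  obtain ⟨h₂, i₂, rfl⟩ := exists_coe_eq b φ₂
  have c₁ := h.no_column (.inr rfl) m₃ m₄
  have c₂ := h.symm.no_column (.inl rfl) m₁ m₂
  obtain ⟨y, z, hyz, hz, hy, hz', hy'⟩ : ∃ y z : ℝ, ((y, z) = (h₁, h₂) ∨ (y, z) = (h₂, h₁)) ∧
      ((a : Real.Angle), (z : Real.Angle)) ∈ R.pos ∧ ((a : Real.Angle), (y : Real.Angle)) ∈ R.neg ∧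
      ((a' : Real.Angle), (z : Real.Angle)) ∈ R'.pos ∧
        ((a' : Real.Angle), (y : Real.Angle)) ∈ R'.neg := by
    have hneg : ∀ {φ : Real.Angle}, φ = h₁ ∨ φ = h₂ → ((a : Real.Angle), φ) ∈ R.neg →
        ((a' : Real.Angle), φ) ∈ R'.verts → ((a' : Real.Angle), φ) ∈ R'.neg := by
      intro φ hφ hm hm'
      obtain ⟨-, -, -, hm, -⟩ := h.transpose.column_neg hφ (.inl ⟨rfl, rfl⟩) hm hm'
      exact hm
    rcases m₁ with m₁ | m₁
    · have m₂ := neg_of_pos_fst m₁ m₂ h.ne_snd.symm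
      have m₄ := hneg (.inr rfl) m₂ m₄
      exact ⟨h₂, h₁, .inr rfl, m₁, m₂, pos_of_neg_fst m₄ m₃ h.ne_snd, m₄⟩
    · have m₂ := pos_of_neg_fst m₁ m₂ h.ne_snd.symm
      have m₃ := hneg (.inl rfl) m₁ m₃
      exact ⟨h₁, h₂, .inl rfl, m₂, m₁, pos_of_neg_fst m₃ m₄ h.ne_snd.symm, m₃⟩
  have hI : y ∈ Set.Ico b (b + 2 * Real.pi) ∧ z ∈ Set.Ico b (b + 2 * Real.pi) := by
    rcases hyz with e | e <;> obtain ⟨rfl, rfl⟩ := Prod.mk.inj e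
    exacts [⟨i₁, i₂⟩, ⟨i₂, i₁⟩]
  have d := hR [(a, y, z)] [] (.inr ⟨y, z, rfl, hI.1, hI.2, hz, hy⟩) (.inl ⟨rfl, c₁⟩)
  have d' := hR' [] [(a', y, z)] (.inl ⟨rfl, c₂⟩) (.inr ⟨y, z, rfl, hI.1, hI.2, hz', hy'⟩)
  refine ⟨_, _, d, d', ?_⟩
  have := commute_word (α := []) (γ := γ.map Prod.snd) i₁ i₂ h.ne_snd hβ hyz
    (by simpa using d.genuine)
  simpa using this

/-- The exchange of a row renames a level. -/
theorem akin_of_bottom (h : Differ R R' θ₁ θ₂ φ₁ φ₂) (m₁ : (θ₁, φ₁) ∈ R.verts)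
    (m₂ : (θ₂, φ₁) ∈ R.verts) (m₃ : (θ₁, φ₂) ∈ R'.verts) (m₄ : (θ₂, φ₂) ∈ R'.verts) : Akin R R' := by
  intro b
  obtain ⟨a, a', β, γ, rfl, rfl, hβ, hR, hR'⟩ := h.exists_frame b
  obtain ⟨h₁, i₁, rfl⟩ := exists_coe_eq b φ₁
  obtain ⟨h₂, i₂, rfl⟩ := exists_coe_eq b φ₂
  have hne : h₁ ≠ h₂ := fun e => h.ne_snd (by rw [e])
  have hβ' := fun l hl => not_arc i₁ i₂ h.ne_snd (hβ l hl)
  rcases m₁ with m₁ | m₁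
  · have m₂ := neg_of_pos_snd m₁ m₂ h.ne_fst.symm
    obtain ⟨ψ, n₁, n₂, n₃, n₄⟩ := h.column_pos (.inl rfl) (.inl ⟨rfl, rfl⟩) m₁ m₃
    obtain ⟨χ, n₅, n₆, n₇, n₈⟩ := h.column_neg (.inr rfl) (.inl ⟨rfl, rfl⟩) m₂ m₄
    obtain ⟨x, ix, rfl⟩ := exists_coe_eq b ψ
    obtain ⟨y, iy, rfl⟩ := exists_coe_eq b χ
    have d := hR [(a, x, h₁)] [(a', h₁, y)] (.inr ⟨_, _, rfl, ix, i₁, m₁, n₁⟩)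
      (.inr ⟨_, _, rfl, i₁, iy, n₅, m₂⟩)
    have d' := hR' [(a, x, h₂)] [(a', h₂, y)] (.inr ⟨_, _, rfl, ix, i₂, n₃, n₂⟩)
      (.inr ⟨_, _, rfl, i₂, iy, n₆, n₇⟩)
    refine ⟨_, _, d, d', ?_⟩
    have g := d.genuine
    have g' := d'.genuine
    simp only [List.map_append, List.map_cons, List.cons_append, List.nil_append]
      at g g' ⊢
    exact g.row_arrival g' hne (not_arc i₁ i₂ h.ne_snd ⟨ix, n₄⟩) (not_arc i₁ i₂ h.ne_snd ⟨iy, n₈⟩) hβ'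
  · have m₂ := pos_of_neg_snd m₁ m₂ h.ne_fst.symm
    obtain ⟨ψ, n₁, n₂, n₃, n₄⟩ := h.column_neg (.inl rfl) (.inl ⟨rfl, rfl⟩) m₁ m₃
    obtain ⟨χ, n₅, n₆, n₇, n₈⟩ := h.column_pos (.inr rfl) (.inl ⟨rfl, rfl⟩) m₂ m₄
    obtain ⟨y, iy, rfl⟩ := exists_coe_eq b ψ
    obtain ⟨x, ix, rfl⟩ := exists_coe_eq b χ
    have d := hR [(a, h₁, y)] [(a', x, h₁)] (.inr ⟨_, _, rfl, i₁, iy, n₁, m₁⟩)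
      (.inr ⟨_, _, rfl, ix, i₁, m₂, n₅⟩)
    have d' := hR' [(a, h₂, y)] [(a', x, h₂)] (.inr ⟨_, _, rfl, i₂, iy, n₂, n₃⟩)
      (.inr ⟨_, _, rfl, ix, i₂, n₇, n₆⟩)
    refine ⟨_, _, d, d', ?_⟩
    have g := d.genuine
    have g' := d'.genuine
    simp only [List.map_append, List.map_cons, List.cons_append, List.nil_append]
      at g g' ⊢
    exact g.row_departure g' hne (not_arc i₁ i₂ h.ne_snd ⟨ix, n₈⟩) (not_arc i₁ i₂ h.ne_snd ⟨iy, n₄⟩) hβ'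

/-- The stabilization at the lower right corner: the new column at `θ₁` is moved next to the column
at `θ₂`, and their jumps are merged. -/
theorem akin_of_stab_right (h : Differ R R' θ₁ θ₂ φ₁ φ₂) (m₁ : (θ₁, φ₁) ∈ R'.verts)
    (m₂ : (θ₂, φ₁) ∈ R.verts) (m₃ : (θ₁, φ₂) ∈ R'.verts) (m₄ : (θ₂, φ₂) ∈ R'.neg) : Akin R R' := by
  intro b
  obtain ⟨a, a', β, γ, rfl, rfl, hβ, hR, hR'⟩ := h.exists_frame b
  obtain ⟨h₁, i₁, rfl⟩ := exists_coe_eq b φ₁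
  obtain ⟨h₂, i₂, rfl⟩ := exists_coe_eq b φ₂
  have m₃' := pos_of_neg_snd m₄ m₃ h.ne_fst
  have m₁' := neg_of_pos_fst m₃' m₁ h.ne_snd
  obtain ⟨ψ, n₁, n₂, n₃, n₄⟩ := h.symm.column_neg (.inr rfl) (.inr ⟨rfl, rfl⟩) m₄ m₂
  obtain ⟨z, iz, rfl⟩ := exists_coe_eq b ψ
  have d := hR [] [(a', h₁, z)] (.inl ⟨rfl, h.no_column (.inl rfl) m₁ m₃⟩)
    (.inr ⟨_, _, rfl, i₁, iz, n₂, n₃⟩)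
  have d' := hR' [(a, h₁, h₂)] [(a', h₂, z)] (.inr ⟨_, _, rfl, i₁, i₂, m₃', m₁'⟩)
    (.inr ⟨_, _, rfl, i₂, iz, n₁, m₄⟩)
  refine ⟨_, _, d, d', ?_⟩
  have g' := d'.genuine
  simp only [List.map_append, List.map_cons, List.cons_append, List.nil_append]
    at g' ⊢
  have e₁ := commute_word (α := []) i₁ i₂ h.ne_snd hβ (.inl rfl) g'
  have gm : Genuine (β.map Prod.snd ++ (h₁, h₂) :: (h₂, z) :: γ.map Prod.snd) :=
    g'.perm List.perm_middle.symm
  have e₂ := gm.merge (cyc_of_not_arc (fun e => h.ne_snd (by rw [e]))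
    (not_arc i₁ i₂ h.ne_snd ⟨iz, n₄⟩))
  exact (e₁.trans e₂).symm

/-- The stabilization at the upper left corner: the new column at `θ₂` is moved next to the column
at `θ₁`, and their jumps are merged. -/
theorem akin_of_stab_left (h : Differ R R' θ₁ θ₂ φ₁ φ₂) (m₁ : (θ₁, φ₁) ∈ R'.verts)
    (m₂ : (θ₂, φ₁) ∈ R'.neg) (m₃ : (θ₁, φ₂) ∈ R.verts) (m₄ : (θ₂, φ₂) ∈ R'.verts) : Akin R R' := by
  intro b
  obtain ⟨a, a', β, γ, rfl, rfl, hβ, hR, hR'⟩ := h.exists_frame b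
  obtain ⟨h₁, i₁, rfl⟩ := exists_coe_eq b φ₁
  obtain ⟨h₂, i₂, rfl⟩ := exists_coe_eq b φ₂
  have m₁' := pos_of_neg_snd m₂ m₁ h.ne_fst
  have m₄' := pos_of_neg_fst m₂ m₄ h.ne_snd.symm
  obtain ⟨ψ, n₁, n₂, n₃, n₄⟩ := h.symm.column_pos (.inl rfl) (.inl ⟨rfl, rfl⟩) m₁' m₃
  obtain ⟨z, iz, rfl⟩ := exists_coe_eq b ψ
  have d := hR [(a, z, h₂)] [] (.inr ⟨_, _, rfl, iz, i₂, n₃, n₂⟩)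
    (.inl ⟨rfl, h.no_column (.inr rfl) (.inr m₂) m₄⟩)
  have d' := hR' [(a, z, h₁)] [(a', h₁, h₂)] (.inr ⟨_, _, rfl, iz, i₁, m₁', n₁⟩)
    (.inr ⟨_, _, rfl, i₁, i₂, m₄', m₂⟩)
  refine ⟨_, _, d, d', ?_⟩
  have g' := d'.genuine
  simp only [List.map_append, List.map_cons, List.cons_append, List.nil_append]
    at g' ⊢
  have gm : Genuine ([(z, h₁)] ++ (h₁, h₂) :: (β.map Prod.snd ++ γ.map Prod.snd)) :=
    g'.perm (List.perm_middle.cons _)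
  have e₁ := commute_word i₁ i₂ h.ne_snd hβ (.inl rfl) gm
  have e₂ := Genuine.merge (α := []) gm (cyc_of_not_arc (fun e => h.ne_snd (by rw [e]))
    (not_arc i₁ i₂ h.ne_snd ⟨iz, n₄⟩)).rot.rot
  exact e₂.symm.trans e₁

end Differ

variable {R R' : RectDiagram}

theorem IsElementaryMoveAt.mem_corners_iff {θ₁ θ₂ φ₁ φ₂ : Real.Angle}
    (h : IsElementaryMoveAt R R' θ₁ θ₂ φ₁ φ₂) (t : Torus) :
    ((t.1 = θ₁ ∨ t.1 = θ₂) ∧ (t.2 = φ₁ ∨ t.2 = φ₂)) ↔ t ∈ symmDiff R.verts R'.verts := by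
  rw [h.symmDiff_eq]; rfl

theorem IsElementaryMoveAt.differ {θ₁ θ₂ φ₁ φ₂ : Real.Angle}
    (h : IsElementaryMoveAt R R' θ₁ θ₂ φ₁ φ₂) : Differ R R' θ₁ θ₂ φ₁ φ₂ := by
  have hiff : ∀ t, t ∉ symmDiff R.verts R'.verts → (t ∈ R.verts ↔ t ∈ R'.verts) := by
    intro t ht; rw [Set.mem_symmDiff] at ht; grind
  have ho : ∀ t, t ∈ R.pos ∧ t ∈ R'.verts ↔ t ∈ R.verts ∧ t ∈ R'.pos := fun t => by
    rw [← Set.mem_inter_iff, h.orientation, Set.mem_inter_iff]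
  have hd : ∀ t, t ∈ R.pos → t ∉ R.neg := fun _ => (Set.disjoint_left.1 R.disjoint ·)
  have hd' : ∀ t, t ∈ R'.pos → t ∉ R'.neg := fun _ => (Set.disjoint_left.1 R'.disjoint ·)
  refine ⟨h.ne_fst, h.ne_snd, fun t h₁ h₂ => ?_, fun t ht => ?_, fun t ht => ?_, fun t ht hr => ?_⟩
  · have := (h.mem_corners_iff t).1 ⟨h₁, h₂⟩
    rw [Set.mem_symmDiff] at this; grind
  · rw [h.mem_corners_iff] at ht
    have h₁ := hiff t ht
    have h₂ := ho t
    rw [mem_verts, mem_verts] at h₁ h₂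
    grind
  · rw [h.mem_corners_iff] at ht
    have h₁ := hiff t ht
    have h₂ := ho t
    have h₃ := hd t
    have h₄ := hd' t
    rw [mem_verts, mem_verts] at h₁ h₂
    grind
  · rw [h.mem_corners_iff, ← h.rect_inter]; exact ⟨hr, ht⟩

/-- There are two kinds of stabilizations of type `←II`, at opposite corners of the rectangle. -/
theorem IsStabilization.akin (h : IsStabilization .leftII R R') : Akin R R' := by
  obtain ⟨θ₁, θ₂, φ₁, φ₂, hm, -, ⟨v, hv, hvr⟩, φ₀, hφ₀, hsub, hsign⟩ := h
  have hd := hm.differ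
  have hR : ∀ t : Torus, t.1 = θ₁ ∨ t.1 = θ₂ → t.2 = φ₁ ∨ t.2 = φ₂ → (t ∈ R.verts ↔ t = v) := by
    intro t h₁ h₂
    rw [← Set.mem_singleton_iff, ← hvr, Set.mem_inter_iff]
    exact (and_iff_left (corners_subset_rect _ _ _ _ ⟨h₁, h₂⟩)).symm
  have hR' : ∀ t : Torus, t.1 = θ₁ ∨ t.1 = θ₂ → t.2 = φ₁ ∨ t.2 = φ₂ → (t ∈ R'.verts ↔ t ≠ v) := by
    intro t h₁ h₂
    rw [← not_iff_not, ← hd.corner_iff t h₁ h₂, hR t h₁ h₂, not_not]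
  have hne := hd.ne_fst
  have hne' := hd.ne_snd
  simp only [StabType.corners, StabType.signedVerts, Set.mem_insert_iff, Set.mem_singleton_iff]
    at hv hφ₀ hsign
  have h₂ : φ₀ = φ₁ ∨ φ₀ = φ₂ → (θ₂, φ₀) ≠ v := fun h =>
    (hR' _ (.inr rfl) h).1 (.inr hsign)
  have h₁ : (θ₁, φ₀) ≠ v := (hR' _ (.inl rfl) hφ₀).1 (hsub ⟨.inl rfl, rfl⟩)
  rcases hv with rfl | rfl
  · have e : φ₀ = φ₁ := hφ₀.resolve_right fun e => h₁ (by rw [e])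
    subst e
    exact hd.akin_of_stab_left ((hR' _ (.inl rfl) (.inl rfl)).2 (by simp [hne'])) hsign
      ((hR _ (.inl rfl) (.inr rfl)).2 rfl) ((hR' _ (.inr rfl) (.inr rfl)).2 (by simp [hne.symm]))
  · have e : φ₀ = φ₂ := hφ₀.resolve_left fun e => h₂ hφ₀ (by rw [e])
    subst e
    exact hd.akin_of_stab_right ((hR' _ (.inl rfl) (.inl rfl)).2 (by simp [hne]))
      ((hR _ (.inr rfl) (.inl rfl)).2 rfl) ((hR' _ (.inl rfl) (.inr rfl)).2 (by simp [hne])) hsign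

theorem corner_injective {θ₁ θ₂ φ₁ φ₂ : Real.Angle} (hθ : θ₁ ≠ θ₂) (hφ : φ₁ ≠ φ₂) :
    Function.Injective (corner θ₁ θ₂ φ₁ φ₂) := by
  intro i j e
  fin_cases i <;> fin_cases j <;> simp_all [corner, hθ.symm, hφ.symm]

/-- The two vertices that move are the ends of one of the four sides of the rectangle. -/
theorem IsExchange.akin (h : IsExchange R R') : Akin R R' := by
  obtain ⟨⟨θ₁, θ₂, φ₁, φ₂, hm⟩, hcard⟩ := h
  have hd := hm.differ
  have hinj := corner_injective hd.ne_fst hd.ne_snd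
  set D : Set Torus := Set.range (corner θ₁ θ₂ φ₁ φ₂) with hD
  have hmem : ∀ t : Torus, t ∈ D ↔ (t.1 = θ₁ ∨ t.1 = θ₂) ∧ (t.2 = φ₁ ∨ t.2 = φ₂) := by
    intro t; rw [hD, range_corner]; rfl
  have hDf : D.Finite := Set.finite_range _
  have c₁ := Set.ncard_inter_add_ncard_sdiff_eq_ncard R.verts D R.finite
  have c₂ := Set.ncard_inter_add_ncard_sdiff_eq_ncard R'.verts D R'.finite
  have c₃ : R.verts \ D = R'.verts \ D := by
    ext t
    simp only [Set.mem_sdiff]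
    exact and_congr_left fun ht => hd.verts_iff fun h => ht ((hmem t).2 h)
  have c₄ : (R.verts ∩ D).ncard + (R'.verts ∩ D).ncard = 4 := by
    rw [← Set.ncard_union_eq ?_ (hDf.inter_of_right _) (hDf.inter_of_right _)]
    · have : R.verts ∩ D ∪ R'.verts ∩ D = D := by
        ext t
        simp only [Set.mem_union, Set.mem_inter_iff]
        have : t ∈ D → (t ∈ R.verts ↔ t ∉ R'.verts) := fun ht =>
          hd.corner_iff t ((hmem t).1 ht).1 ((hmem t).1 ht).2
        grind
      rw [this, hD, ← Set.image_univ, Set.ncard_image_of_injective _ hinj, Set.ncard_univ]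
      simp
    · rw [Set.disjoint_left]
      exact fun t ⟨h₁, h₂⟩ ⟨h₃, _⟩ => (hd.corner_iff t ((hmem t).1 h₂).1 ((hmem t).1 h₂).2).1 h₁ h₃
  -- Since the number of vertices does not change, each diagram has two of the four corners.
  have c₅ : (R.verts ∩ D).ncard = 2 := by
    have : (R.verts ∩ D).ncard = (R'.verts ∩ D).ncard := by
      have := congrArg Set.ncard c₃
      omega
    omega
  obtain ⟨i, hi⟩ := hm.consecutive
  simp only [← hD] at hi
  have hi : R.verts ∩ D = {corner θ₁ θ₂ φ₁ φ₂ i, corner θ₁ θ₂ φ₁ φ₂ (i + 1)} := by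
    rcases hi with hi | hi | hi
    · rw [hi, Set.ncard_singleton] at c₅; omega
    · exact hi
    · have : (R.verts ∩ D).ncard = 3 := Set.ncard_eq_three.2 ⟨_, _, _,
        hinj.ne (by fin_cases i <;> decide), hinj.ne (by fin_cases i <;> decide),
        hinj.ne (by fin_cases i <;> decide), hi⟩
      omega
  have hR : ∀ t : Torus, t.1 = θ₁ ∨ t.1 = θ₂ → t.2 = φ₁ ∨ t.2 = φ₂ → (t ∈ R.verts ↔
      t = corner θ₁ θ₂ φ₁ φ₂ i ∨ t = corner θ₁ θ₂ φ₁ φ₂ (i + 1)) := by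
    intro t h₁ h₂
    have : t ∈ R.verts ∩ D ↔ t = corner θ₁ θ₂ φ₁ φ₂ i ∨ t = corner θ₁ θ₂ φ₁ φ₂ (i + 1) := by
      rw [hi]; exact Iff.rfl
    rw [Set.mem_inter_iff, and_iff_left ((hmem t).2 ⟨h₁, h₂⟩)] at this
    exact this
  have hR' : ∀ t : Torus, t.1 = θ₁ ∨ t.1 = θ₂ → t.2 = φ₁ ∨ t.2 = φ₂ → (t ∈ R'.verts ↔
      ¬ (t = corner θ₁ θ₂ φ₁ φ₂ i ∨ t = corner θ₁ θ₂ φ₁ φ₂ (i + 1))) := by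
    intro t h₁ h₂
    rw [← not_iff_not, ← hd.corner_iff t h₁ h₂, hR t h₁ h₂, not_not]
  have l₁ := hR (θ₁, φ₁) (.inl rfl) (.inl rfl)
  have l₂ := hR (θ₁, φ₂) (.inl rfl) (.inr rfl)
  have l₃ := hR (θ₂, φ₁) (.inr rfl) (.inl rfl)
  have l₄ := hR (θ₂, φ₂) (.inr rfl) (.inr rfl)
  have k₁ := hR' (θ₁, φ₁) (.inl rfl) (.inl rfl)
  have k₂ := hR' (θ₁, φ₂) (.inl rfl) (.inr rfl)
  have k₃ := hR' (θ₂, φ₁) (.inr rfl) (.inl rfl)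
  have k₄ := hR' (θ₂, φ₂) (.inr rfl) (.inr rfl)
  clear hR hR' hi c₁ c₂ c₃ c₄ c₅ hmem
  have hne := hd.ne_fst
  have hne' := hd.ne_snd
  fin_cases i <;> simp [corner, hne, hne', hne.symm, hne'.symm] at l₁ l₂ l₃ l₄ k₁ k₂ k₃ k₄
  · exact hd.akin_of_bottom l₁ l₃ k₂ k₄
  · exact (hd.symm.akin_of_left k₁ k₂ l₃ l₄).symm
  · exact (hd.symm.akin_of_bottom k₁ k₃ l₂ l₄).symm
  · exact hd.akin_of_left l₁ l₂ k₃ k₄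

/-- Equivalent diagrams have drawings with connected words. -/
theorem Related.akin (h : Related R R') : Akin R R' := by
  change Relation.EqvGen _ R R' at h
  induction h with
  | rel R R' h =>
    rcases h with h | ⟨T, rfl, h | h⟩
    exacts [h.akin, h.akin, h.akin.symm]
  | refl R => exact .refl R
  | symm _ _ _ ih => exact ih.symm
  | trans _ _ _ _ _ ih ih' => exact ih.trans ih'

end RectDiagram

open JumpWord

namespace JumpWord

/-! ### Reduction to a finite search -/

variable {Λ Λ' : Type*} [LinearOrder Λ] [LinearOrder Λ']

theorem Genuine.relabel {f : Λ → Λ'} {u : List (Λ × Λ)} (hu : Genuine u)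
    (hf : Set.InjOn f (labels u)) : Genuine (relabel f u) ∧ need (relabel f u) = (need u).image f := by
  have i₁ : ∀ j ∈ u, j.1 ∈ labels u := fun j hj => mem_labels.2 ⟨j, hj, .inl rfl⟩
  have i₂ : ∀ j ∈ u, j.2 ∈ labels u := fun j hj => mem_labels.2 ⟨j, hj, .inr rfl⟩
  have e₁ : (JumpWord.relabel f u).map Prod.fst = (u.map Prod.fst).map f := by simp [JumpWord.relabel]
  have e₂ : (JumpWord.relabel f u).map Prod.snd = (u.map Prod.snd).map f := by simp [JumpWord.relabel]
  have hg : Genuine (JumpWord.relabel f u) := by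
    refine ⟨?_, ?_, fun l => ?_, fun j hj e => ?_⟩
    · rw [e₁]
      refine hu.nodup_fst.map_on fun x hx y hy e => hf ?_ ?_ e
      · obtain ⟨j, hj, rfl⟩ := List.mem_map.1 hx; exact i₁ j hj
      · obtain ⟨j, hj, rfl⟩ := List.mem_map.1 hy; exact i₁ j hj
    · rw [e₂]
      refine hu.nodup_snd.map_on fun x hx y hy e => hf ?_ ?_ e
      · obtain ⟨j, hj, rfl⟩ := List.mem_map.1 hx; exact i₂ j hj
      · obtain ⟨j, hj, rfl⟩ := List.mem_map.1 hy; exact i₂ j hj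
    · rw [e₁, e₂, List.mem_map, List.mem_map]
      exact exists_congr fun x => and_congr_left fun _ => hu.mem_iff x
    · obtain ⟨k, hk, rfl⟩ := List.mem_map.1 hj
      exact hu.ne k hk (hf (i₁ k hk) (i₂ k hk) e)
  have hsub := need_subset_labels u
  have hc : Closed (mapState f (need u, u)) := (closed_mapState (by
    rw [supp, Finset.union_eq_right.2 hsub]; exact hf)).2 hu.closed
  refine ⟨hg, (hg.eq_need hc.1 ?_).symm⟩
  rw [labels_map]
  exact Finset.image_subset_image hsub

theorem Genuine.numbering {f : Λ → ℕ} {u : List (Λ × Λ)} (hu : Genuine u)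
    (hf : CycIso f (labels u)) :
    Numbering (need u, u) (need (JumpWord.relabel f u), JumpWord.relabel f u) := by
  refine ⟨f, ?_, ?_⟩
  · rw [supp, Finset.union_eq_right.2 (need_subset_labels u)]; exact hf
  · rw [mapState, (hu.relabel hf.injOn).2]

theorem crossings_le {S : Finset Λ} {w : List (Λ × Λ)} (h : Valid S w) :
    crossings S w ≤ w.length * S.card := by
  induction w generalizing S with
  | nil => simp
  | cons j w ih =>
    have := ih h.2.2
    rw [card_move h.1 h.2.1] at this
    have h' : cross S j ≤ S.card := Finset.card_filter_le _ _
    simp only [crossings, List.length_cons, Nat.add_mul, Nat.one_mul]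
    omega

theorem wraps_le (w : List (Λ × Λ)) : wraps w ≤ w.length := by
  induction w with
  | nil => simp
  | cons j w ih =>
    have : wrap j ≤ 1 := by unfold wrap; split_ifs <;> omega
    simp only [wraps_cons, List.length_cons]
    omega

theorem card_need_le (w : List (Λ × Λ)) : (need w).card ≤ w.length := by
  induction w with
  | nil => simp [need]
  | cons j w ih =>
    have h₁ := Finset.card_insert_le j.1 ((need w).erase j.2)
    have h₂ := Finset.card_erase_le (s := need w) (a := j.2)
    simp only [need, List.length_cons]
    omega

theorem card_labels_le (w : List (Λ × Λ)) : (labels w).card ≤ 2 * w.length := by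
  rw [labels]
  refine (List.toFinset_card_le _).trans ?_
  simp
  omega

/-- A number of levels that suffices to connect words with at most `n` jumps. Such words have at
most `n` occupied levels, `n * n` crossings and `2 * n` labels; the factor `2` accounts for the two
words before and after a move. -/
def searchBound (n : ℕ) : ℕ := 2 * (levelBound n (n * n) + 2 * n)

theorem BoundedConn.eqvGen {M Q : ℕ} {c d : Finset ℕ × List (ℕ × ℕ)} (h : BoundedConn M Q c d) :
    Relation.EqvGen NatStep c d := by
  induction h with
  | rel _ _ h => exact .rel _ _ h.1
  | refl _ => exact .refl _
  | symm _ _ _ ih => exact .symm _ _ ih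
  | trans _ _ _ _ _ ih ih' => exact .trans _ _ _ ih ih'

/-- Connected words are connected within a finite set of words whose size depends only on their
lengths. -/
theorem Conn.boundedConn {n : ℕ} [Inhabited Λ] {u v : List (Λ × Λ)} (h : Conn u v)
    (hu : Genuine u) (hun : u.length ≤ n) (hvn : v.length ≤ n)
    {c d : Finset ℕ × List (ℕ × ℕ)} (hc : Numbering (need u, u) c) (hd : Numbering (need v, v) d)
    (hcn : supp c ⊆ Finset.range n) (hdn : supp d ⊆ Finset.range n) :
    BoundedConn (searchBound n) (n * searchBound n) c d := by
  have card : ∀ {w : List (Λ × Λ)}, w.length ≤ n → (supp (need w, w)).card ≤ 2 * n := by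
    intro w hw
    rw [supp, Finset.union_eq_right.2 (need_subset_labels w)]
    have := card_labels_le w
    omega
  have hn : (need u).card ≤ n := (card_need_le u).trans hun
  have hcr : crossings (need u) u ≤ n * n :=
    (crossings_le hu.closed.1).trans (Nat.mul_le_mul hun hn)
  have hK : levelBound (need u).card (crossings (need u) u) ≤ levelBound n (n * n) + 2 * n := by
    unfold levelBound
    refine le_add_right ?_
    gcongr
  have near := near_of_eqvGen (K := levelBound n (n * n) + 2 * n) h hu.closed hK
    ((card hun).trans (by omega)) ((card hvn).trans (by omega))
  have hle : 2 * n ≤ searchBound n := by unfold searchBound; omega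
  exact near.boundedConn hu.closed ((card hun).trans hle)
    (Nat.mul_le_mul_right _ ((wraps_le u).trans hun)) hc hd
    (hcn.trans (Finset.range_mono (by omega))) (hdn.trans (Finset.range_mono (by omega)))

theorem arc_iff_cyc {x y z : Λ} (h₁ : y ≠ x) (h₂ : y ≠ z) : Arc x z y ↔ Cyc x y z := by
  simp [Arc, h₁, h₂]

theorem CycIso.of_arc {f : Λ → Λ'} {A : Finset Λ} (hf : Set.InjOn f A)
    (h : ∀ x ∈ A, ∀ y ∈ A, ∀ z ∈ A, x ≠ z → y ≠ x → y ≠ z →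
      (Arc (f x) (f z) (f y) ↔ Arc x z y)) : CycIso f A := by
  refine ⟨hf, fun x hx y hy z hz => ?_⟩
  by_cases hd : x ≠ z ∧ y ≠ x ∧ y ≠ z
  · have := h x hx y hy z hz hd.1 hd.2.1 hd.2.2
    rwa [arc_iff_cyc hd.2.1 hd.2.2, arc_iff_cyc (fun e => hd.2.1 (hf hy hx e))
      fun e => hd.2.2 (hf hy hz e)] at this
  · refine iff_of_false (fun h => hd ⟨?_, ?_, ?_⟩) fun h => hd ⟨h.ne₁₃, h.ne₁₂.symm, h.ne₂₃⟩
    exacts [fun e => h.ne₁₃ (by rw [e]), fun e => h.ne₁₂ (by rw [e]), fun e => h.ne₂₃ (by rw [e])]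

end JumpWord

open RectDiagram

/-- A drawing with another cut. -/
theorem IsDrawing.exists_cut {b : ℝ} {L : List (ℝ × ℝ × ℝ)} {R : RectDiagram} (h : IsDrawing b L R)
    (b' : ℝ) : ∃ g : ℝ → ℝ, CycIso g (labels (L.map Prod.snd)) ∧
      IsDrawing b' (L.map (Prod.map id (Prod.map g g))) R := by
  choose g hg hg' using fun l : ℝ => exists_coe_eq b' (l : Real.Angle)
  refine ⟨g, .of_arc (fun x hx y hy e => ?_) fun x hx y hy z hz hxz hyx hyz => ?_, ?_⟩
  · refine (coe_inj_of_mem_Ico (h.mem_Ico x hx) (h.mem_Ico y hy)).1 ?_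
    rw [← hg' x, ← hg' y, e]
  · have hne : g x ≠ g z := fun e => hxz
      ((coe_inj_of_mem_Ico (h.mem_Ico x hx) (h.mem_Ico z hz)).1 (by rw [← hg' x, ← hg' z, e]))
    rw [← coe_mem_cIcc_iff_arc (hg y) (hg x) (hg z) hne, hg', hg', hg',
      coe_mem_cIcc_iff_arc (h.mem_Ico y hy) (h.mem_Ico x hx) (h.mem_Ico z hz) hxz]
  · refine .of_columns (List.pairwise_map.2 h.sorted) ?_ ?_ ?_
    · intro c hc
      obtain ⟨d, hd, rfl⟩ := List.mem_map.1 hc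
      exact ⟨hg _, hg _⟩
    · intro c hc
      obtain ⟨d, hd, rfl⟩ := List.mem_map.1 hc
      simp only [Prod.map, hg', id]
      exact ⟨h.pos_mem hd, h.neg_mem hd⟩
    · intro t ht
      obtain ⟨d, hd, e, -⟩ := h.mem_verts.1 ht
      exact ⟨_, List.mem_map_of_mem hd, e⟩

/-- `w` is the word of a drawing of `R`, up to an increasing numbering of the heights. -/
def HasWord (R : RectDiagram) (w : List (ℕ × ℕ)) : Prop :=
  ∃ (b : ℝ) (L : List (ℝ × ℝ × ℝ)) (y : ℕ → ℝ), IsDrawing b L R ∧ L.map Prod.snd = relabel y w ∧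
    StrictMonoOn y (labels w)

/-- An increasing map of levels can be undone. -/
theorem exists_leftInverse {y : ℕ → ℝ} {w : List (ℕ × ℕ)} (hy : StrictMonoOn y (labels w)) :
    ∃ f : ℝ → ℕ, relabel f (relabel y w) = w ∧ StrictMonoOn f (labels (relabel y w)) := by
  refine ⟨Function.invFunOn y (labels w), ?_, ?_⟩
  · conv_rhs => rw [← List.map_id w]
    rw [relabel, relabel, List.map_map]
    exact List.map_congr_left fun j hj =>
      Prod.ext (hy.injOn.leftInvOn_invFunOn (mem_labels.2 ⟨j, hj, .inl rfl⟩))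
        (hy.injOn.leftInvOn_invFunOn (mem_labels.2 ⟨j, hj, .inr rfl⟩))
  · rw [labels_map]
    intro l hl m hm hlm
    simp only [Finset.coe_image, Set.mem_image, Finset.mem_coe] at hl hm
    obtain ⟨l, hl, rfl⟩ := hl
    obtain ⟨m, hm, rfl⟩ := hm
    rw [hy.injOn.leftInvOn_invFunOn hl, hy.injOn.leftInvOn_invFunOn hm]
    exact (hy.lt_iff_lt hl hm).1 hlm

/-- The equivalence of diagrams is a bounded search for moves of their words. -/
theorem HasWord.related_iff {R R' : RectDiagram} {w w' : List (ℕ × ℕ)} {n : ℕ} (h : HasWord R w)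
    (h' : HasWord R' w') (hw : w.length ≤ n) (hw' : w'.length ≤ n)
    (hl : labels w ⊆ Finset.range n) (hl' : labels w' ⊆ Finset.range n) :
    Related R R' ↔ BoundedConn (searchBound n) (n * searchBound n) (need w, w) (need w', w') := by
  obtain ⟨b, L, y, hL, hLw, hy⟩ := h
  obtain ⟨b', L', y', hL', hLw', hy'⟩ := h'
  obtain ⟨f, hf, hfm⟩ := exists_leftInverse hy
  obtain ⟨f', hf', hfm'⟩ := exists_leftInverse hy'
  rw [← hLw] at hf hfm
  rw [← hLw'] at hf' hfm'
  have hneed := (hL.genuine.relabel hfm.injOn).2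
  rw [hf] at hneed
  constructor
  · intro h
    -- Drawings with a common horizontal cut have connected words.
    obtain ⟨g, hg, hLg⟩ := hL'.exists_cut b
    have e : (L'.map (Prod.map id (Prod.map g g))).map Prod.snd = relabel g (L'.map Prod.snd) := by
      simp [relabel]
    have hc := h.akin.conn hL hLg
    obtain ⟨g', hg', hgg'⟩ := hg.exists_inverse
    have n₁ := hL.genuine.numbering hfm.cycIso
    rw [hf] at n₁
    have e' : relabel (f' ∘ g') (relabel g (L'.map Prod.snd)) = w' := by
      rw [← hf', relabel, relabel, List.map_map, relabel]
      refine List.map_congr_left fun j hj => ?_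
      simp [Prod.map, hgg' _ (mem_labels.2 ⟨j, hj, .inl rfl⟩),
        hgg' _ (mem_labels.2 ⟨j, hj, .inr rfl⟩)]
    have n₂ := hLg.genuine.numbering (f := f' ∘ g') (by
      rw [e, labels_map]
      refine hg'.comp (hfm'.cycIso.mono ?_)
      intro x hx
      simp only [Finset.mem_image] at hx
      obtain ⟨_, ⟨l, hl, rfl⟩, rfl⟩ := hx
      rwa [hgg' l hl])
    rw [e, e'] at n₂
    rw [e] at hc
    refine hc.boundedConn hL.genuine ?_ ?_ n₁ n₂ ?_ ?_
    · rw [hLw]; simpa [relabel] using hw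
    · rw [hLw']; simpa [relabel] using hw'
    · rw [supp, Finset.union_eq_right.2 (need_subset_labels w)]; exact hl
    · rw [supp, Finset.union_eq_right.2 (need_subset_labels w')]; exact hl'
  · intro h
    have hsub := need_subset_labels (L.map Prod.snd)
    obtain ⟨R'', h₂, h₃⟩ := (Realizes.lift_eqvGen h.eqvGen).1 R ⟨b, L, _, f, hL, hL.genuine.closed, hsub,
      hfm.monotoneOn, hfm.injOn.mono hsub, by rw [mapState, ← hneed, hf]⟩
    exact h₂.trans (h₃.related hL' hLw' hy')

open JumpWord

/-! ### Symmetries of the types -/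

/-- The reflection of the circle reverses arcs. -/
theorem neg_mem_cIcc_neg {x y z : Real.Angle} : -x ∈ Set.cIcc (-z) (-y) ↔ x ∈ Set.cIcc y z := by
  rw [Set.mem_cIcc, Set.mem_cIcc, ← btw_cyclic, ← btw_cyclic (a := x), ← Set.mem_cIcc, ← Set.mem_cIcc]
  obtain ⟨x, -, rfl⟩ := exists_coe_eq 0 x
  obtain ⟨z, hz, rfl⟩ := exists_coe_eq x z
  obtain ⟨y, hy, rfl⟩ : ∃ y' ∈ Set.Ioc x (x + 2 * Real.pi), (y' : Real.Angle) = y := by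
    obtain ⟨w, hw, rfl⟩ := exists_coe_eq x y
    rcases hw.1.eq_or_lt with rfl | h
    · exact ⟨_, ⟨by linarith [hw.2], le_rfl⟩, coe_add_two_pi _⟩
    · exact ⟨w, ⟨h, hw.2.le⟩, rfl⟩
  rw [coe_mem_cIcc_iff_le hz hy, ← Real.Angle.coe_neg, ← Real.Angle.coe_neg, ← Real.Angle.coe_neg,
    ← coe_add_two_pi (-y), ← coe_add_two_pi (-z), coe_mem_cIcc_iff_le ⟨by linarith [hy.2],
      by linarith [hy.1]⟩ ⟨by linarith [hz.2], by linarith [hz.1]⟩]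
  constructor <;> intro h <;> linarith

namespace RectDiagram

/-- The reflection of the torus in the first coordinate. -/
noncomputable def refl : Torus ≃ Torus := (Equiv.neg _).prodCongr (Equiv.refl _)

theorem refl_apply (t : Torus) : refl t = (-t.1, t.2) := rfl

/-- The mirror image of a diagram. -/
def reflect (R : RectDiagram) : RectDiagram where
  pos := refl ⁻¹' R.pos
  neg := refl ⁻¹' R.neg
  finite := by
    rw [← Set.preimage_union]; exact R.finite.preimage refl.injective.injOn
  nonempty := by
    rw [← Set.preimage_union]; exact R.nonempty.preimage refl.surjective
  disjoint := R.disjoint.preimage _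
  image_fst := by
    have : ∀ A : Set Torus, Prod.fst '' (refl ⁻¹' A) = Neg.neg '' (Prod.fst '' A) := by
      intro A
      ext θ
      constructor
      · rintro ⟨t, ht, rfl⟩
        exact ⟨-t.1, ⟨refl t, ht, rfl⟩, neg_neg _⟩
      · rintro ⟨_, ⟨t, ht, rfl⟩, rfl⟩
        exact ⟨(-t.1, t.2), by simpa [refl_apply] using ht, rfl⟩
    rw [this, this, R.image_fst]
  image_snd := by
    have : ∀ A : Set Torus, Prod.snd '' (refl ⁻¹' A) = Prod.snd '' A := by
      intro A
      ext θ
      constructor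
      · rintro ⟨t, ht, rfl⟩
        exact ⟨refl t, ht, rfl⟩
      · rintro ⟨t, ht, rfl⟩
        exact ⟨(-t.1, t.2), by simpa [refl_apply] using ht, rfl⟩
    rw [this, this, R.image_snd]
  injOn_fst_pos s hs t ht e := refl.injective (R.injOn_fst_pos hs ht (congrArg Neg.neg e))
  injOn_fst_neg s hs t ht e := refl.injective (R.injOn_fst_neg hs ht (congrArg Neg.neg e))
  injOn_snd_pos s hs t ht e := refl.injective (R.injOn_snd_pos hs ht e)
  injOn_snd_neg s hs t ht e := refl.injective (R.injOn_snd_neg hs ht e)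

theorem verts_reflect (R : RectDiagram) : R.reflect.verts = refl ⁻¹' R.verts := rfl

theorem reflect_reflect (R : RectDiagram) : R.reflect.reflect = R := by
  have : ∀ A : Set Torus, refl ⁻¹' (refl ⁻¹' A) = A := by
    intro A; ext ⟨x, y⟩; simp [refl_apply]
  exact RectDiagram.ext (this _) (this _)

variable {R₁ R₂ : RectDiagram} {θ₁ θ₂ φ₁ φ₂ : Real.Angle}

theorem refl_preimage_corners (θ₁ θ₂ φ₁ φ₂ : Real.Angle) :
    refl ⁻¹' (({θ₁, θ₂} : Set Real.Angle) ×ˢ {φ₁, φ₂}) = ({-θ₂, -θ₁} : Set Real.Angle) ×ˢ {φ₁, φ₂} := by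
  ext ⟨x, y⟩
  simp only [Set.mem_preimage, refl_apply, Set.mem_prod, Set.mem_insert_iff, Set.mem_singleton_iff,
    neg_eq_iff_eq_neg, or_comm (a := x = -θ₁)]

theorem refl_preimage_rect (θ₁ θ₂ φ₁ φ₂ : Real.Angle) :
    refl ⁻¹' rect θ₁ θ₂ φ₁ φ₂ = rect (-θ₂) (-θ₁) φ₁ φ₂ := by
  ext ⟨x, y⟩
  refine and_congr_left fun _ => ?_
  rw [← neg_mem_cIcc_neg]
  simp [refl_apply]

theorem IsElementaryMoveAt.reflect (h : IsElementaryMoveAt R₁ R₂ θ₁ θ₂ φ₁ φ₂) :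
    IsElementaryMoveAt R₁.reflect R₂.reflect (-θ₂) (-θ₁) φ₁ φ₂ where
  ne_fst := fun e => h.ne_fst (neg_injective e.symm)
  ne_snd := h.ne_snd
  symmDiff_eq := by rw [← refl_preimage_corners, ← h.symmDiff_eq]; rfl
  rect_inter := by
    rw [← refl_preimage_rect]
    exact congrArg (refl ⁻¹' ·) h.rect_inter
  consecutive := by
    obtain ⟨i, hi⟩ := h.consecutive
    have key : ∀ A : Set Torus, R₁.verts ∩ Set.range (corner θ₁ θ₂ φ₁ φ₂) = A →
        R₁.reflect.verts ∩ Set.range (corner (-θ₂) (-θ₁) φ₁ φ₂) = refl ⁻¹' A := by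
      rintro A rfl
      rw [range_corner, range_corner, Set.preimage_inter, refl_preimage_corners]
      rfl
    have e : ∀ k, refl ⁻¹' {corner θ₁ θ₂ φ₁ φ₂ k} = {corner (-θ₂) (-θ₁) φ₁ φ₂ (1 - k)} := by
      intro k
      ext ⟨x, y⟩
      fin_cases k <;> simp [corner, Prod.ext_iff, refl_apply, neg_eq_iff_eq_neg]
    rcases hi with hi | hi | hi
    · exact ⟨1 - i, .inl ((key _ hi).trans (e i))⟩
    · refine ⟨-i, .inr (.inl ((key _ hi).trans ?_))⟩
      have e₁ : -i + 1 = 1 - i := by fin_cases i <;> rfl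
      have e₂ : 1 - (i + 1) = -i := by fin_cases i <;> rfl
      rw [Set.insert_eq, Set.preimage_union, e, e, Set.union_comm, Set.insert_eq, e₁, e₂]
    · refine ⟨-i - 1, .inr (.inr ((key _ hi).trans ?_))⟩
      have e₁ : -i - 1 + 1 = 1 - (i + 1) := by fin_cases i <;> rfl
      have e₂ : 1 - (i + 2) = -i - 1 := by fin_cases i <;> rfl
      have e₃ : -i - 1 + 2 = 1 - i := by fin_cases i <;> rfl
      rw [Set.insert_eq, Set.insert_eq, Set.preimage_union, Set.preimage_union, e, e, e,
        Set.insert_eq, Set.insert_eq, Set.union_comm, Set.union_comm {_}, Set.union_assoc, e₁, e₂,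
        e₃]
  orientation := congrArg (refl ⁻¹' ·) h.orientation

theorem IsElementaryMoveAt.flip (h : IsElementaryMoveAt R₁ R₂ θ₁ θ₂ φ₁ φ₂) :
    IsElementaryMoveAt R₁.flip R₂.flip θ₁ θ₂ φ₁ φ₂ := by
  refine ⟨h.ne_fst, h.ne_snd, by simpa only [verts_flip] using h.symmDiff_eq,
    by simpa only [verts_flip] using h.rect_inter, by simpa only [verts_flip] using h.consecutive, ?_⟩
  have hd : ∀ t, t ∈ R₁.pos → t ∉ R₁.neg := fun _ => (Set.disjoint_left.1 R₁.disjoint ·)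
  have hd' : ∀ t, t ∈ R₂.pos → t ∉ R₂.neg := fun _ => (Set.disjoint_left.1 R₂.disjoint ·)
  ext t
  have ho : t ∈ R₁.pos ∧ t ∈ R₂.verts ↔ t ∈ R₁.verts ∧ t ∈ R₂.pos := by
    rw [← Set.mem_inter_iff, h.orientation, Set.mem_inter_iff]
  have h₁ := hd t
  have h₂ := hd' t
  rw [verts_flip, verts_flip, Set.mem_inter_iff, Set.mem_inter_iff]
  change t ∈ R₁.neg ∧ _ ↔ _ ∧ t ∈ R₂.neg
  rw [mem_verts, mem_verts] at *
  grind

theorem ncard_reflect (R : RectDiagram) : R.reflect.verts.ncard = R.verts.ncard := by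
  rw [verts_reflect, ← Equiv.image_symm_eq_preimage,
    Set.ncard_image_of_injective _ refl.symm.injective]

theorem IsExchange.reflect (h : IsExchange R₁ R₂) : IsExchange R₁.reflect R₂.reflect := by
  obtain ⟨⟨θ₁, θ₂, φ₁, φ₂, h⟩, hc⟩ := h
  exact ⟨⟨_, _, _, _, h.reflect⟩, by rw [ncard_reflect, ncard_reflect, hc]⟩

theorem IsExchange.flip (h : IsExchange R₁ R₂) : IsExchange R₁.flip R₂.flip := by
  obtain ⟨⟨θ₁, θ₂, φ₁, φ₂, h⟩, hc⟩ := h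
  exact ⟨⟨_, _, _, _, h.flip⟩, by rw [verts_flip, verts_flip, hc]⟩

/-- The type with the opposite arrow. -/
def _root_.StabType.flip : StabType → StabType
  | .rightI => .leftI
  | .leftI => .rightI
  | .rightII => .leftII
  | .leftII => .rightII

/-- The type of the mirror image. -/
def _root_.StabType.reflect : StabType → StabType
  | .rightI => .leftII
  | .leftI => .rightII
  | .rightII => .leftI
  | .leftII => .rightI

theorem IsStabilization.flip {T : StabType} (h : IsStabilization T R₁ R₂) :
    IsStabilization T.flip R₁.flip R₂.flip := by
  obtain ⟨θ₁, θ₂, φ₁, φ₂, hm, hc, ⟨v, hv, hvr⟩, φ₀, hφ₀, hsub, hsign⟩ := h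
  refine ⟨θ₁, θ₂, φ₁, φ₂, hm.flip, by rw [verts_flip, verts_flip, hc],
    ⟨v, ?_, by rw [verts_flip, hvr]⟩, φ₀, hφ₀, by rwa [verts_flip], ?_⟩
  · cases T <;> exact hv
  · cases T <;> exact hsign

theorem IsStabilization.reflect {T : StabType} (h : IsStabilization T R₁ R₂) :
    IsStabilization T.reflect R₁.reflect R₂.reflect := by
  obtain ⟨θ₁, θ₂, φ₁, φ₂, hm, hc, ⟨v, hv, hvr⟩, φ₀, hφ₀, hsub, hsign⟩ := h
  have h₁ : (θ₁, φ₀) ∈ R₂.verts := hsub ⟨.inl rfl, rfl⟩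
  refine ⟨-θ₂, -θ₁, φ₁, φ₂, hm.reflect, by rw [ncard_reflect, ncard_reflect, hc],
    ⟨refl v, ?_, ?_⟩, φ₀, hφ₀, ?_, ?_⟩
  · cases T <;> simp only [StabType.corners, StabType.reflect, Set.mem_insert_iff,
      Set.mem_singleton_iff] at hv ⊢ <;> rcases hv with rfl | rfl <;> simp [refl_apply]
  · rw [← refl_preimage_rect, verts_reflect, ← Set.preimage_inter, hvr]
    ext ⟨x, y⟩
    simp [refl_apply, Prod.ext_iff, neg_eq_iff_eq_neg]
  · rintro ⟨x, y⟩ ⟨hx, rfl⟩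
    simp only [Set.mem_insert_iff, Set.mem_singleton_iff] at hx
    refine hsub ⟨?_, rfl⟩
    rcases hx with rfl | rfl <;> simp [refl_apply]
  · have e : refl (-θ₁, φ₀) = (θ₁, φ₀) := by simp [refl_apply]
    cases T <;> refine Set.mem_preimage.2 (e ▸ ?_)
    exacts [neg_of_pos_snd hsign h₁ hm.ne_fst, pos_of_neg_snd hsign h₁ hm.ne_fst,
      neg_of_pos_snd hsign h₁ hm.ne_fst, pos_of_neg_snd hsign h₁ hm.ne_fst]

/-- A symmetry that respects exchanges and turns stabilizations of type `T` into those of type `T'`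
respects the equivalences. -/
theorem moveSetoid_map {T T' : StabType} {τ : RectDiagram → RectDiagram}
    (he : ∀ {R R'}, IsExchange R R' → IsExchange (τ R) (τ R'))
    (hs : ∀ {R R'}, IsStabilization T R R' → IsStabilization T' (τ R) (τ R')) {R R' : RectDiagram}
    (h : (moveSetoid {T}).r R R') : (moveSetoid {T'}).r (τ R) (τ R') := by
  change Relation.EqvGen _ R R' at h
  induction h with
  | rel _ _ h =>
    refine .rel _ _ ?_
    rcases h with h | ⟨_, rfl, h | h⟩
    exacts [.inl (he h), .inr ⟨_, rfl, .inl (hs h)⟩, .inr ⟨_, rfl, .inr (hs h)⟩]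
  | refl R => exact .refl _
  | symm _ _ _ ih => exact .symm _ _ ih
  | trans _ _ _ _ _ ih ih' => exact .trans _ _ _ ih ih'

theorem moveSetoid_flip {T : StabType} {R R' : RectDiagram} :
    (moveSetoid {T.flip}).r R.flip R'.flip ↔ (moveSetoid {T}).r R R' := by
  refine ⟨fun h => ?_, fun h => moveSetoid_map .flip .flip h⟩
  have := moveSetoid_map (T' := T.flip.flip) .flip .flip h
  have e : T.flip.flip = T := by cases T <;> rfl
  rwa [e] at this

theorem moveSetoid_reflect {T : StabType} {R R' : RectDiagram} :
    (moveSetoid {T.reflect}).r R.reflect R'.reflect ↔ (moveSetoid {T}).r R R' := by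
  refine ⟨fun h => ?_, fun h => moveSetoid_map .reflect .reflect h⟩
  have := moveSetoid_map (T' := T.reflect.reflect) .reflect .reflect h
  have e : T.reflect.reflect = T := by cases T <;> rfl
  rwa [e, reflect_reflect, reflect_reflect] at this

/-- The symmetry that turns the type into `←II`. -/
def normalize : StabType → RectDiagram → RectDiagram
  | .leftII, R => R
  | .rightII, R => R.flip
  | .rightI, R => R.reflect
  | .leftI, R => R.reflect.flip

/-- The equivalence for any type reduces to the one for `←II`. -/
theorem moveSetoid_iff_related {T : StabType} {R R' : RectDiagram} :
    (moveSetoid {T}).r R R' ↔ Related (normalize T R) (normalize T R') := by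
  cases T
  · exact moveSetoid_reflect.symm
  · exact moveSetoid_reflect.symm.trans moveSetoid_flip.symm
  · exact moveSetoid_flip.symm
  · exact Iff.rfl

end RectDiagram

open RectDiagram

/-- The reversal of the orientation reverses all jumps. -/
theorem HasWord.flip {R : RectDiagram} {w : List (ℕ × ℕ)} (h : HasWord R w) :
    HasWord R.flip (w.map Prod.swap) := by
  obtain ⟨b, L, y, hL, hw, hy⟩ := h
  refine ⟨b, L.map (Prod.map id Prod.swap), y, .of_columns (List.pairwise_map.2 hL.sorted) ?_ ?_ ?_,
    ?_, hy.mono ?_⟩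
  · intro c hc
    obtain ⟨d, hd, rfl⟩ := List.mem_map.1 hc
    exact ⟨hL.mem_Ico₂ hd, hL.mem_Ico₁ hd⟩
  · intro c hc
    obtain ⟨d, hd, rfl⟩ := List.mem_map.1 hc
    exact ⟨hL.neg_mem hd, hL.pos_mem hd⟩
  · intro t ht
    rw [verts_flip] at ht
    obtain ⟨d, hd, e, -⟩ := hL.mem_verts.1 ht
    exact ⟨_, List.mem_map_of_mem hd, e⟩
  · have := congrArg (List.map Prod.swap) hw
    simpa [relabel, Function.comp_def, Prod.swap, Prod.map] using this
  · intro l hl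
    obtain ⟨j, hj, e⟩ := mem_labels.1 hl
    obtain ⟨k, hk, rfl⟩ := List.mem_map.1 hj
    exact mem_labels.2 ⟨k, hk, e.symm⟩

/-- The reflection reverses the order of the columns. -/
theorem HasWord.reflect {R : RectDiagram} {w : List (ℕ × ℕ)} (h : HasWord R w) :
    HasWord R.reflect w.reverse := by
  obtain ⟨b, L, y, hL, hw, hy⟩ := h
  refine ⟨b, (L.map fun c => (-c.1, c.2)).reverse, y, .of_columns ?_ ?_ ?_ ?_, ?_, hy.mono ?_⟩
  · rw [List.pairwise_reverse, List.pairwise_map]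
    exact hL.sorted.imp fun ⟨h₁, h₂⟩ => ⟨neg_lt_neg h₁, by simp only; linarith⟩
  · intro c hc
    obtain ⟨d, hd, rfl⟩ := List.mem_map.1 (List.mem_reverse.1 hc)
    exact ⟨hL.mem_Ico₁ (c := d) hd, hL.mem_Ico₂ (c := d) hd⟩
  · intro c hc
    obtain ⟨d, hd, rfl⟩ := List.mem_map.1 (List.mem_reverse.1 hc)
    refine ⟨Set.mem_preimage.2 ?_, Set.mem_preimage.2 ?_⟩
    · simpa [refl_apply] using hL.pos_mem hd
    · simpa [refl_apply] using hL.neg_mem hd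
  · intro t ht
    obtain ⟨d, hd, e, -⟩ := (hL.mem_verts (t := refl t)).1 ht
    refine ⟨_, List.mem_reverse.2 (List.mem_map_of_mem hd), ?_⟩
    rw [Real.Angle.coe_neg, ← e, refl_apply, neg_neg]
  · have := congrArg List.reverse hw
    simpa [relabel, Function.comp_def] using this
  · intro l hl
    obtain ⟨j, hj, e⟩ := mem_labels.1 hl
    exact mem_labels.2 ⟨j, List.mem_reverse.1 hj, e⟩

/-- The effect of the symmetry that turns the type into `←II` on the words of drawings. -/
def normalizeWord : StabType → List (ℕ × ℕ) → List (ℕ × ℕ)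
  | .leftII, w => w
  | .rightII, w => w.map Prod.swap
  | .rightI, w => w.reverse
  | .leftI, w => w.reverse.map Prod.swap

theorem HasWord.normalize {R : RectDiagram} {w : List (ℕ × ℕ)} (h : HasWord R w) (T : StabType) :
    HasWord (normalize T R) (normalizeWord T w) := by
  cases T
  exacts [h.reflect, h.reflect.flip, h.flip, h]

theorem length_normalizeWord (T : StabType) (w : List (ℕ × ℕ)) :
    (normalizeWord T w).length = w.length := by
  cases T <;> simp [normalizeWord]

theorem labels_normalizeWord (T : StabType) (w : List (ℕ × ℕ)) :
    labels (normalizeWord T w) = labels w := by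
  have h₁ : ∀ w : List (ℕ × ℕ), labels w.reverse = labels w := fun w => by
    ext l; simp [mem_labels]
  have h₂ : ∀ w : List (ℕ × ℕ), labels (w.map Prod.swap) = labels w := fun w => by
    ext l
    simp only [mem_labels, List.mem_map, exists_exists_and_eq_and, Prod.fst_swap, Prod.snd_swap]
    exact exists_congr fun j => and_congr_right fun _ => or_comm
  cases T
  exacts [h₁ w, (h₂ _).trans (h₁ w), h₂ w, rfl]

open JumpWord RectDiagram

/-! ### Codes -/

namespace DiagramCode

/-- The jump of the `i`-th column of a code, if the code has such a column: from the row of the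
negative vertex to the row of the positive vertex. -/
def column (c : DiagramCode) (i : ℕ) : Option (ℕ × ℕ) :=
  (c.1.flatMap fun p => c.2.filterMap fun q =>
    if p.1 = i ∧ q.1 = i then some (q.2, p.2) else none).head?

/-- A bound for the numbers of the columns and of the rows. -/
def bound (c : DiagramCode) : ℕ := (c.1 ++ c.2).foldr (fun p n => p.1 + p.2 + 1 + n) 0

/-- The word of a code. -/
def word (c : DiagramCode) : List (ℕ × ℕ) := (List.range c.bound).filterMap c.column

theorem lt_bound {c : DiagramCode} {p : ℕ × ℕ} (hp : p ∈ c.1 ∨ p ∈ c.2) :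
    p.1 < c.bound ∧ p.2 < c.bound := by
  have : ∀ l : List (ℕ × ℕ), p ∈ l → p.1 + p.2 < l.foldr (fun p n => p.1 + p.2 + 1 + n) 0 := by
    intro l hl
    induction l with
    | nil => simp at hl
    | cons q l ih =>
      rw [List.foldr_cons]
      rcases List.mem_cons.1 hl with rfl | hl
      · omega
      · have := ih hl; omega
  have := this (c.1 ++ c.2) (List.mem_append.2 hp)
  unfold bound
  omega

theorem mem_of_column {c : DiagramCode} {i : ℕ} {j : ℕ × ℕ} (h : c.column i = some j) :
    (i, j.2) ∈ c.1 ∧ (i, j.1) ∈ c.2 := by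
  have := List.mem_of_head? h
  simp only [List.mem_flatMap, List.mem_filterMap, Option.ite_none_right_eq_some,
    Option.some.injEq] at this
  obtain ⟨p, hp, q, hq, ⟨rfl, e⟩, rfl⟩ := this
  exact ⟨hp, by simpa [← e] using hq⟩

theorem exists_column {c : DiagramCode} {i y z : ℕ} (hp : (i, y) ∈ c.1) (hq : (i, z) ∈ c.2) :
    ∃ j, c.column i = some j := by
  rw [column, ← Option.isSome_iff_exists, List.isSome_head?]
  exact List.ne_nil_of_mem (a := (z, y))
    (List.mem_flatMap.2 ⟨_, hp, List.mem_filterMap.2 ⟨_, hq, by simp⟩⟩)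

theorem length_word (c : DiagramCode) : c.word.length ≤ c.bound :=
  (List.length_filterMap_le _ _).trans (by simp)

theorem labels_word (c : DiagramCode) : labels c.word ⊆ Finset.range c.bound := by
  intro l hl
  obtain ⟨j, hj, e⟩ := mem_labels.1 hl
  obtain ⟨i, -, hi⟩ := List.mem_filterMap.1 hj
  have := mem_of_column hi
  rw [Finset.mem_range]
  rcases e with rfl | rfl
  exacts [(lt_bound (.inr this.2)).2, (lt_bound (.inl this.1)).2]

/-- The word of a code is the word of a drawing of each diagram that the code describes. -/
theorem Describes.hasWord {c : DiagramCode} {R : RectDiagram} (h : c.Describes R) :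
    HasWord R c.word := by
  obtain ⟨a, b, x, y, hx, hxa, hy, hyb, hp, hn⟩ := h
  have hinj : ∀ {i k : ℕ}, (x i : Real.Angle) = x k → i = k := fun e =>
    hx.injective ((coe_inj_of_mem_Ico (hxa _) (hxa _)).1 e)
  have hmem : ∀ d, d ∈ (List.range c.bound).filterMap (fun i => (c.column i).map fun j =>
      (x i, y j.1, y j.2)) ↔ ∃ i j, c.column i = some j ∧ (x i, y j.1, y j.2) = d := by
    intro d
    simp only [List.mem_filterMap, Option.map_eq_some_iff, List.mem_range]
    constructor
    · rintro ⟨i, -, j, h⟩; exact ⟨i, j, h⟩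
    · rintro ⟨i, j, h⟩; exact ⟨i, (lt_bound (.inl (mem_of_column h.1).1)).1, j, h⟩
  refine ⟨b, (List.range c.bound).filterMap fun i => (c.column i).map fun j =>
    (x i, y j.1, y j.2), y, .of_columns ?_ ?_ ?_ ?_, ?_, hy.strictMonoOn _⟩
  · rw [List.pairwise_filterMap]
    refine List.pairwise_lt_range.imp fun {i k} hik d hd e he => ?_
    simp only [Option.map_eq_some_iff] at hd he
    obtain ⟨j, -, rfl⟩ := hd
    obtain ⟨l, -, rfl⟩ := he
    exact ⟨hx hik, by linarith [(hxa i).1, (hxa k).2]⟩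
  · intro d hd
    obtain ⟨i, j, -, rfl⟩ := (hmem d).1 hd
    exact ⟨hyb _, hyb _⟩
  · intro d hd
    obtain ⟨i, j, h, rfl⟩ := (hmem d).1 hd
    rw [hp, hn]
    exact ⟨⟨_, (mem_of_column h).1, rfl⟩, ⟨_, (mem_of_column h).2, rfl⟩⟩
  · intro t ht
    obtain ⟨φ₁, φ₂, -, h₁, h₂⟩ := exists_pos_neg_of_mem_verts ht
    rw [hp] at h₁
    rw [hn] at h₂
    obtain ⟨p, hp', e₁⟩ := h₁
    obtain ⟨q, hq', e₂⟩ := h₂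
    obtain ⟨e₁, -⟩ := Prod.mk.inj e₁
    obtain ⟨e₂, -⟩ := Prod.mk.inj e₂
    have e : q.1 = p.1 := hinj (e₂.symm.trans e₁)
    obtain ⟨j, hj⟩ := exists_column (c := c) (i := p.1) hp' (z := q.2) (by rw [← e]; exact hq')
    exact ⟨_, (hmem _).2 ⟨p.1, j, hj, rfl⟩, e₁⟩
  · rw [List.map_filterMap, relabel, word, List.map_filterMap]
    refine List.filterMap_congr fun i _ => ?_
    cases c.column i <;> rfl

/-- An increasing list of numbers extends to an increasing sequence. -/
theorem exists_strictMono {a : ℝ} {l : List ℝ} (hl : l.Pairwise (· < ·))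
    (hI : ∀ r ∈ l, r ∈ Set.Ico a (a + 2 * Real.pi)) : ∃ x : ℕ → ℝ, StrictMono x ∧
      (∀ i, x i ∈ Set.Ico a (a + 2 * Real.pi)) ∧ ∀ i (hi : i < l.length), x i = l[i] := by
  have hp := Real.two_pi_pos
  obtain ⟨s, hs, hls⟩ := exists_lt_forall_gt (a + 2 * Real.pi) (a :: l) (by
    intro r hr
    rcases List.mem_cons.1 hr with rfl | hr
    · linarith
    · exact (hI r hr).2)
  have has : a < s := hls a List.mem_cons_self
  set e := a + 2 * Real.pi with he
  -- The continuation of the sequence, which increases from `s` to `e`.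
  set f : ℕ → ℝ := fun k => e - (e - s) / (k + 1) with hf
  have f₁ : StrictMono f := by
    refine strictMono_nat_of_lt_succ fun k => ?_
    have : (e - s) / ((k + 1 : ℕ) + 1) < (e - s) / (k + 1) := by
      refine div_lt_div_of_pos_left (by linarith) (by positivity) (by push_cast; linarith)
    simp only [hf]
    linarith
  have f₂ : ∀ k, s ≤ f k := fun k => by
    have := f₁.monotone (Nat.zero_le k)
    simpa [hf] using this
  have f₃ : ∀ k, f k < e := fun k => by
    have : 0 < (e - s) / (k + 1) := by
      have : 0 < e - s := by linarith
      positivity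
    simp only [hf]
    linarith
  refine ⟨fun i => if hi : i < l.length then l[i] else f i, fun i k hik => ?_, fun i => ?_,
    fun i hi => dif_pos hi⟩
  · simp only
    split_ifs with h₁ h₂ h₂
    · exact List.pairwise_iff_getElem.1 hl i k h₁ h₂ hik
    · exact (hls _ (List.mem_cons_of_mem _ (List.getElem_mem h₁))).trans_le (f₂ k)
    · omega
    · exact f₁ hik
  · simp only
    split_ifs with h₁
    · exact hI _ (List.getElem_mem h₁)
    · exact ⟨has.le.trans (f₂ i), f₃ i⟩

/-- The columns are numbered by their positions in a drawing, and the rows by their ranks. -/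
theorem exists_describes (R : RectDiagram) : ∃ c : DiagramCode, c.Describes R := by
  obtain ⟨L, hL, hLI⟩ := IsDrawing.exists_of_cut R 0 0
  obtain ⟨x, hx, hxI, hxL⟩ := exists_strictMono (l := L.map Prod.fst) (a := 0)
    (List.pairwise_map.2 (hL.sorted.imp And.left)) (by
      intro r hr
      obtain ⟨c, hc, rfl⟩ := List.mem_map.1 hr
      exact hLI c hc)
  set H := (labels (L.map Prod.snd)).sort with hH
  obtain ⟨y, hy, hyI, hyL⟩ := exists_strictMono (l := H) (a := 0)
    (labels (L.map Prod.snd)).sortedLT_sort.pairwise (by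
      intro r hr
      exact hL.mem_Ico r ((Finset.mem_sort _).1 hr))
  have hrow : ∀ r ∈ labels (L.map Prod.snd), y (H.idxOf r) = r := by
    intro r hr
    have : H.idxOf r < H.length := List.idxOf_lt_length_iff.2 ((Finset.mem_sort _).2 hr)
    rw [hyL _ this, List.getElem_idxOf]
  have key : ∀ f : ℝ × ℝ → ℝ, (∀ c ∈ L, f c.2 ∈ labels (L.map Prod.snd)) →
      {t : Torus | ∃ c ∈ L, t = ((c.1 : Real.Angle), (f c.2 : Real.Angle))} =
      {t | ∃ p ∈ L.zipIdx.map fun c => (c.2, H.idxOf (f c.1.2)),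
        t = ((x p.1 : Real.Angle), (y p.2 : Real.Angle))} := by
    intro f hf
    have hcol : ∀ c k, L[k]? = some c → x k = c.1 := by
      intro c k hk
      obtain ⟨hk', e⟩ := List.getElem?_eq_some_iff.1 hk
      rw [hxL k (by simpa using hk')]
      simp [e]
    ext t
    constructor
    · rintro ⟨c, hc, rfl⟩
      obtain ⟨k, hk⟩ := List.mem_iff_getElem?.1 hc
      refine ⟨_, List.mem_map_of_mem (List.mem_zipIdx_iff_getElem? (x := (c, k)) |>.2 hk), ?_⟩
      simp only [hcol c k hk, hrow _ (hf c hc)]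
    · rintro ⟨_, hp, rfl⟩
      obtain ⟨⟨c, k⟩, hck, rfl⟩ := List.mem_map.1 hp
      have hk := List.mem_zipIdx_iff_getElem?.1 hck
      have hc := List.mem_of_getElem? hk
      exact ⟨c, hc, by simp only [hcol c k hk, hrow _ (hf c hc)]⟩
  refine ⟨(L.zipIdx.map fun c => (c.2, H.idxOf c.1.2.2), L.zipIdx.map fun c => (c.2, H.idxOf c.1.2.1)),
    0, 0, x, y, hx, hxI, hy, hyI, ?_, ?_⟩
  · exact hL.pos_eq.trans (key Prod.snd fun c hc =>
      mem_labels.2 ⟨c.2, List.mem_map_of_mem hc, .inr rfl⟩)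
  · exact hL.neg_eq.trans (key Prod.fst fun c hc =>
      mem_labels.2 ⟨c.2, List.mem_map_of_mem hc, .inl rfl⟩)

end DiagramCode

/-! ### Primitive recursive predicates -/

-- Primitive recursion becomes a property of functions that `fun_prop` can prove.
attribute [fun_prop] Primrec
attribute [fun_prop] PrimrecPred
attribute [fun_prop] Primrec.id Primrec.const Primrec.comp Primrec.fst Primrec.snd Primrec.pair
attribute [fun_prop] PrimrecPred.and PrimrecPred.or PrimrecPred.not

namespace Search

section Primrec

variable {α β γ : Type*} [Primcodable α] [Primcodable β] [Primcodable γ]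

@[fun_prop] theorem primrec_cons {f : α → β} {g : α → List β} (hf : Primrec f) (hg : Primrec g) :
    Primrec fun a => f a :: g a := Primrec.list_cons.comp hf hg

@[fun_prop] theorem primrec_append {f g : α → List β} (hf : Primrec f) (hg : Primrec g) :
    Primrec fun a => f a ++ g a := Primrec.list_append.comp hf hg

@[fun_prop] theorem primrec_map {f : α → List β} {g : α → β → γ} (hf : Primrec f)
    (hg : Primrec fun x : α × β => g x.1 x.2) : Primrec fun a => (f a).map (g a) :=
  Primrec.list_map hf hg

@[fun_prop] theorem primrec_flatMap {f : α → List β} {g : α → β → List γ} (hf : Primrec f)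
    (hg : Primrec fun x : α × β => g x.1 x.2) : Primrec fun a => (f a).flatMap (g a) :=
  Primrec.list_flatMap hf hg

@[fun_prop] theorem primrec_filterMap {f : α → List β} {g : α → β → Option γ} (hf : Primrec f)
    (hg : Primrec fun x : α × β => g x.1 x.2) : Primrec fun a => (f a).filterMap (g a) :=
  Primrec.listFilterMap hf hg

@[fun_prop] theorem primrec_foldl {f : α → List β} {g : α → γ} {h : α → γ → β → γ}
    (hf : Primrec f) (hg : Primrec g) (hh : Primrec fun x : α × γ × β => h x.1 x.2.1 x.2.2) :
    Primrec fun a => (f a).foldl (h a) (g a) :=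
  Primrec.list_foldl (h := fun a x => h a x.1 x.2) hf hg hh

@[fun_prop] theorem primrec_foldr {f : α → List β} {g : α → γ} {h : α → β → γ → γ}
    (hf : Primrec f) (hg : Primrec g) (hh : Primrec fun x : α × β × γ => h x.1 x.2.1 x.2.2) :
    Primrec fun a => (f a).foldr (h a) (g a) :=
  Primrec.list_foldr (h := fun a x => h a x.1 x.2) hf hg hh

@[fun_prop] theorem primrec_ite {p : α → Prop} [DecidablePred p] {f g : α → β}
    (hp : PrimrecPred p) (hf : Primrec f) (hg : Primrec g) :
    Primrec fun a => if p a then f a else g a := Primrec.ite hp hf hg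

@[fun_prop] theorem primrec_some {f : α → β} (hf : Primrec f) : Primrec fun a => some (f a) :=
  Primrec.option_some.comp hf

@[fun_prop] theorem primrec_range {f : α → ℕ} (hf : Primrec f) :
    Primrec fun a => List.range (f a) := Primrec.list_range.comp hf

@[fun_prop] theorem primrec_add {f g : α → ℕ} (hf : Primrec f) (hg : Primrec g) :
    Primrec fun a => f a + g a := Primrec.nat_add.comp hf hg

@[fun_prop] theorem primrec_mul {f g : α → ℕ} (hf : Primrec f) (hg : Primrec g) :
    Primrec fun a => f a * g a := Primrec.nat_mul.comp hf hg

@[fun_prop] theorem primrecPred_eq {f g : α → β} (hf : Primrec f) (hg : Primrec g) :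
    PrimrecPred fun a => f a = g a := Primrec.eq.comp hf hg

@[fun_prop] theorem primrecPred_lt {f g : α → ℕ} (hf : Primrec f) (hg : Primrec g) :
    PrimrecPred fun a => f a < g a := Primrec.nat_lt.comp hf hg

@[fun_prop] theorem primrecPred_imp {p q : α → Prop} (hp : PrimrecPred p) (hq : PrimrecPred q) :
    PrimrecPred fun a => p a → q a := (hp.not.or hq).of_eq fun _ => imp_iff_not_or.symm

@[fun_prop] theorem primrecPred_iff {p q : α → Prop} (hp : PrimrecPred p) (hq : PrimrecPred q) :
    PrimrecPred fun a => p a ↔ q a :=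
  ((primrecPred_imp hp hq).and (primrecPred_imp hq hp)).of_eq fun _ => iff_def.symm

theorem primrecPred_exists_mem {l : α → List β} {p : α → β → Prop} (hl : Primrec l)
    (hp : PrimrecPred fun x : α × β => p x.1 x.2) : PrimrecPred fun a => ∃ b ∈ l a, p a b := by
  have : PrimrecRel fun (b : β) (a : α) => p a b := hp.comp (Primrec.snd.pair Primrec.fst)
  exact this.exists_mem_list.comp hl Primrec.id

theorem primrecPred_forall_mem {l : α → List β} {p : α → β → Prop} (hl : Primrec l)
    (hp : PrimrecPred fun x : α × β => p x.1 x.2) : PrimrecPred fun a => ∀ b ∈ l a, p a b := by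
  have : PrimrecRel fun (b : β) (a : α) => p a b := hp.comp (Primrec.snd.pair Primrec.fst)
  exact this.forall_mem_list.comp hl Primrec.id

@[fun_prop] theorem primrecPred_mem {f : α → β} {l : α → List β} (hf : Primrec f)
    (hl : Primrec l) : PrimrecPred fun a => f a ∈ l a :=
  (primrecPred_exists_mem (p := fun a b => b = f a) hl (by fun_prop)).of_eq fun a => by simp

theorem primrec_filter {l : α → List β} {p : α → β → Prop} [∀ a, DecidablePred (p a)]
    (hl : Primrec l) (hp : PrimrecPred fun x : α × β => p x.1 x.2) :
    Primrec fun a => (l a).filter (p a) := by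
  have : Primrec fun a => (l a).filterMap fun b => if p a b then some b else none :=
    primrec_filterMap hl (primrec_ite hp (by fun_prop) (by fun_prop))
  refine this.of_eq fun a => ?_
  rw [← List.filterMap_eq_filter]
  refine List.filterMap_congr fun b _ => ?_
  by_cases h : p a b <;> simp [Option.guard, h]

end Primrec

/-! ### Enumerations -/

/-- The sublists of a list. -/
def subs {β : Type*} (l : List β) : List (List β) :=
  l.foldr (fun b r => r ++ r.map fun s => b :: s) [[]]

theorem mem_subs {β : Type*} {l s : List β} : s ∈ subs l ↔ s.Sublist l := by
  induction l generalizing s with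
  | nil => simp [subs]
  | cons b l ih =>
    rw [subs, List.foldr_cons, ← subs, List.mem_append, ih, List.sublist_cons_iff]
    simp only [List.mem_map, ih]
    grind

@[fun_prop] theorem primrec_subs {α β : Type*} [Primcodable α] [Primcodable β] {f : α → List β}
    (hf : Primrec f) : Primrec fun a => subs (f a) := by
  unfold subs
  fun_prop

/-- The lists of length at most `k` with elements from `l`. -/
def listsUpTo {β : Type*} (l : List β) (k : ℕ) : List (List β) :=
  (List.range k).foldl (fun r _ => [] :: l.flatMap fun b => r.map fun s => b :: s) [[]]

theorem mem_listsUpTo {β : Type*} {l s : List β} {k : ℕ} :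
    s ∈ listsUpTo l k ↔ s.length ≤ k ∧ ∀ b ∈ s, b ∈ l := by
  induction k generalizing s with
  | zero => simp +contextual [listsUpTo]
  | succ k ih =>
    rw [listsUpTo, List.range_succ, List.foldl_append, ← listsUpTo]
    simp only [List.foldl_cons, List.foldl_nil, List.mem_cons, List.mem_flatMap, List.mem_map, ih]
    cases s with
    | nil => simp
    | cons b s => grind

@[fun_prop] theorem primrec_listsUpTo {α β : Type*} [Primcodable α] [Primcodable β]
    {f : α → List β} {g : α → ℕ} (hf : Primrec f) (hg : Primrec g) :
    Primrec fun a => listsUpTo (f a) (g a) := by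
  unfold listsUpTo
  fun_prop

/-- The pairs of numbers below `M`. -/
def pairs (M : ℕ) : List (ℕ × ℕ) :=
  (List.range M).flatMap fun x => (List.range M).map fun y => (x, y)

theorem mem_pairs {M : ℕ} {j : ℕ × ℕ} : j ∈ pairs M ↔ j.1 < M ∧ j.2 < M := by
  simp only [pairs, List.mem_flatMap, List.mem_map, List.mem_range]
  grind

@[fun_prop] theorem primrec_pairs {α : Type*} [Primcodable α] {f : α → ℕ} (hf : Primrec f) :
    Primrec fun a => pairs (f a) := by
  unfold pairs
  fun_prop

/-- The words of length at most `Q` with levels below `M`. -/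
def words (M Q : ℕ) : List (List (ℕ × ℕ)) := listsUpTo (pairs M) Q

/-- The states with levels below `M` whose words have length at most `Q`; the sets of occupied
levels are given by lists. -/
def states (M Q : ℕ) : List (List ℕ × List (ℕ × ℕ)) :=
  (subs (List.range M)).flatMap fun S => (words M Q).map fun w => (S, w)

@[fun_prop] theorem primrec_states {α : Type*} [Primcodable α] {f g : α → ℕ} (hf : Primrec f)
    (hg : Primrec g) : Primrec fun a => states (f a) (g a) := by
  unfold states words
  fun_prop

end Search

open JumpWord

namespace Search

/-! ### A search in the finite graph of bounded states -/

/-- The state that is given by a list of occupied levels and a word. -/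
def toState (c : List ℕ × List (ℕ × ℕ)) : Finset ℕ × List (ℕ × ℕ) := (c.1.toFinset, c.2)

/-- The list of states is complete. -/
theorem exists_mem_states {M Q : ℕ} {c : Finset ℕ × List (ℕ × ℕ)} (h : Bounded M Q c) :
    ∃ c' ∈ states M Q, toState c' = c := by
  refine ⟨((List.range M).filter (· ∈ c.1), c.2), ?_, ?_⟩
  · simp only [states, List.mem_flatMap, List.mem_map, mem_subs, words, mem_listsUpTo, mem_pairs]
    refine ⟨_, List.filter_sublist, c.2, ⟨h.2, fun j hj => ?_⟩, rfl⟩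
    have := labels_subset_iff.1 (Finset.subset_union_right.trans h.1) j hj
    simpa using this
  · refine Prod.ext (Finset.ext fun l => ?_) rfl
    have : l ∈ c.1 → l < M := fun hl => by
      simpa using h.1 (Finset.mem_union_left _ hl)
    simpa [toState] using this

theorem bounded_toState {M Q : ℕ} {c : List ℕ × List (ℕ × ℕ)} (h : c ∈ states M Q) :
    Bounded M Q (toState c) := by
  simp only [states, List.mem_flatMap, List.mem_map, mem_subs, words, mem_listsUpTo,
    mem_pairs] at h
  obtain ⟨S, hS, w, ⟨hw, hw'⟩, rfl⟩ := h
  refine ⟨Finset.union_subset (fun l hl => ?_) (labels_subset_iff.2 fun j hj => ?_), hw⟩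
  · simpa using hS.subset (List.mem_toFinset.1 hl)
  · simpa using hw' j hj

/-- Two lists have the same elements. -/
def SameElements (l l' : List ℕ) : Prop := (∀ x ∈ l, x ∈ l') ∧ ∀ x ∈ l', x ∈ l

theorem sameElements_iff {l l' : List ℕ} : SameElements l l' ↔ l.toFinset = l'.toFinset := by
  simp only [SameElements, Finset.ext_iff, List.mem_toFinset]
  grind

/-- The occupied levels after a jump, as a list. -/
def moveList (S : List ℕ) (j : ℕ × ℕ) : List ℕ := j.2 :: S.filter (· ≠ j.1)

theorem toFinset_moveList (S : List ℕ) (j : ℕ × ℕ) :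
    (moveList S j).toFinset = move S.toFinset j := by
  ext l
  simp only [moveList, mem_move, List.mem_toFinset, List.mem_cons, List.mem_filter]
  grind

/-- The levels from `need w`, as a list. -/
def needList (w : List (ℕ × ℕ)) : List ℕ := w.foldr (fun j S => j.1 :: S.filter (· ≠ j.2)) []

theorem toFinset_needList (w : List (ℕ × ℕ)) : (needList w).toFinset = need w := by
  induction w with
  | nil => rfl
  | cons j w ih =>
    ext l
    simp only [needList, List.foldr_cons, mem_need_cons, ← ih, List.mem_toFinset, List.mem_cons,
      List.mem_filter]
    grind

/-- The occupied levels after the jumps of a word, and the assertion that the word is valid. -/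
def run (S : List ℕ) (w : List (ℕ × ℕ)) : List ℕ × Bool :=
  w.foldl (fun p j => (moveList p.1 j, if p.2 = true ∧ j.1 ∈ p.1 ∧ j.2 ∉ p.1 then true else false))
    (S, true)

/-- The word of the state is valid and returns to the occupied levels from which it starts. -/
def IsClosed (c : List ℕ × List (ℕ × ℕ)) : Prop :=
  (run c.1 c.2).2 = true ∧ SameElements (run c.1 c.2).1 c.1

theorem isClosed_iff {c : List ℕ × List (ℕ × ℕ)} : IsClosed c ↔ Closed (toState c) := by
  have key : ∀ (w : List (ℕ × ℕ)) (p : List ℕ × Bool),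
      ((w.foldl (fun p j => (moveList p.1 j,
        if p.2 = true ∧ j.1 ∈ p.1 ∧ j.2 ∉ p.1 then true else false)) p).2 = true ↔
        p.2 = true ∧ Valid p.1.toFinset w) ∧
      (w.foldl (fun p j => (moveList p.1 j,
        if p.2 = true ∧ j.1 ∈ p.1 ∧ j.2 ∉ p.1 then true else false)) p).1.toFinset =
        final p.1.toFinset w := by
    intro w
    induction w with
    | nil => simp
    | cons j w ih =>
      intro p
      rw [List.foldl_cons]
      obtain ⟨h, h'⟩ := ih (moveList p.1 j,
        if p.2 = true ∧ j.1 ∈ p.1 ∧ j.2 ∉ p.1 then true else false)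
      refine ⟨h.trans ?_, h'.trans ?_⟩
      · simp only [valid_cons, List.mem_toFinset, toFinset_moveList]
        split_ifs with hj <;> grind
      · rw [final_cons, toFinset_moveList]
  obtain ⟨h, h'⟩ := key c.2 (c.1, true)
  rw [IsClosed, Closed, sameElements_iff, run, h, h']
  simp [toState]

/-- Swaps and merges of jumps from `P`, with the rest of the word formed by words from `W`. -/
def IsLocal (P : List (ℕ × ℕ)) (W : List (List (ℕ × ℕ))) (v w : List (ℕ × ℕ)) : Prop :=
  ∃ α ∈ W, ∃ β ∈ W, ∃ j ∈ P, ∃ k ∈ P, v = α ++ j :: k :: β ∧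
    (Noncross j k ∧ w = α ++ k :: j :: β ∨
      j.2 = k.1 ∧ Cyc j.1 j.2 k.2 ∧ w = α ++ (j.1, k.2) :: β)

/-- The cyclic permutation of the jumps. -/
def IsRot (P : List (ℕ × ℕ)) (W : List (List (ℕ × ℕ))) (c d : List ℕ × List (ℕ × ℕ)) : Prop :=
  ∃ j ∈ P, ∃ w ∈ W, c.2 = j :: w ∧ d.2 = w ++ [j] ∧ SameElements d.1 (moveList c.1 j)

/-- The replacement of a level; the jumps `j`, `k`, `j'`, `k'` are `(a, y)`, `(x, a)`, `(b, y)`,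
`(x, b)` in the notation of `Step.row`. -/
def IsRow (P : List (ℕ × ℕ)) (W : List (List (ℕ × ℕ))) (c d : List ℕ × List (ℕ × ℕ)) : Prop :=
  ∃ β ∈ W, ∃ γ ∈ W, ∃ j ∈ P, ∃ k ∈ P, ∃ j' ∈ P, ∃ k' ∈ P,
    (j.1 = k.2 ∧ j'.1 = k'.2 ∧ j.2 = j'.2 ∧ k.1 = k'.1) ∧
    (j.1 ≠ j'.1 ∧ ¬ Arc j.1 j'.1 k.1 ∧ ¬ Arc j.1 j'.1 j.2) ∧
    (∀ i ∈ β, ¬ Arc j.1 j'.1 i.1 ∧ ¬ Arc j.1 j'.1 i.2) ∧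
    (∀ i ∈ γ, (j.1 ≠ i.1 ∧ j.1 ≠ i.2) ∧ j'.1 ≠ i.1 ∧ j'.1 ≠ i.2) ∧
    j'.1 ∉ c.1 ∧ c.2 = j :: (β ++ k :: γ) ∧ d.2 = j' :: (β ++ k' :: γ) ∧
    SameElements d.1 (moveList c.1 (j.1, j'.1))

/-- The levels of a state, as a list. -/
def suppList (c : List ℕ × List (ℕ × ℕ)) : List ℕ := c.1 ++ c.2.flatMap fun j => [j.1, j.2]

theorem mem_suppList {c : List ℕ × List (ℕ × ℕ)} {l : ℕ} :
    l ∈ suppList c ↔ l ∈ supp (toState c) := by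
  simp only [suppList, supp, toState, List.mem_append, List.mem_flatMap, Finset.mem_union,
    List.mem_toFinset, mem_labels]
  grind

/-- The entry of a list that serves as the table of a map. -/
def entry (F : List ℕ) (x : ℕ) : ℕ := F.getD x 0

/-- A change of the names of levels, given by a table from `G`. -/
def IsRelabel (G : List (List ℕ)) (c d : List ℕ × List (ℕ × ℕ)) : Prop :=
  ∃ F ∈ G, (∀ x ∈ suppList c, ∀ y ∈ suppList c, entry F x = entry F y → x = y) ∧
    (∀ x ∈ suppList c, ∀ y ∈ suppList c, ∀ z ∈ suppList c,
      (Cyc (entry F x) (entry F y) (entry F z) ↔ Cyc x y z)) ∧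
    SameElements d.1 (c.1.map fun x => entry F x) ∧
    d.2 = c.2.map fun j => (entry F j.1, entry F j.2)

/-- The edges of the graph of bounded states. -/
def Edge (M Q : ℕ) (c d : List ℕ × List (ℕ × ℕ)) : Prop :=
  IsClosed c ∧ (IsClosed d ∧ (IsLocal (pairs M) (words M Q) c.2 d.2 ∧ SameElements d.1 c.1 ∨
    IsRot (pairs M) (words M Q) c d ∨ IsRow (pairs M) (words M Q) c d) ∨
    IsRelabel (listsUpTo (List.range M) M) c d)

theorem mem_words {M Q : ℕ} {w : List (ℕ × ℕ)} :
    w ∈ words M Q ↔ w.length ≤ Q ∧ labels w ⊆ Finset.range M := by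
  simp only [words, mem_listsUpTo, labels_subset_iff, mem_pairs, Finset.mem_range]

theorem toState_eq_iff {d c : List ℕ × List (ℕ × ℕ)} :
    toState d = toState c ↔ d.2 = c.2 ∧ SameElements d.1 c.1 := by
  rw [sameElements_iff, toState, toState, Prod.mk.injEq, and_comm]

theorem step_of_isRow {P : List (ℕ × ℕ)} {W : List (List (ℕ × ℕ))}
    {c d : List ℕ × List (ℕ × ℕ)} (h : IsRow P W c d) : Step (toState c) (toState d) := by
  obtain ⟨β, -, γ, -, ⟨a, y⟩, -, ⟨x, a'⟩, -, ⟨b, y'⟩, -, ⟨x', b'⟩, -, ⟨e₁, e₂, e₃, e₄⟩,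
    ⟨hab, hx, hy⟩, hβ, hγ, hbS, hc, hd, hS⟩ := h
  simp only at e₁ e₂ e₃ e₄ hab hx hy hβ hγ hbS hS
  subst e₁ e₂ e₃ e₄
  have hc' : toState c = (c.1.toFinset, (a, y) :: (β ++ (x, a) :: γ)) := by rw [toState, hc]
  have hd' : toState d = (move c.1.toFinset (a, b), (b, y) :: (β ++ (x, b) :: γ)) := by
    rw [toState, hd, sameElements_iff.1 hS, toFinset_moveList]
  rw [hc', hd']
  refine .row _ β γ hab hx hy (fun l hl => ?_) (fun h => ?_) (fun h => ?_) (by simpa using hbS)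
  · obtain ⟨i, hi, rfl | rfl⟩ := mem_labels.1 hl
    exacts [(hβ i hi).1, (hβ i hi).2]
  · obtain ⟨i, hi, h | h⟩ := mem_labels.1 h
    exacts [(hγ i hi).1.1 h.symm, (hγ i hi).1.2 h.symm]
  · obtain ⟨i, hi, h | h⟩ := mem_labels.1 h
    exacts [(hγ i hi).2.1 h.symm, (hγ i hi).2.2 h.symm]

theorem natStep_of_edge {M Q : ℕ} {c d : List ℕ × List (ℕ × ℕ)} (h : Edge M Q c d) :
    NatStep (toState c) (toState d) := by
  obtain ⟨hc, ⟨hd, h⟩ | h⟩ := h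
  · refine .inl ⟨?_, isClosed_iff.1 hc, isClosed_iff.1 hd⟩
    obtain ⟨⟨α, -, β, -, ⟨x, y⟩, -, ⟨y', z⟩, -, e, h⟩, hS⟩ | ⟨j, -, w, -, e, e', hS⟩ | h := h
    · rw [toState, toState, sameElements_iff.1 hS, e]
      obtain ⟨h, e'⟩ | ⟨e₁, h, e'⟩ := h
      · rw [e']; exact .loc _ (.swap α β h)
      · simp only at e₁ h e'
        subst e₁
        rw [e']; exact .loc _ (.merge α β h)
    · rw [toState, toState, sameElements_iff.1 hS, e, e', toFinset_moveList]
      exact .rot _ _ _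
    · exact step_of_isRow h
  · obtain ⟨F, -, h₁, h₂, h₃, h₄⟩ := h
    refine .inr ⟨isClosed_iff.1 hc, entry F, ⟨fun x hx y hy e => ?_, fun x hx y hy z hz => ?_⟩, ?_⟩
    · exact h₁ x (mem_suppList.2 hx) y (mem_suppList.2 hy) e
    · exact h₂ x (mem_suppList.2 hx) y (mem_suppList.2 hy) z (mem_suppList.2 hz)
    · rw [toState, sameElements_iff.1 h₃, h₄]
      refine Prod.ext ?_ rfl
      ext l
      simp [mapState, toState]

/-- The search covers all moves between bounded states: the words, jumps and tables that occur in a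
move of bounded states are bounded too. -/
theorem edge_of_natStep {M Q : ℕ} {c d : List ℕ × List (ℕ × ℕ)} (hc : c ∈ states M Q)
    (hd : d ∈ states M Q) (h : NatStep (toState c) (toState d)) : Edge M Q c d := by
  have hcB := bounded_toState hc
  have hdB := bounded_toState hd
  have hcW : c.2 ∈ words M Q := mem_words.2 ⟨hcB.2, Finset.subset_union_right.trans hcB.1⟩
  have hdW : d.2 ∈ words M Q := mem_words.2 ⟨hdB.2, Finset.subset_union_right.trans hdB.1⟩
  have sub : ∀ {u v : List (ℕ × ℕ)}, u ∈ words M Q → v.Sublist u → v ∈ words M Q := by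
    intro u v hu hv
    rw [words, mem_listsUpTo] at hu ⊢
    exact ⟨hv.length_le.trans hu.1, fun b hb => hu.2 b (hv.subset hb)⟩
  have mem : ∀ {u : List (ℕ × ℕ)} {j : ℕ × ℕ}, u ∈ words M Q → j ∈ u → j ∈ pairs M :=
    fun hu hj => (mem_listsUpTo.1 hu).2 _ hj
  obtain ⟨h, hc', hd'⟩ | ⟨hc', f, hf, e⟩ := h
  · refine ⟨isClosed_iff.2 hc', .inl ⟨isClosed_iff.2 hd', ?_⟩⟩
    generalize ec : toState c = c₀ at h
    generalize ed : toState d = d₀ at h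
    cases h with
    | loc S h =>
      obtain ⟨rfl, rfl⟩ := Prod.ext_iff.1 ec
      obtain ⟨e, rfl⟩ := Prod.ext_iff.1 ed
      refine .inl ⟨?_, sameElements_iff.2 e⟩
      simp only [toState] at h
      generalize c.2 = v at h hcW
      generalize d.2 = w at h hdW
      cases h with
      | @swap α β j k h =>
        exact ⟨α, sub hcW (by simp), β, sub hcW (by grind), j, mem hcW (by simp), k,
          mem hcW (by simp), rfl, .inl ⟨h, rfl⟩⟩
      | @merge α β x y z h =>
        exact ⟨α, sub hcW (by simp), β, sub hcW (by grind), (x, y), mem hcW (by simp), (y, z),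
          mem hcW (by simp), rfl, .inr ⟨rfl, h, rfl⟩⟩
    | rot S j w =>
      obtain ⟨rfl, e₁⟩ := Prod.ext_iff.1 ec
      obtain ⟨e, e₂⟩ := Prod.ext_iff.1 ed
      simp only [toState] at e₁ e₂ e
      rw [e₁] at hcW
      exact .inr (.inl ⟨j, mem hcW (by simp), w, sub hcW (by simp), e₁, e₂,
        sameElements_iff.2 (by rw [e, toFinset_moveList])⟩)
    | @row S β γ a b x y hab hx hy hβ ha hb hbS =>
      obtain ⟨rfl, e₁⟩ := Prod.ext_iff.1 ec
      obtain ⟨e, e₂⟩ := Prod.ext_iff.1 ed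
      simp only [toState] at e₁ e₂ e hbS
      rw [e₁] at hcW
      rw [e₂] at hdW
      refine .inr (.inr ⟨β, sub hcW (by grind), γ, sub hcW (by grind), (a, y),
        mem hcW (by simp), (x, a), mem hcW (by simp), (b, y), mem hdW (by simp), (x, b),
        mem hdW (by simp), ⟨rfl, rfl, rfl, rfl⟩, ⟨hab, hx, hy⟩, fun i hi =>
          ⟨hβ _ (mem_labels.2 ⟨i, hi, .inl rfl⟩), hβ _ (mem_labels.2 ⟨i, hi, .inr rfl⟩)⟩,
        fun i hi => ?_, by simpa using hbS, e₁, e₂,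
        sameElements_iff.2 (by rw [e, toFinset_moveList])⟩)
      have hi₁ := mem_labels.2 ⟨i, hi, .inl rfl⟩
      have hi₂ := mem_labels.2 ⟨i, hi, .inr rfl⟩
      exact ⟨⟨fun h => ha (by rwa [← show _ = _ from h] at hi₁), fun h => ha (by rwa [← show _ = _ from h] at hi₂)⟩,
        fun h => hb (by rwa [← show _ = _ from h] at hi₁), fun h => hb (by rwa [← show _ = _ from h] at hi₂)⟩
  · refine ⟨isClosed_iff.2 hc', .inr ?_⟩
    set F := (List.range M).map fun x => if x ∈ suppList c then f x else 0 with hF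
    have hFx : ∀ x ∈ suppList c, entry F x = f x := by
      intro x hx
      have : x < M := by simpa using hcB.1 (mem_suppList.1 hx)
      simp [entry, hF, this, hx]
    refine ⟨F, mem_listsUpTo.2 ⟨by simp [hF], ?_⟩, ?_, ?_, ?_⟩
    · intro b hb
      obtain ⟨x, hx, rfl⟩ := List.mem_map.1 hb
      rw [List.mem_range] at hx ⊢
      split_ifs with h
      · have : f x ∈ supp (toState d) := by
          rw [e, supp_mapState]
          exact Finset.mem_image_of_mem f (mem_suppList.1 h)
        simpa using hdB.1 this
      · omega
    · intro x hx y hy h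
      rw [hFx x hx, hFx y hy] at h
      exact hf.injOn (mem_suppList.1 hx) (mem_suppList.1 hy) h
    · intro x hx y hy z hz
      rw [hFx x hx, hFx y hy, hFx z hz]
      exact hf.cyc x (mem_suppList.1 hx) y (mem_suppList.1 hy) z (mem_suppList.1 hz)
    · obtain ⟨e₁, e₂⟩ := Prod.ext_iff.1 e
      have hmem : ∀ x ∈ c.1, x ∈ suppList c := fun x hx => List.mem_append_left _ hx
      have hw : ∀ j ∈ c.2, j.1 ∈ suppList c ∧ j.2 ∈ suppList c := fun j hj =>
        ⟨List.mem_append_right _ (List.mem_flatMap.2 ⟨j, hj, by simp⟩),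
          List.mem_append_right _ (List.mem_flatMap.2 ⟨j, hj, by simp⟩)⟩
      simp only [toState, mapState] at e₁ e₂
      refine ⟨sameElements_iff.2 (e₁.trans ?_), e₂.trans ?_⟩
      · rw [List.map_congr_left fun x hx => hFx x (hmem x hx)]
        ext l
        simp
      · refine List.map_congr_left fun j hj => ?_
        rw [hFx _ (hw j hj).1, hFx _ (hw j hj).2, Prod.map]

/-- A set of states that contains with a state all its neighbours and that contains the state
`(needList v, v)` contains `(needList w, w)`. -/
def Reaches (M Q : ℕ) (v w : List (ℕ × ℕ)) : Prop :=
  ∀ A ∈ subs (states M Q),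
    (∀ c ∈ A, ∀ d ∈ states M Q, Edge M Q c d ∨ Edge M Q d c → d ∈ A) →
    (∃ c ∈ A, c.2 = v ∧ SameElements c.1 (needList v)) →
    ∃ c ∈ A, c.2 = w ∧ SameElements c.1 (needList w)

/-- For the nontrivial direction, take the set of all bounded states connected with `(need v, v)`.
-/
theorem reaches_iff {M Q : ℕ} {v w : List (ℕ × ℕ)} (hv : Bounded M Q (need v, v)) :
    Reaches M Q v w ↔ BoundedConn M Q (need v, v) (need w, w) := by
  have hrep : ∀ (c : List ℕ × List (ℕ × ℕ)) (w : List (ℕ × ℕ)),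
      (c.2 = w ∧ SameElements c.1 (needList w)) ↔ toState c = (need w, w) := by
    intro c w
    rw [← toFinset_needList w, ← toState_eq_iff (c := (needList w, w))]
    rfl
  simp only [Reaches, hrep]
  constructor
  · intro h
    classical
    have hnb : ∀ c ∈ (states M Q).filter fun c => BoundedConn M Q (need v, v) (toState c),
        ∀ d ∈ states M Q, Edge M Q c d ∨ Edge M Q d c →
        d ∈ (states M Q).filter fun c => BoundedConn M Q (need v, v) (toState c) := by
      intro c hc d hd h
      rw [List.mem_filter, decide_eq_true_eq] at hc ⊢
      refine ⟨hd, hc.2.trans _ _ _ ?_⟩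
      obtain h | h := h
      · exact .rel _ _ ⟨natStep_of_edge h, bounded_toState hc.1, bounded_toState hd⟩
      · exact .symm _ _
          (.rel _ _ ⟨natStep_of_edge h, bounded_toState hd, bounded_toState hc.1⟩)
    obtain ⟨c, hc, e⟩ := exists_mem_states hv
    obtain ⟨d, hd, e'⟩ := h _ (mem_subs.2 List.filter_sublist) hnb
      ⟨c, List.mem_filter.2 ⟨hc, by rw [e, decide_eq_true_eq]; exact .refl _⟩, e⟩
    rw [← e']
    simpa using (List.mem_filter.1 hd).2
  · intro h A hA hcl
    have key : ∀ {c d}, BoundedConn M Q c d →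
        ((∃ c' ∈ A, toState c' = c) ↔ ∃ d' ∈ A, toState d' = d) := by
      intro c d h
      induction h with
      | rel c d h =>
        have hA' := (mem_subs.1 hA).subset
        constructor
        · rintro ⟨c', hc', rfl⟩
          obtain ⟨d', hd', rfl⟩ := exists_mem_states h.2.2
          exact ⟨d', hcl c' hc' d' hd' (.inl (edge_of_natStep (hA' hc') hd' h.1)), rfl⟩
        · rintro ⟨d', hd', rfl⟩
          obtain ⟨c', hc', rfl⟩ := exists_mem_states h.2.1
          exact ⟨c', hcl d' hd' c' hc' (.inr (edge_of_natStep hc' (hA' hd') h.1)), rfl⟩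
      | refl _ => rfl
      | symm _ _ _ ih => exact ih.symm
      | trans _ _ _ _ _ ih ih' => exact ih.trans ih'
    exact (key h).1

end Search

open JumpWord

namespace Search

/-! ### Computability of the search -/

section

variable {α : Type*} [Primcodable α]

@[fun_prop] theorem primrec_moveList {f : α → List ℕ} {g : α → ℕ × ℕ} (hf : Primrec f)
    (hg : Primrec g) : Primrec fun a => moveList (f a) (g a) :=
  primrec_cons (by fun_prop) (primrec_filter hf (by fun_prop))

@[fun_prop] theorem primrec_needList {f : α → List (ℕ × ℕ)} (hf : Primrec f) :
    Primrec fun a => needList (f a) := by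
  have h : Primrec fun x : α × (ℕ × ℕ) × List ℕ => x.2.1.1 :: x.2.2.filter (· ≠ x.2.1.2) :=
    primrec_cons (by fun_prop) (primrec_filter (by fun_prop) (by fun_prop))
  exact primrec_foldr (g := fun _ => []) (h := fun _ j S => j.1 :: S.filter (· ≠ j.2)) hf
    (by fun_prop) h

@[fun_prop] theorem primrecPred_sameElements {f g : α → List ℕ} (hf : Primrec f)
    (hg : Primrec g) : PrimrecPred fun a => SameElements (f a) (g a) :=
  (primrecPred_forall_mem hf (by fun_prop)).and (primrecPred_forall_mem hg (by fun_prop))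

@[fun_prop] theorem primrec_run {f : α → List ℕ} {g : α → List (ℕ × ℕ)} (hf : Primrec f)
    (hg : Primrec g) : Primrec fun a => run (f a) (g a) := by
  unfold run
  fun_prop

@[fun_prop] theorem primrecPred_isClosed {f : α → List ℕ × List (ℕ × ℕ)} (hf : Primrec f) :
    PrimrecPred fun a => IsClosed (f a) := by
  unfold IsClosed
  fun_prop

@[fun_prop] theorem primrecPred_cyc {f g h : α → ℕ} (hf : Primrec f) (hg : Primrec g)
    (hh : Primrec h) : PrimrecPred fun a => Cyc (f a) (g a) (h a) := by
  unfold Cyc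
  fun_prop

@[fun_prop] theorem primrecPred_arc {f g h : α → ℕ} (hf : Primrec f) (hg : Primrec g)
    (hh : Primrec h) : PrimrecPred fun a => Arc (f a) (g a) (h a) := by
  unfold Arc
  fun_prop

@[fun_prop] theorem primrecPred_noncross {f g : α → ℕ × ℕ} (hf : Primrec f) (hg : Primrec g) :
    PrimrecPred fun a => Noncross (f a) (g a) := by
  unfold Noncross
  fun_prop

@[fun_prop] theorem primrecPred_isLocal {P : α → List (ℕ × ℕ)} {W : α → List (List (ℕ × ℕ))}
    {v w : α → List (ℕ × ℕ)} (hP : Primrec P) (hW : Primrec W) (hv : Primrec v)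
    (hw : Primrec w) : PrimrecPred fun a => IsLocal (P a) (W a) (v a) (w a) := by
  refine primrecPred_exists_mem (by fun_prop) (primrecPred_exists_mem (by fun_prop)
    (primrecPred_exists_mem (by fun_prop) (primrecPred_exists_mem (by fun_prop) ?_)))
  fun_prop

@[fun_prop] theorem primrecPred_isRot {P : α → List (ℕ × ℕ)} {W : α → List (List (ℕ × ℕ))}
    {c d : α → List ℕ × List (ℕ × ℕ)} (hP : Primrec P) (hW : Primrec W) (hc : Primrec c)
    (hd : Primrec d) : PrimrecPred fun a => IsRot (P a) (W a) (c a) (d a) := by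
  refine primrecPred_exists_mem (by fun_prop) (primrecPred_exists_mem (by fun_prop) ?_)
  fun_prop

@[fun_prop] theorem primrecPred_isRow {P : α → List (ℕ × ℕ)} {W : α → List (List (ℕ × ℕ))}
    {c d : α → List ℕ × List (ℕ × ℕ)} (hP : Primrec P) (hW : Primrec W) (hc : Primrec c)
    (hd : Primrec d) : PrimrecPred fun a => IsRow (P a) (W a) (c a) (d a) := by
  refine primrecPred_exists_mem (by fun_prop) (primrecPred_exists_mem (by fun_prop)
    (primrecPred_exists_mem (by fun_prop) (primrecPred_exists_mem (by fun_prop)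
    (primrecPred_exists_mem (by fun_prop) (primrecPred_exists_mem (by fun_prop)
    (.and (by fun_prop) (.and (by fun_prop) (.and ?_ (.and ?_ (by fun_prop)))))))))) <;>
  exact primrecPred_forall_mem (by fun_prop) (by fun_prop)

@[fun_prop] theorem primrec_suppList {c : α → List ℕ × List (ℕ × ℕ)} (hc : Primrec c) :
    Primrec fun a => suppList (c a) := by
  unfold suppList
  fun_prop

@[fun_prop] theorem primrec_entry {f : α → List ℕ} {g : α → ℕ} (hf : Primrec f)
    (hg : Primrec g) : Primrec fun a => entry (f a) (g a) :=
  (Primrec.list_getD 0).comp hf hg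

@[fun_prop] theorem primrecPred_isRelabel {G : α → List (List ℕ)}
    {c d : α → List ℕ × List (ℕ × ℕ)} (hG : Primrec G) (hc : Primrec c) (hd : Primrec d) :
    PrimrecPred fun a => IsRelabel (G a) (c a) (d a) := by
  refine primrecPred_exists_mem hG (.and (primrecPred_forall_mem (by fun_prop)
    (primrecPred_forall_mem (by fun_prop) (by fun_prop))) (.and (primrecPred_forall_mem
    (by fun_prop) (primrecPred_forall_mem (by fun_prop) (primrecPred_forall_mem (by fun_prop)
    (by fun_prop)))) (by fun_prop)))

@[fun_prop] theorem primrecPred_edge {M Q : α → ℕ} {c d : α → List ℕ × List (ℕ × ℕ)}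
    (hM : Primrec M) (hQ : Primrec Q) (hc : Primrec c) (hd : Primrec d) :
    PrimrecPred fun a => Edge (M a) (Q a) (c a) (d a) := by
  unfold Edge words
  fun_prop

theorem primrecPred_reaches {M Q : α → ℕ} {v w : α → List (ℕ × ℕ)}
    (hM : Primrec M) (hQ : Primrec Q) (hv : Primrec v) (hw : Primrec w) :
    PrimrecPred fun a => Reaches (M a) (Q a) (v a) (w a) := by
  refine primrecPred_forall_mem (by fun_prop) (primrecPred_imp (primrecPred_forall_mem
    (by fun_prop) (primrecPred_forall_mem (by fun_prop) (by fun_prop))) (primrecPred_imp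
    (primrecPred_exists_mem (by fun_prop) (by fun_prop))
    (primrecPred_exists_mem (by fun_prop) (by fun_prop))))

end

end Search

open RectDiagram

namespace DiagramCode

open Search

section

variable {α : Type*} [Primcodable α] {c : α → DiagramCode}

theorem primrec_bound (hc : Primrec c) : Primrec fun a => (c a).bound := by
  unfold bound
  fun_prop

theorem primrec_word (hc : Primrec c) : Primrec fun a => (c a).word := by
  have := primrec_bound hc
  refine primrec_filterMap (by fun_prop) ?_
  unfold column
  exact Primrec.list_head?.comp (by fun_prop)

theorem primrec_normalizeWord (T : StabType) {w : α → List (ℕ × ℕ)} (hw : Primrec w) :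
    Primrec fun a => normalizeWord T (w a) := by
  have hswap : ∀ {w : α → List (ℕ × ℕ)}, Primrec w → Primrec fun a => (w a).map Prod.swap :=
    fun hw => primrec_map (g := fun _ j => (j.2, j.1)) hw (by fun_prop)
  have hrev := Primrec.list_reverse.comp hw
  cases T
  exacts [hrev, hswap hrev, hswap hw, hw]

end

theorem primrec_searchBound {α : Type*} [Primcodable α] {f : α → ℕ} (hf : Primrec f) :
    Primrec fun a => searchBound (f a) := by
  unfold searchBound levelBound
  fun_prop

/-- The search for a connection between the words of two codes. -/
def Decide (T : StabType) (c : DiagramCode × DiagramCode) : Prop :=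
  Reaches (searchBound (c.1.bound + c.2.bound))
    ((c.1.bound + c.2.bound) * searchBound (c.1.bound + c.2.bound))
    (normalizeWord T c.1.word) (normalizeWord T c.2.word)

theorem primrecPred_decide (T : StabType) : PrimrecPred (Decide T) := by
  have h₁ := primrec_bound (Primrec.fst (α := DiagramCode) (β := DiagramCode))
  have h₂ := primrec_bound (Primrec.snd (α := DiagramCode) (β := DiagramCode))
  have hM := primrec_searchBound (primrec_add h₁ h₂)
  exact primrecPred_reaches hM (primrec_mul (primrec_add h₁ h₂) hM)
    (primrec_normalizeWord T (primrec_word .fst)) (primrec_normalizeWord T (primrec_word .snd))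

theorem le_searchBound (n : ℕ) : n ≤ searchBound n := by
  unfold searchBound; omega

theorem Describes.decide_iff {c₁ c₂ : DiagramCode} {R₁ R₂ : RectDiagram} (h₁ : c₁.Describes R₁)
    (h₂ : c₂.Describes R₂) (T : StabType) :
    Decide T (c₁, c₂) ↔ Related (normalize T R₁) (normalize T R₂) := by
  set n := c₁.bound + c₂.bound with hn
  have hlen : ∀ c : DiagramCode, c.bound ≤ n → (normalizeWord T c.word).length ≤ n :=
    fun c hc => (length_normalizeWord T _).trans_le ((length_word c).trans hc)
  have hlab : ∀ c : DiagramCode, c.bound ≤ n →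
      labels (normalizeWord T c.word) ⊆ Finset.range n := fun c hc => by
    rw [labels_normalizeWord]
    exact (labels_word c).trans (Finset.range_subset_range.2 hc)
  have hc₁ : c₁.bound ≤ n := by omega
  have hc₂ : c₂.bound ≤ n := by omega
  rw [(h₁.hasWord.normalize T).related_iff (h₂.hasWord.normalize T) (hlen c₁ hc₁) (hlen c₂ hc₂)
    (hlab c₁ hc₁) (hlab c₂ hc₂)]
  refine reaches_iff ⟨Finset.union_subset ((need_subset_labels _).trans ?_) ?_, ?_⟩
  · exact (hlab c₁ hc₁).trans (Finset.range_subset_range.2 (le_searchBound n))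
  · exact (hlab c₁ hc₁).trans (Finset.range_subset_range.2 (le_searchBound n))
  · obtain hz | hz := Nat.eq_zero_or_pos n
    · exact (hlen c₁ hc₁).trans (by rw [hz]; exact Nat.zero_le _)
    · exact (hlen c₁ hc₁).trans
        (Nat.le_mul_of_pos_right n (hz.trans_le (le_searchBound n)))

end DiagramCode

/-- Every rectangular diagram of a link has a finite code, and for every oriented type `T` there is
an algorithm (a computable function) which decides, given codes of any two rectangular diagrams of
a link `R₁` and `R₂`, whether `[R₁]_T = [R₂]_T`. -/
theorem mainTheorem1 :
    (∀ R : RectDiagram, ∃ c : DiagramCode, c.Describes R) ∧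
    ∀ T : StabType, ∃ f : DiagramCode × DiagramCode → Bool,
      Computable f ∧
      ∀ (c₁ c₂ : DiagramCode) (R₁ R₂ : RectDiagram),
        c₁.Describes R₁ → c₂.Describes R₂ →
          (f (c₁, c₂) = true ↔
            RectDiagram.moveClass {T} R₁ = RectDiagram.moveClass {T} R₂) := by
  classical
  refine ⟨DiagramCode.exists_describes, fun T => ⟨fun c => decide (DiagramCode.Decide T c),
    (DiagramCode.primrecPred_decide T).decide.to_comp, fun c₁ c₂ R₁ R₂ h₁ h₂ => ?_⟩⟩
  rw [decide_eq_true_eq, h₁.decide_iff h₂ T, ← moveSetoid_iff_related]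
  exact Quotient.eq.symm
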